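/- Let $K_1,\dots,K_n$ be knots in $S^3$ with exteriors $M_1,\dots,M_n$, and let $M$ be the exterior of their connected sum. Thus $M=Y\cup M_1\cup\dots\cup M_n$, where $Y=W\times S^1$ for a disc $W=D^2\setminus\mathrm{int}(D_1\sqcup\dots\sqcup D_n)$ with $n$ holes, and $M_j$ is glued to $Y$ along the torus $\Sigma_j=\partial D_j\times S^1=\partial M_j$ so that the meridian and the canonical longitude of $K_j$ become $\mu=\{pt\}\times S^1$ and $\lambda_j=\partial D_j\times\{pt\}$. Spaces are triangulated, and $H^i(\,\cdot\,;\mathfrak g_\rho)$ denotes the twisted cohomology, i.e. the cohomology of $\mathrm{Hom}_{\mathbb Z[\pi_1X]}(C_*(\widetilde X;\mathbb Z),\mathfrak g)$, where $\mathfrak g=\mathfrak{sl}_2(\mathbb C)$ is a $\pi_1(X)$-module through $\mathrm{Ad}\circ\rho$. Let $\rho:\pi_1(M)\to \mathrm{SL}_2(\mathbb C)$ be an irreducible representation, let $\rho_j$ be its restriction to $\pi_1(M_j)$ (defined up to conjugation), let $m$ be an eigenvalue of $\rho(\mu)$, and let $\Delta_{K_j}$ be the Alexander polynomial of $K_j$,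 normalized by $\Delta_{K_j}(t^{-1})=\Delta_{K_j}(t)$ and $\Delta_{K_j}(1)=1$. Assume that * $m\neq\pm1$ and $\Delta_{K_j}(m^2)\neq0$ for all $1\le j\le n$; * for every $j$ such that $\rho_j$ is irreducible, the eigenvalues of $\rho_j(\lambda_j)$ are different from $\pm1$, and $\rho_j$ is $\mu$-regular, i.e. $\dim H^1(M_j;\mathfrak g_{\rho_j})=1$ and the restriction map $H^1(M_j;\mathfrak g_{\rho_j})\to H^1(\mu;\mathfrak g_{\rho_j})$ is injective. Let $k$ be the number of indices $j$ for which $\rho_j$ is abelian. Then $$\dim_{\mathbb C} H^i(M;\mathfrak g_\rho)=\begin{cases} n-k & \text{if } i=1,2,\\ 0 & \text{otherwise.}\end{cases}$$ -/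

import Mathlib

/-!
Triangulated (piecewise linear) knot exteriors, the edge-path group, twisted simplicial
cohomology, and the exterior of a connected sum of knots.

Spaces are finite abstract simplicial complexes `K : PreAbstractSimplicialComplex V`
(the elements of `V` that are not vertices of `K` play no role).
-/

noncomputable section

namespace PreAbstractSimplicialComplex

/-! ### Edge paths and the edge-path group -/

section EdgePaths

variable {V : Type*} [DecidableEq V]

/-- An edge path in `K`: a sequence of vertices, consecutive ones spanning an edge
(or being equal). -/
inductive EdgePath (K : PreAbstractSimplicialComplex V) : V → V → Type _
  | nil (u : V) : EdgePath K u u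
  | cons {u v w : V} (h : {u, v} ∈ K.faces) (p : EdgePath K v w) : EdgePath K u w

namespace EdgePath

variable {K : PreAbstractSimplicialComplex V}

/-- Concatenation of edge paths. -/
def append : {u v w : V} → EdgePath K u v → EdgePath K v w → EdgePath K u w
  | _, _, _, nil _, q => q
  | _, _, _, cons h p, q => cons h (append p q)

/-- The edge path consisting of one edge. -/
def single {u v : V} (h : {u, v} ∈ K.faces) : EdgePath K u v := cons h (nil v)

/-- The reversed edge path. -/
def reverse : {u v : V} → EdgePath K u v → EdgePath K v u
  | _, _, nil u => nil u
  | u, _, cons (v := v) h p => append (reverse p) (single (Finset.pair_comm u v ▸ h))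

/-- An edge path in a subcomplex is an edge path in the complex. -/
def mono {A : PreAbstractSimplicialComplex V} (hA : A ≤ K) :
    {u v : V} → EdgePath A u v → EdgePath K u v
  | _, _, nil u => nil u
  | _, _, cons h p => cons (hA h) (mono hA p)

/-- Homotopy of edge paths relative to the end points: the equivalence relation generated by
deleting constant steps and by replacing two sides of a (possibly degenerate) triangle by the
third side. -/
inductive Homotopic : {u v : V} → EdgePath K u v → EdgePath K u v → Prop
  | refl {u v : V} (p : EdgePath K u v) : Homotopic p p
  | symm {u v : V} {p q : EdgePath K u v} : Homotopic p q → Homotopic q p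
  | trans {u v : V} {p q r : EdgePath K u v} : Homotopic p q → Homotopic q r → Homotopic p r
  | cons {u v w : V} (h : {u, v} ∈ K.faces) {p q : EdgePath K v w} :
      Homotopic p q → Homotopic (EdgePath.cons h p) (EdgePath.cons h q)
  | const {u w : V} (h : {u, u} ∈ K.faces) (p : EdgePath K u w) :
      Homotopic (EdgePath.cons h p) p
  | triangle {u v w x : V} (huv : {u, v} ∈ K.faces) (hvw : {v, w} ∈ K.faces)
      (huw : {u, w} ∈ K.faces) (h : {u, v, w} ∈ K.faces) (p : EdgePath K w x) :
      Homotopic (EdgePath.cons huv (EdgePath.cons hvw p)) (EdgePath.cons huw p)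

theorem append_nil {u v : V} (p : EdgePath K u v) : append p (nil v) = p := by
  induction p with
  | nil u => rfl
  | cons h p ih => simp [append, ih]

theorem append_assoc {u v w x : V} (p : EdgePath K u v) (q : EdgePath K v w)
    (r : EdgePath K w x) : append (append p q) r = append p (append q r) := by
  induction p with
  | nil u => rfl
  | cons h p ih => simp [append, ih]

theorem Homotopic.append_left {u v w : V} (p : EdgePath K u v) {q q' : EdgePath K v w}
    (h : Homotopic q q') : Homotopic (append p q) (append p q') := by
  induction p with
  | nil u => exact h
  | cons e p ih => exact .cons e (ih h)

theorem Homotopic.append_right {u v w : V} {p p' : EdgePath K u v} (h : Homotopic p p')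
    (q : EdgePath K v w) : Homotopic (append p q) (append p' q) := by
  induction h with
  | refl p => exact .refl _
  | symm _ ih => exact .symm (ih q)
  | trans _ _ ih₁ ih₂ => exact .trans (ih₁ q) (ih₂ q)
  | cons e _ ih => exact .cons e (ih q)
  | const e p => exact .const e _
  | triangle h₁ h₂ h₃ h p => exact .triangle h₁ h₂ h₃ h _

theorem left_mem {u v : V} (h : {u, v} ∈ K.faces) : {u, u} ∈ K.faces :=
  (K.isRelLowerSet_faces h).2 (by intro x; simp; tauto) (by simp)

/-- Going along an edge and back is homotopic to the constant path. -/
theorem homotopic_back {u v w : V} (h : {u, v} ∈ K.faces) (h' : {v, u} ∈ K.faces)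
    (p : EdgePath K u w) : Homotopic (EdgePath.cons h (EdgePath.cons h' p)) p := by
  have h3 : ({u, v, u} : Finset V) ∈ K.faces := by
    have : ({u, v, u} : Finset V) = {u, v} := by ext x; simp; tauto
    rwa [this]
  exact .trans (.triangle h h' (left_mem h) h3 p) (.const _ p)

theorem reverse_append {u v w : V} (p : EdgePath K u v) (q : EdgePath K v w) :
    reverse (append p q) = append (reverse q) (reverse p) := by
  induction p with
  | nil u => simp [append, reverse, append_nil]
  | cons h p ih => simp [append, reverse, ih, append_assoc]

theorem reverse_reverse {u v : V} (p : EdgePath K u v) : reverse (reverse p) = p := by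
  induction p with
  | nil u => rfl
  | cons h p ih => simp [reverse, reverse_append, ih, single, append]

theorem append_reverse {u v : V} (p : EdgePath K u v) :
    Homotopic (append p (reverse p)) (nil u) := by
  induction p with
  | nil u => exact .refl _
  | cons h p ih =>
    simp only [append, reverse]
    rw [← append_assoc]
    exact .trans (.cons h (ih.append_right _)) (homotopic_back _ _ _)

theorem reverse_append_self {u v : V} (p : EdgePath K u v) :
    Homotopic (append (reverse p) p) (nil v) := by
  simpa [reverse_reverse] using append_reverse (reverse p)

theorem Homotopic.reverse {u v : V} {p q : EdgePath K u v} (h : Homotopic p q) :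
    Homotopic (reverse p) (reverse q) := by
  have h1 : Homotopic (EdgePath.reverse p) (append (EdgePath.reverse p)
      (append q (EdgePath.reverse q))) := by
    have := (append_reverse q).symm.append_left (EdgePath.reverse p)
    rwa [append_nil] at this
  have h2 : Homotopic (append (append (EdgePath.reverse p) q) (EdgePath.reverse q))
      (EdgePath.reverse q) :=
    ((h.symm.append_left _).trans (reverse_append_self p)).append_right _
  rw [append_assoc] at h2
  exact h1.trans h2

theorem mono_append {A : PreAbstractSimplicialComplex V} (hA : A ≤ K) {u v w : V}
    (p : EdgePath A u v) (q : EdgePath A v w) :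
    mono hA (append p q) = append (mono hA p) (mono hA q) := by
  induction p with
  | nil u => rfl
  | cons h p ih => simp [append, mono, ih]

theorem Homotopic.mono {A : PreAbstractSimplicialComplex V} (hA : A ≤ K) {u v : V}
    {p q : EdgePath A u v} (h : Homotopic p q) :
    Homotopic (EdgePath.mono hA p) (EdgePath.mono hA q) := by
  induction h with
  | refl p => exact .refl _
  | symm _ ih => exact .symm ih
  | trans _ _ ih₁ ih₂ => exact .trans ih₁ ih₂
  | cons e _ ih => exact .cons (hA e) ih
  | const e p => exact .const (hA e) _
  | triangle h₁ h₂ h₃ h p => exact .triangle (hA h₁) (hA h₂) (hA h₃) (hA h) _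

/-- Homotopy of edge paths as a setoid. -/
def homotopySetoid (K : PreAbstractSimplicialComplex V) (u v : V) : Setoid (EdgePath K u v) where
  r := Homotopic
  iseqv := ⟨.refl, .symm, .trans⟩

end EdgePath

/-- Homotopy classes of edge paths from `u` to `v` (the edge-path groupoid of `K`). -/
def PathClass (K : PreAbstractSimplicialComplex V) (u v : V) : Type _ :=
  Quotient (EdgePath.homotopySetoid K u v)

namespace PathClass

variable {K : PreAbstractSimplicialComplex V}

/-- The class of an edge path. -/
def mk {u v : V} (p : EdgePath K u v) : PathClass K u v := Quotient.mk _ p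

/-- Composition of path classes: first `a`, then `b`. -/
def comp {u v w : V} (a : PathClass K u v) (b : PathClass K v w) : PathClass K u w :=
  Quotient.map₂ EdgePath.append
    (fun _ p' (h : EdgePath.Homotopic _ p') q _ (h' : EdgePath.Homotopic q _) =>
      EdgePath.Homotopic.trans (h.append_right q) (h'.append_left p')) a b

/-- The inverse path class. -/
def symm {u v : V} (a : PathClass K u v) : PathClass K v u :=
  Quotient.map EdgePath.reverse (fun _ _ h => EdgePath.Homotopic.reverse h) a

/-- The map of path classes induced by the inclusion of a subcomplex. -/
def mono {A : PreAbstractSimplicialComplex V} (hA : A ≤ K) {u v : V} (a : PathClass A u v) :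
    PathClass K u v :=
  Quotient.map (EdgePath.mono hA) (fun _ _ h => EdgePath.Homotopic.mono hA h) a

/-- The class of the constant path. -/
def refl (K : PreAbstractSimplicialComplex V) (u : V) : PathClass K u u := mk (.nil u)

theorem ind {u v : V} {P : PathClass K u v → Prop} (h : ∀ p, P (mk p)) (a : PathClass K u v) :
    P a :=
  Quotient.inductionOn a h

theorem comp_assoc {u v w x : V} (a : PathClass K u v) (b : PathClass K v w)
    (c : PathClass K w x) : comp (comp a b) c = comp a (comp b c) := by
  induction a using ind
  induction b using ind
  induction c using ind
  exact congrArg mk (EdgePath.append_assoc _ _ _)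

theorem refl_comp {u v : V} (a : PathClass K u v) : comp (refl K u) a = a := by
  induction a using ind
  rfl

theorem comp_refl {u v : V} (a : PathClass K u v) : comp a (refl K v) = a := by
  induction a using ind
  exact congrArg mk (EdgePath.append_nil _)

theorem symm_comp {u v : V} (a : PathClass K u v) : comp (symm a) a = refl K v := by
  induction a using ind
  exact Quotient.sound (s := EdgePath.homotopySetoid K v v) (EdgePath.reverse_append_self _)

theorem mono_comp {A : PreAbstractSimplicialComplex V} (hA : A ≤ K) {u v w : V}
    (a : PathClass A u v) (b : PathClass A v w) :
    mono hA (comp a b) = comp (mono hA a) (mono hA b) := by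
  induction a using ind
  induction b using ind
  exact congrArg mk (EdgePath.mono_append hA _ _)

instance (v : V) : Group (PathClass K v v) :=
  @Group.ofLeftAxioms (PathClass K v v) ⟨comp⟩ ⟨symm⟩ ⟨refl K v⟩
    comp_assoc refl_comp symm_comp

end PathClass

/-- The edge-path group `π₁(K, v)`; the product is concatenation. -/
abbrev Pi1 (K : PreAbstractSimplicialComplex V) (v : V) : Type _ := PathClass K v v

/-- For a subcomplex `A` of `K`, the homomorphism `π₁(A, a) → π₁(K, x)` induced by the inclusion
and a path class `γ` in `K` from `x` to `a`. -/
def inclusionHom {A K : PreAbstractSimplicialComplex V} (hA : A ≤ K) {x a : V}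
    (γ : PathClass K x a) : Pi1 A a →* Pi1 K x :=
  MonoidHom.mk' (fun α => (γ.comp (α.mono hA)).comp γ.symm) (by
    intro α β
    change (γ.comp ((α.comp β).mono hA)).comp γ.symm =
      ((γ.comp (α.mono hA)).comp γ.symm).comp ((γ.comp (β.mono hA)).comp γ.symm)
    simp only [PathClass.mono_comp, PathClass.comp_assoc]
    rw [← PathClass.comp_assoc γ.symm γ, PathClass.symm_comp, PathClass.refl_comp])

/-- `K` is nonempty and (path) connected. -/
def IsConnected (K : PreAbstractSimplicialComplex V) : Prop :=
  (∃ v, {v} ∈ K.faces) ∧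
    ∀ u v, {u} ∈ K.faces → {v} ∈ K.faces → Nonempty (EdgePath K u v)

/-- `K` is connected with trivial fundamental group. -/
def IsSimplyConnected (K : PreAbstractSimplicialComplex V) : Prop :=
  K.IsConnected ∧ ∀ (v : V) (α : Pi1 K v), α = 1

end EdgePaths

/-! ### Combinatorial manifolds of dimension at most three -/

section Manifolds

variable {V : Type*} [DecidableEq V]

/-- The link of a vertex. -/
def link (K : PreAbstractSimplicialComplex V) (v : V) : PreAbstractSimplicialComplex V where
  faces := {s | s.Nonempty ∧ v ∉ s ∧ insert v s ∈ K.faces}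
  isRelLowerSet_faces := by
    rintro s ⟨hs, hv, hK⟩
    refine ⟨hs, fun t hts ht => ⟨ht, fun h => hv (hts h), ?_⟩⟩
    exact (K.isRelLowerSet_faces hK).2 (Finset.insert_subset_insert v hts)
      (Finset.insert_nonempty v t)

/-- The Euler characteristic (of a finite complex). -/
def eulerChar (K : PreAbstractSimplicialComplex V) : ℤ :=
  ∑ᶠ s ∈ K.faces, (-1 : ℤ) ^ (s.card - 1)

/-- The number of edges at a vertex `v`. -/
def degree (K : PreAbstractSimplicialComplex V) (v : V) : ℕ :=
  {u | u ≠ v ∧ {u, v} ∈ K.faces}.ncard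

/-- A triangulated circle. -/
structure IsCircle (K : PreAbstractSimplicialComplex V) : Prop where
  finite : K.faces.Finite
  connected : K.IsConnected
  dim_le : ∀ s ∈ K.faces, s.card ≤ 2
  degree_eq : ∀ v, {v} ∈ K.faces → K.degree v = 2

/-- A triangulated compact interval: a finite connected graph with vertices of degree `1` and
`2`, not all of degree `2`. -/
structure IsArc (K : PreAbstractSimplicialComplex V) : Prop where
  finite : K.faces.Finite
  connected : K.IsConnected
  dim_le : ∀ s ∈ K.faces, s.card ≤ 2
  degree_eq : ∀ v, {v} ∈ K.faces → K.degree v = 1 ∨ K.degree v = 2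
  exists_end : ∃ v, {v} ∈ K.faces ∧ K.degree v = 1

/-- A triangulated compact surface, possibly with boundary. -/
structure IsSurface (K : PreAbstractSimplicialComplex V) : Prop where
  finite : K.faces.Finite
  link_vertex : ∀ v, {v} ∈ K.faces → (K.link v).IsCircle ∨ (K.link v).IsArc

/-- A triangulated 2-sphere: a closed connected surface of Euler characteristic `2`. -/
structure IsTwoSphere (K : PreAbstractSimplicialComplex V) : Prop where
  finite : K.faces.Finite
  connected : K.IsConnected
  link_vertex : ∀ v, {v} ∈ K.faces → (K.link v).IsCircle
  euler : K.eulerChar = 2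

/-- A triangulated 2-disc: a compact connected surface with nonempty boundary and Euler
characteristic `1`. -/
structure IsTwoDisc (K : PreAbstractSimplicialComplex V) : Prop where
  surface : K.IsSurface
  connected : K.IsConnected
  boundary_nonempty : ∃ v, {v} ∈ K.faces ∧ (K.link v).IsArc
  euler : K.eulerChar = 1

/-- A triangulated compact 3-manifold, possibly with boundary: vertex links are 2-spheres (at
interior vertices) or 2-discs (at boundary vertices). -/
structure IsThreeManifold (K : PreAbstractSimplicialComplex V) : Prop where
  finite : K.faces.Finite
  link_vertex : ∀ v, {v} ∈ K.faces → (K.link v).IsTwoSphere ∨ (K.link v).IsTwoDisc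

/-- A triangulated closed 3-manifold. -/
structure IsClosedThreeManifold (K : PreAbstractSimplicialComplex V) : Prop where
  finite : K.faces.Finite
  link_vertex : ∀ v, {v} ∈ K.faces → (K.link v).IsTwoSphere

/-- The boundary of a triangulated `d`-manifold: the subcomplex generated by the faces with `d`
vertices that lie in exactly one face with `d + 1` vertices. -/
def boundary (d : ℕ) (K : PreAbstractSimplicialComplex V) : PreAbstractSimplicialComplex V where
  faces := {s | s.Nonempty ∧ ∃ t ∈ K.faces, s ⊆ t ∧ t.card = d ∧
    {r | r ∈ K.faces ∧ t ⊆ r ∧ r.card = d + 1}.ncard = 1}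
  isRelLowerSet_faces := by
    rintro s ⟨hs, t, ht, hst, h⟩
    exact ⟨hs, fun s' hs' hne => ⟨hne, t, ht, hs'.trans hst, h⟩⟩

/-- `L` is obtained from `K` by an elementary simplicial collapse: removal of a face `t` that is
not contained in any other face, together with a face `s` of codimension one in `t` whose only
proper coface is `t`. -/
def ElementaryCollapse (K L : PreAbstractSimplicialComplex V) : Prop :=
  ∃ s ∈ K.faces, ∃ t ∈ K.faces, s ⊆ t ∧ t.card = s.card + 1 ∧
    (∀ r ∈ K.faces, s ⊆ r → r = s ∨ r = t) ∧ L.faces = K.faces \ {s, t}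

/-- `K` collapses to `L`. -/
def Collapses : PreAbstractSimplicialComplex V → PreAbstractSimplicialComplex V → Prop :=
  Relation.ReflTransGen ElementaryCollapse

/-- The standard (staircase) triangulation of the product of two ordered simplicial complexes. -/
def prod {U T : Type*} [LinearOrder U] [LinearOrder T] (A : PreAbstractSimplicialComplex U)
    (B : PreAbstractSimplicialComplex T) : PreAbstractSimplicialComplex (U × T) where
  faces := {s | s.image Prod.fst ∈ A.faces ∧ s.image Prod.snd ∈ B.faces ∧
    IsChain (· ≤ ·) (s : Set (U × T))}
  isRelLowerSet_faces := by
    rintro s ⟨hA, hB, hc⟩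
    refine ⟨Finset.image_nonempty.1 (A.isRelLowerSet_faces hA).1, fun t hts ht => ⟨?_, ?_, ?_⟩⟩
    · exact (A.isRelLowerSet_faces hA).2 (Finset.image_subset_image hts) (ht.image _)
    · exact (B.isRelLowerSet_faces hB).2 (Finset.image_subset_image hts) (ht.image _)
    · exact hc.mono (by exact_mod_cast hts)

end Manifolds

end PreAbstractSimplicialComplex

open PreAbstractSimplicialComplex

/-! ### Simple closed curves -/

/-- A parametrized simple closed polygon: a periodic sequence of vertices, distinct within a
period. -/
structure SimpleCycle (V : Type*) where
  length : ℕ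
  three_le : 3 ≤ length
  vert : ℕ → V
  periodic : ∀ i, vert (i + length) = vert i
  injective : ∀ i < length, ∀ j < length, vert i = vert j → i = j

namespace SimpleCycle

theorem vert_length {V : Type*} (c : SimpleCycle V) : c.vert c.length = c.vert 0 := by
  simpa using c.periodic 0

variable {V : Type*} [DecidableEq V]

/-- The triangulated circle underlying a closed polygon. -/
def toComplex (c : SimpleCycle V) : PreAbstractSimplicialComplex V where
  faces := {s | s.Nonempty ∧ ∃ i, s ⊆ {c.vert i, c.vert (i + 1)}}
  isRelLowerSet_faces := by
    rintro s ⟨hs, i, hi⟩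
    exact ⟨hs, fun t hts ht => ⟨ht, i, hts.trans hi⟩⟩

theorem edge_mem (c : SimpleCycle V) (i : ℕ) :
    {c.vert i, c.vert (i + 1)} ∈ c.toComplex.faces :=
  ⟨by simp, i, subset_rfl⟩

/-- The path along the polygon from the vertex number `0` to the vertex number `k`. -/
def path (c : SimpleCycle V) : (k : ℕ) → EdgePath c.toComplex (c.vert 0) (c.vert k)
  | 0 => .nil _
  | k + 1 => (path c k).append (.single (c.edge_mem k))

/-- The element of `π₁(K)` (based at the vertex number `0`) represented by going once around a
closed polygon contained in `K`. -/
def loop (c : SimpleCycle V) {K : PreAbstractSimplicialComplex V} (h : c.toComplex ≤ K) :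
    Pi1 K (c.vert 0) :=
  (PathClass.mk (c.vert_length ▸ c.path c.length : EdgePath c.toComplex (c.vert 0) (c.vert 0))).mono h

end SimpleCycle

/-- The standard circle with vertices `0, …, b - 1`. -/
def standardCycle (b : ℕ) (hb : 3 ≤ b) : SimpleCycle ℕ where
  length := b
  three_le := hb
  vert i := i % b
  periodic i := by simp
  injective i hi j hj h := by rwa [Nat.mod_eq_of_lt hi, Nat.mod_eq_of_lt hj] at h

/-! ### Twisted cohomology -/

/-- The quotient `Z / B` of two submodules `B ≤ Z` of a module. -/
abbrev Subquotient {R C : Type*} [Ring R] [AddCommGroup C] [Module R C] (Z B : Submodule R C) :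
    Type _ :=
  Z ⧸ B.submoduleOf Z

section Cohomology

variable {V : Type*} [LinearOrder V]

namespace PreAbstractSimplicialComplex

/-- The `i`-simplices of `K`, with their vertices in increasing order. -/
def Simplex (K : PreAbstractSimplicialComplex V) (i : ℕ) : Type _ :=
  {s : Fin (i + 1) → V // StrictMono s ∧ Finset.univ.image s ∈ K.faces}

namespace Simplex

variable {K : PreAbstractSimplicialComplex V} {i : ℕ}

/-- The face opposite to the vertex number `k`. -/
def face (s : K.Simplex (i + 1)) (k : Fin (i + 2)) : K.Simplex i :=
  ⟨s.1 ∘ k.succAbove, s.2.1.comp (Fin.strictMono_succAbove k),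
    (K.isRelLowerSet_faces s.2.2).2
      (by intro x; simp only [Finset.mem_image]; rintro ⟨a, -, rfl⟩; exact ⟨_, by simp, rfl⟩)
      (Finset.univ_nonempty.image _)⟩

/-- A simplex of a subcomplex as a simplex of the complex. -/
def mono {A : PreAbstractSimplicialComplex V} (hA : A ≤ K) (s : A.Simplex i) : K.Simplex i :=
  ⟨s.1, s.2.1, hA s.2.2⟩

theorem edge_mem (s : K.Simplex i) (a b : Fin (i + 1)) : {s.1 a, s.1 b} ∈ K.faces :=
  (K.isRelLowerSet_faces s.2.2).2 (by intro x; simp; rintro (rfl | rfl) <;> simp) (by simp)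

/-- The edge (possibly constant) from the first vertex of `s` to the first vertex of its
face number `k`. -/
def toFace (s : K.Simplex (i + 1)) (k : Fin (i + 2)) : PathClass K (s.1 0) ((s.face k).1 0) :=
  PathClass.mk (EdgePath.single (s.edge_mem 0 (k.succAbove 0)))

end Simplex

variable (K : PreAbstractSimplicialComplex V) {x : V} {A : Type*} [AddCommGroup A] [Module ℂ A]

/-- The twisted simplicial cochains
`C^i(K; A) = Hom_{ℤ[π₁(K, x)]}(C_i(K̃; ℤ), A)`. The `i`-simplices of the universal cover `K̃`
are the pairs of an `i`-simplex `s` of `K` and a homotopy class of paths from `x` to the first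
vertex of `s`, so a cochain is an equivariant function of such pairs. -/
def Cochain (r : Representation ℂ (Pi1 K x) A) (i : ℕ) :
    Submodule ℂ ((s : K.Simplex i) → PathClass K x (s.1 0) → A) where
  carrier := {c | ∀ s (α : Pi1 K x) (γ : PathClass K x (s.1 0)),
    c s (α.comp γ) = r α (c s γ)}
  add_mem' := by intro a b ha hb s α γ; simp [ha s α γ, hb s α γ]
  zero_mem' := by intro s α γ; simp
  smul_mem' := by intro t a ha s α γ; simp [ha s α γ]

/-- The coboundary map, dual to the simplicial boundary map of the universal cover. -/
def coboundary (r : Representation ℂ (Pi1 K x) A) (i : ℕ) :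
    K.Cochain r i →ₗ[ℂ] K.Cochain r (i + 1) where
  toFun c := ⟨fun s γ => ∑ k : Fin (i + 2),
      (-1 : ℂ) ^ (k : ℕ) • c.1 (s.face k) (γ.comp (s.toFace k)), by
    intro s α γ
    simp only [PathClass.comp_assoc, map_sum, map_smul]
    exact Finset.sum_congr rfl fun k _ => by rw [c.2]⟩
  map_add' a b := by
    ext s γ
    simp [Finset.sum_add_distrib]
  map_smul' t a := by
    ext s γ
    simp only [Submodule.coe_smul, Pi.smul_apply, RingHom.id_apply, Finset.smul_sum]
    exact Finset.sum_congr rfl fun k _ => smul_comm _ _ _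

/-- The cocycles `Z^i(K; A)`. -/
def cocycles (r : Representation ℂ (Pi1 K x) A) (i : ℕ) : Submodule ℂ (K.Cochain r i) :=
  LinearMap.ker (K.coboundary r i)

/-- The coboundaries `B^i(K; A)`. -/
def coboundaries (r : Representation ℂ (Pi1 K x) A) : (i : ℕ) → Submodule ℂ (K.Cochain r i)
  | 0 => ⊥
  | i + 1 => LinearMap.range (K.coboundary r i)

/-- The twisted cohomology `H^i(K; A)`. -/
abbrev Cohomology (r : Representation ℂ (Pi1 K x) A) (i : ℕ) : Type _ :=
  Subquotient (K.cocycles r i) (K.coboundaries r i)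

variable {K}

/-- Restriction of twisted cochains to a subcomplex `B` with base point `b`, along a path class
from the base point `x` of `K` to `b`. -/
def restrictCochain {B : PreAbstractSimplicialComplex V} (hB : B ≤ K) {b : V}
    (γ : PathClass K x b) (r : Representation ℂ (Pi1 K x) A) (i : ℕ) (c : K.Cochain r i) :
    B.Cochain (r.comp (inclusionHom hB γ)) i :=
  ⟨fun s δ => c.1 (s.mono hB) (γ.comp (δ.mono hB)), by
    intro s α δ
    have h := c.2 (s.mono hB) (inclusionHom hB γ α) (γ.comp (δ.mono hB))
    have e : γ.comp ((α.comp δ).mono hB) =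
        (inclusionHom hB γ α).comp (γ.comp (δ.mono hB)) := by
      change γ.comp ((α.comp δ).mono hB) =
        ((γ.comp (α.mono hB)).comp γ.symm).comp (γ.comp (δ.mono hB))
      simp only [PathClass.mono_comp, PathClass.comp_assoc]
      rw [← PathClass.comp_assoc γ.symm γ, PathClass.symm_comp, PathClass.refl_comp]
    exact (congrArg (c.1 (s.mono hB)) e).trans h⟩

end PreAbstractSimplicialComplex

end Cohomology

/-! ### Representations in `SL₂(ℂ)` -/

section SL2

open Matrix

/-- The standard representation of `SL₂(ℂ)` on `ℂ²`. -/
def standardRep : Representation ℂ (SpecialLinearGroup (Fin 2) ℂ) (Fin 2 → ℂ) where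
  toFun g := Matrix.mulVecLin g.1
  map_one' := by ext; simp
  map_mul' g h := by simp [Matrix.mulVecLin_mul]; rfl

/-- The adjoint representation of `SL₂(ℂ)` on its Lie algebra: `Ad(g) X = g X g⁻¹`. -/
def adjointRep : Representation ℂ (SpecialLinearGroup (Fin 2) ℂ)
    (LieAlgebra.SpecialLinear.sl (Fin 2) ℂ) where
  toFun g :=
    { toFun := fun X => ⟨g.1 * X.1 * (g⁻¹).1, by
        have hX : X.1.trace = 0 := X.2
        have hg : (g⁻¹).1 * g.1 = 1 := congrArg Subtype.val (inv_mul_cancel g)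
        change (g.1 * X.1 * (g⁻¹).1).trace = 0
        rw [Matrix.trace_mul_comm, ← Matrix.mul_assoc, hg, Matrix.one_mul, hX]⟩
      map_add' := fun X Y => Subtype.ext (by
        change g.1 * (X.1 + Y.1) * (g⁻¹).1 = g.1 * X.1 * (g⁻¹).1 + g.1 * Y.1 * (g⁻¹).1
        rw [Matrix.mul_add, Matrix.add_mul])
      map_smul' := fun t X => Subtype.ext (by
        change g.1 * (t • X.1) * (g⁻¹).1 = t • (g.1 * X.1 * (g⁻¹).1)
        rw [Matrix.mul_smul, Matrix.smul_mul]) }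
  map_one' := by
    refine LinearMap.ext fun X => Subtype.ext ?_
    change (1 : SpecialLinearGroup (Fin 2) ℂ).1 * X.1 * (1⁻¹ : SpecialLinearGroup (Fin 2) ℂ).1 = X.1
    simp
  map_mul' g h := by
    refine LinearMap.ext fun X => Subtype.ext ?_
    change (g * h).1 * X.1 * ((g * h)⁻¹).1 = g.1 * (h.1 * X.1 * (h⁻¹).1) * (g⁻¹).1
    have h1 : (g * h).1 = g.1 * h.1 := rfl
    have h2 : ((g * h)⁻¹).1 = (h⁻¹).1 * (g⁻¹).1 := by rw [_root_.mul_inv_rev]; rfl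
    rw [h1, h2]
    simp only [Matrix.mul_assoc]

variable {G : Type*} [Group G]

/-- A homomorphism `G → SL₂(ℂ)` is irreducible if no line of `ℂ²` is invariant. -/
def IrreducibleSL2 (ρ : G →* SpecialLinearGroup (Fin 2) ℂ) : Prop :=
  Representation.IsIrreducible (standardRep.comp ρ)

/-- A homomorphism `G → SL₂(ℂ)` is abelian if its image is abelian. -/
def AbelianSL2 (ρ : G →* SpecialLinearGroup (Fin 2) ℂ) : Prop :=
  ∀ g h : G, Commute (ρ g) (ρ h)

/-- `t` is an eigenvalue of the matrix `g`. -/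
def EigenvalueSL2 (g : SpecialLinearGroup (Fin 2) ℂ) (t : ℂ) : Prop :=
  Module.End.HasEigenvalue (standardRep g) t

variable {V : Type*} [LinearOrder V]

/-- `H^i(K; sl₂(ℂ)_ρ)`, the cohomology of `K` with coefficients in `sl₂(ℂ)` twisted by `Ad ∘ ρ`. -/
abbrev AdCohomology (K : PreAbstractSimplicialComplex V) {x : V}
    (ρ : Pi1 K x →* SpecialLinearGroup (Fin 2) ℂ) (i : ℕ) : Type _ :=
  K.Cohomology (adjointRep.comp ρ) i

/-- `ρ` is `μ`-regular, for a closed curve `μ` in `E` through the base point: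
`dim H¹(E; sl₂(ℂ)_ρ) = 1` and the restriction `H¹(E; sl₂(ℂ)_ρ) → H¹(μ; sl₂(ℂ)_ρ)` is injective
(a cocycle on `E` whose restriction to `μ` is a coboundary is a coboundary). -/
def IsMuRegular {E : PreAbstractSimplicialComplex V} (μ : SimpleCycle V) (hμ : μ.toComplex ≤ E)
    (ρ : Pi1 E (μ.vert 0) →* SpecialLinearGroup (Fin 2) ℂ) : Prop :=
  Module.rank ℂ (AdCohomology E ρ 1) = 1 ∧
    ∀ c ∈ E.cocycles (adjointRep.comp ρ) 1,
      restrictCochain hμ (PathClass.refl E (μ.vert 0)) (adjointRep.comp ρ) 1 c ∈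
        μ.toComplex.coboundaries _ 1 →
      c ∈ E.coboundaries (adjointRep.comp ρ) 1

end SL2

/-! ### Knot exteriors -/

section Knots

variable {V : Type*} [LinearOrder V]

/-- `E` is a triangulated exterior of a knot `K` in the 3-sphere, with boundary torus `T`,
meridian `μ` and canonical longitude `ℓ`.

The ambient 3-sphere is `E ∪ N`, where `N` is a regular neighbourhood of `K`: a 3-manifold that
collapses to `K` and contains `K` in its interior. The ambient manifold is only required to be
closed and simply connected, which every triangulated 3-sphere is. The meridian is an essential
simple closed curve of `T` that is contractible in `N`; the canonical longitude is an essential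
simple closed curve of `T` that is null-homologous in `E`, i.e. trivial in the abelianization of
the knot group. -/
structure IsKnotExterior (E T : PreAbstractSimplicialComplex V) (μ ℓ : SimpleCycle V) :
    Prop where
  manifold : E.IsThreeManifold
  connected : E.IsConnected
  boundary_eq : E.boundary 3 = T
  exists_knot : ∃ N K : PreAbstractSimplicialComplex V,
    (E ⊔ N).IsClosedThreeManifold ∧ (E ⊔ N).IsSimplyConnected ∧ E ⊓ N = T ∧
    N.IsThreeManifold ∧ N.boundary 3 = T ∧ K.IsCircle ∧ K ≤ N ∧ K ⊓ T = ⊥ ∧ N.Collapses K ∧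
    ∃ h : μ.toComplex ≤ N, μ.loop h = 1
  meridian : ∃ h : μ.toComplex ≤ T, μ.loop h ≠ 1
  longitude : ∃ h : ℓ.toComplex ≤ T, ℓ.loop h ≠ 1
  longitude_null : ∃ h : ℓ.toComplex ≤ E, ℓ.loop h ∈ commutator (Pi1 E (ℓ.vert 0))

/-! ### The Alexander polynomial -/

/-- The zeroth Fitting (order) ideal of a finitely generated module: it is generated by the
determinants of square matrices of relations between the elements of generating families. -/
def fittingIdeal (R M : Type*) [CommRing R] [AddCommGroup M] [Module R M] : Ideal R :=
  Ideal.span {d | ∃ (r : ℕ) (x : Fin r → M) (N : Matrix (Fin r) (Fin r) R),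
    Submodule.span R (Set.range x) = ⊤ ∧ (∀ a, ∑ b, N a b • x b = 0) ∧ N.det = d}

open LaurentPolynomial in
/-- The simplicial boundary map `C_{i+1} → C_i` of the infinite cyclic cover of `E` associated
with an integral 1-cocycle `z`, as a map of free `ℤ[t, t⁻¹]`-modules: the cover has vertex set
`V × ℤ`, an edge from `(u, a)` to `(v, a + z u v)` for each edge of `E`, and each simplex is
lifted so that its first vertex is at level `0`. -/
def cyclicBoundary (E : PreAbstractSimplicialComplex V) (z : V → V → ℤ) (i : ℕ) :
    (E.Simplex (i + 1) →₀ ℤ[T;T⁻¹]) →ₗ[ℤ[T;T⁻¹]] (E.Simplex i →₀ ℤ[T;T⁻¹]) :=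
  Finsupp.linearCombination ℤ[T;T⁻¹] fun s => ∑ k : Fin (i + 2),
    Finsupp.single (s.face k) ((-1) ^ (k : ℕ) * T (z (s.1 0) ((s.face k).1 0)))

open LaurentPolynomial in
/-- The Alexander module: the first homology of the infinite cyclic cover. -/
abbrev AlexanderModule (E : PreAbstractSimplicialComplex V) (z : V → V → ℤ) : Type _ :=
  Subquotient (LinearMap.ker (cyclicBoundary E z 0)) (LinearMap.range (cyclicBoundary E z 1))

/-- `z` is an integral simplicial 1-cocycle on `E` with value `1` on the closed curve `μ`. -/
def IsMeridionalCocycle (E : PreAbstractSimplicialComplex V) (μ : SimpleCycle V)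
    (z : V → V → ℤ) : Prop :=
  (∀ u v w, {u, v, w} ∈ E.faces → z u v + z v w = z u w) ∧
    ∑ i ∈ Finset.range μ.length, z (μ.vert i) (μ.vert (i + 1)) = 1

open LaurentPolynomial in
/-- `Δ` is the Alexander polynomial of the knot with exterior `E` and meridian `μ`: the generator
of the order ideal of the Alexander module, in the usual normalization `Δ(t⁻¹) = Δ(t)` and
`Δ(1) = 1`, which fixes the unit. -/
def IsAlexanderPolynomial (E : PreAbstractSimplicialComplex V) (μ : SimpleCycle V)
    (Δ : ℤ[T;T⁻¹]) : Prop :=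
  invert Δ = Δ ∧ eval₂ (RingHom.id ℤ) 1 Δ = 1 ∧
    ∃ z, IsMeridionalCocycle E μ z ∧ Ideal.span {Δ} = fittingIdeal ℤ[T;T⁻¹] (AlexanderModule E z)

end Knots

/-! ### Composing spaces and exteriors of connected sums -/

/-- A composing space `Y = W × S¹`, triangulated with vertices in `V`. Here `W` is a disc with `n`
holes: a compact connected surface of Euler characteristic `1 - n` with `n + 1` boundary
circles, namely `outer` and `inner j` for `j : Fin n`. The circle `S¹` has `b` vertices, and `φ`
identifies the vertices of the product triangulation with those of `Y`. -/
structure ComposingSpace (V U : Type*) [LinearOrder V] [LinearOrder U] (n : ℕ) where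
  W : PreAbstractSimplicialComplex U
  outer : SimpleCycle U
  inner : Fin n → SimpleCycle U
  surface : W.IsSurface
  connected : W.IsConnected
  euler : W.eulerChar = 1 - n
  boundary_eq : W.boundary 2 = outer.toComplex ⊔ ⨆ j, (inner j).toComplex
  outer_disjoint : ∀ j, outer.toComplex ⊓ (inner j).toComplex = ⊥
  inner_disjoint : ∀ i j, i ≠ j → (inner i).toComplex ⊓ (inner j).toComplex = ⊥
  b : ℕ
  three_le : 3 ≤ b
  φ : U × ℕ → V
  φ_injOn : Set.InjOn φ {p | {p.1} ∈ W.faces ∧ p.2 < b}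

namespace ComposingSpace

variable {V U : Type*} [LinearOrder V] [LinearOrder U] {n : ℕ} (Y : ComposingSpace V U n)

/-- The circle factor. -/
abbrev fibre : SimpleCycle ℕ := standardCycle Y.b Y.three_le

/-- The triangulated 3-manifold `Y = W × S¹`. -/
def toComplex : PreAbstractSimplicialComplex V := (Y.W.prod Y.fibre.toComplex).map Y.φ

/-- The boundary torus `Σ_j = ∂D_j × S¹`. -/
def torus (j : Fin n) : PreAbstractSimplicialComplex V :=
  ((Y.inner j).toComplex.prod Y.fibre.toComplex).map Y.φ

theorem fibre_lt (i : ℕ) : Y.fibre.vert i < Y.b :=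
  Nat.mod_lt _ (lt_of_lt_of_le (by norm_num) Y.three_le)

theorem cycle_le_of_boundary (c : SimpleCycle U) (h : c.toComplex ≤ Y.W.boundary 2) :
    c.toComplex ≤ Y.W := by
  intro s hs
  obtain ⟨hne, t, ht, hst, -⟩ := h hs
  exact (Y.W.isRelLowerSet_faces ht).2 hst hne

theorem outer_le : Y.outer.toComplex ≤ Y.W :=
  Y.cycle_le_of_boundary _ (by rw [Y.boundary_eq]; exact le_sup_left)

theorem inner_le (j : Fin n) : (Y.inner j).toComplex ≤ Y.W :=
  Y.cycle_le_of_boundary _ (by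
    rw [Y.boundary_eq]
    exact (le_iSup (fun j => (Y.inner j).toComplex) j).trans le_sup_right)

theorem vert_mem (c : SimpleCycle U) (h : c.toComplex ≤ Y.W) (i : ℕ) :
    {c.vert i} ∈ Y.W.faces :=
  h ⟨by simp, i, by simp⟩

/-- The fibre `{w} × S¹` over the first vertex `w` of a polygon `c` in `W`. -/
def fibreOver (c : SimpleCycle U) (h : c.toComplex ≤ Y.W) : SimpleCycle V where
  length := Y.b
  three_le := Y.three_le
  vert i := Y.φ (c.vert 0, Y.fibre.vert i)
  periodic i := congrArg (fun k => Y.φ (c.vert 0, k)) (Y.fibre.periodic i)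
  injective i hi j hj hij := by
    have := Y.φ_injOn ⟨Y.vert_mem c h 0, Y.fibre_lt i⟩ ⟨Y.vert_mem c h 0, Y.fibre_lt j⟩ hij
    exact Y.fibre.injective i hi j hj (congrArg Prod.snd this)

/-- The meridian `μ` on the outer boundary torus `Σ = ∂D² × S¹`. -/
def outerMeridian : SimpleCycle V := Y.fibreOver Y.outer Y.outer_le

/-- The meridian `μ` on the boundary torus `Σ_j`. -/
def meridian (j : Fin n) : SimpleCycle V := Y.fibreOver (Y.inner j) (Y.inner_le j)

/-- The curve `λ_j = ∂D_j × {pt}` on the boundary torus `Σ_j`. -/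
def longitude (j : Fin n) : SimpleCycle V where
  length := (Y.inner j).length
  three_le := (Y.inner j).three_le
  vert i := Y.φ ((Y.inner j).vert i, Y.fibre.vert 0)
  periodic i := congrArg (fun w => Y.φ (w, Y.fibre.vert 0)) ((Y.inner j).periodic i)
  injective i hi k hk hik := by
    have := Y.φ_injOn ⟨Y.vert_mem _ (Y.inner_le j) i, Y.fibre_lt 0⟩
      ⟨Y.vert_mem _ (Y.inner_le j) k, Y.fibre_lt 0⟩ hik
    exact (Y.inner j).injective i hi k hk (congrArg Prod.fst this)

theorem outerMeridian_le : Y.outerMeridian.toComplex ≤ Y.toComplex := by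
  rintro s ⟨hs, i, hi⟩
  have hmem : ({Y.outerMeridian.vert i, Y.outerMeridian.vert (i + 1)} : Finset V) ∈
      Y.toComplex.faces := by
    refine ⟨{(Y.outer.vert 0, Y.fibre.vert i), (Y.outer.vert 0, Y.fibre.vert (i + 1))},
      ⟨?_, ?_, ?_⟩, ?_⟩
    · simpa using Y.vert_mem _ Y.outer_le 0
    · simpa using Y.fibre.edge_mem i
    · intro p hp q hq _
      simp only [Finset.coe_insert, Finset.coe_singleton, Set.mem_insert_iff,
        Set.mem_singleton_iff] at hp hq
      have hle : ∀ a b : ℕ, ((Y.outer.vert 0, a) : U × ℕ) ≤ (Y.outer.vert 0, b) ∨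
          ((Y.outer.vert 0, b) : U × ℕ) ≤ (Y.outer.vert 0, a) := fun a b => by
        simpa only [Prod.mk_le_mk, le_refl, true_and] using le_total a b
      rcases hp with rfl | rfl <;> rcases hq with rfl | rfl <;> exact hle _ _
    · simp [outerMeridian, fibreOver]
  exact (Y.toComplex.isRelLowerSet_faces hmem).2 hi hs

end ComposingSpace

/-- The exterior `M = Y ∪ M_1 ∪ … ∪ M_n` of the connected sum of `n` knots: the exterior `M_j` of
the `j`-th knot is glued to the composing space `Y` along `∂M_j = Σ_j`, such that its meridian
and canonical longitude are `μ` and `λ_j`. -/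
structure ConnectedSumExterior (V U : Type*) [LinearOrder V] [LinearOrder U] (n : ℕ) where
  Y : ComposingSpace V U n
  piece : Fin n → PreAbstractSimplicialComplex V
  isKnotExterior : ∀ j, IsKnotExterior (piece j) (Y.torus j) (Y.meridian j) (Y.longitude j)
  piece_inter : ∀ j, piece j ⊓ Y.toComplex = Y.torus j
  piece_disjoint : ∀ i j, i ≠ j → piece i ⊓ piece j = ⊥

namespace ConnectedSumExterior

variable {V U : Type*} [LinearOrder V] [LinearOrder U] {n : ℕ} (X : ConnectedSumExterior V U n)

/-- The triangulated 3-manifold `M`. -/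
def M : PreAbstractSimplicialComplex V := X.Y.toComplex ⊔ ⨆ j, X.piece j

theorem piece_le (j : Fin n) : X.piece j ≤ X.M :=
  (le_iSup X.piece j).trans le_sup_right

theorem meridian_le (j : Fin n) : (X.Y.meridian j).toComplex ≤ X.piece j := by
  obtain ⟨h, -⟩ := (X.isKnotExterior j).meridian
  exact h.trans (by rw [← X.piece_inter j]; exact inf_le_left)

theorem longitude_le (j : Fin n) : (X.Y.longitude j).toComplex ≤ X.piece j := by
  obtain ⟨h, -⟩ := (X.isKnotExterior j).longitude
  exact h.trans (by rw [← X.piece_inter j]; exact inf_le_left)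

theorem outerMeridian_le : X.Y.outerMeridian.toComplex ≤ X.M :=
  X.Y.outerMeridian_le.trans le_sup_left

/-- The base point of `M`, on the meridian of its boundary torus. -/
abbrev base : V := X.Y.outerMeridian.vert 0

/-- The base point of `M_j`, the common point of `μ` and `λ_j` on `Σ_j`. -/
abbrev pieceBase (j : Fin n) : V := (X.Y.meridian j).vert 0

/-- The class of the meridian in `π₁(M)`. -/
def mu : Pi1 X.M X.base := X.Y.outerMeridian.loop X.outerMeridian_le

/-- The class of the canonical longitude `λ_j` in `π₁(M_j)`. -/
def pieceLongitude (j : Fin n) : Pi1 (X.piece j) (X.pieceBase j) :=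
  (X.Y.longitude j).loop (X.longitude_le j)

/-- The restriction `ρ_j` of `ρ` to `π₁(M_j)`, along a path class `γ` in `M` between the base
points (another choice of `γ` conjugates `ρ_j`). -/
def restrict (ρ : Pi1 X.M X.base →* Matrix.SpecialLinearGroup (Fin 2) ℂ) (j : Fin n)
    (γ : PathClass X.M X.base (X.pieceBase j)) :
    Pi1 (X.piece j) (X.pieceBase j) →* Matrix.SpecialLinearGroup (Fin 2) ℂ :=
  ρ.comp (inclusionHom (X.piece_le j) γ)

end ConnectedSumExterior

end

set_option linter.unusedSectionVars false

noncomputable section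

namespace PreAbstractSimplicialComplex

variable {V : Type*} [DecidableEq V] {Γ : Type*} [Group Γ]
  {K : PreAbstractSimplicialComplex V}

/-! Up to conjugation `ρ` is the holonomy of a flat transport `G`: a matrix on every oriented edge,
with trivial holonomy around triangles (`exists_isFlat`). Twisted cochains then become plain
functions on simplices (`rank_cohomology_eq`), and 1-cocycles become functions `f` of pairs of
vertices with `f u v + Ad(G u v) f v w = f u w`. In `Y = W × S¹` the fibre is central and its
holonomy has the distinct eigenvalues `m`, `m⁻¹`. Frames of eigenvectors of the fibres therefore
make `G` diagonal on all of `Y`, with fibre holonomy `diag(m, m⁻¹)` (`exists_isDiagonalTransport`).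

Only the first cohomology needs work. `H⁰` vanishes because an irreducible representation has no
invariant vector in `sl₂`. `H³` vanishes because `M` has a free boundary component, the outer torus,
from which every tetrahedron is reached by crossing triangles (`tetrahedron_induction`). The Euler
characteristic of `M` is zero (`euler_M`), so `H²` and `H¹` have equal dimension.

Over `Y` the adjoint module splits into two off-diagonal lines, on which the fibre acts by `m^{±2} ≠
1` and which contribute nothing, and the trivial line spanned by `h = diag(1, -1)`. Modulo
coboundaries a cocycle on `Y` is thus an ordinary one: a class on `W` and a period `t` along the
fibre, the same at every `Σ_j` (`exists_cocycle_normal_form`). On each piece a cocycle of period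
zero is a coboundary, and a cocycle of period one exists (`PieceRegularity`). For irreducible `ρ_j`
this is `μ`-regularity. For reducible `ρ_j` it follows from `Δ_{K_j}(m²) ≠ 0`, which makes `ρ_j`
factor through the abelianization (`AlexanderRegular.eq_one_of_not_irreducible`) and makes crossed
homomorphisms depend, up to principal ones, on the meridian only
(`AlexanderRegular.crossed_principal`). In particular reducible and abelian mean the same here.

Since `H¹(W)` realizes arbitrary integrals along the inner boundary circles
(`exists_cocycle_integral_eq`), the generators of the pieces extend over `Y` and glue to a cocycle
`f₀` with all periods one. Given a cocycle of period `t`, subtract `t f₀`. The rest is `dp_j` on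
each piece and `dq` on `Y`, and `q - p_j` is parallel on `Σ_j`, hence equal to `c_j h`. If `ρ_j` is
reducible, `h` extends to a parallel section over the piece and `c_j` can be absorbed. If `ρ_j` is
irreducible, the piece has no parallel section and `c_j` survives as a bending parameter. So `H¹(M)`
is spanned by `f₀` and one bending parameter for each irreducible piece, with a single relation:
bending all pieces equally is a coboundary. At least one piece is irreducible, since otherwise `h`
would extend to a parallel section over `M`. The dimension is therefore the number of irreducible
pieces, `n - k` (`rank_funCohomology_one`). -/

theorem face_mono (K : PreAbstractSimplicialComplex V) {s t : Finset V} (ht : t ∈ K.faces)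
    (hst : s ⊆ t) (hs : s.Nonempty) : s ∈ K.faces :=
  (K.isRelLowerSet_faces ht).2 hst hs

theorem face_nonempty (K : PreAbstractSimplicialComplex V) {s : Finset V} (hs : s ∈ K.faces) :
    s.Nonempty :=
  (K.isRelLowerSet_faces hs).1

theorem left_mem_of_edge {u v : V} (h : {u, v} ∈ K.faces) : {u} ∈ K.faces :=
  K.face_mono h (by simp) (by simp)

theorem right_mem_of_edge {u v : V} (h : {u, v} ∈ K.faces) : {v} ∈ K.faces :=
  K.face_mono h (by simp) (by simp)

theorem edge_symm {u v : V} (h : {u, v} ∈ K.faces) : {v, u} ∈ K.faces := by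
  rwa [Finset.pair_comm]

/-! ### Flat transports and holonomy -/

/-- A flat transport on `K` with values in a group: a group element for each oriented edge, with
trivial holonomy around triangles. -/
def IsFlat (K : PreAbstractSimplicialComplex V) (G : V → V → Γ) : Prop :=
  ∀ u v w, {u, v, w} ∈ K.faces → G u v * G v w = G u w

namespace IsFlat

variable {G : V → V → Γ}

theorem mono {A : PreAbstractSimplicialComplex V} (hG : K.IsFlat G) (hA : A ≤ K) : A.IsFlat G :=
  fun u v w h => hG u v w (hA h)

theorem self (hG : K.IsFlat G) {u : V} (h : {u} ∈ K.faces) : G u u = 1 := by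
  have := hG u u u (by simpa using h)
  simpa using this

theorem mul_symm (hG : K.IsFlat G) {u v : V} (h : {u, v} ∈ K.faces) : G u v * G v u = 1 := by
  rw [hG u v u, hG.self (left_mem_of_edge h)]
  have : ({u, v, u} : Finset V) = {u, v} := by ext x; simp; tauto
  rwa [this]

theorem symm (hG : K.IsFlat G) {u v : V} (h : {u, v} ∈ K.faces) : G v u = (G u v)⁻¹ :=
  (inv_eq_of_mul_eq_one_right (hG.mul_symm h)).symm

theorem map {Γ' : Type*} [Group Γ'] (ψ : Γ →* Γ') (hG : K.IsFlat G) :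
    K.IsFlat fun u v => ψ (G u v) :=
  fun u v w h => by rw [← map_mul, hG u v w h]

/-- A change of frames preserves flatness. -/
theorem gauge (hG : K.IsFlat G) (h : V → Γ) : K.IsFlat fun u v => (h u)⁻¹ * G u v * h v :=
  fun u v w huvw => by
    beta_reduce
    rw [← hG u v w huvw]
    group

end IsFlat

/-- The holonomy of an edge path. -/
def EdgePath.hol (G : V → V → Γ) : {u v : V} → EdgePath K u v → Γ
  | _, _, .nil _ => 1
  | u, _, .cons (v := v) _ p => G u v * hol G p

namespace EdgePath

variable {G : V → V → Γ}

theorem hol_append {u v w : V} (p : EdgePath K u v) (q : EdgePath K v w) :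
    hol G (append p q) = hol G p * hol G q := by
  induction p with
  | nil u => simp [append, hol]
  | cons h p ih => simp [append, hol, ih, mul_assoc]

theorem hol_mono {A : PreAbstractSimplicialComplex V} (hA : A ≤ K) {u v : V}
    (p : EdgePath A u v) : hol G (p.mono hA) = hol G p := by
  induction p with
  | nil u => rfl
  | cons h p ih => simp [mono, hol, ih]

theorem hol_eq_of_homotopic (hG : K.IsFlat G) {u v : V} {p q : EdgePath K u v}
    (h : Homotopic p q) : hol G p = hol G q := by
  induction h with
  | refl p => rfl
  | symm _ ih => exact ih.symm
  | trans _ _ ih₁ ih₂ => exact ih₁.trans ih₂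
  | cons e _ ih => simp [hol, ih]
  | const e p => simp [hol, hG.self (left_mem_of_edge e)]
  | triangle h₁ h₂ h₃ h p => simp [hol, ← mul_assoc, hG _ _ _ h]

theorem hol_gauge (h : V → Γ) {u v : V} (p : EdgePath K u v) :
    hol (fun u v => (h u)⁻¹ * G u v * h v) p = (h u)⁻¹ * hol G p * h v := by
  induction p with
  | nil u => simp [hol]
  | cons e p ih => rw [hol, ih, hol]; group

end EdgePath

namespace PathClass

variable {G : V → V → Γ}

/-- The holonomy of a path class. -/
def hol (hG : K.IsFlat G) {u v : V} (a : PathClass K u v) : Γ :=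
  Quotient.lift (s := EdgePath.homotopySetoid K u v) (EdgePath.hol G)
    (fun _ _ h => EdgePath.hol_eq_of_homotopic hG h) a

@[simp]
theorem hol_mk (hG : K.IsFlat G) {u v : V} (p : EdgePath K u v) : hol hG (mk p) = p.hol G := rfl

@[simp]
theorem hol_comp (hG : K.IsFlat G) {u v w : V} (a : PathClass K u v) (b : PathClass K v w) :
    hol hG (a.comp b) = hol hG a * hol hG b := by
  induction a using ind
  induction b using ind
  exact EdgePath.hol_append _ _

@[simp]
theorem hol_refl (hG : K.IsFlat G) (u : V) : hol hG (refl K u) = 1 := rfl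

@[simp]
theorem hol_symm (hG : K.IsFlat G) {u v : V} (a : PathClass K u v) :
    hol hG a.symm = (hol hG a)⁻¹ := by
  rw [eq_inv_iff_mul_eq_one, ← hol_comp, symm_comp, hol_refl]

@[simp]
theorem hol_mono {A : PreAbstractSimplicialComplex V} (hG : K.IsFlat G) (hA : A ≤ K) {u v : V}
    (a : PathClass A u v) : hol hG (a.mono hA) = hol (hG.mono hA) a := by
  induction a using ind
  exact EdgePath.hol_mono hA _

theorem comp_symm {u v : V} (a : PathClass K u v) : comp a (symm a) = refl K u := by
  induction a using ind
  exact Quotient.sound (s := EdgePath.homotopySetoid K u u) (EdgePath.append_reverse _)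

end PathClass

/-- The holonomy representation of the edge-path group. -/
def holHom {G : V → V → Γ} (hG : K.IsFlat G) (x : V) : Pi1 K x →* Γ :=
  MonoidHom.mk' (fun α => PathClass.hol hG α) fun α β => PathClass.hol_comp hG α β

theorem holHom_apply {G : V → V → Γ} (hG : K.IsFlat G) {x : V} (α : Pi1 K x) :
    holHom hG x α = PathClass.hol hG α := rfl

theorem holHom_inclusionHom {A : PreAbstractSimplicialComplex V} {G : V → V → Γ}
    (hG : K.IsFlat G) (hA : A ≤ K) {x a : V} (γ : PathClass K x a) (α : Pi1 A a) :
    holHom hG x (inclusionHom hA γ α) =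
      PathClass.hol hG γ * holHom (hG.mono hA) a α * (PathClass.hol hG γ)⁻¹ := by
  change PathClass.hol hG ((γ.comp (α.mono hA)).comp γ.symm) = _
  simp [holHom_apply]

/-- Every representation of the edge-path group is, up to conjugation, the holonomy of a flat
transport. -/
theorem exists_isFlat (hK : K.IsConnected) {x : V} (hx : {x} ∈ K.faces) (ρ : Pi1 K x →* Γ) :
    ∃ (G : V → V → Γ) (hG : K.IsFlat G) (g : Γ), ∀ α, ρ α = g * holHom hG x α * g⁻¹ := by
  classical
  have hδ : ∀ v, {v} ∈ K.faces → Nonempty (PathClass K x v) := fun v hv =>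
    (hK.2 x v hx hv).map PathClass.mk
  let δ : ∀ v, {v} ∈ K.faces → PathClass K x v := fun v hv => (hδ v hv).some
  -- The paths `δ` from `x` are chosen arbitrarily; they close up any path from `u` to `v` to a loop
  -- at `x`, on which `ρ` can be evaluated.
  let F : ∀ u v, {u} ∈ K.faces → {v} ∈ K.faces → PathClass K u v → Γ := fun u v hu hv a =>
    ρ (((δ u hu).comp a).comp (δ v hv).symm)
  have hF : ∀ u v w hu hv hw (a : PathClass K u v) (b : PathClass K v w),
      F u v hu hv a * F v w hv hw b = F u w hu hw (a.comp b) := by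
    intro u v w hu hv hw a b
    change ρ _ * ρ _ = ρ _
    rw [← map_mul]
    congr 1
    change PathClass.comp _ _ = _
    simp only [PathClass.comp_assoc]
    rw [← PathClass.comp_assoc (δ v hv).symm, PathClass.symm_comp, PathClass.refl_comp]
  have hF1 : ∀ u hu, F u u hu hu (PathClass.refl K u) = 1 := by
    intro u hu
    change ρ _ = 1
    rw [PathClass.comp_refl, PathClass.comp_symm]
    exact map_one ρ
  let G : V → V → Γ := fun u v => if h : {u, v} ∈ K.faces then
    F u v (left_mem_of_edge h) (right_mem_of_edge h) (.mk (.single h)) else 1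
  have hG : K.IsFlat G := by
    intro u v w h
    have huv : {u, v} ∈ K.faces := K.face_mono h (by intro x; simp; tauto) (by simp)
    have hvw : {v, w} ∈ K.faces := K.face_mono h (by intro x; simp; tauto) (by simp)
    have huw : {u, w} ∈ K.faces := K.face_mono h (by intro x; simp; tauto) (by simp)
    simp only [G, dif_pos huv, dif_pos hvw, dif_pos huw]
    rw [hF u v w (left_mem_of_edge huv) (left_mem_of_edge hvw) (right_mem_of_edge hvw)]
    exact congrArg (F u w (left_mem_of_edge huv) (right_mem_of_edge hvw))
      (Quotient.sound (s := EdgePath.homotopySetoid K u w)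
        (EdgePath.Homotopic.triangle huv hvw huw h _))
  have hol : ∀ u v hu hv (p : EdgePath K u v), p.hol G = F u v hu hv (.mk p) := by
    intro u v hu hv p
    induction p with
    | nil u => exact (hF1 u hu).symm
    | cons h p ih =>
      rw [EdgePath.hol, ih (right_mem_of_edge h) hv]
      simp only [G, dif_pos h]
      exact hF _ _ _ hu (right_mem_of_edge h) hv _ _
  -- The path `δ x` is a loop that need not be trivial. The holonomy of `α` is `ρ` of its conjugate
  -- by `δ x`, and this is undone by the inverse of `ρ (δ x)`.
  refine ⟨G, hG, (ρ (δ x hx))⁻¹, fun α => ?_⟩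
  induction α using PathClass.ind with
  | h p =>
    rw [holHom_apply, PathClass.hol_mk, hol x x hx hx]
    change _ = _ * ρ (δ x hx * PathClass.mk p * (δ x hx)⁻¹) * _
    simp only [map_mul, map_inv]
    group

/-- A vector fixed by the holonomy of all loops extends to a parallel section. -/
theorem IsFlat.exists_section {X : Type*} [MulAction Γ X] {G : V → V → Γ} (hG : K.IsFlat G)
    (hK : K.IsConnected) {b : V} (hb : {b} ∈ K.faces) {x₀ : X}
    (h : ∀ α : Pi1 K b, holHom hG b α • x₀ = x₀) :
    ∃ s : V → X, s b = x₀ ∧ ∀ u v, {u, v} ∈ K.faces → G u v • s v = s u := by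
  classical
  have hδ : ∀ v, {v} ∈ K.faces → Nonempty (PathClass K b v) := fun v hv =>
    (hK.2 b v hb hv).map PathClass.mk
  let δ : ∀ v, {v} ∈ K.faces → PathClass K b v := fun v hv => (hδ v hv).some
  -- Transport of `x₀` along any path will do, because loops fix `x₀`. The value outside the
  -- vertices of `K` plays no role.
  refine ⟨fun v => if hv : {v} ∈ K.faces then (PathClass.hol hG (δ v hv))⁻¹ • x₀ else x₀, ?_, ?_⟩
  · simp only [dif_pos hb]
    rw [inv_smul_eq_iff]
    exact (h (δ b hb)).symm
  · intro u v huv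
    have hu := left_mem_of_edge huv
    have hv := right_mem_of_edge huv
    simp only [dif_pos hu, dif_pos hv]
    have := h (((δ u hu).comp (.mk (.single huv))).comp (δ v hv).symm)
    simp only [holHom_apply, PathClass.hol_comp, PathClass.hol_mk, PathClass.hol_symm,
      EdgePath.single, EdgePath.hol, mul_one, mul_smul] at this
    rw [eq_inv_smul_iff, this]

theorem EdgePath.hol_smul_section {X : Type*} [MulAction Γ X] {G : V → V → Γ} {s : V → X}
    (hs : ∀ u v, {u, v} ∈ K.faces → G u v • s v = s u) {u v : V} (p : EdgePath K u v) :
    p.hol G • s v = s u := by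
  induction p with
  | nil u => simp [hol]
  | cons h p ih => rw [hol, mul_smul, ih, hs _ _ h]

/-- Parallel sections that agree at one vertex agree at all vertices. -/
theorem IsConnected.section_unique {X : Type*} [MulAction Γ X] {G : V → V → Γ}
    (hK : K.IsConnected) {b : V} (hb : {b} ∈ K.faces) {s s' : V → X}
    (hs : ∀ u v, {u, v} ∈ K.faces → G u v • s v = s u)
    (hs' : ∀ u v, {u, v} ∈ K.faces → G u v • s' v = s' u) (h : s b = s' b)
    {v : V} (hv : {v} ∈ K.faces) : s v = s' v := by
  obtain ⟨p⟩ := hK.2 v b hv hb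
  rw [← p.hol_smul_section hs, ← p.hol_smul_section hs', h]

end PreAbstractSimplicialComplex

open PreAbstractSimplicialComplex

/-! ### Holonomy around polygons -/

/-- The holonomy along the first `k` edges of a sequence of vertices. -/
def seqHol {V Γ : Type*} [Group Γ] (G : V → V → Γ) (v : ℕ → V) : ℕ → Γ
  | 0 => 1
  | k + 1 => seqHol G v k * G (v k) (v (k + 1))

theorem SimpleCycle.hol_path {V Γ : Type*} [DecidableEq V] [Group Γ] (c : SimpleCycle V)
    (G : V → V → Γ) (k : ℕ) : (c.path k).hol G = seqHol G c.vert k := by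
  induction k with
  | zero => rfl
  | succ k ih => simp [path, EdgePath.hol_append, ih, seqHol, EdgePath.single, EdgePath.hol]

theorem SimpleCycle.hol_loop {V Γ : Type*} [DecidableEq V] [Group Γ] (c : SimpleCycle V)
    {G : V → V → Γ} {K : PreAbstractSimplicialComplex V} (hG : K.IsFlat G)
    (h : c.toComplex ≤ K) : holHom hG _ (c.loop h) = seqHol G c.vert c.length := by
  rw [holHom_apply, SimpleCycle.loop, PathClass.hol_mono, PathClass.hol_mk, ← c.hol_path]
  -- The definition of `loop` contains casts along `vert_length`. Holonomy does not see them; they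
  -- disappear once the end points are general.
  have : ∀ (w v : V) (e : v = w) (e' : w = v) (p : EdgePath c.toComplex v w),
      (@Eq.rec V w (fun x _ => EdgePath c.toComplex x x)
        (@Eq.rec V v (fun x _ => EdgePath c.toComplex x w) p w e) v e').hol G = p.hol G := by
    rintro w v rfl e' p
    rfl
  exact this _ _ c.vert_length.symm c.vert_length _

end

noncomputable section

namespace PreAbstractSimplicialComplex

variable {V : Type*} [LinearOrder V] {Γ : Type*} [Group Γ]
  {K : PreAbstractSimplicialComplex V} {A : Type*} [AddCommGroup A] [Module ℂ A]

theorem Simplex.vertex_mem {i : ℕ} (s : K.Simplex i) (a : Fin (i + 1)) : {s.1 a} ∈ K.faces :=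
  left_mem_of_edge (s.edge_mem a a)

@[ext]
theorem Simplex.ext {i : ℕ} {s t : K.Simplex i} (h : ∀ a, s.1 a = t.1 a) : s = t :=
  Subtype.ext (funext h)

/-! ### Cochains as functions on simplices -/

/-- The coboundary map of cochains given as functions on simplices, with respect to a
transport `G` acting on the coefficients. -/
def funCoboundary (K : PreAbstractSimplicialComplex V) (r : Representation ℂ Γ A)
    (G : V → V → Γ) (i : ℕ) : (K.Simplex i → A) →ₗ[ℂ] (K.Simplex (i + 1) → A) where
  toFun f s := ∑ k : Fin (i + 2),
    (-1 : ℂ) ^ (k : ℕ) • r (G (s.1 0) ((s.face k).1 0)) (f (s.face k))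
  map_add' a b := by
    ext s
    simp [Finset.sum_add_distrib]
  map_smul' t a := by
    ext s
    simp only [Pi.smul_apply, RingHom.id_apply, Finset.smul_sum, map_smul]
    exact Finset.sum_congr rfl fun k _ => smul_comm _ _ _

/-- The coboundaries among functions on simplices. -/
def funCoboundaries (K : PreAbstractSimplicialComplex V) (r : Representation ℂ Γ A)
    (G : V → V → Γ) : (i : ℕ) → Submodule ℂ (K.Simplex i → A)
  | 0 => ⊥
  | i + 1 => LinearMap.range (K.funCoboundary r G i)

section toCochain

variable {r : Representation ℂ Γ A} {G : V → V → Γ} {x : V}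

theorem rep_inv_cancel (r : Representation ℂ Γ A) (g : Γ) (a : A) : r g⁻¹ (r g a) = a := by
  rw [← Module.End.mul_apply, ← map_mul, inv_mul_cancel, map_one, Module.End.one_apply]

theorem rep_cancel_inv (r : Representation ℂ Γ A) (g : Γ) (a : A) : r g (r g⁻¹ a) = a := by
  simp

/-- The twisted cochain defined by a function on simplices, for coefficients given by the holonomy
of a flat transport. -/
def toCochain (hG : K.IsFlat G) (g : Γ) {r' : Representation ℂ (Pi1 K x) A}
    (hr : ∀ α, r' α = r (g * holHom hG x α * g⁻¹)) (i : ℕ) :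
    (K.Simplex i → A) →ₗ[ℂ] K.Cochain r' i where
  toFun f := ⟨fun s ε => r (g * PathClass.hol hG ε) (f s), by
    intro s α γ
    rw [hr, ← Module.End.mul_apply, ← map_mul]
    refine congrArg (fun a => r a (f s)) ?_
    change g * PathClass.hol hG (PathClass.comp α γ) = _
    rw [PathClass.hol_comp, holHom_apply]
    group⟩
  map_add' a b := by
    ext s ε
    simp
  map_smul' t a := by
    ext s ε
    simp

theorem toCochain_apply (hG : K.IsFlat G) (g : Γ) {r' : Representation ℂ (Pi1 K x) A}
    (hr : ∀ α, r' α = r (g * holHom hG x α * g⁻¹)) (i : ℕ) (f : K.Simplex i → A)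
    (s : K.Simplex i) (ε : PathClass K x (s.1 0)) :
    (toCochain hG g hr i f).1 s ε = r (g * PathClass.hol hG ε) (f s) := rfl

/-- Equivariance determines a cochain on all path classes to the first vertex of a simplex from its
value on a single one, and connectedness provides one. -/
theorem toCochain_bijective (hG : K.IsFlat G) (g : Γ) {r' : Representation ℂ (Pi1 K x) A}
    (hr : ∀ α, r' α = r (g * holHom hG x α * g⁻¹)) (hK : K.IsConnected) (hx : {x} ∈ K.faces)
    (i : ℕ) : Function.Bijective (toCochain hG g hr i) := by
  have hε : ∀ s : K.Simplex i, Nonempty (PathClass K x (s.1 0)) := fun s =>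
    (hK.2 _ _ hx (s.vertex_mem 0)).map PathClass.mk
  let ε := fun s : K.Simplex i => (hε s).some
  constructor
  · refine (injective_iff_map_eq_zero _).2 fun f hf => ?_
    ext s
    have : (toCochain hG g hr i f).1 s (ε s) = 0 := by
      have h0 : toCochain hG g hr i f = 0 := hf
      rw [h0]
      rfl
    rw [toCochain_apply] at this
    rw [← rep_inv_cancel r (g * PathClass.hol hG (ε s)) (f s), this, map_zero, Pi.zero_apply]
  · intro c
    refine ⟨fun s => r (g * PathClass.hol hG (ε s))⁻¹ (c.1 s (ε s)), ?_⟩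
    ext s δ
    rw [toCochain_apply]
    have h := c.2 s (δ.comp (ε s).symm : Pi1 K x) (ε s)
    rw [PathClass.comp_assoc, PathClass.symm_comp, PathClass.comp_refl] at h
    rw [h, hr, ← Module.End.mul_apply, ← map_mul, holHom_apply, PathClass.hol_comp,
      PathClass.hol_symm]
    congr 2
    group

/-- The value on a simplex is expressed in the frame at its first vertex. Passing to a face whose
first vertex is different changes the frame by the holonomy of `toFace`, which is the factor `G` in
`funCoboundary`. -/
theorem coboundary_toCochain (hG : K.IsFlat G) (g : Γ) {r' : Representation ℂ (Pi1 K x) A}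
    (hr : ∀ α, r' α = r (g * holHom hG x α * g⁻¹)) (i : ℕ) (f : K.Simplex i → A) :
    K.coboundary r' i (toCochain hG g hr i f) =
      toCochain hG g hr (i + 1) (K.funCoboundary r G i f) := by
  ext s ε
  rw [toCochain_apply]
  simp only [coboundary, funCoboundary, LinearMap.coe_mk, AddHom.coe_mk, map_sum, map_smul]
  refine Finset.sum_congr rfl fun k _ => ?_
  rw [toCochain_apply, ← Module.End.mul_apply, ← map_mul, PathClass.hol_comp, mul_assoc]
  congr 3
  refine congrArg (fun a => g * (PathClass.hol hG ε * a)) ?_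
  change EdgePath.hol G (EdgePath.single _) = _
  simp [EdgePath.single, EdgePath.hol]

/-- Restriction along `γ` only moves the reference frame: the conjugator `g` is replaced by `g`
times the holonomy of `γ`, and the function on simplices stays the same. -/
theorem restrictCochain_toCochain {B : PreAbstractSimplicialComplex V} (hB : B ≤ K) {b : V}
    (γ : PathClass K x b) (hG : K.IsFlat G) (g : Γ) {r' : Representation ℂ (Pi1 K x) A}
    (hr : ∀ α, r' α = r (g * holHom hG x α * g⁻¹))
    (hr' : ∀ α, r'.comp (inclusionHom hB γ) α =
      r (g * PathClass.hol hG γ * holHom (hG.mono hB) b α * (g * PathClass.hol hG γ)⁻¹))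
    (i : ℕ) (f : K.Simplex i → A) :
    restrictCochain hB γ r' i (toCochain hG g hr i f) =
      toCochain (hG.mono hB) (g * PathClass.hol hG γ) hr' i (fun s => f (s.mono hB)) := by
  ext s ε
  rw [toCochain_apply]
  change r (g * PathClass.hol hG (γ.comp (ε.mono hB))) _ = _
  rw [PathClass.hol_comp, PathClass.hol_mono, mul_assoc]

theorem comp_inclusionHom_eq {B : PreAbstractSimplicialComplex V} (hB : B ≤ K) {b : V}
    (γ : PathClass K x b) (hG : K.IsFlat G) (g : Γ) {r' : Representation ℂ (Pi1 K x) A}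
    (hr : ∀ α, r' α = r (g * holHom hG x α * g⁻¹)) (α : Pi1 B b) :
    r'.comp (inclusionHom hB γ) α =
      r (g * PathClass.hol hG γ * holHom (hG.mono hB) b α * (g * PathClass.hol hG γ)⁻¹) := by
  rw [MonoidHom.comp_apply, hr, holHom_inclusionHom]
  congr 1
  group

theorem toCochain_mem_cocycles (hG : K.IsFlat G) (g : Γ) {r' : Representation ℂ (Pi1 K x) A}
    (hr : ∀ α, r' α = r (g * holHom hG x α * g⁻¹)) (hK : K.IsConnected) (hx : {x} ∈ K.faces)
    {i : ℕ} {f : K.Simplex i → A} :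
    toCochain hG g hr i f ∈ K.cocycles r' i ↔ K.funCoboundary r G i f = 0 := by
  rw [cocycles, LinearMap.mem_ker, coboundary_toCochain]
  exact map_eq_zero_iff _ (toCochain_bijective hG g hr hK hx _).1

theorem toCochain_mem_coboundaries (hG : K.IsFlat G) (g : Γ) {r' : Representation ℂ (Pi1 K x) A}
    (hr : ∀ α, r' α = r (g * holHom hG x α * g⁻¹)) (hK : K.IsConnected) (hx : {x} ∈ K.faces)
    {i : ℕ} {f : K.Simplex i → A} :
    toCochain hG g hr i f ∈ K.coboundaries r' i ↔ f ∈ K.funCoboundaries r G i := by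
  cases i with
  | zero =>
    change _ ∈ (⊥ : Submodule ℂ _) ↔ _ ∈ (⊥ : Submodule ℂ _)
    rw [Submodule.mem_bot, Submodule.mem_bot]
    exact map_eq_zero_iff _ (toCochain_bijective hG g hr hK hx _).1
  | succ i =>
    change _ ∈ LinearMap.range _ ↔ _ ∈ LinearMap.range _
    constructor
    · rintro ⟨c, hc⟩
      obtain ⟨f', rfl⟩ := (toCochain_bijective hG g hr hK hx i).2 c
      rw [coboundary_toCochain] at hc
      exact ⟨f', (toCochain_bijective hG g hr hK hx _).1 hc⟩
    · rintro ⟨f', rfl⟩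
      exact ⟨toCochain hG g hr i f', coboundary_toCochain hG g hr i f'⟩

theorem mem_submoduleOf_iff {R C : Type*} [Ring R] [AddCommGroup C] [Module R C]
    {Z B : Submodule R C} {x : Z} : x ∈ B.submoduleOf Z ↔ (x : C) ∈ B := Iff.rfl

/-- Twisted cohomology computed by functions on simplices. -/
theorem rank_cohomology_eq (hG : K.IsFlat G) (g : Γ) {r' : Representation ℂ (Pi1 K x) A}
    (hr : ∀ α, r' α = r (g * holHom hG x α * g⁻¹)) (hK : K.IsConnected) (hx : {x} ∈ K.faces)
    (i : ℕ) : Module.rank ℂ (K.Cohomology r' i) =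
      Module.rank ℂ (Subquotient (LinearMap.ker (K.funCoboundary r G i))
        (K.funCoboundaries r G i)) := by
  let e : (K.Simplex i → A) ≃ₗ[ℂ] K.Cochain r' i :=
    LinearEquiv.ofBijective _ (toCochain_bijective hG g hr hK hx i)
  let e' : LinearMap.ker (K.funCoboundary r G i) ≃ₗ[ℂ] K.cocycles r' i :=
    e.ofSubmodules _ _ (by
      ext c
      obtain ⟨f, rfl⟩ := e.surjective c
      rw [Submodule.mem_map_equiv, e.symm_apply_apply]
      exact (toCochain_mem_cocycles hG g hr hK hx).symm)
  refine (LinearEquiv.rank_eq (Submodule.Quotient.equiv _ _ e' ?_)).symm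
  ext c
  obtain ⟨f, rfl⟩ := e'.surjective c
  rw [Submodule.mem_map_equiv, e'.symm_apply_apply, mem_submoduleOf_iff,
    mem_submoduleOf_iff]
  exact (toCochain_mem_coboundaries hG g hr hK hx).symm

end toCochain

/-! ### One-cocycles as functions of pairs of vertices -/

section OneCocycles

variable (K) (r : Representation ℂ Γ A) (G : V → V → Γ)

/-- Twisted 1-cocycles, as functions of pairs of vertices. -/
def pairCocycles : Submodule ℂ (V → V → A) where
  carrier := {f | ∀ u v w, {u, v, w} ∈ K.faces → f u v + r (G u v) (f v w) = f u w}
  add_mem' {a b} ha hb u v w h := by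
    simp only [Pi.add_apply, map_add, ← ha u v w h, ← hb u v w h]
    abel
  zero_mem' := by intro u v w _; simp
  smul_mem' t a ha u v w h := by
    simp only [Pi.smul_apply, map_smul, ← ha u v w h, smul_add]

/-- Functions of pairs of vertices that are twisted coboundaries on the edges of `K`. -/
def pairCoboundaries : Submodule ℂ (V → V → A) where
  carrier := {f | ∃ p : V → A, ∀ u v, {u, v} ∈ K.faces → f u v = r (G u v) (p v) - p u}
  add_mem' := by
    rintro a b ⟨p, hp⟩ ⟨q, hq⟩
    refine ⟨p + q, fun u v h => ?_⟩
    simp only [Pi.add_apply, map_add, hp u v h, hq u v h]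
    abel
  zero_mem' := ⟨0, by simp⟩
  smul_mem' := by
    rintro t a ⟨p, hp⟩
    refine ⟨t • p, fun u v h => ?_⟩
    simp only [Pi.smul_apply, map_smul, hp u v h, smul_sub]

variable {K r G}

theorem pairCocycles_mono {B : PreAbstractSimplicialComplex V} (hB : B ≤ K) :
    K.pairCocycles r G ≤ B.pairCocycles r G := fun _ hf u v w h => hf u v w (hB h)

theorem pairCoboundary_mem (hG : K.IsFlat G) (p : V → A) :
    (fun u v => r (G u v) (p v) - p u) ∈ K.pairCocycles r G := by
  intro u v w h
  simp only [map_sub]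
  rw [← Module.End.mul_apply, ← map_mul, hG u v w h]
  abel

theorem pairCocycle_self (hG : K.IsFlat G) {f : V → V → A} (hf : f ∈ K.pairCocycles r G) {u : V}
    (h : {u} ∈ K.faces) : f u u = 0 := by
  have := hf u u u (by simpa using h)
  rw [hG.self h, map_one, Module.End.one_apply] at this
  simpa using this

theorem pairCocycle_symm (hG : K.IsFlat G) {f : V → V → A} (hf : f ∈ K.pairCocycles r G) {u v : V}
    (h : {u, v} ∈ K.faces) : f u v = -r (G u v) (f v u) := by
  have e : ({u, v, u} : Finset V) = {u, v} := by ext x; simp; tauto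
  have := hf u v u (by rwa [e])
  rw [pairCocycle_self hG hf (left_mem_of_edge h)] at this
  exact eq_neg_of_add_eq_zero_left this

variable (K A) in
/-- The simplicial 1-cochain defined by a function of pairs of vertices. -/
def pairRestrict : (V → V → A) →ₗ[ℂ] (K.Simplex 1 → A) where
  toFun f s := f (s.1 0) (s.1 1)
  map_add' _ _ := rfl
  map_smul' _ _ := rfl

theorem funCoboundary_zero_apply (hG : K.IsFlat G) (p : K.Simplex 0 → A) (s : K.Simplex 1) :
    K.funCoboundary r G 0 p s = r (G (s.1 0) (s.1 1)) (p (s.face 0)) - p (s.face 1) := by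
  have h1 : G (s.1 0) ((s.face 1).1 0) = 1 := hG.self (s.vertex_mem 0)
  change ∑ k : Fin 2, (-1 : ℂ) ^ (k : ℕ) • r (G (s.1 0) ((s.face k).1 0)) (p (s.face k)) = _
  rw [Fin.sum_univ_two, h1, map_one, Module.End.one_apply]
  simp only [Fin.val_zero, Fin.val_one, pow_zero, pow_one, one_smul, neg_smul, sub_eq_add_neg]
  rfl

theorem funCoboundary_one_apply (hG : K.IsFlat G) (c : K.Simplex 1 → A) (s : K.Simplex 2) :
    K.funCoboundary r G 1 c s = r (G (s.1 0) (s.1 1)) (c (s.face 0)) - c (s.face 1) +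
      c (s.face 2) := by
  have h1 : G (s.1 0) ((s.face 1).1 0) = 1 := hG.self (s.vertex_mem 0)
  have h2 : G (s.1 0) ((s.face 2).1 0) = 1 := hG.self (s.vertex_mem 0)
  change ∑ k : Fin 3, (-1 : ℂ) ^ (k : ℕ) • r (G (s.1 0) ((s.face k).1 0)) (c (s.face k)) = _
  rw [Fin.sum_univ_three, h1, h2, map_one, Module.End.one_apply, Module.End.one_apply]
  simp only [Fin.val_zero, Fin.val_one, Fin.val_two, pow_zero, pow_one, one_smul, neg_smul,
    sub_eq_add_neg, neg_one_sq]
  rfl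

theorem funCoboundary_pairRestrict (hG : K.IsFlat G) {f : V → V → A}
    (hf : f ∈ K.pairCocycles r G) : K.funCoboundary r G 1 (pairRestrict K A f) = 0 := by
  ext s
  rw [funCoboundary_one_apply hG, Pi.zero_apply]
  have h := hf (s.1 0) (s.1 1) (s.1 2) (K.face_mono s.2.2 (by
    intro x; simp only [Finset.mem_insert, Finset.mem_singleton, Finset.mem_image]
    rintro (rfl | rfl | rfl) <;> exact ⟨_, by simp, rfl⟩) (by simp))
  change r _ (f (s.1 1) (s.1 2)) - f (s.1 0) (s.1 2) + f (s.1 0) (s.1 1) = 0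
  rw [← h]
  abel

/-- The edge spanned by two vertices. -/
def Simplex.edge {u v : V} (huv : u < v) (h : {u, v} ∈ K.faces) : K.Simplex 1 :=
  ⟨![u, v], by
    intro i j hij
    fin_cases i <;> fin_cases j <;> simp_all, by
    have : Finset.univ.image ![u, v] = {u, v} := by ext x; simp [eq_comm]
    rwa [this]⟩

/-- The vertex as a simplex. -/
def Simplex.vertex {u : V} (h : {u} ∈ K.faces) : K.Simplex 0 :=
  ⟨fun _ => u, fun i j hij => absurd hij (by omega), by
    have : Finset.univ.image (fun _ : Fin 1 => u) = {u} := by ext x; simp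
    rwa [this]⟩

/-- The triangle spanned by three vertices. -/
def Simplex.triangle {u v w : V} (huv : u < v) (hvw : v < w) (h : {u, v, w} ∈ K.faces) :
    K.Simplex 2 :=
  ⟨![u, v, w], by
    intro i j hij
    have := huv.trans hvw
    fin_cases i <;> fin_cases j <;> simp_all, by
    have : Finset.univ.image ![u, v, w] = {u, v, w} := by ext x; simp [Fin.exists_fin_succ, eq_comm]
    rwa [this]⟩

/-- A cochain on increasing edges is extended to all ordered pairs by twisted antisymmetry. For
sorted triangles the equation of `pairCocycles` is the cocycle condition. It is preserved by the two
adjacent transpositions of the vertices, and these generate all orderings. -/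
theorem exists_pairRestrict_eq (hG : K.IsFlat G) {c : K.Simplex 1 → A}
    (hc : K.funCoboundary r G 1 c = 0) : ∃ f ∈ K.pairCocycles r G, pairRestrict K A f = c := by
  classical
  let f : V → V → A := fun u v =>
    if h : u < v ∧ {u, v} ∈ K.faces then c (.edge h.1 h.2)
    else if h : v < u ∧ {v, u} ∈ K.faces then -r (G u v) (c (.edge h.1 h.2)) else 0
  have hlt : ∀ u v (huv : u < v) (h : {u, v} ∈ K.faces), f u v = c (.edge huv h) :=
    fun u v huv h => dif_pos ⟨huv, h⟩
  have hself : ∀ u, f u u = 0 := fun u => by simp [f]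
  have hgt : ∀ u v, v < u → {u, v} ∈ K.faces → f u v = -r (G u v) (f v u) := by
    intro u v hvu h
    have h' := edge_symm h
    rw [hlt v u hvu h']
    simp only [f]
    rw [dif_neg (fun h => lt_asymm hvu h.1), dif_pos ⟨hvu, h'⟩]
  have hsymm : ∀ u v, {u, v} ∈ K.faces → f u v = -r (G u v) (f v u) := by
    intro u v h
    rcases lt_trichotomy u v with huv | rfl | hvu
    · rw [hgt v u huv (edge_symm h), map_neg, neg_neg, ← Module.End.mul_apply, ← map_mul,
        hG.mul_symm h, map_one, Module.End.one_apply]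
    · simp [hself]
    · exact hgt u v hvu h
  let P := fun u v w => f u v + r (G u v) (f v w) = f u w
  have hsw1 : ∀ u v w, {u, v, w} ∈ K.faces → P u v w → P v u w := by
    intro u v w h hP
    have huv : {u, v} ∈ K.faces := K.face_mono h (by intro x; simp; tauto) (by simp)
    change f v u + r (G v u) (f u w) = f v w
    rw [← hP, map_add, hsymm v u (edge_symm huv), neg_add_cancel_left, ← Module.End.mul_apply,
      ← map_mul, hG.mul_symm (edge_symm huv), map_one, Module.End.one_apply]
  have hsw2 : ∀ u v w, {u, v, w} ∈ K.faces → P u v w → P u w v := by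
    intro u v w h hP
    have hvw : {v, w} ∈ K.faces := K.face_mono h (by intro x; simp; tauto) (by simp)
    change f u w + r (G u w) (f w v) = f u v
    rw [← hP, hsymm w v (edge_symm hvw), map_neg, ← Module.End.mul_apply (r (G u w)), ← map_mul,
      ← hG u v w h, mul_assoc, hG.mul_symm hvw, mul_one, add_neg_cancel_right]
  have hsorted : ∀ u v w, u ≤ v → v ≤ w → {u, v, w} ∈ K.faces → P u v w := by
    intro u v w huv hvw h
    rcases huv.eq_or_lt with rfl | huv
    · have hu : {u} ∈ K.faces := K.face_mono h (by simp) (by simp)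
      change f u u + r (G u u) (f u w) = f u w
      rw [hself, hG.self hu, map_one, Module.End.one_apply, zero_add]
    · rcases hvw.eq_or_lt with rfl | hvw
      · change f u v + r (G u v) (f v v) = f u v
        rw [hself, map_zero, add_zero]
      · have h0 := congrFun hc (.triangle huv hvw h)
        rw [funCoboundary_one_apply hG, Pi.zero_apply] at h0
        have huv' : {u, v} ∈ K.faces := K.face_mono h (by intro x; simp; tauto) (by simp)
        have hvw' : {v, w} ∈ K.faces := K.face_mono h (by intro x; simp; tauto) (by simp)
        have huw' : {u, w} ∈ K.faces := K.face_mono h (by intro x; simp; tauto) (by simp)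
        change f u v + r (G u v) (f v w) = f u w
        rw [hlt u v huv huv', hlt v w hvw hvw', hlt u w (huv.trans hvw) huw']
        have e0 : (Simplex.triangle huv hvw h).face 0 = .edge hvw hvw' := by
          ext a; fin_cases a <;> rfl
        have e1 : (Simplex.triangle huv hvw h).face 1 = .edge (huv.trans hvw) huw' := by
          ext a; fin_cases a <;> rfl
        have e2 : (Simplex.triangle huv hvw h).face 2 = .edge huv huv' := by
          ext a; fin_cases a <;> rfl
        rw [e0, e1, e2] at h0
        change r (G u v) _ - _ + _ = 0 at h0
        rw [sub_add_eq_add_sub, sub_eq_zero, add_comm] at h0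
        exact h0
  refine ⟨f, ?_, ?_⟩
  · intro u v w h
    have p1 : ({v, u, w} : Finset V) = {u, v, w} := by ext x; simp; tauto
    have p2 : ({u, w, v} : Finset V) = {u, v, w} := by ext x; simp; tauto
    have p3 : ({v, w, u} : Finset V) = {u, v, w} := by ext x; simp; tauto
    have p4 : ({w, u, v} : Finset V) = {u, v, w} := by ext x; simp; tauto
    have p5 : ({w, v, u} : Finset V) = {u, v, w} := by ext x; simp; tauto
    change P u v w
    rcases le_total u v with h1 | h1 <;> rcases le_total v w with h2 | h2 <;>
      rcases le_total u w with h3 | h3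
    · exact hsorted _ _ _ h1 h2 h
    · exact hsorted _ _ _ h1 h2 h
    · exact hsw2 _ _ _ (by rwa [p2]) (hsorted _ _ _ h3 h2 (by rwa [p2]))
    · exact hsw2 _ _ _ (by rwa [p2]) (hsw1 _ _ _ (by rwa [p4])
        (hsorted _ _ _ h3 h1 (by rwa [p4])))
    · exact hsw1 _ _ _ (by rwa [p1]) (hsorted _ _ _ h1 h3 (by rwa [p1]))
    · exact hsw1 _ _ _ (by rwa [p1]) (hsw2 _ _ _ (by rwa [p3])
        (hsorted _ _ _ h2 h3 (by rwa [p3])))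
    · exact hsw1 _ _ _ (by rwa [p1]) (hsw2 _ _ _ (by rwa [p3]) (hsw1 _ _ _ (by rwa [p5])
        (hsorted _ _ _ h2 h1 (by rwa [p5]))))
    · exact hsw1 _ _ _ (by rwa [p1]) (hsw2 _ _ _ (by rwa [p3]) (hsw1 _ _ _ (by rwa [p5])
        (hsorted _ _ _ h2 h1 (by rwa [p5]))))
  · ext s
    change f (s.1 0) (s.1 1) = c s
    rw [hlt _ _ (s.2.1 (by simp)) (s.edge_mem 0 1)]
    congr 1
    ext a; fin_cases a <;> rfl

theorem exists_primitive_of_funCoboundary_zero (hG : K.IsFlat G) {f : V → V → A}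
    (hf : f ∈ K.pairCocycles r G) {p : K.Simplex 0 → A}
    (hp : K.funCoboundary r G 0 p = pairRestrict K A f) :
    ∃ q : V → A, (∀ v (h : {v} ∈ K.faces), q v = p (.vertex h)) ∧
      ∀ u v, {u, v} ∈ K.faces → f u v = r (G u v) (q v) - q u := by
  classical
  let q : V → A := fun v => if h : {v} ∈ K.faces then p (.vertex h) else 0
  have hq : ∀ u v, u < v → {u, v} ∈ K.faces → f u v = r (G u v) (q v) - q u := by
    intro u v huv h
    have := congrFun hp (.edge huv h)
    rw [funCoboundary_zero_apply hG] at this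
    change _ = f u v at this
    rw [← this]
    simp only [q, dif_pos (left_mem_of_edge h), dif_pos (right_mem_of_edge h)]
    have e0 : (Simplex.edge huv h).face 0 = .vertex (right_mem_of_edge h) := by
      ext a; fin_cases a; rfl
    have e1 : (Simplex.edge huv h).face 1 = .vertex (left_mem_of_edge h) := by
      ext a; fin_cases a; rfl
    rw [e0, e1]
    rfl
  refine ⟨q, fun v h => dif_pos h, fun u v h => ?_⟩
  rcases lt_trichotomy u v with huv | rfl | hvu
  · exact hq u v huv h
  · have hu := left_mem_of_edge h
    rw [pairCocycle_self hG hf hu, hG.self hu]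
    simp
  · rw [pairCocycle_symm hG hf h, hq v u hvu (edge_symm h), map_sub, ← Module.End.mul_apply,
      ← map_mul, hG.mul_symm h, map_one, Module.End.one_apply]
    abel

theorem pairRestrict_mem_coboundaries (hG : K.IsFlat G) {f : V → V → A}
    (hf : f ∈ K.pairCocycles r G) :
    pairRestrict K A f ∈ K.funCoboundaries r G 1 ↔ f ∈ K.pairCoboundaries r G := by
  constructor
  · rintro ⟨p, hp⟩
    obtain ⟨q, -, hq⟩ := exists_primitive_of_funCoboundary_zero hG hf hp
    exact ⟨q, hq⟩
  · rintro ⟨p, hp⟩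
    refine ⟨fun s => p (s.1 0), ?_⟩
    ext s
    rw [funCoboundary_zero_apply hG]
    exact (hp _ _ (s.edge_mem 0 1)).symm

/-- The dimension of the first cohomology, from a parametrization of the cocycles modulo
coboundaries. -/
theorem finrank_funCohomology_one {P : Type*} [AddCommGroup P] [Module ℂ P] [FiniteDimensional ℂ P]
    (hG : K.IsFlat G) (L : P →ₗ[ℂ] (V → V → A)) (hL : ∀ p, L p ∈ K.pairCocycles r G)
    (hsurj : ∀ f ∈ K.pairCocycles r G, ∃ p, f - L p ∈ K.pairCoboundaries r G) {p₀ : P}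
    (hp₀ : p₀ ≠ 0) (hker : ∀ p, L p ∈ K.pairCoboundaries r G ↔ ∃ t : ℂ, p = t • p₀) :
    Module.rank ℂ (Subquotient (LinearMap.ker (K.funCoboundary r G 1))
      (K.funCoboundaries r G 1)) = ((Module.finrank ℂ P - 1 : ℕ) : Cardinal) := by
  let Z := LinearMap.ker (K.funCoboundary r G 1)
  let L' : P →ₗ[ℂ] Z := LinearMap.codRestrict Z (pairRestrict K A ∘ₗ L)
    fun p => funCoboundary_pairRestrict hG (hL p)
  let Q := ((K.funCoboundaries r G 1).submoduleOf Z).mkQ ∘ₗ L'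
  have hQ : Function.Surjective Q := by
    intro y
    obtain ⟨⟨c, hc⟩, rfl⟩ := Submodule.mkQ_surjective _ y
    obtain ⟨f, hf, rfl⟩ := exists_pairRestrict_eq hG hc
    obtain ⟨p, hp⟩ := hsurj f hf
    refine ⟨p, Eq.symm ?_⟩
    change Submodule.Quotient.mk _ = Submodule.Quotient.mk _
    rw [Submodule.Quotient.eq, mem_submoduleOf_iff]
    change pairRestrict K A f - pairRestrict K A (L p) ∈ _
    rw [← map_sub]
    exact (pairRestrict_mem_coboundaries hG (sub_mem hf (hL p))).2 hp
  have hkerQ : LinearMap.ker Q = ℂ ∙ p₀ := by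
    ext p
    rw [LinearMap.mem_ker, Submodule.mem_span_singleton]
    change Submodule.Quotient.mk _ = 0 ↔ _
    rw [Submodule.Quotient.mk_eq_zero, mem_submoduleOf_iff]
    refine (pairRestrict_mem_coboundaries hG (hL p)).trans ((hker p).trans ?_)
    simp only [eq_comm]
  have e := LinearMap.quotKerEquivOfSurjective Q hQ
  have h1 : Module.finrank ℂ (LinearMap.ker Q) = 1 := by
    rw [hkerQ]; exact finrank_span_singleton hp₀
  have h2 := Submodule.finrank_quotient_add_finrank (LinearMap.ker Q)
  have : Module.Finite ℂ (Subquotient Z (K.funCoboundaries r G 1)) := Module.Finite.equiv e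
  rw [← Module.finrank_eq_rank, ← e.finrank_eq]
  congr 1
  omega

end OneCocycles

end PreAbstractSimplicialComplex

end

/-! ### Dimensions of cochain spaces and the Euler characteristic. -/

noncomputable section

namespace PreAbstractSimplicialComplex

variable {V : Type*} [LinearOrder V] {Γ : Type*} [Group Γ]
  {K : PreAbstractSimplicialComplex V} {A : Type*} [AddCommGroup A] [Module ℂ A]

/-- Simplices with ordered vertices are the same as faces. -/
def simplexEquiv (K : PreAbstractSimplicialComplex V) (i : ℕ) :
    K.Simplex i ≃ {s : Finset V // s ∈ K.faces ∧ s.card = i + 1} where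
  toFun s := ⟨Finset.univ.image s.1, s.2.2, by
    rw [Finset.card_image_of_injective _ s.2.1.injective, Finset.card_univ, Fintype.card_fin]⟩
  invFun t := ⟨t.1.orderEmbOfFin t.2.2, (t.1.orderEmbOfFin t.2.2).strictMono, by
    simpa only [Finset.image_orderEmbOfFin_univ] using t.2.1⟩
  left_inv s := Subtype.ext (Finset.orderEmbOfFin_unique _
    (fun x => Finset.mem_image_of_mem _ (Finset.mem_univ x)) s.2.1).symm
  right_inv t := Subtype.ext (Finset.image_orderEmbOfFin_univ _ _)

/-- The number of faces with `k` vertices. -/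
def numFaces (K : PreAbstractSimplicialComplex V) (k : ℕ) : ℕ :=
  {s | s ∈ K.faces ∧ s.card = k}.ncard

theorem card_simplex (i : ℕ) : Nat.card (K.Simplex i) = K.numFaces (i + 1) := by
  rw [Nat.card_congr (K.simplexEquiv i)]
  rfl

theorem finite_simplex (hK : K.faces.Finite) (i : ℕ) : Finite (K.Simplex i) := by
  have : Finite {s : Finset V // s ∈ K.faces ∧ s.card = i + 1} :=
    (hK.subset fun s hs => hs.1 : {s | s ∈ K.faces ∧ s.card = i + 1}.Finite)
  exact Finite.of_equiv _ (K.simplexEquiv i).symm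

theorem finrank_cochain (hK : K.faces.Finite) (i : ℕ) [FiniteDimensional ℂ A] :
    Module.finrank ℂ (K.Simplex i → A) = K.numFaces (i + 1) * Module.finrank ℂ A := by
  have := finite_simplex hK i
  have := Fintype.ofFinite (K.Simplex i)
  rw [Module.finrank_pi_fintype, Finset.sum_const, Finset.card_univ, smul_eq_mul,
    ← Nat.card_eq_fintype_card, card_simplex]

variable {r : Representation ℂ Γ A} {G : V → V → Γ}

theorem funCoboundary_two_apply (hG : K.IsFlat G) (c : K.Simplex 2 → A) (s : K.Simplex 3) :
    K.funCoboundary r G 2 c s = r (G (s.1 0) (s.1 1)) (c (s.face 0)) - c (s.face 1) +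
      c (s.face 2) - c (s.face 3) := by
  have h1 : G (s.1 0) ((s.face 1).1 0) = 1 := hG.self (s.vertex_mem 0)
  have h2 : G (s.1 0) ((s.face 2).1 0) = 1 := hG.self (s.vertex_mem 0)
  have h3 : G (s.1 0) ((s.face 3).1 0) = 1 := hG.self (s.vertex_mem 0)
  change ∑ k : Fin 4, (-1 : ℂ) ^ (k : ℕ) • r (G (s.1 0) ((s.face k).1 0)) (c (s.face k)) = _
  rw [Fin.sum_univ_four, h1, h2, h3, map_one, Module.End.one_apply, Module.End.one_apply,
    Module.End.one_apply]
  have e3 : (-1 : ℂ) ^ ((3 : Fin 4) : ℕ) = -1 := by norm_num [Fin.val_ofNat]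
  rw [e3]
  simp only [Fin.val_zero, Fin.val_one, Fin.val_two, pow_zero, pow_one, one_smul, neg_smul,
    sub_eq_add_neg, neg_one_sq]
  rfl

theorem funCoboundary_comp_zero (hG : K.IsFlat G) (p : K.Simplex 0 → A) :
    K.funCoboundary r G 1 (K.funCoboundary r G 0 p) = 0 := by
  ext s
  rw [funCoboundary_one_apply hG, funCoboundary_zero_apply hG, funCoboundary_zero_apply hG,
    funCoboundary_zero_apply hG, Pi.zero_apply]
  have e1 : (s.face 1).face 0 = (s.face 0).face 0 := by ext a; fin_cases a; rfl
  have e2 : (s.face 2).face 0 = (s.face 0).face 1 := by ext a; fin_cases a; rfl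
  have e3 : (s.face 2).face 1 = (s.face 1).face 1 := by ext a; fin_cases a; rfl
  have h := hG (s.1 0) (s.1 1) (s.1 2) (K.face_mono s.2.2 (by
    intro x; simp only [Finset.mem_insert, Finset.mem_singleton, Finset.mem_image]
    rintro (rfl | rfl | rfl) <;> exact ⟨_, by simp, rfl⟩) (by simp))
  rw [e1, e2, e3]
  change r (G (s.1 0) (s.1 1)) (r (G (s.1 1) (s.1 2)) _ - _) - (r (G (s.1 0) (s.1 2)) _ - _) +
    (r (G (s.1 0) (s.1 1)) _ - _) = 0
  rw [← h, map_mul, Module.End.mul_apply, map_sub]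
  abel

theorem funCoboundary_comp_one (hG : K.IsFlat G) (c : K.Simplex 1 → A) :
    K.funCoboundary r G 2 (K.funCoboundary r G 1 c) = 0 := by
  ext s
  rw [funCoboundary_two_apply hG]
  simp only [funCoboundary_one_apply hG, Pi.zero_apply]
  have e1 : (s.face 1).face 0 = (s.face 0).face 0 := by ext a; fin_cases a <;> rfl
  have e2 : (s.face 2).face 0 = (s.face 0).face 1 := by ext a; fin_cases a <;> rfl
  have e3 : (s.face 2).face 1 = (s.face 1).face 1 := by ext a; fin_cases a <;> rfl
  have e4 : (s.face 3).face 0 = (s.face 0).face 2 := by ext a; fin_cases a <;> rfl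
  have e5 : (s.face 3).face 1 = (s.face 1).face 2 := by ext a; fin_cases a <;> rfl
  have e6 : (s.face 3).face 2 = (s.face 2).face 2 := by ext a; fin_cases a <;> rfl
  have h := hG (s.1 0) (s.1 1) (s.1 2) (K.face_mono s.2.2 (by
    intro x; simp only [Finset.mem_insert, Finset.mem_singleton, Finset.mem_image]
    rintro (rfl | rfl | rfl) <;> exact ⟨_, by simp, rfl⟩) (by simp))
  rw [e1, e2, e3, e4, e5, e6]
  change r (G (s.1 0) (s.1 1)) (r (G (s.1 1) (s.1 2)) _ - _ + _) -
    (r (G (s.1 0) (s.1 2)) _ - _ + _) + (r (G (s.1 0) (s.1 1)) _ - _ + _) -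
    (r (G (s.1 0) (s.1 1)) _ - _ + _) = 0
  rw [← h, map_mul, Module.End.mul_apply, map_add, map_sub]
  abel

theorem finrank_subquotient {C : Type*} [AddCommGroup C] [Module ℂ C] [FiniteDimensional ℂ C]
    {Z B : Submodule ℂ C} (h : B ≤ Z) :
    Module.finrank ℂ (Subquotient Z B) + Module.finrank ℂ B = Module.finrank ℂ Z := by
  rw [← (Submodule.submoduleOfEquivOfLe h).finrank_eq]
  exact Submodule.finrank_quotient_add_finrank _

/-- The cohomology in all degrees of a complex of dimension at most three and Euler characteristic
zero, without cohomology in degrees zero and three. -/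
theorem rank_funCohomology [FiniteDimensional ℂ A] (hG : K.IsFlat G) (hK : K.faces.Finite)
    (hdim : ∀ s ∈ K.faces, s.card ≤ 4)
    (heuler : K.numFaces 1 + K.numFaces 3 = K.numFaces 2 + K.numFaces 4)
    (hinj : LinearMap.ker (K.funCoboundary r G 0) = ⊥)
    (hsurj : LinearMap.range (K.funCoboundary r G 2) = ⊤) {h : ℕ}
    (h1 : Module.rank ℂ (Subquotient (LinearMap.ker (K.funCoboundary r G 1))
      (K.funCoboundaries r G 1)) = h) (i : ℕ) :
    Module.rank ℂ (Subquotient (LinearMap.ker (K.funCoboundary r G i))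
      (K.funCoboundaries r G i)) = ((if i = 1 ∨ i = 2 then h else 0 : ℕ) : Cardinal) := by
  have hfin := finite_simplex hK
  have hfd : ∀ i, FiniteDimensional ℂ (K.Simplex i → A) := fun i => inferInstance
  match i with
  | 0 =>
    have : Subsingleton (LinearMap.ker (K.funCoboundary r G 0)) := by
      rw [hinj]; infer_instance
    have : Subsingleton (Subquotient (LinearMap.ker (K.funCoboundary r G 0))
      (K.funCoboundaries r G 0)) := (Submodule.mkQ_surjective _).subsingleton
    simp
  | 1 => simpa using h1
  | 2 =>
    have r0 := LinearMap.finrank_range_add_finrank_ker (K.funCoboundary r G 0)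
    have r1 := LinearMap.finrank_range_add_finrank_ker (K.funCoboundary r G 1)
    have r2 := LinearMap.finrank_range_add_finrank_ker (K.funCoboundary r G 2)
    rw [hinj, finrank_bot, finrank_cochain hK] at r0
    rw [finrank_cochain hK] at r1
    rw [hsurj, finrank_top, finrank_cochain hK, finrank_cochain hK] at r2
    have q1 := finrank_subquotient (Z := LinearMap.ker (K.funCoboundary r G 1))
      (B := K.funCoboundaries r G 1) (by
        rintro _ ⟨p, rfl⟩
        exact funCoboundary_comp_zero hG p)
    have q2 := finrank_subquotient (Z := LinearMap.ker (K.funCoboundary r G 2))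
      (B := K.funCoboundaries r G 2) (by
        rintro _ ⟨p, rfl⟩
        exact funCoboundary_comp_one hG p)
    rw [← Module.finrank_eq_rank, Nat.cast_inj] at h1
    rw [h1] at q1
    change _ + Module.finrank ℂ (LinearMap.range (K.funCoboundary r G 0)) = _ at q1
    change _ + Module.finrank ℂ (LinearMap.range (K.funCoboundary r G 1)) = _ at q2
    rw [← Module.finrank_eq_rank]
    congr 1
    simp only [or_true, if_true]
    -- The Euler characteristic enters multiplied by the dimension of the coefficients. Since `d⁰`
    -- is injective and `d²` is onto, the alternating sum of dimensions leaves exactly the equality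
    -- of `H¹` and `H²`.
    have e : (K.numFaces 1 + K.numFaces 3) * Module.finrank ℂ A =
      (K.numFaces 2 + K.numFaces 4) * Module.finrank ℂ A := by rw [heuler]
    rw [add_mul, add_mul] at e
    change _ = K.numFaces 1 * _ at r0
    change _ = K.numFaces 2 * _ at r1
    change K.numFaces 4 * _ + _ = K.numFaces 3 * _ at r2
    omega
  | 3 =>
    have : Subsingleton (Subquotient (LinearMap.ker (K.funCoboundary r G 3))
      (K.funCoboundaries r G 3)) := by
      rw [Submodule.Quotient.subsingleton_iff, eq_top_iff]
      rintro ⟨x, _⟩ -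
      rw [mem_submoduleOf_iff]
      change x ∈ LinearMap.range (K.funCoboundary r G 2)
      rw [hsurj]
      trivial
    simp
  | i + 4 =>
    have : IsEmpty (K.Simplex (i + 4)) := ⟨fun s => by
      have := hdim _ s.2.2
      rw [Finset.card_image_of_injective _ s.2.1.injective, Finset.card_univ,
        Fintype.card_fin] at this
      omega⟩
    have : Subsingleton (Subquotient (LinearMap.ker (K.funCoboundary r G (i + 4)))
      (K.funCoboundaries r G (i + 4))) := (Submodule.mkQ_surjective _).subsingleton
    simp

end PreAbstractSimplicialComplex

end

noncomputable section

/-! ### The Alexander module and crossed homomorphisms -/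

/-- Cramer's rule: multiplying the matrix of relations by its adjugate shows that its determinant
kills every generator of the module. -/
theorem smul_eq_zero_of_mem_fittingIdeal {R M : Type*} [CommRing R] [AddCommGroup M] [Module R M]
    {a : R} (ha : a ∈ fittingIdeal R M) (x : M) : a • x = 0 := by
  have h : fittingIdeal R M ≤ Module.annihilator R M := by
    refine Ideal.span_le.2 ?_
    rintro _ ⟨n, y, N, hy, hN, rfl⟩
    rw [SetLike.mem_coe, Module.mem_annihilator]
    have hdet : ∀ c, N.det • y c = 0 := by
      intro c
      have h1 : ∑ a, N.adjugate c a • ∑ b, N a b • y b = 0 := by simp [hN]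
      simp only [Finset.smul_sum, smul_smul] at h1
      rw [Finset.sum_comm] at h1
      simp only [← Finset.sum_smul] at h1
      have h2 : ∀ b, ∑ a, N.adjugate c a * N a b = (N.det • (1 : Matrix _ _ R)) c b := by
        intro b
        rw [← Matrix.adjugate_mul, Matrix.mul_apply]
      simp only [h2, Matrix.smul_apply, Matrix.one_apply, smul_eq_mul, mul_ite, mul_one,
        mul_zero, ite_smul, zero_smul, Finset.sum_ite_eq, Finset.mem_univ, if_true] at h1
      exact h1
    intro m
    have hm : m ∈ Submodule.span R (Set.range y) := hy ▸ Submodule.mem_top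
    induction hm using Submodule.span_induction with
    | mem x hx => obtain ⟨c, rfl⟩ := hx; exact hdet c
    | zero => exact smul_zero _
    | add x y _ _ hx hy => rw [smul_add, hx, hy, add_zero]
    | smul t x _ hx => rw [smul_comm, hx, smul_zero]
  exact Module.mem_annihilator.1 (h ha) x

namespace PreAbstractSimplicialComplex

open LaurentPolynomial

variable {V : Type*} [LinearOrder V] {E : PreAbstractSimplicialComplex V} {z : V → V → ℤ}

/-- The sum of a function of oriented edges along an edge path, twisted by the action of the
powers of `T`. -/
def EdgePath.crossedSum {N : Type*} [AddCommGroup N] [Module ℤ[T;T⁻¹] N]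
    (z : V → V → ℤ) (c : V → V → N) :
    {u v : V} → EdgePath E u v → N
  | _, _, .nil _ => 0
  | u, _, .cons (v := v) _ p => c u v + (T (z u v) : ℤ[T;T⁻¹]) • crossedSum z c p

/-- The chain of the infinite cyclic cover defined by a lift of an edge path. -/
def EdgePath.cyclicChain (z : V → V → ℤ) :
    {u v : V} → EdgePath E u v → (E.Simplex 1 →₀ ℤ[T;T⁻¹])
  | _, _, .nil _ => 0
  | u, _, .cons (v := v) h p =>
    (if huv : u < v then Finsupp.single (.edge huv h) 1
      else if hvu : v < u then -Finsupp.single (.edge hvu (edge_symm h)) (T (z u v)) else 0) +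
    (T (z u v) : ℤ[T;T⁻¹]) • cyclicChain z p

theorem cyclicBoundary_edge (hz : E.IsFlat fun u v => Multiplicative.ofAdd (z u v)) {u v : V}
    (huv : u < v) (h : {u, v} ∈ E.faces) (a : ℤ[T;T⁻¹]) :
    cyclicBoundary E z 0 (Finsupp.single (.edge huv h) a) =
      Finsupp.single (.vertex (right_mem_of_edge h)) (a * T (z u v)) -
        Finsupp.single (.vertex (left_mem_of_edge h)) a := by
  rw [cyclicBoundary, Finsupp.linearCombination_single, Fin.sum_univ_two]
  have e0 : (Simplex.edge huv h).face 0 = .vertex (right_mem_of_edge h) := by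
    ext a; fin_cases a; rfl
  have e1 : (Simplex.edge huv h).face 1 = .vertex (left_mem_of_edge h) := by
    ext a; fin_cases a; rfl
  rw [e0, e1]
  change a • (Finsupp.single _ (_ * T (z u v)) + Finsupp.single _ (_ * T (z u u))) = _
  have h0 : z u u = 0 := hz.self (left_mem_of_edge h)
  rw [h0, smul_add, Finsupp.smul_single, Finsupp.smul_single]
  simp [sub_eq_add_neg]

/-- The boundary of a lifted path is its end minus its start, and the end lies at the level given by
the degree of the path. So closed paths of degree zero lift to cycles. -/
theorem cyclicBoundary_cyclicChain (hz : E.IsFlat fun u v => Multiplicative.ofAdd (z u v))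
    {u v : V} (p : EdgePath E u v) (hu : {u} ∈ E.faces) (hv : {v} ∈ E.faces) :
    cyclicBoundary E z 0 (p.cyclicChain z) =
      Finsupp.single (.vertex hv)
        (T (Multiplicative.toAdd (p.hol fun u v => Multiplicative.ofAdd (z u v)))) -
      Finsupp.single (.vertex hu) 1 := by
  induction p with
  | nil u => simp [EdgePath.cyclicChain, EdgePath.hol]
  | @cons u v w h p ih =>
    have hm := right_mem_of_edge h
    rw [EdgePath.cyclicChain, map_add, map_smul, ih hm hv, EdgePath.hol, toAdd_mul, T_add,
      toAdd_ofAdd, smul_sub, Finsupp.smul_single, Finsupp.smul_single, smul_eq_mul, smul_eq_mul,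
      mul_one]
    have key : cyclicBoundary E z 0 (if huv : u < v then Finsupp.single (.edge huv h) 1
      else if hvu : v < u then -Finsupp.single (.edge hvu (edge_symm h)) (T (z u v)) else 0) =
        Finsupp.single (.vertex hm) (T (z u v)) - Finsupp.single (.vertex hu) 1 := by
      rcases lt_trichotomy u v with huv | rfl | hvu
      · rw [dif_pos huv, cyclicBoundary_edge hz, one_mul]
      · have h0 : z u u = 0 := hz.self hu
        simp [h0]
      · rw [dif_neg (lt_asymm hvu), dif_pos hvu, map_neg, cyclicBoundary_edge hz, ← T_add]
        have h0 : z u v + z v u = 0 := hz.mul_symm h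
        rw [h0, T_zero, neg_sub]
    rw [key]
    abel

/-- The evaluation of a function of pairs of vertices on chains of the infinite cyclic cover. -/
def cyclicEval (E : PreAbstractSimplicialComplex V) {N : Type*} [AddCommGroup N]
    [Module ℤ[T;T⁻¹] N] (c : V → V → N) : (E.Simplex 1 →₀ ℤ[T;T⁻¹]) →ₗ[ℤ[T;T⁻¹]] N :=
  Finsupp.linearCombination ℤ[T;T⁻¹] fun s => c (s.1 0) (s.1 1)

section

variable {N : Type*} [AddCommGroup N] [Module ℤ[T;T⁻¹] N] {c : V → V → N}

theorem cyclicEval_single (s : E.Simplex 1) (a : ℤ[T;T⁻¹]) :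
    cyclicEval E c (Finsupp.single s a) = a • c (s.1 0) (s.1 1) :=
  Finsupp.linearCombination_single _ _ _

theorem crossed_self (hz : E.IsFlat fun u v => Multiplicative.ofAdd (z u v))
    (hc : ∀ u v w, {u, v, w} ∈ E.faces → c u v + (T (z u v) : ℤ[T;T⁻¹]) • c v w = c u w)
    {v : V} (hv : {v} ∈ E.faces) : c v v = 0 := by
  have h1 := hc v v v (by simpa using hv)
  have h0 : z v v = 0 := hz.self hv
  rw [h0, T_zero, one_smul] at h1
  simpa using h1

theorem cyclicEval_cyclicChain (hz : E.IsFlat fun u v => Multiplicative.ofAdd (z u v))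
    (hc : ∀ u v w, {u, v, w} ∈ E.faces → c u v + (T (z u v) : ℤ[T;T⁻¹]) • c v w = c u w)
    {u v : V} (p : EdgePath E u v) : cyclicEval E c (p.cyclicChain z) = p.crossedSum z c := by
  induction p with
  | nil u => exact map_zero _
  | @cons u v w h p ih =>
    rw [EdgePath.cyclicChain, EdgePath.crossedSum, map_add, map_smul, ih]
    congr 1
    rcases lt_trichotomy u v with huv | rfl | hvu
    · rw [dif_pos huv, cyclicEval_single, one_smul]
      rfl
    · rw [dif_neg (lt_irrefl u), dif_neg (lt_irrefl u), map_zero,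
        crossed_self hz hc (left_mem_of_edge h)]
    · rw [dif_neg (lt_asymm hvu), dif_pos hvu, map_neg, cyclicEval_single]
      have e : ({u, v, u} : Finset V) = {u, v} := by ext x; simp; tauto
      have h1 := hc u v u (by rwa [e])
      rw [crossed_self hz hc (left_mem_of_edge h)] at h1
      exact (eq_neg_of_add_eq_zero_left h1).symm

/-- The crossed cocycle equation says that evaluation on 1-chains of the cyclic cover kills the
boundaries of triangles. Evaluation therefore factors through the Alexander module on cycles. -/
theorem cyclicEval_cyclicBoundary (hz : E.IsFlat fun u v => Multiplicative.ofAdd (z u v))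
    (hc : ∀ u v w, {u, v, w} ∈ E.faces → c u v + (T (z u v) : ℤ[T;T⁻¹]) • c v w = c u w) :
    cyclicEval E c ∘ₗ cyclicBoundary E z 1 = 0 := by
  refine Finsupp.lhom_ext' fun s => LinearMap.ext_ring ?_
  rw [LinearMap.comp_apply, LinearMap.comp_apply, Finsupp.lsingle_apply, cyclicBoundary,
    Finsupp.linearCombination_single, one_smul, map_sum]
  simp only [cyclicEval_single]
  rw [Fin.sum_univ_three]
  have h := hc (s.1 0) (s.1 1) (s.1 2) (E.face_mono s.2.2 (by
    intro x; simp only [Finset.mem_insert, Finset.mem_singleton, Finset.mem_image]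
    rintro (rfl | rfl | rfl) <;> exact ⟨_, by simp, rfl⟩) (by simp))
  have h0 : z (s.1 0) (s.1 0) = 0 := hz.self (s.vertex_mem 0)
  have e0 : ((-1) ^ ((0 : Fin 3) : ℕ) * T (z (s.1 0) ((s.face 0).1 0)) : ℤ[T;T⁻¹]) =
      T (z (s.1 0) (s.1 1)) := by
    rw [Fin.val_zero, pow_zero, one_mul]; rfl
  have e1 : ((-1) ^ ((1 : Fin 3) : ℕ) * T (z (s.1 0) ((s.face 1).1 0)) : ℤ[T;T⁻¹]) = -1 := by
    have : z (s.1 0) ((s.face 1).1 0) = 0 := h0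
    rw [this, T_zero, Fin.val_one, pow_one, mul_one]
  have e2 : ((-1) ^ ((2 : Fin 3) : ℕ) * T (z (s.1 0) ((s.face 2).1 0)) : ℤ[T;T⁻¹]) = 1 := by
    have : z (s.1 0) ((s.face 2).1 0) = 0 := h0
    rw [this, T_zero, Fin.val_two, neg_one_sq, mul_one]
  have f0 : c ((s.face 0).1 0) ((s.face 0).1 1) = c (s.1 1) (s.1 2) := rfl
  have f1 : c ((s.face 1).1 0) ((s.face 1).1 1) = c (s.1 0) (s.1 2) := rfl
  have f2 : c ((s.face 2).1 0) ((s.face 2).1 1) = c (s.1 0) (s.1 1) := rfl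
  rw [e0, e1, e2, f0, f1, f2, ← h, neg_smul, one_smul, one_smul]
  simp only [LinearMap.zero_comp, LinearMap.zero_apply]
  abel

/-- The Alexander polynomial annihilates the values of twisted 1-cocycles on closed edge paths of
degree zero. -/
theorem smul_crossedSum_eq_zero (hz : E.IsFlat fun u v => Multiplicative.ofAdd (z u v))
    {Δ : ℤ[T;T⁻¹]} (hΔ : Δ ∈ fittingIdeal ℤ[T;T⁻¹] (AlexanderModule E z))
    (hc : ∀ u v w, {u, v, w} ∈ E.faces → c u v + (T (z u v) : ℤ[T;T⁻¹]) • c v w = c u w)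
    {u : V} (hu : {u} ∈ E.faces) (p : EdgePath E u u)
    (hp : p.hol (fun u v => Multiplicative.ofAdd (z u v)) = 1) :
    Δ • p.crossedSum z c = 0 := by
  have hmem : p.cyclicChain z ∈ LinearMap.ker (cyclicBoundary E z 0) := by
    rw [LinearMap.mem_ker, cyclicBoundary_cyclicChain hz p hu hu, hp, toAdd_one, T_zero, sub_self]
  have h0 : Δ • (Submodule.Quotient.mk ⟨_, hmem⟩ : AlexanderModule E z) = 0 :=
    smul_eq_zero_of_mem_fittingIdeal hΔ _
  rw [← Submodule.Quotient.mk_smul, Submodule.Quotient.mk_eq_zero, mem_submoduleOf_iff] at h0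
  obtain ⟨y, hy⟩ := h0
  have h1 : cyclicEval E c (Δ • p.cyclicChain z) = 0 := by
    change _ = Δ • p.cyclicChain z at hy
    rw [← hy]
    exact LinearMap.congr_fun (cyclicEval_cyclicBoundary hz hc) y
  rwa [map_smul, cyclicEval_cyclicChain hz hc] at h1

end

/-- The Alexander polynomial annihilates the values of crossed homomorphisms on elements of degree
zero. -/
theorem smul_crossedHom_eq_zero (hE : E.IsConnected)
    (hz : E.IsFlat fun u v => Multiplicative.ofAdd (z u v))
    {Δ : ℤ[T;T⁻¹]} (hΔ : Δ ∈ fittingIdeal ℤ[T;T⁻¹] (AlexanderModule E z))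
    {N : Type*} [AddCommGroup N] [Module ℤ[T;T⁻¹] N] {b : V} (hb : {b} ∈ E.faces) {F : Pi1 E b → N}
    (hF : ∀ α β, F (α * β) = F α + (T (Multiplicative.toAdd (holHom hz b α)) : ℤ[T;T⁻¹]) • F β)
    {α : Pi1 E b} (hα : holHom hz b α = 1) : Δ • F α = 0 := by
  classical
  have hF1 : F 1 = 0 := by
    have := hF 1 1
    simpa using this
  have hδ : ∀ v, {v} ∈ E.faces → Nonempty (PathClass E b v) := fun v hv =>
    (hE.2 b v hb hv).map PathClass.mk
  let δ : ∀ v, {v} ∈ E.faces → PathClass E b v := fun v hv => (hδ v hv).some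
  let d : ∀ v, {v} ∈ E.faces → ℤ := fun v hv => Multiplicative.toAdd (PathClass.hol hz (δ v hv))
  -- The function `F` of loops is extended to paths by closing them up with `δ`. The power of `T`
  -- removes the degree of the initial path `δ u`, so that `I` is crossed with respect to the degree
  -- of the path itself.
  let I : ∀ u v, {u} ∈ E.faces → {v} ∈ E.faces → PathClass E u v → N := fun u v hu hv a =>
    (T (-d u hu) : ℤ[T;T⁻¹]) • F (((δ u hu).comp a).comp (δ v hv).symm)
  have hI : ∀ u v w hu hv hw (a : PathClass E u v) (a' : PathClass E v w),
      I u w hu hw (a.comp a') =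
        I u v hu hv a + (T (Multiplicative.toAdd (PathClass.hol hz a)) : ℤ[T;T⁻¹]) • I v w hv hw a' := by
    intro u v w hu hv hw a a'
    change (T _ : ℤ[T;T⁻¹]) • F _ = (T _ : ℤ[T;T⁻¹]) • F _ + (T _ : ℤ[T;T⁻¹]) • (T _ : ℤ[T;T⁻¹]) • F _
    have e : ((δ u hu).comp (a.comp a')).comp (δ w hw).symm =
        ((((δ u hu).comp a).comp (δ v hv).symm : Pi1 E b) *
          (((δ v hv).comp a').comp (δ w hw).symm : Pi1 E b) : Pi1 E b) := by
      change _ = PathClass.comp _ _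
      simp only [PathClass.comp_assoc]
      rw [← PathClass.comp_assoc (δ v hv).symm, PathClass.symm_comp, PathClass.refl_comp]
    rw [e, hF, smul_add, smul_smul, smul_smul, ← T_add, ← T_add,
      holHom_apply, PathClass.hol_comp, PathClass.hol_comp, PathClass.hol_symm]
    congr 3
    simp only [toAdd_mul, toAdd_inv, d]
    ring
  have hIrefl : ∀ u hu, I u u hu hu (PathClass.refl E u) = 0 := by
    intro u hu
    change (T _ : ℤ[T;T⁻¹]) • F _ = 0
    rw [PathClass.comp_refl, PathClass.comp_symm]
    change (T _ : ℤ[T;T⁻¹]) • F 1 = 0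
    rw [hF1, smul_zero]
  let c : V → V → N := fun u v => if h : {u, v} ∈ E.faces then
    I u v (left_mem_of_edge h) (right_mem_of_edge h) (.mk (.single h)) else 0
  have hsingle : ∀ {u v} (h : {u, v} ∈ E.faces),
      Multiplicative.toAdd (PathClass.hol hz (.mk (.single h))) = z u v := by
    intro u v h
    simp [EdgePath.single, EdgePath.hol]
  have hc : ∀ u v w, {u, v, w} ∈ E.faces → c u v + (T (z u v) : ℤ[T;T⁻¹]) • c v w = c u w := by
    intro u v w h
    have huv : {u, v} ∈ E.faces := E.face_mono h (by intro x; simp; tauto) (by simp)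
    have hvw : {v, w} ∈ E.faces := E.face_mono h (by intro x; simp; tauto) (by simp)
    have huw : {u, w} ∈ E.faces := E.face_mono h (by intro x; simp; tauto) (by simp)
    simp only [c, dif_pos huv, dif_pos hvw, dif_pos huw]
    have := hI u v w (left_mem_of_edge huv) (left_mem_of_edge hvw) (right_mem_of_edge hvw)
      (.mk (.single huv)) (.mk (.single hvw))
    rw [hsingle] at this
    rw [← this]
    exact congrArg (I u w (left_mem_of_edge huv) (right_mem_of_edge hvw))
      (Quotient.sound (s := EdgePath.homotopySetoid E u w)
        (EdgePath.Homotopic.triangle huv hvw huw h _))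
  have hsum : ∀ {u v} (p : EdgePath E u v) hu hv, p.crossedSum z c = I u v hu hv (.mk p) := by
    intro u v p
    induction p with
    | nil u => intro hu hv; exact (hIrefl u hu).symm
    | @cons u v w h p ih =>
      intro hu hv
      have hm := right_mem_of_edge h
      rw [EdgePath.crossedSum, ih hm hv]
      simp only [c, dif_pos h]
      rw [← hsingle h]
      exact (hI u v w hu hm hv _ _).symm
  induction α using PathClass.ind with
  | h p =>
    have h1 := smul_crossedSum_eq_zero hz hΔ hc hb p hα
    rw [hsum p hb hb] at h1
    -- As `α` has degree zero, conjugation by `δ b` multiplies `F α` by `T` to the degree of `δ b`,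
    -- and the factor in `I` cancels this. The two terms from `δ b` and its inverse cancel because
    -- `F` vanishes at `1`.
    have h2 : I b b hb hb (.mk p) = F (.mk p) := by
      change (T (-d b hb) : ℤ[T;T⁻¹]) • F (δ b hb * PathClass.mk p * (δ b hb)⁻¹) = _
      have h3 := hF (δ b hb) (δ b hb)⁻¹
      rw [mul_inv_cancel, hF1] at h3
      rw [hF, hF, map_mul, hα, mul_one, add_right_comm, ← h3, zero_add, smul_smul, ← T_add]
      change (T (-d b hb + d b hb) : ℤ[T;T⁻¹]) • _ = _
      rw [neg_add_cancel, T_zero, one_smul]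
    rwa [h2] at h1

end PreAbstractSimplicialComplex

end

noncomputable section

/-! ### Knot groups and representations in `SL₂(ℂ)` -/

open PreAbstractSimplicialComplex Matrix LaurentPolynomial

/-- The consequences for a group `π`, with abelianization `ν` and meridian `μ`, of the fact that
its Alexander polynomial does not vanish at `1`, `m²` and `m⁻²`. -/
structure AlexanderRegular {π : Type*} [Group π] (ν : π →* Multiplicative ℤ) (μ : π) (m : ℂˣ) :
    Prop where
  deg : ν μ = Multiplicative.ofAdd 1
  hom : ∀ (a : π →* ℂˣ) (α : π), ν α = 1 → a α = 1
  crossed : ∀ ζ : ℂˣ, ζ = 1 ∨ ζ = m ^ 2 ∨ ζ = (m ^ 2)⁻¹ → ∀ F : π → ℂ,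
    (∀ α β, F (α * β) = F α + ((ζ ^ Multiplicative.toAdd (ν α) : ℂˣ) : ℂ) * F β) →
    ∀ α, ν α = 1 → F α = 0

theorem eval₂_one_eq (p : ℤ[T;T⁻¹]) :
    LaurentPolynomial.eval₂ (Int.castRingHom ℂ) 1 p =
      ((LaurentPolynomial.eval₂ (RingHom.id ℤ) 1 p : ℤ) : ℂ) := by
  induction p using LaurentPolynomial.induction_on' with
  | add p q hp hq => rw [map_add, map_add, hp, hq, Int.cast_add]
  | C_mul_T n a => simp

theorem eval₂_invert (x : ℂˣ) (p : ℤ[T;T⁻¹]) :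
    LaurentPolynomial.eval₂ (Int.castRingHom ℂ) x (invert p) =
      LaurentPolynomial.eval₂ (Int.castRingHom ℂ) x⁻¹ p := by
  induction p using LaurentPolynomial.induction_on' with
  | add p q hp hq => rw [map_add, map_add, map_add, hp, hq]
  | C_mul_T n a => simp

theorem seqHol_ofAdd {V : Type*} (z : V → V → ℤ) (v : ℕ → V) (k : ℕ) :
    seqHol (fun u v => Multiplicative.ofAdd (z u v)) v k =
      Multiplicative.ofAdd (∑ i ∈ Finset.range k, z (v i) (v (i + 1))) := by
  induction k with
  | zero => rfl
  | succ k ih => rw [seqHol, ih, Finset.sum_range_succ, ofAdd_add]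

theorem SimpleCycle.vert_zero_mem {V : Type*} [DecidableEq V] (c : SimpleCycle V)
    {K : PreAbstractSimplicialComplex V} (h : c.toComplex ≤ K) : {c.vert 0} ∈ K.faces :=
  h (left_mem_of_edge (c.edge_mem 0))

/-- The targets become modules over Laurent polynomials by letting `t` act as `1` on `ℂˣ` and as `ζ`
on `ℂ`. There `Δ` annihilates the values in question and acts invertibly: `Δ(1) = 1`, `Δ(m²) ≠ 0` by
hypothesis, and `Δ(m⁻²) = Δ(m²)` by symmetry. -/
theorem IsAlexanderPolynomial.alexanderRegular {V : Type*} [LinearOrder V]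
    {E : PreAbstractSimplicialComplex V} {μ : SimpleCycle V} {Δ : ℤ[T;T⁻¹]}
    (hΔ : IsAlexanderPolynomial E μ Δ) (hE : E.IsConnected) (hμ : μ.toComplex ≤ E) {m : ℂˣ}
    (hm : LaurentPolynomial.eval₂ (Int.castRingHom ℂ) (m ^ 2) Δ ≠ 0) :
    ∃ ν : Pi1 E (μ.vert 0) →* Multiplicative ℤ, AlexanderRegular ν (μ.loop hμ) m := by
  obtain ⟨hinv, hone, z, ⟨hz, hzμ⟩, hspan⟩ := hΔ
  have hzf : E.IsFlat fun u v => Multiplicative.ofAdd (z u v) := fun u v w h => by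
    rw [← ofAdd_add, hz u v w h]
  have hmem : Δ ∈ fittingIdeal ℤ[T;T⁻¹] (AlexanderModule E z) := by
    rw [← hspan]; exact Ideal.mem_span_singleton_self Δ
  have hb := μ.vert_zero_mem hμ
  refine ⟨holHom hzf _, ?_, ?_, ?_⟩
  · rw [μ.hol_loop hzf hμ, seqHol_ofAdd, hzμ]
  · intro a α hα
    let _ : Module ℤ[T;T⁻¹] (Additive ℂˣ) :=
      Module.compHom _ (LaurentPolynomial.eval₂ (RingHom.id ℤ) 1)
    have hsmul : ∀ (p : ℤ[T;T⁻¹]) (x : Additive ℂˣ),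
      p • x = (LaurentPolynomial.eval₂ (RingHom.id ℤ) 1 p : ℤ) • x := fun _ _ => rfl
    have h := smul_crossedHom_eq_zero (N := Additive ℂˣ) hE hzf hmem hb
      (F := fun α => Additive.ofMul (a α)) (by
        intro α β
        rw [hsmul, map_mul, ofMul_mul, eval₂_T, _root_.one_zpow, Units.val_one, one_smul]) hα
    rw [hsmul, hone, one_smul] at h
    exact h
  · intro ζ hζ F hF α hα
    have hζ0 : LaurentPolynomial.eval₂ (Int.castRingHom ℂ) ζ Δ ≠ 0 := by
      rcases hζ with rfl | rfl | rfl
      · rw [eval₂_one_eq, hone]; simp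
      · exact hm
      · rwa [← eval₂_invert, hinv]
    let _ : Module ℤ[T;T⁻¹] ℂ :=
      Module.compHom _ (LaurentPolynomial.eval₂ (Int.castRingHom ℂ) ζ)
    have hsmul : ∀ (p : ℤ[T;T⁻¹]) (x : ℂ),
      p • x = LaurentPolynomial.eval₂ (Int.castRingHom ℂ) ζ p * x := fun _ _ => rfl
    have h := smul_crossedHom_eq_zero (N := ℂ) hE hzf hmem hb (F := F) (by
        intro α β
        rw [hsmul, eval₂_T, hF]) hα
    rw [hsmul] at h
    exact (mul_eq_zero.1 h).resolve_left hζ0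

namespace AlexanderRegular

variable {π : Type*} [Group π] {ν : π →* Multiplicative ℤ} {μ : π} {m : ℂˣ}

/-- Since the meridian has degree one, every element is an element of degree zero times a power of
the meridian. -/
theorem map_mul_zpow_eq_one (h : AlexanderRegular ν μ m) (α : π) :
    ν (α * μ ^ (-Multiplicative.toAdd (ν α))) = 1 := by
  rw [map_mul, map_zpow, h.deg, ← ofAdd_zsmul, smul_eq_mul, mul_one, ofAdd_neg, ofAdd_toAdd,
    mul_inv_cancel]

theorem hom_eq (h : AlexanderRegular ν μ m) {H : Type*} [Group H] {f : π →* H}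
    (hf : ∀ α, ν α = 1 → f α = 1) (α : π) : f α = f μ ^ Multiplicative.toAdd (ν α) := by
  have := hf _ (h.map_mul_zpow_eq_one α)
  rw [map_mul, map_zpow, _root_.zpow_neg, mul_inv_eq_one] at this
  exact this

/-- A triangular representation is trivial on elements of degree zero. -/
theorem triangular (h : AlexanderRegular ν μ m) {a b d : π → ℂ} (ha1 : a 1 = 1)
    (ha : ∀ α β, a (α * β) = a α * a β) (hb : ∀ α β, b (α * β) = a α * b β + b α * d β)
    (had : ∀ α, a α * d α = 1) (haμ : a μ = m ∨ a μ = (m⁻¹ : ℂˣ)) {α : π} (hα : ν α = 1) :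
    a α = 1 ∧ b α = 0 := by
  let a' : π →* ℂˣ :=
    { toFun := fun α => ⟨a α, d α, had α, by rw [mul_comm, had]⟩
      map_one' := Units.ext ha1
      map_mul' := fun α β => Units.ext (ha α β) }
  have ha' : ∀ α, a α = a' α := fun _ => rfl
  have hpow := h.hom_eq (h.hom a')
  have hone : a α = 1 := by rw [ha', h.hom a' α hα, Units.val_one]
  refine ⟨hone, ?_⟩
  -- The product `a b` is a crossed homomorphism for the character `a²`, because `a d = 1`. This
  -- character is the power by `ν` of its value at the meridian, which is `m²` or `m⁻²`.
  have hF := h.crossed (a' μ ^ 2) (by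
    rcases haμ with h | h
    · right; left
      rw [show a' μ = m from Units.ext h]
    · right; right
      rw [show a' μ = m⁻¹ from Units.ext h, inv_pow]) (fun α => a α * b α) (by
      intro α β
      have : (((a' μ ^ 2) ^ Multiplicative.toAdd (ν α) : ℂˣ) : ℂ) = a α ^ 2 := by
        rw [← zpow_natCast, ← _root_.zpow_mul, mul_comm, _root_.zpow_mul, ← hpow, zpow_natCast,
          Units.val_pow_eq_pow_val, ← ha']
      rw [this, ha, hb]
      have := had β
      linear_combination (a α * b α) * this) α hα
  simpa [hone] using hF

end AlexanderRegular

/-! ### Diagonal matrices and the adjoint action -/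

local notation "SL2" => SpecialLinearGroup (Fin 2) ℂ
local notation "sl2" => LieAlgebra.SpecialLinear.sl (Fin 2) ℂ

/-- Diagonal matrices in `SL₂(ℂ)`. -/
def IsDiagSL (g : SL2) : Prop := g.1 0 1 = 0 ∧ g.1 1 0 = 0

/-- The diagonal matrix with entries `m` and `m⁻¹`. -/
def diagSL (m : ℂˣ) : SL2 := ⟨!![(m : ℂ), 0; 0, (m⁻¹ : ℂˣ)], by simp [Matrix.det_fin_two]⟩

theorem isDiagSL_diagSL (m : ℂˣ) : IsDiagSL (diagSL m) := by simp [IsDiagSL, diagSL]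

theorem slTwo_ext {X Y : sl2} (h0 : X.1 0 0 = Y.1 0 0) (h1 : X.1 0 1 = Y.1 0 1)
    (h2 : X.1 1 0 = Y.1 1 0) : X = Y := by
  have hX : X.1.trace = 0 := X.2
  have hY : Y.1.trace = 0 := Y.2
  rw [Matrix.trace_fin_two] at hX hY
  refine Subtype.ext (Matrix.ext fun i j => ?_)
  fin_cases i <;> fin_cases j
  · exact h0
  · exact h1
  · exact h2
  · change X.1 1 1 = Y.1 1 1
    linear_combination hX - hY - h0

theorem slTwo_apply_one_one (X : sl2) : X.1 1 1 = -X.1 0 0 := by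
  have hX : X.1.trace = 0 := X.2
  rw [Matrix.trace_fin_two] at hX
  linear_combination hX

/-- An element of `sl₂(ℂ)` with given entries. -/
def slMk (x y z : ℂ) : sl2 := ⟨!![x, y; z, -x], by
  change Matrix.trace (!![x, y; z, -x] : Matrix (Fin 2) (Fin 2) ℂ) = 0
  simp [Matrix.trace_fin_two]⟩

@[simp] theorem slMk_zero_zero (x y z : ℂ) : (slMk x y z).1 0 0 = x := rfl
@[simp] theorem slMk_zero_one (x y z : ℂ) : (slMk x y z).1 0 1 = y := rfl
@[simp] theorem slMk_one_zero (x y z : ℂ) : (slMk x y z).1 1 0 = z := rfl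

theorem sl_add_apply (X Y : sl2) (i j : Fin 2) : (X + Y).1 i j = X.1 i j + Y.1 i j := rfl
theorem sl_sub_apply (X Y : sl2) (i j : Fin 2) : (X - Y).1 i j = X.1 i j - Y.1 i j := rfl
theorem sl_smul_apply (t : ℂ) (X : sl2) (i j : Fin 2) : (t • X).1 i j = t * X.1 i j := rfl
theorem sl_zero_apply (i j : Fin 2) : (0 : sl2).1 i j = 0 := rfl

theorem adjointRep_val (g : SL2) (X : sl2) : (adjointRep g X).1 = g.1 * X.1 * g.1.adjugate := rfl

namespace IsDiagSL

variable {g : SL2}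

theorem mul_eq_one (hg : IsDiagSL g) : g.1 0 0 * g.1 1 1 = 1 := by
  have := g.2
  rw [Matrix.det_fin_two, hg.1, zero_mul, sub_zero] at this
  exact this

theorem adjoint_zero_zero (hg : IsDiagSL g) (X : sl2) : (adjointRep g X).1 0 0 = X.1 0 0 := by
  rw [adjointRep_val, Matrix.adjugate_fin_two]
  simp [Matrix.mul_apply, Fin.sum_univ_two, hg.1, hg.2]
  linear_combination (X.1 0 0) * hg.mul_eq_one

theorem adjoint_zero_one (hg : IsDiagSL g) (X : sl2) :
    (adjointRep g X).1 0 1 = g.1 0 0 ^ 2 * X.1 0 1 := by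
  rw [adjointRep_val, Matrix.adjugate_fin_two]
  simp [Matrix.mul_apply, Fin.sum_univ_two, hg.1, hg.2]
  ring

theorem adjoint_one_zero (hg : IsDiagSL g) (X : sl2) :
    (adjointRep g X).1 1 0 = g.1 1 1 ^ 2 * X.1 1 0 := by
  rw [adjointRep_val, Matrix.adjugate_fin_two]
  simp [Matrix.mul_apply, Fin.sum_univ_two, hg.1, hg.2]
  ring

theorem adjoint_slMk (hg : IsDiagSL g) (x : ℂ) : adjointRep g (slMk x 0 0) = slMk x 0 0 := by
  refine slTwo_ext ?_ ?_ ?_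
  · rw [hg.adjoint_zero_zero]
  · rw [hg.adjoint_zero_one]; simp
  · rw [hg.adjoint_one_zero]; simp

theorem ext {g h : SL2} (hg : IsDiagSL g) (hh : IsDiagSL h) (e : g.1 0 0 = h.1 0 0) : g = h := by
  have h1 := hg.mul_eq_one
  have h2 := hh.mul_eq_one
  refine Subtype.ext (Matrix.ext fun i j => ?_)
  fin_cases i <;> fin_cases j
  · exact e
  · exact hg.1.trans hh.1.symm
  · exact hg.2.trans hh.2.symm
  · change g.1 1 1 = h.1 1 1
    rw [e] at h1
    have h0 : h.1 0 0 ≠ 0 := left_ne_zero_of_mul_eq_one h2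
    exact mul_left_cancel₀ h0 (h1.trans h2.symm)

end IsDiagSL

theorem units_sub_inv_ne_zero {m : ℂˣ} (h1 : (m : ℂ) ≠ 1) (h2 : (m : ℂ) ≠ -1) :
    (m : ℂ) - (m⁻¹ : ℂˣ) ≠ 0 := by
  intro h
  have h3 : (m : ℂ) * (m⁻¹ : ℂˣ) = 1 := m.mul_inv
  have h4 : ((m : ℂ) - 1) * (m + 1) = 0 := by linear_combination m * h + h3
  rcases mul_eq_zero.1 h4 with h | h
  · exact h1 (sub_eq_zero.1 h)
  · exact h2 (eq_neg_of_add_eq_zero_left h)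

/-- Matrices that commute with a diagonal matrix with distinct eigenvalues are diagonal. -/
theorem isDiagSL_of_commute {m : ℂˣ} (h1 : (m : ℂ) ≠ 1) (h2 : (m : ℂ) ≠ -1) {g : SL2}
    (h : g * diagSL m = diagSL m * g) : IsDiagSL g := by
  have hne := units_sub_inv_ne_zero h1 h2
  have h' : g.1 * (diagSL m).1 = (diagSL m).1 * g.1 := congrArg Subtype.val h
  have h01 := congrFun (congrFun h' 0) 1
  have h10 := congrFun (congrFun h' 1) 0
  simp only [diagSL, Matrix.mul_apply, Fin.sum_univ_two] at h01 h10
  simp at h01 h10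
  have e := Units.val_inv_eq_inv_val m
  constructor
  · refine (mul_eq_zero.1 (?_ : ((m : ℂ) - (m⁻¹ : ℂˣ)) * g.1 0 1 = 0)).resolve_left hne
    rw [e]
    linear_combination -h01
  · refine (mul_eq_zero.1 (?_ : ((m : ℂ) - (m⁻¹ : ℂˣ)) * g.1 1 0 = 0)).resolve_left hne
    rw [e]
    linear_combination h10

/-- The characteristic polynomial of a matrix of determinant one and trace `t + s` with `t s = 1`
has the roots `t` and `s`. -/
theorem exists_mulVec_eq {g : SL2} {t s : ℂ} (hts : t * s = 1) (htr : g.1.trace = t + s) :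
    ∃ v : Fin 2 → ℂ, v ≠ 0 ∧ g.1 *ᵥ v = t • v := by
  have hdet : (g.1 - t • (1 : Matrix (Fin 2) (Fin 2) ℂ)).det = 0 := by
    have hg := g.2
    rw [Matrix.det_fin_two] at hg
    rw [Matrix.trace_fin_two] at htr
    rw [Matrix.det_fin_two]
    simp
    linear_combination hg - hts - t * htr
  obtain ⟨v, hv, h⟩ := Matrix.exists_mulVec_eq_zero_iff.2 hdet
  refine ⟨v, hv, ?_⟩
  rw [Matrix.sub_mulVec, Matrix.smul_mulVec, Matrix.one_mulVec, sub_eq_zero] at h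
  exact h

theorem EigenvalueSL2.trace_eq {g : SL2} {m : ℂˣ} (h : EigenvalueSL2 g m) :
    g.1.trace = m + (m⁻¹ : ℂˣ) := by
  obtain ⟨v, hv, hv0⟩ := h.exists_hasEigenvector
  rw [Module.End.mem_eigenspace_iff] at hv
  have hv' : g.1 *ᵥ v = (m : ℂ) • v := hv
  have hdet : (g.1 - (m : ℂ) • (1 : Matrix (Fin 2) (Fin 2) ℂ)).det = 0 := by
    refine Matrix.exists_mulVec_eq_zero_iff.1 ⟨v, hv0, ?_⟩
    rw [Matrix.sub_mulVec, Matrix.smul_mulVec, Matrix.one_mulVec, hv', sub_self]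
  have hg := g.2
  rw [Matrix.det_fin_two] at hg hdet
  rw [Matrix.trace_fin_two]
  simp at hdet
  have h3 : (m : ℂ) * (m⁻¹ : ℂˣ) = 1 := m.mul_inv
  refine mul_left_cancel₀ m.ne_zero ?_
  linear_combination hg - hdet - h3

/-- A matrix in `SL₂(ℂ)` with distinct eigenvalues can be diagonalized. -/
theorem exists_conj_eq_diagSL {m : ℂˣ} (h1 : (m : ℂ) ≠ 1) (h2 : (m : ℂ) ≠ -1) {g : SL2}
    (htr : g.1.trace = m + (m⁻¹ : ℂˣ)) : ∃ h : SL2, h⁻¹ * g * h = diagSL m := by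
  obtain ⟨v, hv0, hv⟩ := exists_mulVec_eq m.mul_inv htr
  obtain ⟨w, hw0, hw⟩ := exists_mulVec_eq m.inv_mul (htr.trans (add_comm _ _))
  have hne := units_sub_inv_ne_zero h1 h2
  have hdet : v 0 * w 1 - w 0 * v 1 ≠ 0 := by
    intro hd
    have hex : ∃ c : ℂ, w = c • v := by
      by_cases hv00 : v 0 = 0
      · have hv1 : v 1 ≠ 0 := fun h => hv0 (by ext i; fin_cases i <;> simp [hv00, h])
        refine ⟨w 1 / v 1, ?_⟩
        ext i; fin_cases i
        · have : w 0 * v 1 = 0 := by rw [hv00] at hd; linear_combination -hd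
          simpa [hv00, hv1] using this
        · simp [hv1]
      · refine ⟨w 0 / v 0, ?_⟩
        ext i; fin_cases i
        · simp [hv00]
        · change w 1 = w 0 / v 0 * v 1
          field_simp
          linear_combination hd
    obtain ⟨c, rfl⟩ := hex
    rw [Matrix.mulVec_smul, hv] at hw
    apply hw0
    have : ((m : ℂ) - (m⁻¹ : ℂˣ)) • c • v = 0 := by
      rw [sub_smul, ← hw, smul_comm, sub_self]
    exact (smul_eq_zero.1 this).resolve_left hne
  let D := v 0 * w 1 - w 0 * v 1
  -- The columns are eigenvectors; dividing the first one by `D` makes the determinant one.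
  let h : SL2 := ⟨!![v 0 / D, w 0; v 1 / D, w 1], by
    rw [Matrix.det_fin_two_of]
    change v 0 / D * w 1 - w 0 * (v 1 / D) = 1
    rw [div_mul_eq_mul_div, mul_div_assoc', ← sub_div, div_self hdet]⟩
  refine ⟨h, ?_⟩
  rw [mul_assoc, inv_mul_eq_iff_eq_mul]
  refine Subtype.ext ?_
  change g.1 * h.1 = h.1 * (diagSL m).1
  have hv_0 := congrFun hv 0
  have hv_1 := congrFun hv 1
  have hw_0 := congrFun hw 0
  have hw_1 := congrFun hw 1
  simp [Matrix.mulVec, dotProduct, Fin.sum_univ_two] at hv_0 hv_1 hw_0 hw_1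
  ext i j
  fin_cases i <;> fin_cases j <;>
    simp [h, diagSL, Matrix.mul_apply, Fin.sum_univ_two]
  · linear_combination hv_0 / D
  · linear_combination hw_0
  · linear_combination hv_1 / D
  · linear_combination hw_1

/-! ### Irreducibility -/

section Irreducible

variable {π : Type*} [Group π] {ρ : π →* SL2}

/-- An element of `sl₂(ℂ)` invariant under an irreducible representation vanishes. -/
theorem IrreducibleSL2.eq_zero_of_invariant (hρ : IrreducibleSL2 ρ) {X : sl2}
    (hX : ∀ α, adjointRep (ρ α) X = X) : X = 0 := by
  have hcomm : ∀ α, (ρ α).1 * X.1 = X.1 * (ρ α).1 := by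
    intro α
    have h : (ρ α).1 * X.1 * (ρ α).1.adjugate = X.1 := congrArg Subtype.val (hX α)
    have h1 : (ρ α).1.adjugate * (ρ α).1 = 1 := by
      rw [Matrix.adjugate_mul, (ρ α).2, one_smul]
    calc (ρ α).1 * X.1 = (ρ α).1 * X.1 * ((ρ α).1.adjugate * (ρ α).1) := by rw [h1, mul_one]
      _ = X.1 * (ρ α).1 := by rw [← mul_assoc, h]
  -- Schur's lemma: an eigenspace of `X` is invariant, hence everything, so `X` is scalar; a scalar
  -- matrix of trace zero vanishes.
  obtain ⟨c, hc⟩ := Module.End.exists_eigenvalue (Matrix.mulVecLin X.1)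
  let W : Subrepresentation (standardRep.comp ρ) :=
    ⟨Module.End.eigenspace (Matrix.mulVecLin X.1) c, by
      intro α v hv
      rw [Module.End.mem_eigenspace_iff] at hv ⊢
      change X.1 *ᵥ v = c • v at hv
      change X.1 *ᵥ ((ρ α).1 *ᵥ v) = c • ((ρ α).1 *ᵥ v)
      rw [Matrix.mulVec_mulVec, ← hcomm, ← Matrix.mulVec_mulVec, hv, Matrix.mulVec_smul]⟩
  have : IsSimpleOrder (Subrepresentation (standardRep.comp ρ)) := hρ
  rcases IsSimpleOrder.eq_bot_or_eq_top W with h | h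
  · exact absurd (congrArg Subrepresentation.toSubmodule h) hc
  · have hall : ∀ v, X.1 *ᵥ v = c • v := by
      intro v
      have hv : v ∈ W.toSubmodule := by rw [h]; exact Submodule.mem_top (R := ℂ)
      exact Module.End.mem_eigenspace_iff.1 hv
    have hX' : X.1 = c • 1 := by
      refine Matrix.ext_of_mulVec_single fun i => ?_
      rw [hall, Matrix.smul_mulVec, Matrix.one_mulVec]
    have h00 : X.1 0 0 = c := by simp [hX']
    have h11 : X.1 1 1 = c := by simp [hX']
    have h01 : X.1 0 1 = 0 := by simp [hX']
    have h10 : X.1 1 0 = 0 := by simp [hX']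
    have hc0 : c = 0 := by
      have := slTwo_apply_one_one X
      rw [h00, h11] at this
      linear_combination this / 2
    exact slTwo_ext (by rw [h00, hc0]; rfl) h01 h10

/-- A representation with a common eigenvector is not irreducible. -/
theorem IrreducibleSL2.not_eigenvector (hρ : IrreducibleSL2 ρ) {v : Fin 2 → ℂ} (hv : v ≠ 0)
    (h : ∀ α, ∃ c : ℂ, (ρ α).1 *ᵥ v = c • v) : False := by
  let W : Subrepresentation (standardRep.comp ρ) := ⟨ℂ ∙ v, by
    intro α w hw
    obtain ⟨t, rfl⟩ := Submodule.mem_span_singleton.1 hw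
    obtain ⟨c, hc⟩ := h α
    change (ρ α).1 *ᵥ (t • v) ∈ _
    rw [Matrix.mulVec_smul, hc]
    exact Submodule.smul_mem _ _ (Submodule.smul_mem _ _ (Submodule.mem_span_singleton_self v))⟩
  have : IsSimpleOrder (Subrepresentation (standardRep.comp ρ)) := hρ
  rcases IsSimpleOrder.eq_bot_or_eq_top W with h | h
  · have h' := congrArg Subrepresentation.toSubmodule h
    exact hv (Submodule.span_singleton_eq_bot.1 h')
  · have h' : ℂ ∙ v = ⊤ := congrArg Subrepresentation.toSubmodule h
    have h1 := finrank_span_singleton (K := ℂ) hv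
    rw [h', finrank_top] at h1
    simp at h1

/-- In dimension two a proper nonzero invariant subspace is a line, and a vector spanning it is a
common eigenvector. -/
theorem exists_eigenvector_of_not_irreducibleSL2 (hρ : ¬ IrreducibleSL2 ρ) :
    ∃ v : Fin 2 → ℂ, v ≠ 0 ∧ ∀ α, ∃ c : ℂ, (ρ α).1 *ᵥ v = c • v := by
  by_contra hcon
  push Not at hcon
  apply hρ
  have hnt : Nontrivial (Subrepresentation (standardRep.comp ρ)) := by
    refine ⟨⊥, ⊤, fun h => ?_⟩
    have h' : (⊥ : Submodule ℂ (Fin 2 → ℂ)) = ⊤ := congrArg Subrepresentation.toSubmodule h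
    exact bot_ne_top h'
  refine { eq_bot_or_eq_top := fun W => ?_ }
  by_contra hW
  push Not at hW
  have hbot : W.toSubmodule ≠ ⊥ := fun h => hW.1 (Subrepresentation.toSubmodule_injective h)
  have htop : W.toSubmodule ≠ ⊤ := fun h => hW.2 (Subrepresentation.toSubmodule_injective h)
  obtain ⟨v, hvW, hv0⟩ := Submodule.exists_mem_ne_zero_of_ne_bot hbot
  have hlt := Submodule.finrank_lt htop
  rw [Module.finrank_fin_fun] at hlt
  have hle : ℂ ∙ v ≤ W.toSubmodule := (Submodule.span_singleton_le_iff_mem _ _).2 hvW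
  have heq : ℂ ∙ v = W.toSubmodule := by
    refine Submodule.eq_of_le_of_finrank_le hle ?_
    rw [finrank_span_singleton hv0]
    omega
  obtain ⟨α, hα⟩ := hcon v hv0
  have := W.apply_mem_toSubmodule α hvW
  rw [← heq, Submodule.mem_span_singleton] at this
  obtain ⟨c, hc⟩ := this
  exact hα c hc.symm

theorem IrreducibleSL2.conj (hρ : IrreducibleSL2 ρ) {σ : π →* SL2} {g : SL2}
    (h : ∀ α, ρ α = g * σ α * g⁻¹) : IrreducibleSL2 σ := by
  by_contra hσ
  obtain ⟨v, hv0, hv⟩ := exists_eigenvector_of_not_irreducibleSL2 hσ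
  have hg : ∀ w, (g⁻¹).1 *ᵥ (g.1 *ᵥ w) = w := by
    intro w
    have e : (g⁻¹).1 * g.1 = 1 := congrArg Subtype.val (inv_mul_cancel g)
    rw [Matrix.mulVec_mulVec, e, Matrix.one_mulVec]
  refine hρ.not_eigenvector (v := g.1 *ᵥ v) (fun h0 => hv0 ?_) fun α => ?_
  · rw [← hg v, h0, Matrix.mulVec_zero]
  · obtain ⟨c, hc⟩ := hv α
    refine ⟨c, ?_⟩
    have e : (ρ α).1 = g.1 * (σ α).1 * (g⁻¹).1 := congrArg Subtype.val (h α)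
    rw [e, ← Matrix.mulVec_mulVec, hg, ← Matrix.mulVec_mulVec, hc, Matrix.mulVec_smul]

end Irreducible

/-! ### Reducible representations of knot groups and their crossed homomorphisms. -/

section Abelian

variable {π : Type*} [Group π] {ν : π →* Multiplicative ℤ} {μ : π} {m : ℂˣ} {σ : π →* SL2}

/-- A reducible representation of a knot group, such that the Alexander polynomial does not vanish
at the square of an eigenvalue of the meridian, is trivial on elements of degree zero. -/
theorem AlexanderRegular.eq_one_of_not_irreducible (h : AlexanderRegular ν μ m)
    (h1 : (m : ℂ) ≠ 1) (h2 : (m : ℂ) ≠ -1) (hμ : σ μ = diagSL m) (hσ : ¬ IrreducibleSL2 σ) {α : π}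
    (hα : ν α = 1) : σ α = 1 := by
  obtain ⟨v, hv0, hv⟩ := exists_eigenvector_of_not_irreducibleSL2 hσ
  have hne := units_sub_inv_ne_zero h1 h2
  have hmul : ∀ α β i j, (σ (α * β)).1 i j =
      (σ α).1 i 0 * (σ β).1 0 j + (σ α).1 i 1 * (σ β).1 1 j := by
    intro α β i j
    rw [map_mul]
    change ((σ α).1 * (σ β).1) i j = _
    rw [Matrix.mul_apply, Fin.sum_univ_two]
  have hdet : ∀ α, (σ α).1 0 0 * (σ α).1 1 1 - (σ α).1 0 1 * (σ α).1 1 0 = 1 := fun α => by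
    rw [← Matrix.det_fin_two]; exact (σ α).2
  have hone : ∀ i, (σ 1).1 i i = 1 := by
    intro i
    rw [map_one]
    change (1 : Matrix (Fin 2) (Fin 2) ℂ) i i = 1
    simp
  obtain ⟨c, hc⟩ := hv μ
  rw [hμ] at hc
  have hc0 := congrFun hc 0
  have hc1 := congrFun hc 1
  simp [diagSL, Matrix.mulVec, dotProduct, Fin.sum_univ_two] at hc0 hc1
  -- The only eigenlines of `diag(m, m⁻¹)` are the coordinate axes, so the common eigenvector lies
  -- on one of them and the representation is upper or lower triangular.
  by_cases hv1 : v 1 = 0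
  · have hv00 : v 0 ≠ 0 := fun h => hv0 (by ext i; fin_cases i <;> simp [hv1, h])
    have h10 : ∀ α, (σ α).1 1 0 = 0 := by
      intro α
      obtain ⟨c, hc⟩ := hv α
      have := congrFun hc 1
      simp [Matrix.mulVec, dotProduct, Fin.sum_univ_two, hv1] at this
      exact this.resolve_right hv00
    have ht := h.triangular (a := fun α => (σ α).1 0 0) (b := fun α => (σ α).1 0 1)
      (d := fun α => (σ α).1 1 1) (hone 0) (fun α β => by rw [hmul, h10, mul_zero, add_zero])
      (fun α β => hmul α β 0 1) (fun α => by have := hdet α; rw [h10] at this; simpa using this)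
      (Or.inl (by simp [hμ, diagSL])) hα
    refine IsDiagSL.ext ⟨ht.2, h10 α⟩ (by simp [IsDiagSL]) ?_
    rw [ht.1]
    simp
  · have hv00 : v 0 = 0 := by
      have hcm : (m : ℂ)⁻¹ = c := hc1.resolve_right hv1
      rcases hc0 with h | h
      · exact absurd (by rw [h, ← hcm, Units.val_inv_eq_inv_val, sub_self]) hne
      · exact h
    have h01 : ∀ α, (σ α).1 0 1 = 0 := by
      intro α
      obtain ⟨c, hc⟩ := hv α
      have := congrFun hc 0
      simp [Matrix.mulVec, dotProduct, Fin.sum_univ_two, hv00] at this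
      exact this.resolve_right hv1
    -- After exchanging the coordinates the lower triangular case has the shape of the upper
    -- triangular one, with `m⁻¹` in place of `m`.
    have ht := h.triangular (a := fun α => (σ α).1 1 1) (b := fun α => (σ α).1 1 0)
      (d := fun α => (σ α).1 0 0) (hone 1) (fun α β => by rw [hmul, h01 β, mul_zero, zero_add])
      (fun α β => by rw [hmul]; ring)
      (fun α => by have := hdet α; rw [h01] at this; rw [mul_comm]; simpa using this)
      (Or.inr (by simp [hμ, diagSL])) hα
    refine IsDiagSL.ext ⟨h01 α, ht.2⟩ (by simp [IsDiagSL]) ?_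
    have := hdet α
    rw [h01, ht.1] at this
    simpa using this

theorem units_sq_zpow (ζ : ℂˣ) (k : ℤ) :
    (((ζ ^ 2) ^ k : ℂˣ) : ℂ) = ((ζ ^ k : ℂˣ) : ℂ) ^ 2 := by
  rw [← Units.val_pow_eq_pow_val, ← zpow_natCast, ← zpow_natCast, ← _root_.zpow_mul,
    ← _root_.zpow_mul, mul_comm]

theorem diagSL_zpow {m : ℂˣ} (k : ℤ) : diagSL m ^ k = diagSL (m ^ k) := by
  let f : ℂˣ →* SL2 :=
    { toFun := diagSL
      map_one' := Subtype.ext (by ext i j; fin_cases i <;> fin_cases j <;> simp [diagSL])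
      map_mul' := fun a b => Subtype.ext (by
        change _ = (diagSL a).1 * (diagSL b).1
        ext i j
        fin_cases i <;> fin_cases j <;> simp [diagSL, Matrix.mul_apply, mul_comm]) }
  exact (map_zpow f m k).symm

/-- Crossed homomorphisms on a knot group with values in `sl₂(ℂ)`, twisted by an abelian
representation, are determined up to principal ones by the meridian. -/
theorem AlexanderRegular.crossed_principal (h : AlexanderRegular ν μ m)
    (h1 : (m : ℂ) ≠ 1) (h2 : (m : ℂ) ≠ -1) (hμ : σ μ = diagSL m)
    (hσ : ∀ α, ν α = 1 → σ α = 1) {F : π → sl2}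
    (hF : ∀ α β, F (α * β) = F α + adjointRep (σ α) (F β)) (hFμ : (F μ).1 0 0 = 0) :
    ∃ X : sl2, ∀ α, F α = adjointRep (σ α) X - X := by
  have hne := units_sub_inv_ne_zero h1 h2
  have hmm : (m : ℂ) * (m⁻¹ : ℂˣ) = 1 := m.mul_inv
  have hne1 : (m : ℂ) ^ 2 - 1 ≠ 0 := fun h0 => hne (by
    refine mul_left_cancel₀ m.ne_zero ?_
    linear_combination h0 - hmm)
  have hne2 : ((m⁻¹ : ℂˣ) : ℂ) ^ 2 - 1 ≠ 0 := fun h0 => hne (by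
    refine mul_left_cancel₀ (m⁻¹).ne_zero ?_
    linear_combination -h0 + hmm)
  have hσ' := h.hom_eq hσ
  have hσd : ∀ α, σ α = diagSL (m ^ Multiplicative.toAdd (ν α)) := fun α => by
    rw [hσ', hμ, diagSL_zpow]
  have hdiag : ∀ α, IsDiagSL (σ α) := fun α => by rw [hσd]; exact isDiagSL_diagSL _
  -- The meridian scales the off-diagonal entries by `m²` and `m⁻²`, so `X` solves for the
  -- off-diagonal entries of `F μ`. The diagonal entry cannot be changed by a principal crossed
  -- homomorphism and is zero by hypothesis.
  let X : sl2 := slMk 0 ((F μ).1 0 1 / ((m : ℂ) ^ 2 - 1))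
    ((F μ).1 1 0 / (((m⁻¹ : ℂˣ) : ℂ) ^ 2 - 1))
  let F' : π → sl2 := fun α => F α - (adjointRep (σ α) X - X)
  have hF' : ∀ α β, F' (α * β) = F' α + adjointRep (σ α) (F' β) := by
    intro α β
    simp only [F', hF, map_sub]
    rw [map_mul, map_mul, Module.End.mul_apply]
    abel
  have hF'μ : F' μ = 0 := by
    refine slTwo_ext ?_ ?_ ?_
    · change (F μ).1 0 0 - ((adjointRep (σ μ) X).1 0 0 - X.1 0 0) = 0
      rw [(hdiag μ).adjoint_zero_zero, hFμ]
      simp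
    · change (F μ).1 0 1 - ((adjointRep (σ μ) X).1 0 1 - X.1 0 1) = 0
      rw [(hdiag μ).adjoint_zero_one, hμ]
      change (F μ).1 0 1 - ((m : ℂ) ^ 2 * ((F μ).1 0 1 / ((m : ℂ) ^ 2 - 1)) -
        (F μ).1 0 1 / ((m : ℂ) ^ 2 - 1)) = 0
      field_simp
      ring
    · change (F μ).1 1 0 - ((adjointRep (σ μ) X).1 1 0 - X.1 1 0) = 0
      rw [(hdiag μ).adjoint_one_zero, hμ]
      change (F μ).1 1 0 - (((m⁻¹ : ℂˣ) : ℂ) ^ 2 * ((F μ).1 1 0 / (((m⁻¹ : ℂˣ) : ℂ) ^ 2 - 1)) -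
        (F μ).1 1 0 / (((m⁻¹ : ℂˣ) : ℂ) ^ 2 - 1)) = 0
      have : ∀ a x : ℂ, x - 1 ≠ 0 → a - (x * (a / (x - 1)) - a / (x - 1)) = 0 := by
        intro a x hx
        field_simp
        ring
      exact this _ _ hne2
  -- The representation is by powers of `diag(m, m⁻¹)`, so the three entries of `F'` are crossed
  -- homomorphisms to `ℂ` for the parameters `1`, `m²` and `m⁻²`.
  have hker : ∀ α, ν α = 1 → F' α = 0 := by
    intro α hα
    refine slTwo_ext ?_ ?_ ?_
    · refine h.crossed 1 (Or.inl rfl) (fun α => (F' α).1 0 0) (fun α β => ?_) α hα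
      rw [hF', sl_add_apply, (hdiag α).adjoint_zero_zero]
      simp
    · refine h.crossed (m ^ 2) (Or.inr (Or.inl rfl)) (fun α => (F' α).1 0 1) (fun α β => ?_) α hα
      rw [hF', sl_add_apply, (hdiag α).adjoint_zero_one, hσd, units_sq_zpow]
      rfl
    · refine h.crossed (m ^ 2)⁻¹ (Or.inr (Or.inr rfl)) (fun α => (F' α).1 1 0) (fun α β => ?_) α hα
      rw [hF', sl_add_apply, (hdiag α).adjoint_one_zero, hσd, ← inv_pow, units_sq_zpow, _root_.inv_zpow]
      rfl
  have hF'1 : F' 1 = 0 := hker 1 (map_one ν)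
  have hpow : ∀ k : ℕ, F' (μ ^ k) = 0 := by
    intro k
    induction k with
    | zero => rw [pow_zero, hF'1]
    | succ k ih => rw [pow_succ, hF', ih, hF'μ, map_zero, add_zero]
  have hinv : ∀ α, F' α = 0 → F' α⁻¹ = 0 := by
    intro α hα
    have h0 := hF' α⁻¹ α
    rw [inv_mul_cancel, hF'1, hα, map_zero, add_zero] at h0
    exact h0.symm
  have hzpow : ∀ k : ℤ, F' (μ ^ k) = 0 := by
    intro k
    obtain ⟨n, rfl | rfl⟩ := k.eq_nat_or_neg
    · rw [zpow_natCast]; exact hpow n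
    · rw [_root_.zpow_neg, zpow_natCast]; exact hinv _ (hpow n)
  refine ⟨X, fun α => sub_eq_zero.1 (?_ : F' α = 0)⟩
  -- `F'` vanishes on elements of degree zero and on powers of the meridian, and these together
  -- generate the group.
  have e : α = α * μ ^ (-Multiplicative.toAdd (ν α)) * μ ^ Multiplicative.toAdd (ν α) := by group
  rw [e, hF', hker _ (h.map_mul_zpow_eq_one α), hzpow, map_zero, add_zero]

end Abelian

end

noncomputable section

namespace PreAbstractSimplicialComplex

/-! ### Flat transports on products -/

section Product

variable {U T : Type*} [LinearOrder U] [LinearOrder T] {A : PreAbstractSimplicialComplex U}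
  {B : PreAbstractSimplicialComplex T} {Γ : Type*} [Group Γ] {G : U × T → U × T → Γ}

theorem mem_prod_of_le {p q r : U × T} (hpq : p ≤ q) (hqr : q ≤ r)
    (hA : {p.1, q.1, r.1} ∈ A.faces) (hB : {p.2, q.2, r.2} ∈ B.faces) :
    {p, q, r} ∈ (A.prod B).faces := by
  refine ⟨by simpa [Finset.image_insert] using hA, by simpa [Finset.image_insert] using hB, ?_⟩
  have hpr := hpq.trans hqr
  intro x hx y hy _
  simp only [Finset.coe_insert, Finset.coe_singleton, Set.mem_insert_iff,
    Set.mem_singleton_iff] at hx hy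
  rcases hx with rfl | rfl | rfl <;> rcases hy with rfl | rfl | rfl <;> simp [*]

theorem mem_prod_const {s : Finset U} (hs : s ∈ A.faces) {i : T} (hi : {i} ∈ B.faces) :
    s.image (fun w => (w, i)) ∈ (A.prod B).faces := by
  refine ⟨?_, ?_, ?_⟩
  · rw [Finset.image_image]
    simpa [Function.comp_def] using hs
  · rw [Finset.image_image]
    have : (Prod.snd ∘ fun w : U => (w, i)) = fun _ => i := rfl
    rw [this, Finset.image_const (A.face_nonempty hs)]
    exact hi
  · intro x hx y hy _
    simp only [Finset.coe_image, Set.mem_image] at hx hy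
    obtain ⟨a, _, rfl⟩ := hx
    obtain ⟨c, _, rfl⟩ := hy
    simpa using le_total a c

theorem fst_mem_of_mem_prod {s : Finset (U × T)} (hs : s ∈ (A.prod B).faces) :
    s.image Prod.fst ∈ A.faces := hs.1

theorem edge_fst_mem {p q : U × T} (h : {p, q} ∈ (A.prod B).faces) : {p.1, q.1} ∈ A.faces := by
  simpa [Finset.image_insert] using h.1

theorem edge_snd_mem {p q : U × T} (h : {p, q} ∈ (A.prod B).faces) : {p.2, q.2} ∈ B.faces := by
  simpa [Finset.image_insert] using h.2.1

theorem edge_le_total {p q : U × T} (h : {p, q} ∈ (A.prod B).faces) : p ≤ q ∨ q ≤ p := by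
  by_cases hpq : p = q
  · exact Or.inl hpq.le
  · exact h.2.2 (by simp) (by simp) hpq

theorem vertical_mem {w : U} (hw : {w} ∈ A.faces) {i j : T} (hij : {i, j} ∈ B.faces) :
    {(w, i), (w, j)} ∈ (A.prod B).faces := by
  have key : ∀ i j : T, i ≤ j → {i, j} ∈ B.faces → {(w, i), (w, j)} ∈ (A.prod B).faces := by
    intro i j h hij
    have := mem_prod_of_le (A := A) (B := B) (p := (w, i)) (q := (w, i)) (r := (w, j)) le_rfl
      (by simpa using h) (by simpa using hw) (by simpa using hij)
    simpa using this
  rcases le_total i j with h | h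
  · exact key i j h hij
  · exact edge_symm (key j i h (edge_symm hij))

theorem horizontal_mem {w w' : U} (hw : {w, w'} ∈ A.faces) {i : T} (hi : {i} ∈ B.faces) :
    {(w, i), (w', i)} ∈ (A.prod B).faces := by
  simpa [Finset.image_insert] using mem_prod_const hw hi

theorem IsFlat.square (hG : (A.prod B).IsFlat G) {w w' : U} (hw : {w, w'} ∈ A.faces) {i j : T}
    (hij : {i, j} ∈ B.faces) :
    G (w, i) (w', i) * G (w', i) (w', j) = G (w, i) (w, j) * G (w, j) (w', j) := by
  have key : ∀ (w w' : U) (i j : T), w ≤ w' → i ≤ j → {w, w'} ∈ A.faces → {i, j} ∈ B.faces →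
      G (w, i) (w', i) * G (w', i) (w', j) = G (w, i) (w, j) * G (w, j) (w', j) := by
    intro w w' i j hw hi hww hij
    rw [hG, hG]
    · exact mem_prod_of_le (by simpa using hi) (by simpa using hw) (by simpa using hww)
        (by simpa using hij)
    · exact mem_prod_of_le (by simpa using hw) (by simpa using hi) (by simpa using hww)
        (by simpa using hij)
  have key2 : ∀ (w w' : U) (i j : T), w ≤ w' → {w, w'} ∈ A.faces → {i, j} ∈ B.faces →
      G (w, i) (w', i) * G (w', i) (w', j) = G (w, i) (w, j) * G (w, j) (w', j) := by
    intro w w' i j hw hww hij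
    rcases le_total i j with hi | hi
    · exact key w w' i j hw hi hww hij
    · have h := key w w' j i hw hi hww (edge_symm hij)
      rw [hG.symm (vertical_mem (right_mem_of_edge hww) (edge_symm hij)),
        hG.symm (vertical_mem (left_mem_of_edge hww) (edge_symm hij)), mul_inv_eq_iff_eq_mul,
        mul_assoc, h, inv_mul_cancel_left]
  rcases le_total w w' with h | h
  · exact key2 w w' i j h hw hij
  · have h := key2 w' w i j h (edge_symm hw) hij
    rw [hG.symm (horizontal_mem (edge_symm hw) (left_mem_of_edge hij)),
      hG.symm (horizontal_mem (edge_symm hw) (right_mem_of_edge hij)), inv_mul_eq_iff_eq_mul,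
      ← mul_assoc, h, mul_inv_cancel_right]

/-- The corner `(q.1, p.2)` lies between `p` and `q` in the product order, whichever of the two is
smaller, so the three vertices span a face. -/
theorem IsFlat.diagonal (hG : (A.prod B).IsFlat G) {p q : U × T}
    (h : {p, q} ∈ (A.prod B).faces) : G p q = G p (q.1, p.2) * G (q.1, p.2) q := by
  have h1 := edge_fst_mem h
  have h2 := edge_snd_mem h
  rw [hG]
  rcases edge_le_total h with hpq | hqp
  · exact mem_prod_of_le ⟨hpq.1, le_rfl⟩ ⟨le_rfl, hpq.2⟩ (by simpa using h1) (by simpa using h2)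
  · have := mem_prod_of_le (A := A) (B := B) (p := q) (q := (q.1, p.2)) (r := p) ⟨le_rfl, hqp.2⟩
      ⟨hqp.1, le_rfl⟩ (by simpa using edge_symm h1) (by simpa using edge_symm h2)
    have e : ({p, (q.1, p.2), q} : Finset (U × T)) = {q, (q.1, p.2), p} := by ext; simp; tauto
    rwa [e]

end Product

/-! ### Products with a circle -/

section Circle

theorem standardCycle_vert (b : ℕ) (hb : 3 ≤ b) (i : ℕ) : (standardCycle b hb).vert i = i % b := rfl

theorem standardCycle_lt {b : ℕ} {hb : 3 ≤ b} {s : Finset ℕ}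
    (hs : s ∈ (standardCycle b hb).toComplex.faces) {i : ℕ} (hi : i ∈ s) : i < b := by
  obtain ⟨-, j, hj⟩ := hs
  have := hj hi
  simp only [standardCycle_vert, Finset.mem_insert, Finset.mem_singleton] at this
  rcases this with rfl | rfl <;> exact Nat.mod_lt _ (by omega)

theorem standardCycle_singleton_mem {b : ℕ} (hb : 3 ≤ b) {i : ℕ} (hi : i < b) :
    {i} ∈ (standardCycle b hb).toComplex.faces :=
  ⟨by simp, i, by simp [standardCycle_vert, Nat.mod_eq_of_lt hi]⟩

/-- The edges of the standard circle. -/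
theorem standardCycle_subset {b : ℕ} {hb : 3 ≤ b} {s : Finset ℕ}
    (hs : s ∈ (standardCycle b hb).toComplex.faces) :
    (∃ i, i + 1 < b ∧ s ⊆ {i, i + 1}) ∨ s ⊆ {b - 1, 0} := by
  obtain ⟨-, j, hj⟩ := hs
  simp only [standardCycle_vert] at hj
  have hlt : j % b < b := Nat.mod_lt _ (by omega)
  by_cases h : j % b + 1 < b
  · left
    refine ⟨j % b, h, ?_⟩
    have : (j + 1) % b = j % b + 1 := by
      rw [Nat.add_mod, Nat.mod_eq_of_lt (by omega : 1 < b), Nat.mod_eq_of_lt h]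
    rwa [this] at hj
  · right
    have h1 : j % b = b - 1 := by omega
    have : (j + 1) % b = 0 := by
      rw [Nat.add_mod, Nat.mod_eq_of_lt (by omega : 1 < b), h1]
      have : b - 1 + 1 = b := by omega
      rw [this, Nat.mod_self]
    rwa [this, h1] at hj

/-- The number of times that an edge of the standard circle passes from the last to the first
vertex. -/
def wrap (b i j : ℕ) : ℤ :=
  if i = b - 1 ∧ j = 0 then 1 else if i = 0 ∧ j = b - 1 then -1 else 0

/-- So `wrap` is an integral cocycle on the circle, of degree one by `sum_wrap`. A face lies in a
single edge: either `wrap` vanishes there, or the edge joins `b - 1` to `0` and all cases can be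
listed. -/
theorem wrap_add {b : ℕ} {hb : 3 ≤ b} {i j k : ℕ}
    (h : {i, j, k} ∈ (standardCycle b hb).toComplex.faces) : wrap b i j + wrap b j k = wrap b i k := by
  rcases standardCycle_subset h with ⟨l, hl, hs⟩ | hs
  · have hi := hs (by simp : i ∈ _)
    have hj := hs (by simp : j ∈ _)
    have hk := hs (by simp : k ∈ _)
    simp only [Finset.mem_insert, Finset.mem_singleton] at hi hj hk
    have h0 : ∀ x y, (x = l ∨ x = l + 1) → (y = l ∨ y = l + 1) → wrap b x y = 0 := by
      intro x y hx hy
      rw [wrap, if_neg (by omega), if_neg (by omega)]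
    rw [h0 _ _ hi hj, h0 _ _ hj hk, h0 _ _ hi hk, add_zero]
  · have hi := hs (by simp : i ∈ _)
    have hj := hs (by simp : j ∈ _)
    have hk := hs (by simp : k ∈ _)
    simp only [Finset.mem_insert, Finset.mem_singleton] at hi hj hk
    have e1 : wrap b (b - 1) (b - 1) = 0 := by rw [wrap, if_neg (by omega), if_neg (by omega)]
    have e2 : wrap b 0 0 = 0 := by rw [wrap, if_neg (by omega), if_neg (by omega)]
    have e3 : wrap b (b - 1) 0 = 1 := by rw [wrap, if_pos (by omega)]
    have e4 : wrap b 0 (b - 1) = -1 := by rw [wrap, if_neg (by omega), if_pos (by omega)]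
    rcases hi with rfl | rfl <;> rcases hj with rfl | rfl <;> rcases hk with rfl | rfl <;>
      simp only [e1, e2, e3, e4] <;> rfl

variable {U : Type*} [LinearOrder U] {A : PreAbstractSimplicialComplex U} {b : ℕ} {hb : 3 ≤ b}
  {Γ : Type*} [Group Γ] {G : U × ℕ → U × ℕ → Γ}

/-- The holonomy along the fibre over `w` from the vertex number `0` to the vertex number `k`. -/
def fibreHol (b : ℕ) (G : U × ℕ → U × ℕ → Γ) (w : U) (k : ℕ) : Γ :=
  seqHol G (fun i => (w, i % b)) k

local notation "S¹" => SimpleCycle.toComplex (standardCycle b hb)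

/-- Stacking `k` commuting squares pushes a horizontal edge along the fibre. Once around, for `k =
b`, this says that the fibre commutes with horizontal edges (`fibreHol_comm`). -/
theorem fibreHol_intertwine (hG : (A.prod S¹).IsFlat G) {w w' : U} (hw : {w, w'} ∈ A.faces)
    (k : ℕ) : G (w, 0) (w', 0) * fibreHol b G w' k =
      fibreHol b G w k * G (w, k % b) (w', k % b) := by
  induction k with
  | zero => simp [fibreHol, seqHol]
  | succ k ih =>
    have h := hG.square hw ((standardCycle b hb).edge_mem k)
    rw [standardCycle_vert, standardCycle_vert] at h
    simp only [fibreHol, seqHol] at ih ⊢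
    rw [← mul_assoc, ih, mul_assoc, h, mul_assoc]

theorem fibreHol_comm (hG : (A.prod S¹).IsFlat G) {w w' : U} (hw : {w, w'} ∈ A.faces) :
    G (w, 0) (w', 0) * fibreHol b G w' b = fibreHol b G w b * G (w, 0) (w', 0) := by
  simpa using fibreHol_intertwine hG hw b

/-- In frames transported along the fibre from height `0`, all vertical edges are trivial except the
closing one from `b - 1` to `0`, which carries the whole holonomy. -/
theorem vertical_eq (hG : (A.prod S¹).IsFlat G) {w : U} (hw : {w} ∈ A.faces) {i j : ℕ}
    (hij : {i, j} ∈ (S¹).faces) :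
    G (w, i) (w, j) = (fibreHol b G w i)⁻¹ * fibreHol b G w b ^ wrap b i j * fibreHol b G w j := by
  have hmem : ∀ {i j}, {i, j} ∈ (S¹).faces → {(w, i), (w, j)} ∈ (A.prod S¹).faces :=
    fun h => vertical_mem hw h
  have hself : ∀ i, i < b → G (w, i) (w, i) = 1 := fun i hi =>
    hG.self (by
      have := hmem (i := i) (j := i) (by simpa using standardCycle_singleton_mem hb hi)
      simpa using this)
  have hsucc : ∀ i, i + 1 < b → fibreHol b G w (i + 1) = fibreHol b G w i * G (w, i) (w, i + 1) := by
    intro i hi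
    change fibreHol b G w i * G (w, i % b) (w, (i + 1) % b) = _
    rw [Nat.mod_eq_of_lt (by omega), Nat.mod_eq_of_lt hi]
  have hlast : fibreHol b G w b = fibreHol b G w (b - 1) * G (w, b - 1) (w, 0) := by
    obtain ⟨c, rfl⟩ : ∃ c, b = c + 1 := ⟨b - 1, by omega⟩
    change fibreHol (c + 1) G w c * G (w, c % (c + 1)) (w, (c + 1) % (c + 1)) = _
    rw [Nat.mod_eq_of_lt (by omega), Nat.mod_self, Nat.add_sub_cancel]
  have hzero : fibreHol b G w 0 = 1 := rfl
  rcases standardCycle_subset hij with ⟨l, hl, hs⟩ | hs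
  · have hi := hs (by simp : i ∈ _)
    have hj := hs (by simp : j ∈ _)
    simp only [Finset.mem_insert, Finset.mem_singleton] at hi hj
    have h0 : wrap b i j = 0 := by rw [wrap, if_neg (by omega), if_neg (by omega)]
    rw [h0, zpow_zero, mul_one]
    rcases hi with rfl | rfl <;> rcases hj with rfl | rfl
    · rw [hself _ (by omega), inv_mul_cancel]
    · rw [hsucc _ hl, inv_mul_cancel_left]
    · rw [hsucc _ hl, mul_inv_rev, inv_mul_cancel_right, hG.symm (hmem (edge_symm hij))]
    · rw [hself _ (by omega), inv_mul_cancel]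
  · have hi := hs (by simp : i ∈ _)
    have hj := hs (by simp : j ∈ _)
    simp only [Finset.mem_insert, Finset.mem_singleton] at hi hj
    rcases hi with rfl | rfl <;> rcases hj with rfl | rfl
    · rw [wrap, if_neg (by omega), if_neg (by omega), hself _ (by omega)]
      group
    · rw [wrap, if_pos (by omega), zpow_one, hlast, hzero]
      group
    · rw [wrap, if_neg (by omega), if_pos (by omega), hG.symm (hmem (edge_symm hij)), hlast, hzero]
      group
    · rw [wrap, if_neg (by omega), if_neg (by omega), hself _ (by omega)]
      group

/-- Normal form of a flat transport on the product of a complex with a circle. -/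
theorem IsFlat.normal_form (hG : (A.prod S¹).IsFlat G) {p q : U × ℕ}
    (h : {p, q} ∈ (A.prod S¹).faces) :
    G p q = (fibreHol b G p.1 p.2)⁻¹ * G (p.1, 0) (q.1, 0) *
      fibreHol b G q.1 b ^ wrap b p.2 q.2 * fibreHol b G q.1 q.2 := by
  have h1 := edge_fst_mem h
  have h2 := edge_snd_mem h
  have hlt : p.2 < b := standardCycle_lt h2 (by simp)
  have h3 := fibreHol_intertwine hG h1 p.2
  rw [Nat.mod_eq_of_lt hlt] at h3
  have e : G p (q.1, p.2) =
      (fibreHol b G p.1 p.2)⁻¹ * (G (p.1, 0) (q.1, 0) * fibreHol b G q.1 p.2) := by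
    rw [h3, inv_mul_cancel_left]
  rw [hG.diagonal h, vertical_eq hG (right_mem_of_edge h1) h2, e]
  group

/-- The holonomy of the fibre through a vertex. -/
def fibreLoop (b : ℕ) (G : U × ℕ → U × ℕ → Γ) (p : U × ℕ) : Γ :=
  (fibreHol b G p.1 p.2)⁻¹ * fibreHol b G p.1 b * fibreHol b G p.1 p.2

/-- This is the centrality of the fibre: the fibre holonomy is parallel under conjugation. It is the
reason why diagonalizing the fibres diagonalizes the transport on all of `Y`. -/
theorem IsFlat.fibreLoop_comm (hG : (A.prod S¹).IsFlat G) {p q : U × ℕ}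
    (h : {p, q} ∈ (A.prod S¹).faces) : G p q * fibreLoop b G q = fibreLoop b G p * G p q := by
  have h1 := fibreHol_comm hG (edge_fst_mem h)
  rw [hG.normal_form h, fibreLoop, fibreLoop]
  calc _ = (fibreHol b G p.1 p.2)⁻¹ * (G (p.1, 0) (q.1, 0) * fibreHol b G q.1 b) *
        fibreHol b G q.1 b ^ wrap b p.2 q.2 * fibreHol b G q.1 q.2 := by group
    _ = _ := by rw [h1]; group

/-- If the holonomy of each fibre has a unique fixed point, then the fixed points form a parallel
section. -/
theorem IsFlat.exists_fibre_section {X : Type*} [MulAction Γ X] (hG : (A.prod S¹).IsFlat G)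
    {x : U → X} (hx : ∀ w, {w} ∈ A.faces → fibreHol b G w b • x w = x w)
    (huniq : ∀ w y, {w} ∈ A.faces → fibreHol b G w b • y = y → y = x w) :
    ∃ s : U × ℕ → X, ∀ p q, {p, q} ∈ (A.prod S¹).faces → G p q • s q = s p := by
  refine ⟨fun p => (fibreHol b G p.1 p.2)⁻¹ • x p.1, fun p q h => ?_⟩
  have h1 := edge_fst_mem h
  rw [hG.normal_form h, ← mul_smul, mul_inv_cancel_right, mul_smul, mul_smul]
  have hz : ∀ k : ℤ, fibreHol b G q.1 b ^ k • x q.1 = x q.1 := by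
    intro k
    have hfix : fibreHol b G q.1 b ∈ MulAction.stabilizer Γ (x q.1) := hx _ (right_mem_of_edge h1)
    exact Subgroup.zpow_mem _ hfix k
  rw [hz]
  congr 1
  -- The point transported from the fibre over `q.1` is fixed by the fibre over `p.1`, as the
  -- horizontal edge intertwines the two holonomies; uniqueness identifies it.
  refine huniq _ _ (left_mem_of_edge h1) ?_
  rw [← mul_smul, ← fibreHol_comm hG h1, mul_smul, hx _ (right_mem_of_edge h1)]

end Circle

end PreAbstractSimplicialComplex

end

noncomputable section

namespace PreAbstractSimplicialComplex

variable {V : Type*} [DecidableEq V] {K : PreAbstractSimplicialComplex V}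

/-! ### Links and cofaces -/

/-- Edge paths may contain constant steps; discarding them allows the step hypothesis to assume
distinct end points. -/
theorem IsConnected.induction (hK : K.IsConnected) {P : V → Prop}
    (hstep : ∀ u v, {u, v} ∈ K.faces → u ≠ v → P u → P v) {u v : V} (hu : {u} ∈ K.faces)
    (hv : {v} ∈ K.faces) (h : P u) : P v := by
  obtain ⟨p⟩ := hK.2 u v hu hv
  induction p with
  | nil u => exact h
  | @cons u w v e p ih =>
    by_cases huw : u = w
    · subst huw; exact ih hu hv h
    · exact ih (right_mem_of_edge e) hv (hstep _ _ e huw h)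

/-- The vertices that span a face together with `t`. -/
def cofaces (K : PreAbstractSimplicialComplex V) (t : Finset V) : Set V :=
  {u | u ∉ t ∧ insert u t ∈ K.faces}

theorem ncard_cofaces (t : Finset V) :
    {r | r ∈ K.faces ∧ t ⊆ r ∧ r.card = t.card + 1}.ncard = (K.cofaces t).ncard := by
  have : {r | r ∈ K.faces ∧ t ⊆ r ∧ r.card = t.card + 1} =
      (fun u => insert u t) '' K.cofaces t := by
    ext r
    constructor
    · rintro ⟨hr, htr, hc⟩
      have h1 : (r \ t).card = 1 := by rw [Finset.card_sdiff_of_subset htr, hc]; omega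
      obtain ⟨u, hu⟩ := Finset.card_eq_one.1 h1
      have hur : u ∈ r \ t := hu ▸ Finset.mem_singleton_self u
      have e : insert u t = r := by
        rw [Finset.insert_eq, ← hu, Finset.sdiff_union_of_subset htr]
      exact ⟨u, ⟨(Finset.mem_sdiff.1 hur).2, e ▸ hr⟩, e⟩
    · rintro ⟨u, ⟨hu, hK⟩, rfl⟩
      exact ⟨hK, Finset.subset_insert _ _, Finset.card_insert_of_notMem hu⟩
  rw [this]
  refine Set.InjOn.ncard_image ?_
  intro u hu v hv h
  have : u ∈ insert v t := by
    have h' : insert u t = insert v t := h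
    rw [← h']; exact Finset.mem_insert_self _ _
  exact (Finset.mem_insert.1 this).resolve_right hu.1

theorem mem_link {v : V} {s : Finset V} :
    s ∈ (K.link v).faces ↔ s.Nonempty ∧ v ∉ s ∧ insert v s ∈ K.faces := Iff.rfl

theorem mem_link_link {v w : V} {s : Finset V} : s ∈ ((K.link v).link w).faces ↔
    s.Nonempty ∧ w ∉ s ∧ v ∉ s ∧ v ≠ w ∧ insert v (insert w s) ∈ K.faces := by
  rw [mem_link, mem_link]
  simp only [Finset.mem_insert, not_or, Finset.insert_nonempty, true_and]
  tauto

theorem erase_mem_link {s : Finset V} (hs : s ∈ K.faces) {v : V} (hv : v ∈ s) (h : 2 ≤ s.card) :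
    s.erase v ∈ (K.link v).faces :=
  ⟨Finset.card_pos.1 (by rw [Finset.card_erase_of_mem hv]; omega), Finset.notMem_erase v s, by
    rwa [Finset.insert_erase hv]⟩

theorem degree_link {v a : V} (hva : v ≠ a) :
    (K.link v).degree a = (K.cofaces {v, a}).ncard := by
  rw [degree]
  congr 1
  ext u
  have e : (insert u {v, a} : Finset V) = insert v {u, a} := by ext; simp; tauto
  simp only [cofaces, Set.mem_ofPred_eq, mem_link, e]
  simp
  tauto

theorem degree_link_link {v w a : V} (hvw : v ≠ w) (hva : v ≠ a) (hwa : w ≠ a) :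
    ((K.link v).link w).degree a = (K.cofaces {v, w, a}).ncard := by
  rw [degree]
  congr 1
  ext u
  have e : (insert u {v, w, a} : Finset V) = insert v (insert w {u, a}) := by ext; simp; tauto
  simp only [cofaces, Set.mem_ofPred_eq, mem_link_link, e]
  simp
  tauto

/-- A triangulated circle or compact interval. -/
structure IsLinear (L : PreAbstractSimplicialComplex V) : Prop where
  connected : L.IsConnected
  dim_le : ∀ s ∈ L.faces, s.card ≤ 2
  degree_eq : ∀ v, {v} ∈ L.faces → L.degree v = 1 ∨ L.degree v = 2

theorem IsCircle.isLinear (h : K.IsCircle) : K.IsLinear :=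
  ⟨h.connected, h.dim_le, fun v hv => Or.inr (h.degree_eq v hv)⟩

theorem IsArc.isLinear (h : K.IsArc) : K.IsLinear := ⟨h.connected, h.dim_le, h.degree_eq⟩

theorem IsLinear.exists_edge (h : K.IsLinear) {v : V} (hv : {v} ∈ K.faces) :
    ∃ u, u ≠ v ∧ {u, v} ∈ K.faces := by
  have : {u | u ≠ v ∧ {u, v} ∈ K.faces}.Nonempty := by
    refine Set.nonempty_of_ncard_ne_zero ?_
    have := h.degree_eq v hv
    rw [degree] at this
    omega
  exact this

theorem IsTwoSphere.link_linear (h : K.IsTwoSphere) {v : V} (hv : {v} ∈ K.faces) :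
    (K.link v).IsLinear := (h.link_vertex v hv).isLinear

theorem IsSurface.link_linear (h : K.IsSurface) {v : V} (hv : {v} ∈ K.faces) :
    (K.link v).IsLinear :=
  (h.link_vertex v hv).elim IsCircle.isLinear IsArc.isLinear

/-! ### Cofaces and chains of adjacent triangles in surfaces. -/

namespace IsSurface

variable (hK : K.IsSurface)
include hK

theorem card_le {s : Finset V} (hs : s ∈ K.faces) : s.card ≤ 3 := by
  by_contra hc
  obtain ⟨v, hv⟩ := K.face_nonempty hs
  have h1 := (hK.link_linear (K.face_mono hs (by simpa using hv) (by simp))).dim_le _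
    (erase_mem_link hs hv (by omega))
  rw [Finset.card_erase_of_mem hv] at h1
  omega

theorem ncard_cofaces {t : Finset V} (ht : t ∈ K.faces) (hc : t.card = 2) :
    (K.cofaces t).ncard = 1 ∨ (K.cofaces t).ncard = 2 := by
  obtain ⟨v, a, hva, rfl⟩ := Finset.card_eq_two.1 hc
  rw [← degree_link hva]
  refine (hK.link_linear (left_mem_of_edge ht)).degree_eq a ?_
  exact ⟨by simp, by simpa using hva, ht⟩

/-- In a connected surface, a property of triangles that passes to adjacent triangles holds for
all triangles. -/
theorem induction (hconn : K.IsConnected) {S : Finset V → Prop}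
    (hadj : ∀ t σ σ', t ∈ K.faces → t.card = 2 → σ ∈ K.faces → σ.card = 3 → σ' ∈ K.faces →
      σ'.card = 3 → t ⊆ σ → t ⊆ σ' → S σ → S σ')
    {σ : Finset V} (hσ : σ ∈ K.faces) (hσ3 : σ.card = 3) (h : S σ) {σ' : Finset V}
    (hσ' : σ' ∈ K.faces) (hσ'3 : σ'.card = 3) : S σ' := by
  -- Around a vertex `v`: the triangles at `v` are the edges of its link, which is connected.
  have hvert : ∀ v σ σ', σ ∈ K.faces → σ.card = 3 → v ∈ σ → σ' ∈ K.faces → σ'.card = 3 →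
      v ∈ σ' → S σ → S σ' := by
    intro v σ σ' hσ hσ3 hvσ hσ' hσ'3 hvσ' h
    have hv : {v} ∈ K.faces := K.face_mono hσ (by simpa using hvσ) (by simp)
    let P : V → Prop := fun w => ∀ τ ∈ K.faces, τ.card = 3 → {v, w} ⊆ τ → S τ
    obtain ⟨w, hw, hwv⟩ := Finset.exists_mem_ne (by omega : 1 < σ.card) v
    obtain ⟨w', hw', hwv'⟩ := Finset.exists_mem_ne (by omega : 1 < σ'.card) v
    have hmem : ∀ {σ w}, σ ∈ K.faces → v ∈ σ → w ∈ σ → {v, w} ∈ K.faces := fun hσ hv hw =>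
      K.face_mono hσ (by intro x; simp; rintro (rfl | rfl) <;> assumption) (by simp)
    have hmem' : ∀ {σ w}, σ ∈ K.faces → v ∈ σ → w ∈ σ → w ≠ v → {w} ∈ (K.link v).faces :=
      fun hσ hv hw hne => ⟨by simp, by simpa using hne.symm, hmem hσ hv hw⟩
    have hP : P w := by
      intro τ hτ hτ3 hsub
      refine hadj {v, w} σ τ (hmem hσ hvσ hw) (Finset.card_pair hwv.symm) hσ hσ3 hτ hτ3 ?_ hsub h
      intro x; simp; rintro (rfl | rfl) <;> assumption
    have hP' : P w' := by
      refine (hK.link_linear hv).connected.induction (fun a a' haa hne hPa => ?_)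
        (hmem' hσ hvσ hw hwv) (hmem' hσ' hvσ' hw' hwv') hP
      obtain ⟨-, hva, htri⟩ := haa
      simp only [Finset.mem_insert, Finset.mem_singleton, not_or] at hva
      have hcard : ({v, a, a'} : Finset V).card = 3 := Finset.card_eq_three.2
        ⟨v, a, a', hva.1, hva.2, hne, rfl⟩
      have hS := hPa {v, a, a'} htri hcard (by intro x; simp; tauto)
      intro τ hτ hτ3 hsub
      refine hadj {v, a'} {v, a, a'} τ (K.face_mono hτ hsub (by simp)) (Finset.card_pair hva.2)
        htri hcard hτ hτ3 (by intro x; simp; tauto) hsub hS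
    exact hP' σ' hσ' hσ'3 (by intro x; simp; rintro (rfl | rfl) <;> assumption)
  -- From vertex to vertex: every edge of `K` lies in a triangle, which is shared by the stars of
  -- its two ends.
  let P : V → Prop := fun v => ∀ τ ∈ K.faces, τ.card = 3 → v ∈ τ → S τ
  obtain ⟨v, hv⟩ := K.face_nonempty hσ
  obtain ⟨v', hv'⟩ := K.face_nonempty hσ'
  have hP : P v := fun τ hτ hτ3 hvτ => hvert v σ τ hσ hσ3 hv hτ hτ3 hvτ h
  have hP' : P v' := by
    refine hconn.induction (fun a a' haa hne hPa => ?_) (K.face_mono hσ (by simpa using hv)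
      (by simp)) (K.face_mono hσ' (by simpa using hv') (by simp)) hP
    obtain ⟨c, hc, hcmem⟩ := (hK.link_linear (left_mem_of_edge haa)).exists_edge
      (v := a') ⟨by simp, by simpa using hne, haa⟩
    obtain ⟨-, hva, htri⟩ := hcmem
    simp only [Finset.mem_insert, Finset.mem_singleton, not_or] at hva
    have hcard : ({a, c, a'} : Finset V).card = 3 := Finset.card_eq_three.2
      ⟨a, c, a', hva.1, hva.2, hc, rfl⟩
    have hS := hPa {a, c, a'} htri hcard (by simp)
    exact fun τ hτ hτ3 hvτ => hvert a' {a, c, a'} τ htri hcard (by simp) hτ hτ3 hvτ hS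
  exact hP' σ' hσ' hσ'3 hv'

end IsSurface

/-! ### Cofaces, chains of adjacent tetrahedra and boundary vertices in 3-manifolds. -/

namespace IsThreeManifold

variable (hK : K.IsThreeManifold)
include hK

theorem link_link_linear {v w : V} (hvw : {v, w} ∈ K.faces) (hne : v ≠ w) :
    ((K.link v).link w).IsLinear := by
  have hw : {w} ∈ (K.link v).faces := ⟨by simp, by simpa using hne, hvw⟩
  rcases hK.link_vertex v (left_mem_of_edge hvw) with h | h
  · exact h.link_linear hw
  · exact h.surface.link_linear hw

theorem card_le {s : Finset V} (hs : s ∈ K.faces) : s.card ≤ 4 := by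
  by_contra hc
  obtain ⟨v, w, hv, hw, hvw⟩ := Finset.one_lt_card_iff.1 (by omega : 1 < s.card)
  have hvw' : {v, w} ∈ K.faces :=
    K.face_mono hs (by intro x; simp; rintro (rfl | rfl) <;> assumption) (by simp)
  have hw' : w ∈ s.erase v := Finset.mem_erase.2 ⟨hvw.symm, hw⟩
  have h0 := erase_mem_link hs hv (by omega)
  have h1 := (hK.link_link_linear hvw' hvw).dim_le _ (erase_mem_link h0 hw' (by
    rw [Finset.card_erase_of_mem hv]; omega))
  rw [Finset.card_erase_of_mem hw', Finset.card_erase_of_mem hv] at h1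
  omega

theorem ncard_cofaces {t : Finset V} (ht : t ∈ K.faces) (hc : t.card = 3) :
    (K.cofaces t).ncard = 1 ∨ (K.cofaces t).ncard = 2 := by
  obtain ⟨v, w, a, hvw, hva, hwa, rfl⟩ := Finset.card_eq_three.1 hc
  rw [← degree_link_link hvw hva hwa]
  refine (hK.link_link_linear (K.face_mono ht (by intro x; simp; tauto) (by simp))
    hvw).degree_eq a ?_
  rw [mem_link_link]
  exact ⟨by simp, by simpa using hwa, by simpa using hva, hvw, ht⟩

/-- In a connected 3-manifold, a property of tetrahedra that passes to adjacent tetrahedra holds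
for all tetrahedra. -/
theorem induction (hconn : K.IsConnected) {S : Finset V → Prop}
    (hadj : ∀ t σ σ', t ∈ K.faces → t.card = 3 → σ ∈ K.faces → σ.card = 4 → σ' ∈ K.faces →
      σ'.card = 4 → t ⊆ σ → t ⊆ σ' → S σ → S σ')
    {σ : Finset V} (hσ : σ ∈ K.faces) (hσ4 : σ.card = 4) (h : S σ) {σ' : Finset V}
    (hσ' : σ' ∈ K.faces) (hσ'4 : σ'.card = 4) : S σ' := by
  -- Around an edge: the tetrahedra containing it are the edges of its link, a connected graph.
  have hedge : ∀ v w, v ≠ w → ∀ σ σ', σ ∈ K.faces → σ.card = 4 → v ∈ σ → w ∈ σ → σ' ∈ K.faces →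
      σ'.card = 4 → v ∈ σ' → w ∈ σ' → S σ → S σ' := by
    intro v w hvw σ σ' hσ hσ4 hvσ hwσ hσ' hσ'4 hvσ' hwσ' h
    have hex : ∀ σ : Finset V, σ.card = 4 → v ∈ σ → w ∈ σ → ∃ a ∈ σ, v ≠ a ∧ w ≠ a := by
      intro σ hσ4 hv hw
      have : ({v, w} : Finset V).card < σ.card := by rw [Finset.card_pair hvw]; omega
      obtain ⟨a, ha, hna⟩ := Finset.exists_mem_notMem_of_card_lt_card this
      simp only [Finset.mem_insert, Finset.mem_singleton, not_or] at hna
      exact ⟨a, ha, Ne.symm hna.1, Ne.symm hna.2⟩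
    obtain ⟨a, ha, hva, hwa⟩ := hex σ hσ4 hvσ hwσ
    obtain ⟨a', ha', hva', hwa'⟩ := hex σ' hσ'4 hvσ' hwσ'
    let P : V → Prop := fun a => ∀ τ ∈ K.faces, τ.card = 4 → {v, w, a} ⊆ τ → S τ
    have hsub : ∀ {σ : Finset V} {a}, v ∈ σ → w ∈ σ → a ∈ σ → {v, w, a} ⊆ σ := by
      intro σ a hv hw ha x
      simp
      rintro (rfl | rfl | rfl) <;> assumption
    have hP : P a := by
      intro τ hτ hτ4 hs
      exact hadj {v, w, a} σ τ (K.face_mono hτ hs (by simp))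
        (Finset.card_eq_three.2 ⟨v, w, a, hvw, hva, hwa, rfl⟩) hσ hσ4 hτ hτ4
        (hsub hvσ hwσ ha) hs h
    have hmem : ∀ {σ a}, σ ∈ K.faces → v ∈ σ → w ∈ σ → a ∈ σ → v ≠ a → w ≠ a →
        {a} ∈ ((K.link v).link w).faces := by
      intro σ a hσ hv hw ha hva hwa
      rw [mem_link_link]
      exact ⟨by simp, by simpa using hwa, by simpa using hva, hvw,
        K.face_mono hσ (hsub hv hw ha) (by simp)⟩
    have hvw' : {v, w} ∈ K.faces :=
      K.face_mono hσ (by intro x; simp; rintro (rfl | rfl) <;> assumption) (by simp)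
    have hP' : P a' := by
      refine (hK.link_link_linear hvw' hvw).connected.induction (fun c c' hcc hne hPc => ?_)
        (hmem hσ hvσ hwσ ha hva hwa) (hmem hσ' hvσ' hwσ' ha' hva' hwa') hP
      rw [mem_link_link] at hcc
      obtain ⟨-, hwc, hvc, -, htet⟩ := hcc
      simp only [Finset.mem_insert, Finset.mem_singleton, not_or] at hwc hvc
      have hcard : ({v, w, c, c'} : Finset V).card = 4 := Finset.card_eq_succ.2
        ⟨v, {w, c, c'}, by simp [hvw, hvc], rfl,
          Finset.card_eq_three.2 ⟨w, c, c', hwc.1, hwc.2, hne, rfl⟩⟩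
      have hS := hPc _ htet hcard (by intro x; simp; tauto)
      intro τ hτ hτ4 hs
      exact hadj {v, w, c'} {v, w, c, c'} τ (K.face_mono hτ hs (by simp))
        (Finset.card_eq_three.2 ⟨v, w, c', hvw, hvc.2, hwc.2, rfl⟩) htet hcard hτ hτ4
        (by intro x; simp; tauto) hs hS
    exact hP' σ' hσ' hσ'4 (hsub hvσ' hwσ' ha')
  have htet : ∀ v w w', {v, w} ∈ K.faces → v ≠ w → {w'} ∈ ((K.link v).link w).faces →
      ∃ τ ∈ K.faces, τ.card = 4 ∧ {v, w, w'} ⊆ τ := by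
    intro v w w' hvw hne hw'
    obtain ⟨a, ha, hmem⟩ := (hK.link_link_linear hvw hne).exists_edge hw'
    rw [mem_link_link] at hmem
    obtain ⟨-, hwc, hvc, -, htet⟩ := hmem
    simp only [Finset.mem_insert, Finset.mem_singleton, not_or] at hwc hvc
    refine ⟨{v, w, a, w'}, htet, Finset.card_eq_succ.2 ⟨v, {w, a, w'}, by simp [hne, hvc], rfl,
      Finset.card_eq_three.2 ⟨w, a, w', hwc.1, hwc.2, ha, rfl⟩⟩, by intro x; simp; tauto⟩
  have hlink : ∀ v, {v} ∈ K.faces → (K.link v).IsConnected := by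
    intro v hv
    rcases hK.link_vertex v hv with h | h
    · exact h.connected
    · exact h.connected
  -- Around a vertex: walk in its connected link. Each step gives a triangle at `v`, which lies in a
  -- tetrahedron, and `hedge` turns around the edges.
  have hvert : ∀ v σ σ', σ ∈ K.faces → σ.card = 4 → v ∈ σ → σ' ∈ K.faces → σ'.card = 4 →
      v ∈ σ' → S σ → S σ' := by
    intro v σ σ' hσ hσ4 hvσ hσ' hσ'4 hvσ' h
    have hv : {v} ∈ K.faces := K.face_mono hσ (by simpa using hvσ) (by simp)
    let P : V → Prop := fun w => ∀ τ ∈ K.faces, τ.card = 4 → v ∈ τ → w ∈ τ → S τ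
    obtain ⟨w, hw, hwv⟩ := Finset.exists_mem_ne (by omega : 1 < σ.card) v
    obtain ⟨w', hw', hwv'⟩ := Finset.exists_mem_ne (by omega : 1 < σ'.card) v
    have hmem' : ∀ {σ w}, σ ∈ K.faces → v ∈ σ → w ∈ σ → w ≠ v → {w} ∈ (K.link v).faces :=
      fun hσ hv hw hne => ⟨by simp, by simpa using hne.symm, K.face_mono hσ
        (by intro x; simp; rintro (rfl | rfl) <;> assumption) (by simp)⟩
    have hP : P w := fun τ hτ hτ4 hvτ hwτ =>
      hedge v w hwv.symm σ τ hσ hσ4 hvσ hw hτ hτ4 hvτ hwτ h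
    have hP' : P w' := by
      refine (hlink v hv).induction (fun a a' haa hne hPa => ?_)
        (hmem' hσ hvσ hw hwv) (hmem' hσ' hvσ' hw' hwv') hP
      obtain ⟨-, hva, htri⟩ := haa
      simp only [Finset.mem_insert, Finset.mem_singleton, not_or] at hva
      obtain ⟨τ, hτ, hτ4, hsub⟩ := htet v a a' (K.face_mono htri (by intro x; simp; tauto)
        (by simp)) hva.1 (by
          rw [mem_link_link]
          exact ⟨by simp, by simpa using hne, by simpa using hva.2, hva.1, htri⟩)
      have hvτ := hsub (by simp : v ∈ _)
      have haτ := hsub (by simp : a ∈ _)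
      have ha'τ := hsub (by simp : a' ∈ _)
      have hS := hPa τ hτ hτ4 hvτ haτ
      exact fun τ' hτ' hτ'4 hv' ha' => hedge v a' hva.2 τ τ' hτ hτ4 hvτ ha'τ hτ' hτ'4 hv' ha' hS
    exact hP' σ' hσ' hσ'4 hvσ' hw'
  -- From vertex to vertex along the edges of `K`, each of which lies in a tetrahedron.
  let P : V → Prop := fun v => ∀ τ ∈ K.faces, τ.card = 4 → v ∈ τ → S τ
  obtain ⟨v, hv⟩ := K.face_nonempty hσ
  obtain ⟨v', hv'⟩ := K.face_nonempty hσ'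
  have hP : P v := fun τ hτ hτ4 hvτ => hvert v σ τ hσ hσ4 hv hτ hτ4 hvτ h
  have hP' : P v' := by
    refine hconn.induction (fun a a' haa hne hPa => ?_) (K.face_mono hσ (by simpa using hv)
      (by simp)) (K.face_mono hσ' (by simpa using hv') (by simp)) hP
    obtain ⟨c, hc⟩ := (hK.link_link_linear haa hne).connected.1
    obtain ⟨τ, hτ, hτ4, hsub⟩ := htet a a' c haa hne hc
    have hS := hPa τ hτ hτ4 (hsub (by simp))
    exact fun τ' hτ' hτ'4 ha' => hvert a' τ τ' hτ hτ4 (hsub (by simp)) hτ' hτ'4 ha' hS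
  exact hP' σ' hσ' hσ'4 hv'

/-- The boundary vertices are those whose link is a disc. -/
theorem singleton_mem_boundary_iff {v : V} (hv : {v} ∈ K.faces) :
    {v} ∈ (K.boundary 3).faces ↔ (K.link v).IsTwoDisc := by
  constructor
  · rintro ⟨-, t, ht, hvt, htc, hcard⟩
    refine (hK.link_vertex v hv).resolve_left fun hs => ?_
    rw [Finset.singleton_subset_iff] at hvt
    have h2 : (t.erase v).card = 2 := by rw [Finset.card_erase_of_mem hvt, htc]
    obtain ⟨w, a, hwa, he⟩ := Finset.card_eq_two.1 h2
    have hte : t = {v, w, a} := by rw [← he, Finset.insert_erase hvt]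
    have hvw : v ≠ w := by
      rintro rfl
      have := Finset.notMem_erase v t
      rw [he] at this
      simp at this
    have hva : v ≠ a := by
      rintro rfl
      have := Finset.notMem_erase v t
      rw [he] at this
      simp at this
    rw [← htc, PreAbstractSimplicialComplex.ncard_cofaces, hte, ← degree_link_link hvw hva hwa]
      at hcard
    have hw : {w} ∈ (K.link v).faces := ⟨by simp, by simpa using hvw,
      K.face_mono ht (by rw [hte]; intro x; simp; tauto) (by simp)⟩
    have := (hs.link_vertex w hw).degree_eq a (by
      rw [mem_link_link]
      exact ⟨by simp, by simpa using hwa, by simpa using hva, hvw, hte ▸ ht⟩)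
    omega
  · intro hd
    -- A boundary vertex `w` of the disc has an arc as link. An end `a` of this arc has degree one
    -- there, so the triangle `v, w, a` lies in a single tetrahedron.
    obtain ⟨w, hw, harc⟩ := hd.boundary_nonempty
    obtain ⟨a, ha, hdeg⟩ := harc.exists_end
    rw [mem_link_link] at ha
    obtain ⟨-, hwa, hva, hvw, ht⟩ := ha
    simp only [Finset.mem_singleton] at hwa hva
    refine ⟨by simp, {v, w, a}, ht, by simp,
      Finset.card_eq_three.2 ⟨v, w, a, hvw, hva, hwa, rfl⟩, ?_⟩
    have hc : ({v, w, a} : Finset V).card = 3 :=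
      Finset.card_eq_three.2 ⟨v, w, a, hvw, hva, hwa, rfl⟩
    have := PreAbstractSimplicialComplex.ncard_cofaces (K := K) {v, w, a}
    rw [hc] at this
    rw [this, ← degree_link_link hvw hva hwa, hdeg]

end IsThreeManifold

end PreAbstractSimplicialComplex

end

noncomputable section

namespace PreAbstractSimplicialComplex

/-! ### Counting faces -/

section Counting

variable {V : Type*} [LinearOrder V] {K : PreAbstractSimplicialComplex V}

theorem numFaces_eq_card (hK : K.faces.Finite) (k : ℕ) :
    K.numFaces k = (hK.toFinset.filter fun s => s.card = k).card := by
  rw [numFaces, ← Set.ncard_coe_finset]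
  congr 1
  ext s
  simp

theorem sum_faces (hK : K.faces.Finite) (hdim : ∀ s ∈ K.faces, s.card ≤ 4) (g : ℕ → ℤ) :
    ∑ s ∈ hK.toFinset, g s.card = K.numFaces 1 * g 1 + K.numFaces 2 * g 2 +
      K.numFaces 3 * g 3 + K.numFaces 4 * g 4 := by
  have hmaps : ∀ s ∈ hK.toFinset, s.card ∈ Finset.Icc 1 4 := fun s hs => by
    rw [Set.Finite.mem_toFinset] at hs
    exact Finset.mem_Icc.2 ⟨Finset.card_pos.2 (K.face_nonempty hs), hdim s hs⟩
  rw [← Finset.sum_fiberwise_of_maps_to hmaps]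
  have : ∀ k ∈ Finset.Icc 1 4, ∑ s ∈ hK.toFinset with s.card = k, g s.card =
      K.numFaces k * g k := by
    intro k _
    rw [Finset.sum_congr rfl fun s hs => by rw [(Finset.mem_filter.1 hs).2], Finset.sum_const,
      numFaces_eq_card hK, nsmul_eq_mul]
  rw [Finset.sum_congr rfl this, show Finset.Icc 1 4 = ({1, 2, 3, 4} : Finset ℕ) by decide]
  simp [add_assoc]

theorem eulerChar_eq_sum (hK : K.faces.Finite) :
    K.eulerChar = ∑ s ∈ hK.toFinset, (-1 : ℤ) ^ (s.card - 1) := by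
  rw [eulerChar, finsum_mem_eq_finite_toFinset_sum _ hK]

/-- Adding `v` identifies the faces of the link with the faces of `K` that contain `v` and another
vertex; the number of vertices grows by one, whence the exponent. -/
theorem eulerChar_link (hK : K.faces.Finite) (v : V) :
    (K.link v).eulerChar =
      ∑ s ∈ hK.toFinset, if v ∈ s ∧ 2 ≤ s.card then (-1 : ℤ) ^ s.card else 0 := by
  have hfin : (K.link v).faces.Finite := by
    refine Set.Finite.of_finite_image (f := fun s => insert v s) (hK.subset ?_) ?_
    · rintro _ ⟨s, hs, rfl⟩
      exact hs.2.2
    · intro s hs t ht h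
      have := congrArg (Finset.erase · v) h
      simpa [Finset.erase_insert hs.2.1, Finset.erase_insert ht.2.1] using this
  rw [eulerChar_eq_sum hfin, ← Finset.sum_filter]
  refine Finset.sum_bij (fun s _ => insert v s) ?_ ?_ ?_ ?_
  · intro s hs
    rw [Set.Finite.mem_toFinset] at hs
    have := Finset.card_pos.2 hs.1
    simp only [Finset.mem_filter, Set.Finite.mem_toFinset, Finset.mem_insert_self, true_and,
      Finset.card_insert_of_notMem hs.2.1]
    exact ⟨hs.2.2, by omega⟩
  · intro s hs t ht h
    rw [Set.Finite.mem_toFinset] at hs ht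
    have := congrArg (Finset.erase · v) h
    simpa [Finset.erase_insert hs.2.1, Finset.erase_insert ht.2.1] using this
  · intro s hs
    simp only [Finset.mem_filter, Set.Finite.mem_toFinset] at hs
    exact ⟨s.erase v, by simpa using erase_mem_link hs.1 hs.2.1 hs.2.2,
      Finset.insert_erase hs.2.1⟩
  · intro s hs
    rw [Set.Finite.mem_toFinset] at hs
    have := Finset.card_pos.2 hs.1
    rw [Finset.card_insert_of_notMem hs.2.1]
    obtain ⟨c, hc⟩ : ∃ c, s.card = c + 1 := ⟨s.card - 1, by omega⟩
    rw [hc, Nat.add_sub_cancel, pow_succ, pow_succ]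
    ring

/-- Exchanging the sums, a face with `k ≥ 2` vertices is counted once for each of its vertices, with
sign `(-1)^k`. -/
theorem sum_eulerChar_link (hK : K.faces.Finite) (hdim : ∀ s ∈ K.faces, s.card ≤ 4) :
    ∑ v ∈ hK.toFinset.sup id, (K.link v).eulerChar =
      2 * K.numFaces 2 - 3 * K.numFaces 3 + 4 * K.numFaces 4 := by
  rw [Finset.sum_congr rfl fun v _ => eulerChar_link hK v, Finset.sum_comm]
  have : ∀ s ∈ hK.toFinset, (∑ v ∈ hK.toFinset.sup id,
      if v ∈ s ∧ 2 ≤ s.card then (-1 : ℤ) ^ s.card else 0) =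
      (fun k : ℕ => if 2 ≤ k then (k : ℤ) * (-1) ^ k else 0) s.card := by
    intro s hs
    by_cases h : 2 ≤ s.card
    · simp only [h, and_true, if_true]
      have hsub : s ⊆ hK.toFinset.sup id := Finset.le_sup (f := id) hs
      rw [← Finset.sum_filter, Finset.filter_mem_eq_inter, Finset.inter_eq_right.2 hsub,
        Finset.sum_const, nsmul_eq_mul]
    · simp [h]
  rw [Finset.sum_congr rfl this,
    sum_faces hK hdim fun k : ℕ => if 2 ≤ k then (k : ℤ) * (-1) ^ k else 0]
  norm_num
  ring

theorem mem_sup_faces (hK : K.faces.Finite) {v : V} :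
    v ∈ hK.toFinset.sup id ↔ {v} ∈ K.faces := by
  rw [Finset.mem_sup]
  constructor
  · rintro ⟨s, hs, hv⟩
    exact K.face_mono (by simpa using hs) (by simpa using hv) (by simp)
  · intro h
    exact ⟨{v}, by simpa using h, by simp⟩

theorem numFaces_one (hK : K.faces.Finite) : K.numFaces 1 = (hK.toFinset.sup id).card := by
  rw [numFaces_eq_card hK]
  symm
  refine Finset.card_bij (fun v _ => {v}) ?_ (fun _ _ _ _ h => Finset.singleton_injective h) ?_
  · intro v hv
    rw [mem_sup_faces] at hv
    simpa using hv
  · intro s hs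
    simp only [Finset.mem_filter, Set.Finite.mem_toFinset] at hs
    obtain ⟨v, rfl⟩ := Finset.card_eq_one.1 hs.2
    exact ⟨v, (mem_sup_faces hK).2 hs.1, rfl⟩

theorem boundary_le (d : ℕ) : K.boundary d ≤ K := by
  rintro s ⟨hs, t, ht, hst, -⟩
  exact K.face_mono ht hst hs

theorem mem_boundary_iff {d : ℕ} {t : Finset V} (ht : t ∈ K.faces) (hc : t.card = d) :
    t ∈ (K.boundary d).faces ↔ (K.cofaces t).ncard = 1 := by
  rw [← PreAbstractSimplicialComplex.ncard_cofaces, hc]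
  constructor
  · rintro ⟨-, t', ht', hsub, hc', h⟩
    rwa [Finset.eq_of_subset_of_card_le hsub (by omega)]
  · intro h
    exact ⟨K.face_nonempty ht, t, ht, subset_rfl, hc, h⟩

namespace IsThreeManifold

variable (hK : K.IsThreeManifold)
include hK

/-- Double count of pairs of a triangle in a tetrahedron: a tetrahedron has four triangles, and a
triangle lies in two tetrahedra, or in one if it is on the boundary. -/
theorem four_mul_numFaces :
    4 * K.numFaces 4 + (K.boundary 3).numFaces 3 = 2 * K.numFaces 3 := by
  classical
  have hfin := hK.finite
  have h := Finset.sum_card_bipartiteAbove_eq_sum_card_bipartiteBelow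
    (s := hfin.toFinset.filter fun s => s.card = 3)
    (t := hfin.toFinset.filter fun s => s.card = 4) (fun a b => a ⊆ b)
  have h1 : ∀ r ∈ hfin.toFinset.filter fun s => s.card = 4,
      (Finset.bipartiteBelow (fun a b => a ⊆ b) (hfin.toFinset.filter fun s => s.card = 3)
        r).card = 4 := by
    intro r hr
    simp only [Finset.mem_filter, Set.Finite.mem_toFinset] at hr
    have : Finset.bipartiteBelow (fun a b => a ⊆ b) (hfin.toFinset.filter fun s => s.card = 3) r =
        r.powersetCard 3 := by
      ext t
      simp only [Finset.mem_bipartiteBelow, Finset.mem_filter, Set.Finite.mem_toFinset,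
        Finset.mem_powersetCard]
      constructor
      · rintro ⟨⟨-, h3⟩, h⟩
        exact ⟨h, h3⟩
      · rintro ⟨h, h3⟩
        exact ⟨⟨K.face_mono hr.1 h (Finset.card_pos.1 (by omega)), h3⟩, h⟩
    rw [this, Finset.card_powersetCard, hr.2]
    rfl
  have h2 : ∀ t ∈ hfin.toFinset.filter fun s => s.card = 3,
      (Finset.bipartiteAbove (fun a b => a ⊆ b) (hfin.toFinset.filter fun s => s.card = 4)
        t).card + (if t ∈ (K.boundary 3).faces then 1 else 0) = 2 := by
    intro t ht
    simp only [Finset.mem_filter, Set.Finite.mem_toFinset] at ht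
    have : (Finset.bipartiteAbove (fun a b => a ⊆ b) (hfin.toFinset.filter fun s => s.card = 4)
        t).card = (K.cofaces t).ncard := by
      rw [← PreAbstractSimplicialComplex.ncard_cofaces, ← Set.ncard_coe_finset]
      congr 1
      ext r
      simp only [Finset.coe_bipartiteAbove, Finset.mem_filter, Set.Finite.mem_toFinset, ht.2,
        Set.mem_ofPred_eq]
      tauto
    rw [this, mem_boundary_iff ht.1 ht.2]
    rcases hK.ncard_cofaces ht.1 ht.2 with h | h <;> simp [h]
  rw [Finset.sum_congr rfl h1, Finset.sum_const, smul_eq_mul, ← numFaces_eq_card] at h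
  have h3 := Finset.sum_congr rfl h2
  rw [Finset.sum_add_distrib, h, Finset.sum_const, smul_eq_mul, ← numFaces_eq_card,
    ← Finset.card_filter, Finset.filter_filter] at h3
  have h4 : (hfin.toFinset.filter fun s => s.card = 3 ∧ s ∈ (K.boundary 3).faces).card =
      (K.boundary 3).numFaces 3 := by
    rw [numFaces, ← Set.ncard_coe_finset]
    congr 1
    ext s
    simp only [Finset.coe_filter, Set.Finite.mem_toFinset, Set.mem_ofPred_eq]
    exact ⟨fun h => ⟨h.2.2, h.2.1⟩, fun h => ⟨boundary_le 3 h.1, h.2, h.1⟩⟩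
  rw [h4] at h3
  omega

/-- The link of a vertex is a sphere, of Euler characteristic two, or at the boundary a disc, of
Euler characteristic one. The sum over all vertices is `sum_eulerChar_link`. -/
theorem two_mul_numFaces_one : 2 * (K.numFaces 1 : ℤ) - (K.boundary 3).numFaces 1 =
    2 * K.numFaces 2 - 3 * K.numFaces 3 + 4 * K.numFaces 4 := by
  classical
  have hfin := hK.finite
  have hbfin : (K.boundary 3).faces.Finite := hfin.subset (boundary_le 3)
  rw [← sum_eulerChar_link hfin fun s hs => hK.card_le hs]
  have : ∀ v ∈ hfin.toFinset.sup id, (K.link v).eulerChar =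
      2 - if {v} ∈ (K.boundary 3).faces then 1 else 0 := by
    intro v hv
    rw [mem_sup_faces] at hv
    rw [hK.singleton_mem_boundary_iff hv]
    rcases hK.link_vertex v hv with h | h
    · have hn : ¬(K.link v).IsTwoDisc := fun h' => by
        have := h.euler
        rw [h'.euler] at this
        omega
      rw [if_neg hn, h.euler, sub_zero]
    · rw [if_pos h, h.euler]
      norm_num
  rw [Finset.sum_congr rfl this, Finset.sum_sub_distrib, Finset.sum_const, nsmul_eq_mul,
    ← numFaces_one, ← Finset.sum_filter, Finset.sum_const, nsmul_eq_mul, mul_one, mul_comm,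
    numFaces_one hbfin]
  congr 3
  ext v
  rw [Finset.mem_filter, mem_sup_faces, mem_sup_faces]
  exact ⟨fun h => ⟨boundary_le 3 h, h⟩, fun h => h.2⟩

/-- The Euler characteristic of a 3-manifold whose boundary has Euler characteristic zero is
zero. -/
theorem euler_eq_zero (hb : (K.boundary 3).numFaces 3 = 2 * (K.boundary 3).numFaces 1) :
    (K.numFaces 1 : ℤ) - K.numFaces 2 + K.numFaces 3 - K.numFaces 4 = 0 := by
  -- The two counts express twice the Euler characteristic as the number of boundary vertices minus
  -- half the number of boundary triangles.
  have h1 := hK.four_mul_numFaces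
  have h2 := hK.two_mul_numFaces_one
  omega

end IsThreeManifold

end Counting

end PreAbstractSimplicialComplex

end

noncomputable section

namespace PreAbstractSimplicialComplex

/-! ### The faces of a product with a circle -/

section Staircase

variable {U : Type*} [LinearOrder U] {A : PreAbstractSimplicialComplex U} {b : ℕ} {hb : 3 ≤ b}

/-- The face of the prism over `σ` with vertices `(y, lo)` for `y ≤ x` and `(y, hi)` for
`x ≤ y`. -/
def stair (σ : Finset U) (x : U) (lo hi : ℕ) : Finset (U × ℕ) :=
  (σ.filter (· ≤ x)).image (fun y => (y, lo)) ∪ (σ.filter (x ≤ ·)).image (fun y => (y, hi))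

/-- The face of the prism over `σ` with vertices `(y, lo)` for `y < x` and `(y, hi)` for
`x ≤ y`. -/
def stairCut (σ : Finset U) (x : U) (lo hi : ℕ) : Finset (U × ℕ) :=
  (σ.filter (· < x)).image (fun y => (y, lo)) ∪ (σ.filter (x ≤ ·)).image (fun y => (y, hi))

theorem mem_stair {σ : Finset U} {x : U} {lo hi : ℕ} {p : U × ℕ} :
    p ∈ stair σ x lo hi ↔ p.1 ∈ σ ∧ (p.1 ≤ x ∧ p.2 = lo ∨ x ≤ p.1 ∧ p.2 = hi) := by
  obtain ⟨y, i⟩ := p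
  simp only [stair, Finset.mem_union, Finset.mem_image, Finset.mem_filter, Prod.mk.injEq]
  constructor
  · rintro (⟨z, ⟨h1, h2⟩, rfl, rfl⟩ | ⟨z, ⟨h1, h2⟩, rfl, rfl⟩) <;> simp [h1, h2]
  · rintro ⟨h, ⟨h1, rfl⟩ | ⟨h1, rfl⟩⟩
    · exact Or.inl ⟨y, ⟨h, h1⟩, rfl, rfl⟩
    · exact Or.inr ⟨y, ⟨h, h1⟩, rfl, rfl⟩

theorem mem_stairCut {σ : Finset U} {x : U} {lo hi : ℕ} {p : U × ℕ} :
    p ∈ stairCut σ x lo hi ↔ p.1 ∈ σ ∧ (p.1 < x ∧ p.2 = lo ∨ x ≤ p.1 ∧ p.2 = hi) := by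
  obtain ⟨y, i⟩ := p
  simp only [stairCut, Finset.mem_union, Finset.mem_image, Finset.mem_filter, Prod.mk.injEq]
  constructor
  · rintro (⟨z, ⟨h1, h2⟩, rfl, rfl⟩ | ⟨z, ⟨h1, h2⟩, rfl, rfl⟩) <;> simp [h1, h2]
  · rintro ⟨h, ⟨h1, rfl⟩ | ⟨h1, rfl⟩⟩
    · exact Or.inl ⟨y, ⟨h, h1⟩, rfl, rfl⟩
    · exact Or.inr ⟨y, ⟨h, h1⟩, rfl, rfl⟩

/-- Exactly the column over `x` contains both heights. -/
theorem card_stair {σ : Finset U} {x : U} (hx : x ∈ σ) {lo hi : ℕ} (h : lo < hi) :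
    (stair σ x lo hi).card = σ.card + 1 := by
  rw [stair, Finset.card_union_of_disjoint, Finset.card_image_of_injective _
    (Prod.mk_left_injective lo), Finset.card_image_of_injective _ (Prod.mk_left_injective hi)]
  · rw [← Finset.card_union_add_card_inter, ← Finset.filter_or, ← Finset.filter_and]
    have h1 : σ.filter (fun y => y ≤ x ∨ x ≤ y) = σ :=
      Finset.filter_true_of_mem fun y _ => le_total y x
    have h2 : σ.filter (fun y => y ≤ x ∧ x ≤ y) = {x} := by
      ext y
      simp only [Finset.mem_filter, Finset.mem_singleton]
      constructor
      · rintro ⟨-, h1, h2⟩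
        exact le_antisymm h1 h2
      · rintro rfl
        exact ⟨hx, le_rfl, le_rfl⟩
    rw [h1, h2, Finset.card_singleton]
  · rw [Finset.disjoint_left]
    simp only [Finset.mem_image, not_exists, not_and]
    rintro _ ⟨y, _, rfl⟩ z _ hz
    exact h.ne' (congrArg Prod.snd hz)

theorem card_stairCut {σ : Finset U} {x : U} {lo hi : ℕ} (h : lo < hi) :
    (stairCut σ x lo hi).card = σ.card := by
  rw [stairCut, Finset.card_union_of_disjoint, Finset.card_image_of_injective _
    (Prod.mk_left_injective lo), Finset.card_image_of_injective _ (Prod.mk_left_injective hi)]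
  · rw [← Finset.card_union_add_card_inter, ← Finset.filter_or, ← Finset.filter_and]
    have h1 : σ.filter (fun y => y < x ∨ x ≤ y) = σ :=
      Finset.filter_true_of_mem fun y _ => lt_or_ge y x
    have h2 : σ.filter (fun y => y < x ∧ x ≤ y) = ∅ :=
      Finset.filter_false_of_mem fun y _ h => absurd h.1 (not_lt.2 h.2)
    rw [h1, h2, Finset.card_empty]
    rfl
  · rw [Finset.disjoint_left]
    simp only [Finset.mem_image, not_exists, not_and]
    rintro _ ⟨y, _, rfl⟩ z _ hz
    exact h.ne' (congrArg Prod.snd hz)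

theorem image_fst_stair {σ : Finset U} {x : U} {lo hi : ℕ} :
    (stair σ x lo hi).image Prod.fst = σ := by
  ext y
  simp only [Finset.mem_image, mem_stair]
  constructor
  · rintro ⟨p, ⟨h, -⟩, rfl⟩
    exact h
  · intro h
    rcases le_total y x with h1 | h1
    · exact ⟨(y, lo), ⟨h, Or.inl ⟨h1, rfl⟩⟩, rfl⟩
    · exact ⟨(y, hi), ⟨h, Or.inr ⟨h1, rfl⟩⟩, rfl⟩

theorem image_fst_stairCut {σ : Finset U} {x : U} {lo hi : ℕ} :
    (stairCut σ x lo hi).image Prod.fst = σ := by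
  ext y
  simp only [Finset.mem_image, mem_stairCut]
  constructor
  · rintro ⟨p, ⟨h, -⟩, rfl⟩
    exact h
  · intro h
    rcases lt_or_ge y x with h1 | h1
    · exact ⟨(y, lo), ⟨h, Or.inl ⟨h1, rfl⟩⟩, rfl⟩
    · exact ⟨(y, hi), ⟨h, Or.inr ⟨h1, rfl⟩⟩, rfl⟩

theorem stairCut_subset_stair {σ : Finset U} {x : U} {lo hi : ℕ} :
    stairCut σ x lo hi ⊆ stair σ x lo hi := by
  intro p
  rw [mem_stair, mem_stairCut]
  rintro ⟨h, h1 | h1⟩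
  · exact ⟨h, Or.inl ⟨h1.1.le, h1.2⟩⟩
  · exact ⟨h, Or.inr h1⟩

theorem stair_mem {σ : Finset U} (hσ : σ ∈ A.faces) {x : U} {lo hi : ℕ}
    {B : PreAbstractSimplicialComplex ℕ} (h : lo ≤ hi) (hB : {lo, hi} ∈ B.faces) :
    stair σ x lo hi ∈ (A.prod B).faces := by
  refine ⟨by rwa [image_fst_stair], ?_, ?_⟩
  · refine B.face_mono hB ?_ ?_
    · intro i
      simp only [Finset.mem_image, mem_stair, Finset.mem_insert, Finset.mem_singleton]
      rintro ⟨p, ⟨-, ⟨-, hp⟩ | ⟨-, hp⟩⟩, rfl⟩ <;> simp [hp]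
    · have : ((stair σ x lo hi).image Prod.fst).Nonempty := by
        rw [image_fst_stair]
        exact A.face_nonempty hσ
      exact (Finset.image_nonempty.1 this).image _
  · intro p hp q hq _
    rw [Finset.mem_coe, mem_stair] at hp hq
    obtain ⟨y, i⟩ := p
    obtain ⟨z, j⟩ := q
    simp only at hp hq
    rcases hp with ⟨-, ⟨hp, rfl⟩ | ⟨hp, rfl⟩⟩ <;> rcases hq with ⟨-, ⟨hq, rfl⟩ | ⟨hq, rfl⟩⟩
    · simpa using le_total y z
    · exact Or.inl ⟨hp.trans hq, h⟩
    · exact Or.inr ⟨hq.trans hp, h⟩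
    · simpa using le_total y z

theorem stairCut_mem {σ : Finset U} (hσ : σ ∈ A.faces) {x : U} {lo hi : ℕ}
    {B : PreAbstractSimplicialComplex ℕ} (h : lo ≤ hi) (hB : {lo, hi} ∈ B.faces) :
    stairCut σ x lo hi ∈ (A.prod B).faces := by
  refine (A.prod B).face_mono (stair_mem hσ h hB) stairCut_subset_stair ?_
  have : ((stairCut σ x lo hi).image Prod.fst).Nonempty := by
    rw [image_fst_stairCut]
    exact A.face_nonempty hσ
  exact Finset.image_nonempty.1 this

theorem image_snd_stair {σ : Finset U} {x : U} (hx : x ∈ σ) {lo hi : ℕ} :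
    (stair σ x lo hi).image Prod.snd = {lo, hi} := by
  ext i
  simp only [Finset.mem_image, mem_stair, Finset.mem_insert, Finset.mem_singleton]
  constructor
  · rintro ⟨p, ⟨-, ⟨-, h⟩ | ⟨-, h⟩⟩, rfl⟩ <;> simp [h]
  · rintro (rfl | rfl)
    · exact ⟨(x, i), ⟨hx, Or.inl ⟨le_rfl, rfl⟩⟩, rfl⟩
    · exact ⟨(x, i), ⟨hx, Or.inr ⟨le_rfl, rfl⟩⟩, rfl⟩

theorem image_snd_stairCut {σ : Finset U} {x y : U} (hx : x ∈ σ) (hy : y ∈ σ) (hyx : y < x)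
    {lo hi : ℕ} : (stairCut σ x lo hi).image Prod.snd = {lo, hi} := by
  ext i
  simp only [Finset.mem_image, mem_stairCut, Finset.mem_insert, Finset.mem_singleton]
  constructor
  · rintro ⟨p, ⟨-, ⟨-, h⟩ | ⟨-, h⟩⟩, rfl⟩ <;> simp [h]
  · rintro (rfl | rfl)
    · exact ⟨(y, i), ⟨hy, Or.inl ⟨hyx, rfl⟩⟩, rfl⟩
    · exact ⟨(x, i), ⟨hx, Or.inr ⟨le_rfl, rfl⟩⟩, rfl⟩

/-- The pairs of adjacent vertices of the standard circle, in increasing order. -/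
def cycleEdges (b : ℕ) : Finset (ℕ × ℕ) :=
  insert (0, b - 1) ((Finset.range (b - 1)).image fun i => (i, i + 1))

theorem card_cycleEdges (hb : 3 ≤ b) : (cycleEdges b).card = b := by
  rw [cycleEdges, Finset.card_insert_of_notMem, Finset.card_image_of_injective, Finset.card_range]
  · omega
  · exact fun i j h => congrArg Prod.fst h
  · simp only [Finset.mem_image, Finset.mem_range, Prod.mk.injEq, not_exists, not_and]
    rintro i hi rfl
    omega

theorem mem_cycleEdges {p : ℕ × ℕ} :
    p ∈ cycleEdges b ↔ p.1 < p.2 ∧ {p.1, p.2} ∈ (standardCycle b hb).toComplex.faces := by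
  obtain ⟨i, j⟩ := p
  simp only [cycleEdges, Finset.mem_insert, Finset.mem_image, Finset.mem_range, Prod.mk.injEq]
  constructor
  · rintro (⟨rfl, rfl⟩ | ⟨l, hl, rfl, rfl⟩)
    · refine ⟨by omega, by simp, b - 1, ?_⟩
      rw [standardCycle_vert, standardCycle_vert, Nat.mod_eq_of_lt (by omega),
        Nat.sub_add_cancel (by omega), Nat.mod_self, Finset.pair_comm]
    · refine ⟨by omega, by simp, l, ?_⟩
      rw [standardCycle_vert, standardCycle_vert, Nat.mod_eq_of_lt (by omega),
        Nat.mod_eq_of_lt (by omega)]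
  · rintro ⟨hij, h⟩
    rcases standardCycle_subset h with ⟨l, hl, hs⟩ | hs
    · have h1 := hs (by simp : i ∈ _)
      have h2 := hs (by simp : j ∈ _)
      simp only [Finset.mem_insert, Finset.mem_singleton] at h1 h2
      exact Or.inr ⟨l, by omega, by omega, by omega⟩
    · have h1 := hs (by simp : i ∈ _)
      have h2 := hs (by simp : j ∈ _)
      simp only [Finset.mem_insert, Finset.mem_singleton] at h1 h2
      exact Or.inl ⟨by omega, by omega⟩

/-- The faces of the product of a complex with a circle. -/
theorem mem_prod_circle {s : Finset (U × ℕ)}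
    (hs : s ∈ (A.prod (standardCycle b hb).toComplex).faces) :
    (∃ i < b, s = (s.image Prod.fst).image fun y => (y, i)) ∨
      ∃ e ∈ cycleEdges b, ∃ x ∈ s.image Prod.fst, s = stair (s.image Prod.fst) x e.1 e.2 ∨
        (∃ y ∈ s.image Prod.fst, y < x) ∧ s = stairCut (s.image Prod.fst) x e.1 e.2 := by
  obtain ⟨-, h2, hchain⟩ := hs
  have hle : (s.image Prod.snd).card ≤ 2 := by
    obtain ⟨-, i, hi⟩ := h2
    exact (Finset.card_le_card hi).trans Finset.card_le_two
  have hpos := Finset.card_pos.2 (PreAbstractSimplicialComplex.face_nonempty _ h2)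
  rcases (by omega : (s.image Prod.snd).card = 1 ∨ (s.image Prod.snd).card = 2) with h | h
  · left
    obtain ⟨i, hi⟩ := Finset.card_eq_one.1 h
    have hmem : ∀ p ∈ s, p.2 = i := fun p hp => by
      have := Finset.mem_image_of_mem Prod.snd hp
      rwa [hi, Finset.mem_singleton] at this
    refine ⟨i, standardCycle_lt h2 (by rw [hi]; simp), ?_⟩
    rw [Finset.image_image]
    refine Finset.ext fun p => ?_
    simp only [Finset.mem_image, Function.comp_apply]
    constructor
    · intro hp
      exact ⟨p, hp, by rw [← hmem p hp]⟩
    · rintro ⟨q, hq, rfl⟩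
      rwa [← hmem q hq]
  · right
    obtain ⟨lo, hi, hne, heq⟩ : ∃ lo hi : ℕ, lo < hi ∧ s.image Prod.snd = {lo, hi} := by
      obtain ⟨i, j, hij, heq⟩ := Finset.card_eq_two.1 h
      rcases lt_or_gt_of_ne hij with h' | h'
      · exact ⟨i, j, h', heq⟩
      · exact ⟨j, i, h', by rw [heq, Finset.pair_comm]⟩
    have hmem : ∀ p ∈ s, p.2 = lo ∨ p.2 = hi := fun p hp => by
      have := Finset.mem_image_of_mem Prod.snd hp
      rwa [heq, Finset.mem_insert, Finset.mem_singleton] at this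
    have hQ : ((s.filter fun p => p.2 = hi).image Prod.fst).Nonempty := by
      have : hi ∈ s.image Prod.snd := by rw [heq]; simp
      obtain ⟨p, hp, hp2⟩ := Finset.mem_image.1 this
      exact ⟨p.1, Finset.mem_image_of_mem _ (Finset.mem_filter.2 ⟨hp, hp2⟩)⟩
    have hmQ : ∀ y, y ∈ (s.filter fun p => p.2 = hi).image Prod.fst ↔ (y, hi) ∈ s := by
      intro y
      simp only [Finset.mem_image, Finset.mem_filter]
      constructor
      · rintro ⟨p, ⟨hp, rfl⟩, rfl⟩
        exact hp
      · intro hy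
        exact ⟨(y, hi), ⟨hy, rfl⟩, rfl⟩
    -- The column `x` is the first one at the upper height. Because the face is a chain, columns at
    -- the lower height come no later. The face is a `stair` or a `stairCut` according to whether
    -- `(x, lo)` belongs to it.
    obtain ⟨x, hxs, hmin⟩ : ∃ x, (x, hi) ∈ s ∧ ∀ y, (y, hi) ∈ s → x ≤ y :=
      ⟨_, (hmQ _).1 (Finset.min'_mem _ hQ), fun y hy => Finset.min'_le _ _ ((hmQ y).2 hy)⟩
    have hlow : ∀ y, (y, lo) ∈ s → y ≤ x := by
      intro y hy
      have hne' : ((y, lo) : U × ℕ) ≠ (x, hi) := fun h => hne.ne (congrArg Prod.snd h)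
      rcases hchain hy hxs hne' with h' | h'
      · exact h'.1
      · exact absurd h'.2 (not_le.2 hne)
    have hσ : ∀ y, y ∈ s.image Prod.fst ↔ (y, lo) ∈ s ∨ (y, hi) ∈ s := by
      intro y
      rw [Finset.mem_image]
      constructor
      · rintro ⟨⟨z, i⟩, hp, rfl⟩
        rcases hmem _ hp with h' | h' <;> simp only at h' <;> subst h' <;> simp [hp]
      · rintro (h' | h') <;> exact ⟨_, h', rfl⟩
    refine ⟨(lo, hi), (mem_cycleEdges (hb := hb)).2 ⟨hne, by rwa [← heq]⟩, x,
      (hσ x).2 (Or.inr hxs), ?_⟩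
    by_cases hx : (x, lo) ∈ s
    · left
      refine Finset.ext fun ⟨y, i⟩ => ?_
      rw [mem_stair, hσ]
      simp only
      constructor
      · intro hy
        rcases hmem _ hy with h' | h' <;> simp only at h' <;> subst h'
        · exact ⟨Or.inl hy, Or.inl ⟨hlow y hy, rfl⟩⟩
        · exact ⟨Or.inr hy, Or.inr ⟨hmin y hy, rfl⟩⟩
      · rintro ⟨h1 | h1, ⟨h2, rfl⟩ | ⟨h2, rfl⟩⟩
        · exact h1
        · rwa [le_antisymm (hlow y h1) h2]
        · rwa [le_antisymm h2 (hmin y h1)]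
        · exact h1
    · right
      refine ⟨?_, Finset.ext fun ⟨y, i⟩ => ?_⟩
      · have : lo ∈ s.image Prod.snd := by rw [heq]; simp
        obtain ⟨⟨y, i⟩, hp, hp2⟩ := Finset.mem_image.1 this
        simp only at hp2
        subst hp2
        refine ⟨y, (hσ y).2 (Or.inl hp), lt_of_le_of_ne (hlow y hp) ?_⟩
        rintro rfl
        exact hx hp
      · rw [mem_stairCut, hσ]
        simp only
        constructor
        · intro hy
          rcases hmem _ hy with h' | h' <;> simp only at h' <;> subst h'
          · refine ⟨Or.inl hy, Or.inl ⟨lt_of_le_of_ne (hlow y hy) ?_, rfl⟩⟩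
            rintro rfl
            exact hx hy
          · exact ⟨Or.inr hy, Or.inr ⟨hmin y hy, rfl⟩⟩
        · rintro ⟨h1 | h1, ⟨h2, rfl⟩ | ⟨h2, rfl⟩⟩
          · exact h1
          · rwa [le_antisymm (hlow y h1) h2]
          · exact absurd (hmin y h1) (not_le.2 h2)
          · exact h1

theorem stair_injective {σ τ : Finset U} {x y : U} {d e : ℕ × ℕ} (hx : x ∈ σ) (hy : y ∈ τ)
    (hd : d.1 < d.2) (he : e.1 < e.2) (h : stair σ x d.1 d.2 = stair τ y e.1 e.2) :
    σ = τ ∧ x = y ∧ d = e := by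
  have h1 : σ = τ := by rw [← image_fst_stair (σ := σ), h, image_fst_stair]
  have h2 := congrArg (Finset.image Prod.snd) h
  rw [image_snd_stair hx, image_snd_stair hy] at h2
  have h3 : d = e := by
    have a1 : d.1 ∈ ({e.1, e.2} : Finset ℕ) := by rw [← h2]; simp
    have a2 : d.2 ∈ ({e.1, e.2} : Finset ℕ) := by rw [← h2]; simp
    simp only [Finset.mem_insert, Finset.mem_singleton] at a1 a2
    ext <;> omega
  subst h1 h3
  refine ⟨rfl, ?_, rfl⟩
  have a1 : (x, d.2) ∈ stair σ y d.1 d.2 := by rw [← h, mem_stair]; simp [hx]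
  have a2 : (y, d.2) ∈ stair σ x d.1 d.2 := by rw [h, mem_stair]; simp [hy]
  rw [mem_stair] at a1 a2
  simp only [hd.ne', and_false, and_true, false_or] at a1 a2
  exact le_antisymm a2.2 a1.2

theorem stairCut_injective {σ τ : Finset U} {x y x' y' : U} {d e : ℕ × ℕ} (hx : x ∈ σ)
    (hx' : x' ∈ σ) (hxx : x' < x) (hy : y ∈ τ) (hy' : y' ∈ τ) (hyy : y' < y)
    (hd : d.1 < d.2) (he : e.1 < e.2) (h : stairCut σ x d.1 d.2 = stairCut τ y e.1 e.2) :
    σ = τ ∧ x = y ∧ d = e := by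
  have h1 : σ = τ := by rw [← image_fst_stairCut (σ := σ), h, image_fst_stairCut]
  have h2 := congrArg (Finset.image Prod.snd) h
  rw [image_snd_stairCut hx hx' hxx, image_snd_stairCut hy hy' hyy] at h2
  have h3 : d = e := by
    have a1 : d.1 ∈ ({e.1, e.2} : Finset ℕ) := by rw [← h2]; simp
    have a2 : d.2 ∈ ({e.1, e.2} : Finset ℕ) := by rw [← h2]; simp
    simp only [Finset.mem_insert, Finset.mem_singleton] at a1 a2
    ext <;> omega
  subst h1 h3
  refine ⟨rfl, ?_, rfl⟩
  have a1 : (x, d.2) ∈ stairCut σ y d.1 d.2 := by rw [← h, mem_stairCut]; simp [hx]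
  have a2 : (y, d.2) ∈ stairCut σ x d.1 d.2 := by rw [h, mem_stairCut]; simp [hy]
  rw [mem_stairCut] at a1 a2
  simp only [hd.ne', and_false, and_true, false_or] at a1 a2
  exact le_antisymm a2.2 a1.2

theorem stair_ne_stairCut {σ τ : Finset U} {x y : U} {d e : ℕ × ℕ} (hx : x ∈ σ)
    (hd : d.1 < d.2) (he : e.1 < e.2) :
    stair σ x d.1 d.2 ≠ stairCut τ y e.1 e.2 := by
  intro h
  have h1 : σ = τ := by rw [← image_fst_stair (σ := σ), h, image_fst_stairCut]
  have := congrArg Finset.card h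
  rw [card_stair hx hd, card_stairCut he, h1] at this
  omega

/-- The number of faces of the product of a complex with a circle. -/
theorem numFaces_prod_circle (hA : A.faces.Finite) (k : ℕ) :
    (A.prod (standardCycle b hb).toComplex).numFaces (k + 1) =
      b * ((k + 1) * A.numFaces (k + 1) + k * A.numFaces k) := by
  set F : ℕ → Finset (Finset U) := fun k => hA.toFinset.filter fun s => s.card = k with hF
  have hmF : ∀ {k σ}, σ ∈ F k ↔ σ ∈ A.faces ∧ σ.card = k := by
    intro k σ
    simp [hF]
  have hcF : ∀ k, (F k).card = A.numFaces k := fun k => (numFaces_eq_card hA k).symm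
  have hne : ∀ {k σ}, σ ∈ F k → σ.Nonempty := fun h => A.face_nonempty (hmF.1 h).1
  have hlt : ∀ {e}, e ∈ cycleEdges b → e.1 < e.2 := fun he => ((mem_cycleEdges (hb := hb)).1 he).1
  have hface : ∀ {e}, e ∈ cycleEdges b → {e.1, e.2} ∈ (standardCycle b hb).toComplex.faces :=
    fun he => (mem_cycleEdges.1 he).2
  -- Three disjoint kinds of faces: `C` at a single height, `R` with a doubled column over a face
  -- with `k` vertices, and `D` cut between two columns over a face with `k + 1` vertices. In `D`
  -- the first column is excluded, since a cut there would be at a single height.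
  let C : Finset (Finset (U × ℕ)) :=
    (F (k + 1) ×ˢ Finset.range b).image fun p => p.1.image fun y => (y, p.2)
  let R : Finset (Finset (U × ℕ)) :=
    (((F k).sigma fun σ => σ) ×ˢ cycleEdges b).image fun p => stair p.1.1 p.1.2 p.2.1 p.2.2
  let D : Finset (Finset (U × ℕ)) :=
    (((F (k + 1)).sigma fun σ => σ.filter fun x => ∃ y ∈ σ, y < x) ×ˢ cycleEdges b).image
      fun p => stairCut p.1.1 p.1.2 p.2.1 p.2.2
  have hset : {s | s ∈ (A.prod (standardCycle b hb).toComplex).faces ∧ s.card = k + 1} =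
      ((C ∪ R ∪ D : Finset (Finset (U × ℕ))) : Set (Finset (U × ℕ))) := by
    ext s
    simp only [Finset.coe_union, Set.mem_union, Finset.mem_coe, C, R, D, Finset.mem_image,
      Finset.mem_product, Finset.mem_sigma, Finset.mem_range, Finset.mem_filter, Prod.exists,
      Sigma.exists]
    constructor
    · rintro ⟨hs, hc⟩
      have hσ := fst_mem_of_mem_prod hs
      rcases mem_prod_circle hs with ⟨i, hi, h⟩ | ⟨⟨lo, hi⟩, he, x, hx, h | ⟨⟨y, hy, hyx⟩, h⟩⟩
      · refine Or.inl (Or.inl ⟨_, i, ⟨hmF.2 ⟨hσ, ?_⟩, hi⟩, h.symm⟩)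
        rw [← hc]
        conv_rhs => rw [h]
        rw [Finset.card_image_of_injective _ (Prod.mk_left_injective i)]
      · refine Or.inl (Or.inr ⟨_, x, lo, hi, ⟨⟨hmF.2 ⟨hσ, ?_⟩, hx⟩, he⟩, h.symm⟩)
        rw [h, card_stair hx (hlt he)] at hc
        omega
      · refine Or.inr ⟨_, x, lo, hi, ⟨⟨hmF.2 ⟨hσ, ?_⟩, hx, y, hy, hyx⟩, he⟩, h.symm⟩
        rwa [h, card_stairCut (hlt he)] at hc
    · rintro ((⟨σ, i, ⟨hσ, hi⟩, rfl⟩ | ⟨σ, x, lo, hi, ⟨⟨hσ, hx⟩, he⟩, rfl⟩) |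
        ⟨σ, x, lo, hi, ⟨⟨hσ, hx, -⟩, he⟩, rfl⟩)
      · exact ⟨mem_prod_const (hmF.1 hσ).1 (standardCycle_singleton_mem hb hi), by
          rw [Finset.card_image_of_injective _ (Prod.mk_left_injective i), (hmF.1 hσ).2]⟩
      · exact ⟨stair_mem (hmF.1 hσ).1 (hlt he).le (hface he), by
          rw [card_stair hx (hlt he), (hmF.1 hσ).2]⟩
      · exact ⟨stairCut_mem (hmF.1 hσ).1 (hlt he).le (hface he), by
          rw [card_stairCut (hlt he), (hmF.1 hσ).2]⟩
  have hCsnd : ∀ s ∈ C, (s.image Prod.snd).card = 1 := by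
    intro s hs
    simp only [C, Finset.mem_image, Finset.mem_product, Prod.exists] at hs
    obtain ⟨σ, i, ⟨hσ, -⟩, rfl⟩ := hs
    rw [Finset.image_image]
    change (σ.image fun _ => i).card = 1
    rw [Finset.image_const (hne hσ), Finset.card_singleton]
  have hRsnd : ∀ s ∈ R, (s.image Prod.snd).card = 2 := by
    intro s hs
    simp only [R, Finset.mem_image, Finset.mem_product, Finset.mem_sigma, Prod.exists,
      Sigma.exists] at hs
    obtain ⟨σ, x, lo, hi, ⟨⟨-, hx⟩, he⟩, rfl⟩ := hs
    rw [image_snd_stair hx, Finset.card_pair (hlt he).ne]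
  have hDsnd : ∀ s ∈ D, (s.image Prod.snd).card = 2 := by
    intro s hs
    simp only [D, Finset.mem_image, Finset.mem_product, Finset.mem_sigma, Finset.mem_filter,
      Prod.exists, Sigma.exists] at hs
    obtain ⟨σ, x, lo, hi, ⟨⟨-, hx, y, hy, hyx⟩, he⟩, rfl⟩ := hs
    rw [image_snd_stairCut hx hy hyx, Finset.card_pair (hlt he).ne]
  have hCR : Disjoint C R := Finset.disjoint_left.2 fun s h1 h2 => by
    have := hCsnd s h1
    rw [hRsnd s h2] at this
    omega
  have hCD : Disjoint (C ∪ R) D := by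
    rw [Finset.disjoint_union_left]
    refine ⟨Finset.disjoint_left.2 fun s h1 h2 => ?_, Finset.disjoint_left.2 fun s h1 h2 => ?_⟩
    · have := hCsnd s h1
      rw [hDsnd s h2] at this
      omega
    · simp only [R, D, Finset.mem_image, Finset.mem_product, Finset.mem_sigma, Finset.mem_filter,
        Prod.exists, Sigma.exists] at h1 h2
      obtain ⟨σ, x, lo, hi, ⟨⟨-, hx⟩, he⟩, rfl⟩ := h1
      obtain ⟨τ, z, lo', hi', ⟨⟨-, hz, y, hy, hyz⟩, he'⟩, h⟩ := h2
      exact stair_ne_stairCut (d := (lo, hi)) (e := (lo', hi')) hx (hlt he) (hlt he')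
        h.symm
  have hC : C.card = A.numFaces (k + 1) * b := by
    rw [Finset.card_image_of_injOn, Finset.card_product, hcF, Finset.card_range]
    rintro ⟨σ, i⟩ h1 ⟨τ, j⟩ h2 h
    simp only [Finset.coe_product, Set.mem_prod, Finset.mem_coe] at h1 h2
    simp only at h
    have e1 : σ = τ := by
      have := congrArg (Finset.image Prod.fst) h
      simpa [Finset.image_image, Function.comp_def] using this
    have e2 := congrArg (Finset.image Prod.snd) h
    simp only [Finset.image_image, Function.comp_def, Finset.image_const (hne h1.1),
      Finset.image_const (hne h2.1), Finset.singleton_inj] at e2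
    rw [e1, e2]
  have hR : R.card = A.numFaces k * k * b := by
    rw [Finset.card_image_of_injOn, Finset.card_product, Finset.card_sigma,
      Finset.sum_congr rfl fun σ hσ => (hmF.1 hσ).2, Finset.sum_const, hcF, card_cycleEdges hb,
      smul_eq_mul]
    rintro ⟨⟨σ, x⟩, d⟩ h1 ⟨⟨τ, y⟩, e⟩ h2 h
    simp only [Finset.coe_product, Set.mem_prod, Finset.mem_coe, Finset.mem_sigma] at h1 h2
    obtain ⟨rfl, rfl, rfl⟩ := stair_injective h1.1.2 h2.1.2 (hlt h1.2) (hlt h2.2) h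
    rfl
  have hD : D.card = A.numFaces (k + 1) * k * b := by
    have hcard : ∀ σ ∈ F (k + 1), (σ.filter fun x => ∃ y ∈ σ, y < x).card = k := by
      intro σ hσ
      have : (σ.filter fun x => ∃ y ∈ σ, y < x) = σ.erase (σ.min' (hne hσ)) := by
        ext x
        rw [Finset.mem_filter, Finset.mem_erase]
        constructor
        · rintro ⟨hx, y, hy, hyx⟩
          refine ⟨?_, hx⟩
          rintro rfl
          exact absurd (Finset.min'_le _ _ hy) (not_le.2 hyx)
        · rintro ⟨hne', hx⟩
          exact ⟨hx, _, Finset.min'_mem _ (hne hσ),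
            lt_of_le_of_ne (Finset.min'_le _ _ hx) hne'.symm⟩
      rw [this, Finset.card_erase_of_mem (Finset.min'_mem _ _), (hmF.1 hσ).2, Nat.add_sub_cancel]
    rw [Finset.card_image_of_injOn, Finset.card_product, Finset.card_sigma,
      Finset.sum_congr rfl hcard, Finset.sum_const, hcF, card_cycleEdges hb, smul_eq_mul]
    rintro ⟨⟨σ, x⟩, d⟩ h1 ⟨⟨τ, y⟩, e⟩ h2 h
    simp only [Finset.coe_product, Set.mem_prod, Finset.mem_coe, Finset.mem_sigma,
      Finset.mem_filter] at h1 h2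
    obtain ⟨⟨-, hx, x', hx', hxx⟩, hd⟩ := h1
    obtain ⟨⟨-, hy, y', hy', hyy⟩, he⟩ := h2
    obtain ⟨rfl, rfl, rfl⟩ := stairCut_injective hx hx' hxx hy hy' hyy (hlt hd) (hlt he) h
    rfl
  rw [numFaces, hset, Set.ncard_coe_finset, Finset.card_union_of_disjoint hCD,
    Finset.card_union_of_disjoint hCR, hC, hR, hD]
  ring

end Staircase

end PreAbstractSimplicialComplex

end

noncomputable section

namespace PreAbstractSimplicialComplex

/-! ### Images, suprema and products -/

section

variable {V U : Type*} [DecidableEq V] [DecidableEq U]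

theorem mem_iSup_faces {ι : Type*} {K : ι → PreAbstractSimplicialComplex V} {s : Finset V} :
    s ∈ (⨆ j, K j).faces ↔ ∃ j, s ∈ (K j).faces := by
  constructor
  · intro h
    obtain ⟨_, ⟨L, rfl⟩, hs⟩ := h
    simp only [Set.mem_iUnion, Set.mem_range] at hs
    obtain ⟨⟨j, rfl⟩, hs⟩ := hs
    exact ⟨j, hs⟩
  · rintro ⟨j, h⟩
    exact le_iSup K j h

theorem numFaces_map {A : PreAbstractSimplicialComplex U} {φ : U → V}
    (hφ : Set.InjOn φ {u | {u} ∈ A.faces}) (k : ℕ) : (A.map φ).numFaces k = A.numFaces k := by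
  have hsub : ∀ t ∈ A.faces, (t : Set U) ⊆ {u | {u} ∈ A.faces} := fun t ht u hu =>
    A.face_mono ht (by simpa using hu) (by simp)
  have : {s | s ∈ (A.map φ).faces ∧ s.card = k} =
      (fun t => t.image φ) '' {t | t ∈ A.faces ∧ t.card = k} := by
    ext s
    constructor
    · rintro ⟨⟨t, ht, rfl⟩, hc⟩
      exact ⟨t, ⟨ht, by rwa [Finset.card_image_of_injOn (hφ.mono (hsub t ht))] at hc⟩, rfl⟩
    · rintro ⟨t, ⟨ht, hc⟩, rfl⟩
      exact ⟨⟨t, ht, rfl⟩, by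
        change (t.image φ).card = k
        rwa [Finset.card_image_of_injOn (hφ.mono (hsub t ht))]⟩
  rw [numFaces, this, Set.InjOn.ncard_image]
  · rfl
  · intro t ht t' ht' h
    have h' : (t : Set U) = t' := (hφ.image_eq_image_iff (hsub t ht.1) (hsub t' ht'.1)).1 (by
      simpa only [Finset.coe_image] using congrArg (fun s : Finset V => (s : Set V)) h)
    exact_mod_cast h'

/-- Two vertices joined by an edge path. -/
def Joined (K : PreAbstractSimplicialComplex V) (u v : V) : Prop := Nonempty (EdgePath K u v)

namespace Joined

variable {K : PreAbstractSimplicialComplex V} {u v w : V}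

theorem refl (u : V) : K.Joined u u := ⟨.nil u⟩

theorem symm (h : K.Joined u v) : K.Joined v u := h.map EdgePath.reverse

theorem trans (h : K.Joined u v) (h' : K.Joined v w) : K.Joined u w := by
  obtain ⟨p⟩ := h
  obtain ⟨q⟩ := h'
  exact ⟨p.append q⟩

theorem of_edge (h : {u, v} ∈ K.faces) : K.Joined u v := ⟨.single h⟩

theorem mono {L : PreAbstractSimplicialComplex V} (h : K.Joined u v) (hL : K ≤ L) :
    L.Joined u v := h.map (EdgePath.mono hL)

theorem map {A : PreAbstractSimplicialComplex U} {a c : U} (h : A.Joined a c) (φ : U → V) :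
    (A.map φ).Joined (φ a) (φ c) := by
  obtain ⟨p⟩ := h
  induction p with
  | nil u => exact refl _
  | @cons u v w e p ih =>
    exact (of_edge (K := A.map φ) ⟨{u, v}, e, by simp⟩).trans ih

end Joined

end

section

variable {U : Type*} [LinearOrder U] {A : PreAbstractSimplicialComplex U} {b : ℕ} {hb : 3 ≤ b}

theorem prod_circle_joined (hA : A.IsConnected) {p q : U × ℕ} (hp : {p.1} ∈ A.faces)
    (hq : {q.1} ∈ A.faces) (hp2 : p.2 < b) (hq2 : q.2 < b) :
    (A.prod (standardCycle b hb).toComplex).Joined p q := by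
  have hvert : ∀ (w : U) (k : ℕ), {w} ∈ A.faces → k < b →
      (A.prod (standardCycle b hb).toComplex).Joined (w, 0) (w, k) := by
    intro w k hw hk
    induction k with
    | zero => exact Joined.refl _
    | succ k ih =>
      refine (ih (by omega)).trans (Joined.of_edge (vertical_mem hw ?_))
      have := (standardCycle b hb).edge_mem k
      rwa [standardCycle_vert, standardCycle_vert, Nat.mod_eq_of_lt (by omega),
        Nat.mod_eq_of_lt hk] at this
  have hhor : (A.prod (standardCycle b hb).toComplex).Joined (p.1, 0) (q.1, 0) := by
    refine hA.induction (P := fun w => Joined _ (p.1, 0) (w, 0)) (fun u v huv _ h => ?_) hp hq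
      (Joined.refl _)
    exact h.trans (Joined.of_edge (horizontal_mem huv (standardCycle_singleton_mem hb (by omega))))
  exact ((hvert _ _ hp hp2).symm.trans hhor).trans (hvert _ _ hq hq2)

end

end PreAbstractSimplicialComplex

open PreAbstractSimplicialComplex

/-! ### Vertices and edges of closed polygons. -/

namespace SimpleCycle

variable {V : Type*} [LinearOrder V] (c : SimpleCycle V)

theorem vert_mod (i : ℕ) : c.vert (i % c.length) = c.vert i := by
  conv_rhs => rw [← Nat.mod_add_div i c.length]
  generalize i / c.length = d
  induction d with
  | zero => simp
  | succ d ih => rw [Nat.mul_succ, ← Nat.add_assoc, c.periodic, ih]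

theorem vert_eq_iff {i j : ℕ} : c.vert i = c.vert j ↔ i % c.length = j % c.length := by
  have h3 := c.three_le
  constructor
  · intro h
    rw [← c.vert_mod i, ← c.vert_mod j] at h
    exact c.injective _ (Nat.mod_lt _ (by omega)) _ (Nat.mod_lt _ (by omega)) h
  · intro h
    rw [← c.vert_mod i, h, c.vert_mod]

theorem singleton_mem (i : ℕ) : {c.vert i} ∈ c.toComplex.faces := ⟨by simp, i, by simp⟩

theorem exists_of_singleton_mem {v : V} (h : {v} ∈ c.toComplex.faces) :
    ∃ i < c.length, c.vert i = v := by
  have h3 := c.three_le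
  obtain ⟨-, i, hi⟩ := h
  have := hi (Finset.mem_singleton_self v)
  rw [Finset.mem_insert, Finset.mem_singleton] at this
  rcases this with rfl | rfl
  · exact ⟨i % c.length, Nat.mod_lt _ (by omega), c.vert_mod i⟩
  · exact ⟨(i + 1) % c.length, Nat.mod_lt _ (by omega), c.vert_mod _⟩

theorem vert_succ_ne (i : ℕ) : c.vert i ≠ c.vert (i + 1) := by
  rw [Ne, c.vert_eq_iff]
  have h3 := c.three_le
  have hlt := Nat.mod_lt i (by omega : 0 < c.length)
  rw [Nat.add_mod, Nat.mod_eq_of_lt (by omega : 1 < c.length)]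
  by_cases h : i % c.length + 1 < c.length
  · rw [Nat.mod_eq_of_lt h]
    omega
  · have : i % c.length + 1 = c.length := by omega
    rw [this, Nat.mod_self]
    omega

theorem card_le {s : Finset V} (hs : s ∈ c.toComplex.faces) : s.card ≤ 2 := by
  obtain ⟨-, i, hi⟩ := hs
  exact (Finset.card_le_card hi).trans Finset.card_le_two

theorem exists_of_card_two {s : Finset V} (hs : s ∈ c.toComplex.faces) (hc : s.card = 2) :
    ∃ i < c.length, s = {c.vert i, c.vert (i + 1)} := by
  have h3 := c.three_le
  obtain ⟨-, i, hi⟩ := hs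
  refine ⟨i % c.length, Nat.mod_lt _ (by omega), ?_⟩
  have e : c.vert (i % c.length + 1) = c.vert (i + 1) := by
    rw [c.vert_eq_iff, Nat.mod_add_mod]
  rw [e, c.vert_mod]
  exact Finset.eq_of_subset_of_card_le hi (by rw [hc]; exact Finset.card_le_two)

/-- A polygon with at least three vertices passes through each edge once; with two vertices this
would fail. -/
theorem edge_injective {i j : ℕ} (hi : i < c.length) (hj : j < c.length)
    (h : ({c.vert i, c.vert (i + 1)} : Finset V) = {c.vert j, c.vert (j + 1)}) : i = j := by
  have h3 := c.three_le
  have h1 : c.vert i ∈ ({c.vert j, c.vert (j + 1)} : Finset V) := by rw [← h]; simp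
  have h2 : c.vert (i + 1) ∈ ({c.vert j, c.vert (j + 1)} : Finset V) := by rw [← h]; simp
  simp only [Finset.mem_insert, Finset.mem_singleton, c.vert_eq_iff, Nat.mod_eq_of_lt hi,
    Nat.mod_eq_of_lt hj] at h1 h2
  have hs : ∀ k, k < c.length → (k + 1) % c.length = if k + 1 = c.length then 0 else k + 1 := by
    intro k hk
    split_ifs with h
    · rw [h, Nat.mod_self]
    · exact Nat.mod_eq_of_lt (by omega)
  rw [hs j hj] at h1
  rw [hs i hi, hs j hj] at h2
  clear hs h
  by_cases a1 : i + 1 = c.length <;> by_cases a2 : j + 1 = c.length <;>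
    simp only [a1, a2, if_true, if_false] at h1 h2 <;> omega

theorem numFaces_one : c.toComplex.numFaces 1 = c.length := by
  rw [numFaces, ← Set.ncard_coe_finset (s := Finset.range c.length) |>.trans (Finset.card_range _)]
  symm
  refine Set.ncard_congr (fun i _ => {c.vert i}) ?_ ?_ ?_
  · intro i _
    exact ⟨c.singleton_mem i, Finset.card_singleton _⟩
  · intro i j hi hj h
    simp only [Finset.coe_range, Set.mem_Iio] at hi hj
    exact c.injective i hi j hj (Finset.singleton_injective h)
  · rintro s ⟨hs, hc⟩
    obtain ⟨v, rfl⟩ := Finset.card_eq_one.1 hc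
    obtain ⟨i, hi, rfl⟩ := c.exists_of_singleton_mem hs
    exact ⟨i, by simpa using hi, rfl⟩

theorem numFaces_two : c.toComplex.numFaces 2 = c.length := by
  rw [numFaces, ← Set.ncard_coe_finset (s := Finset.range c.length) |>.trans (Finset.card_range _)]
  symm
  refine Set.ncard_congr (fun i _ => {c.vert i, c.vert (i + 1)}) ?_ ?_ ?_
  · intro i _
    exact ⟨c.edge_mem i, Finset.card_pair (c.vert_succ_ne i)⟩
  · intro i j hi hj h
    simp only [Finset.coe_range, Set.mem_Iio] at hi hj
    exact c.edge_injective hi hj h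
  · rintro s ⟨hs, hc⟩
    obtain ⟨i, hi, rfl⟩ := c.exists_of_card_two hs hc
    exact ⟨i, by simpa using hi, rfl⟩

theorem finite_faces : c.toComplex.faces.Finite := by
  refine Set.Finite.subset (Finset.finite_toSet
    ((Finset.range c.length).image c.vert).powerset) ?_
  intro s hs
  rw [Finset.mem_coe, Finset.mem_powerset]
  intro v hv
  obtain ⟨i, hi, rfl⟩ := c.exists_of_singleton_mem
    (c.toComplex.face_mono hs (by simpa using hv) (by simp))
  exact Finset.mem_image_of_mem _ (by simpa using hi)

end SimpleCycle

namespace PreAbstractSimplicialComplex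

theorem numFaces_eq_zero {V : Type*} [LinearOrder V] {K : PreAbstractSimplicialComplex V} {d k : ℕ}
    (h : ∀ s ∈ K.faces, s.card ≤ d) (hk : d < k) : K.numFaces k = 0 := by
  have : {s | s ∈ K.faces ∧ s.card = k} = ∅ := by
    ext s
    simp only [Set.mem_ofPred_eq, Set.mem_empty_iff_false, iff_false]
    rintro ⟨hs, rfl⟩
    exact absurd (h s hs) (by omega)
  rw [numFaces, this, Set.ncard_empty]

end PreAbstractSimplicialComplex

/-! ### The composing space and the connected sum -/

namespace ComposingSpace

variable {V U : Type*} [LinearOrder V] [LinearOrder U] {n : ℕ} (Y : ComposingSpace V U n)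

theorem vertex_mem_prod {p : U × ℕ} (h : {p} ∈ (Y.W.prod Y.fibre.toComplex).faces) :
    {p.1} ∈ Y.W.faces ∧ p.2 < Y.b :=
  ⟨by simpa using h.1, standardCycle_lt (hb := Y.three_le) h.2.1 (by simp)⟩

theorem injOn_prod : Set.InjOn Y.φ {p | {p} ∈ (Y.W.prod Y.fibre.toComplex).faces} :=
  Y.φ_injOn.mono fun _ h => Y.vertex_mem_prod h

theorem prod_inner_le (j : Fin n) :
    (Y.inner j).toComplex.prod Y.fibre.toComplex ≤ Y.W.prod Y.fibre.toComplex :=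
  fun _ h => ⟨Y.inner_le j h.1, h.2⟩

theorem torus_le (j : Fin n) : Y.torus j ≤ Y.toComplex := by
  rintro _ ⟨t, ht, rfl⟩
  exact ⟨t, Y.prod_inner_le j ht, rfl⟩

theorem card_le {s : Finset V} (hs : s ∈ Y.toComplex.faces) : s.card ≤ 4 := by
  obtain ⟨t, ht, rfl⟩ := hs
  refine Finset.card_image_le.trans ?_
  have hσ := Y.surface.card_le ht.1
  rcases mem_prod_circle (hb := Y.three_le) ht with ⟨i, hi, h⟩ | ⟨e, he, x, hx, h | ⟨-, h⟩⟩
  · rw [h]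
    exact Finset.card_image_le.trans (by omega)
  · rw [h, card_stair hx ((mem_cycleEdges (hb := Y.three_le)).1 he).1]
    omega
  · rw [h, card_stairCut ((mem_cycleEdges (hb := Y.three_le)).1 he).1]
    omega

theorem finite_faces : Y.toComplex.faces.Finite := by
  refine Set.Finite.subset (Finset.finite_toSet
    ((Y.surface.finite.toFinset.sup id ×ˢ Finset.range Y.b).image Y.φ).powerset) ?_
  rintro _ ⟨t, ht, rfl⟩
  change t.image Y.φ ∈ _
  rw [Finset.mem_coe, Finset.mem_powerset]
  refine Finset.image_subset_image fun p hp => ?_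
  rw [Finset.mem_product, mem_sup_faces, Finset.mem_range]
  exact Y.vertex_mem_prod (PreAbstractSimplicialComplex.face_mono _ ht (by simpa using hp)
    (by simp))

theorem numFaces_succ (k : ℕ) : Y.toComplex.numFaces (k + 1) =
    Y.b * ((k + 1) * Y.W.numFaces (k + 1) + k * Y.W.numFaces k) := by
  rw [toComplex, numFaces_map Y.injOn_prod,
    numFaces_prod_circle (hb := Y.three_le) Y.surface.finite]

theorem numFaces_torus_succ (j : Fin n) (k : ℕ) : (Y.torus j).numFaces (k + 1) =
    Y.b * ((k + 1) * (Y.inner j).toComplex.numFaces (k + 1) +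
      k * (Y.inner j).toComplex.numFaces k) := by
  have hinj : Set.InjOn Y.φ {p | {p} ∈ ((Y.inner j).toComplex.prod Y.fibre.toComplex).faces} :=
    Y.injOn_prod.mono fun p h => Y.prod_inner_le j (a := {p}) h
  rw [torus, numFaces_map hinj, numFaces_prod_circle (hb := Y.three_le) (Y.inner j).finite_faces]

end ComposingSpace

namespace ConnectedSumExterior

variable {V U : Type*} [LinearOrder V] [LinearOrder U] {n : ℕ} (X : ConnectedSumExterior V U n)

theorem mem_M {s : Finset V} :
    s ∈ X.M.faces ↔ s ∈ X.Y.toComplex.faces ∨ ∃ j, s ∈ (X.piece j).faces := by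
  rw [← mem_iSup_faces]
  rfl

theorem mem_torus {j : Fin n} {s : Finset V} : s ∈ (X.Y.torus j).faces ↔
    s ∈ (X.piece j).faces ∧ s ∈ X.Y.toComplex.faces := by
  rw [← X.piece_inter j]
  rfl

theorem piece_unique {i j : Fin n} {s : Finset V} (hi : s ∈ (X.piece i).faces)
    (hj : s ∈ (X.piece j).faces) : i = j := by
  by_contra h
  have h' := X.piece_disjoint i j h
  have : s ∈ (X.piece i ⊓ X.piece j).faces := ⟨hi, hj⟩
  rw [h'] at this
  exact this

theorem card_le {s : Finset V} (hs : s ∈ X.M.faces) : s.card ≤ 4 := by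
  rcases X.mem_M.1 hs with h | ⟨j, h⟩
  · exact X.Y.card_le h
  · exact (X.isKnotExterior j).manifold.card_le h

theorem finite_faces : X.M.faces.Finite := by
  have : X.M.faces = X.Y.toComplex.faces ∪ ⋃ j, (X.piece j).faces := by
    ext s
    rw [X.mem_M, Set.mem_union, Set.mem_iUnion]
  rw [this]
  exact X.Y.finite_faces.union (Set.finite_iUnion fun j => (X.isKnotExterior j).manifold.finite)

/-- Inclusion and exclusion: the pieces are disjoint from each other, and each meets `Y` exactly in
its torus. -/
theorem numFaces_M (k : ℕ) : X.M.numFaces k + ∑ j, (X.Y.torus j).numFaces k =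
    X.Y.toComplex.numFaces k + ∑ j, (X.piece j).numFaces k := by
  classical
  have hfin : ∀ {K : PreAbstractSimplicialComplex V}, K ≤ X.M → K.faces.Finite := fun h =>
    X.finite_faces.subset h
  have hY : X.Y.toComplex ≤ X.M := le_sup_left
  have hT : ∀ j, X.Y.torus j ≤ X.M := fun j => (X.Y.torus_le j).trans hY
  rw [numFaces_eq_card X.finite_faces, numFaces_eq_card (hfin hY),
    Finset.sum_congr rfl fun j _ => numFaces_eq_card (hfin (hT j)) k,
    Finset.sum_congr rfl fun j _ => numFaces_eq_card (hfin (X.piece_le j)) k]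
  have hcard : ∀ j, ((hfin (X.piece_le j)).toFinset.filter fun s => s.card = k).card =
      ((hfin (X.piece_le j)).toFinset.filter fun s => s.card = k ∧
        s ∉ X.Y.toComplex.faces).card +
      ((hfin (hT j)).toFinset.filter fun s => s.card = k).card := by
    intro j
    rw [← Finset.card_filter_add_card_filter_not (fun s => s ∉ X.Y.toComplex.faces),
      Finset.filter_filter, Finset.filter_filter]
    congr 2
    ext s
    simp only [Finset.mem_filter, Set.Finite.mem_toFinset, not_not, X.mem_torus]
    tauto
  rw [Finset.sum_congr rfl fun j _ => hcard j, Finset.sum_add_distrib, ← add_assoc]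
  congr 1
  rw [← Finset.card_biUnion, ← Finset.card_union_of_disjoint]
  · congr 1
    ext s
    simp only [Finset.mem_filter, Finset.mem_union, Finset.mem_biUnion, Set.Finite.mem_toFinset,
      X.mem_M, Finset.mem_univ, true_and]
    by_cases h : s ∈ X.Y.toComplex.faces
    · simp [h]
    · simp [h]
  · rw [Finset.disjoint_left]
    intro s hs h
    simp only [Finset.mem_filter, Finset.mem_biUnion, Set.Finite.mem_toFinset] at hs h
    obtain ⟨j, -, -, -, h⟩ := h
    exact h hs.1
  · intro i _ j _ hij
    rw [Function.onFun, Finset.disjoint_left]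
    intro s hi hj
    simp only [Finset.mem_filter, Set.Finite.mem_toFinset] at hi hj
    exact hij (X.piece_unique hi.1 hj.1)

/-- The Euler characteristic of the exterior of a connected sum is zero. -/
theorem euler_M : X.M.numFaces 1 + X.M.numFaces 3 = X.M.numFaces 2 + X.M.numFaces 4 := by
  have hW4 : X.Y.W.numFaces 4 = 0 :=
    numFaces_eq_zero (fun s hs => X.Y.surface.card_le hs) (by norm_num)
  have h3 : ∀ j, (X.Y.inner j).toComplex.numFaces 3 = 0 := fun j =>
    numFaces_eq_zero (fun s hs => (X.Y.inner j).card_le hs) (by norm_num)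
  have h4 : ∀ j, (X.Y.inner j).toComplex.numFaces 4 = 0 := fun j =>
    numFaces_eq_zero (fun s hs => (X.Y.inner j).card_le hs) (by norm_num)
  -- All constituents have Euler characteristic zero: the pieces because their boundary has twice as
  -- many triangles as vertices, the tori and `Y` by the count of faces of a product with a circle.
  have hpiece : ∀ j, (X.piece j).numFaces 1 + (X.piece j).numFaces 3 =
      (X.piece j).numFaces 2 + (X.piece j).numFaces 4 := by
    intro j
    have hE := X.isKnotExterior j
    have := hE.manifold.euler_eq_zero (by
      rw [hE.boundary_eq, X.Y.numFaces_torus_succ j 2, X.Y.numFaces_torus_succ j 0, h3,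
        SimpleCycle.numFaces_one, SimpleCycle.numFaces_two]
      ring)
    omega
  have htorus : ∀ j, (X.Y.torus j).numFaces 1 + (X.Y.torus j).numFaces 3 =
      (X.Y.torus j).numFaces 2 + (X.Y.torus j).numFaces 4 := by
    intro j
    rw [X.Y.numFaces_torus_succ j 0, X.Y.numFaces_torus_succ j 1, X.Y.numFaces_torus_succ j 2,
      X.Y.numFaces_torus_succ j 3, h3, h4]
    ring
  have hY : X.Y.toComplex.numFaces 1 + X.Y.toComplex.numFaces 3 =
      X.Y.toComplex.numFaces 2 + X.Y.toComplex.numFaces 4 := by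
    rw [X.Y.numFaces_succ 0, X.Y.numFaces_succ 1, X.Y.numFaces_succ 2, X.Y.numFaces_succ 3, hW4]
    ring
  have e1 := X.numFaces_M 1
  have e2 := X.numFaces_M 2
  have e3 := X.numFaces_M 3
  have e4 := X.numFaces_M 4
  have s1 := Finset.sum_congr rfl fun j (_ : j ∈ Finset.univ) => hpiece j
  have s2 := Finset.sum_congr rfl fun j (_ : j ∈ Finset.univ) => htorus j
  simp only [Finset.sum_add_distrib] at s1 s2
  omega

theorem torus_vertex_mem (j : Fin n) : {X.pieceBase j} ∈ (X.Y.torus j).faces := by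
  obtain ⟨h, -⟩ := (X.isKnotExterior j).meridian
  exact h ((X.Y.meridian j).singleton_mem 0)

theorem base_mem : {X.base} ∈ X.Y.toComplex.faces :=
  X.Y.outerMeridian_le (X.Y.outerMeridian.singleton_mem 0)

theorem Y_joined {u v : V} (hu : {u} ∈ X.Y.toComplex.faces) (hv : {v} ∈ X.Y.toComplex.faces) :
    X.Y.toComplex.Joined u v := by
  have key : ∀ {u}, {u} ∈ X.Y.toComplex.faces → ∃ p : U × ℕ, {p.1} ∈ X.Y.W.faces ∧ p.2 < X.Y.b ∧
      X.Y.φ p = u := by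
    rintro u ⟨t, ht, h⟩
    change t.image X.Y.φ = {u} at h
    obtain ⟨p, hp⟩ := PreAbstractSimplicialComplex.face_nonempty _ ht
    have := X.Y.vertex_mem_prod (PreAbstractSimplicialComplex.face_mono _ ht
      (Finset.singleton_subset_iff.2 hp) (by simp))
    refine ⟨p, this.1, this.2, ?_⟩
    have := Finset.mem_image_of_mem X.Y.φ hp
    rwa [h, Finset.mem_singleton] at this
  obtain ⟨p, hp1, hp2, rfl⟩ := key hu
  obtain ⟨q, hq1, hq2, rfl⟩ := key hv
  exact (prod_circle_joined (hb := X.Y.three_le) X.Y.connected hp1 hq1 hp2 hq2).map X.Y.φ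

theorem M_connected : X.M.IsConnected := by
  have hY : X.Y.toComplex ≤ X.M := le_sup_left
  have key : ∀ u, {u} ∈ X.M.faces → X.M.Joined u X.base := by
    intro u hu
    rcases X.mem_M.1 hu with h | ⟨j, h⟩
    · exact (X.Y_joined h X.base_mem).mono hY
    · have hj := X.mem_torus.1 (X.torus_vertex_mem j)
      have h1 : (X.piece j).Joined u (X.pieceBase j) :=
        (X.isKnotExterior j).connected.2 _ _ h hj.1
      exact (h1.mono (X.piece_le j)).trans ((X.Y_joined hj.2 X.base_mem).mono hY)
  exact ⟨⟨X.base, hY X.base_mem⟩, fun u v hu hv => (key u hu).trans (key v hv).symm⟩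

end ConnectedSumExterior

end

noncomputable section

namespace PreAbstractSimplicialComplex

/-! ### Surjectivity of the top coboundary map -/

section TopCohomology

variable {V : Type*} [LinearOrder V] {Γ : Type*} [Group Γ]
  {K : PreAbstractSimplicialComplex V} {A : Type*} [AddCommGroup A] [Module ℂ A]
  {r : Representation ℂ Γ A} {G : V → V → Γ} {i : ℕ}

/-- The set of vertices of a simplex. -/
def Simplex.support (s : K.Simplex i) : Finset V := Finset.univ.image s.1

theorem Simplex.support_mem (s : K.Simplex i) : s.support ∈ K.faces := s.2.2

theorem Simplex.card_support (s : K.Simplex i) : s.support.card = i + 1 := by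
  rw [support, Finset.card_image_of_injective _ s.2.1.injective, Finset.card_univ,
    Fintype.card_fin]

theorem Simplex.support_injective : Function.Injective (support : K.Simplex i → Finset V) :=
  fun _ _ h => (K.simplexEquiv i).injective (Subtype.ext h)

theorem Simplex.exists_support_eq {t : Finset V} (ht : t ∈ K.faces) (hc : t.card = i + 1) :
    ∃ s : K.Simplex i, s.support = t := by
  obtain ⟨s, hs⟩ := (K.simplexEquiv i).surjective ⟨t, ht, hc⟩
  exact ⟨s, congrArg Subtype.val hs⟩

theorem Simplex.support_face (s : K.Simplex (i + 1)) (k : Fin (i + 2)) :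
    (s.face k).support = s.support.erase (s.1 k) := by
  ext x
  simp only [support, face, Finset.mem_image, Finset.mem_univ, true_and, Finset.mem_erase,
    Function.comp_apply]
  constructor
  · rintro ⟨a, rfl⟩
    exact ⟨fun h => Fin.succAbove_ne k a (s.2.1.injective h), _, rfl⟩
  · rintro ⟨hne, a, rfl⟩
    have hak : a ≠ k := fun h => hne (h ▸ rfl)
    obtain ⟨c, rfl⟩ := Fin.exists_succAbove_eq hak
    exact ⟨c, rfl⟩

theorem Simplex.face_injective (s : K.Simplex (i + 1)) : Function.Injective s.face := by
  intro k l h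
  have h' := congrArg support h
  rw [support_face, support_face] at h'
  by_contra hne
  have : s.1 k ∈ s.support.erase (s.1 l) :=
    Finset.mem_erase.2 ⟨fun h => hne (s.2.1.injective h), Finset.mem_image_of_mem _
      (Finset.mem_univ k)⟩
  rw [← h'] at this
  exact Finset.notMem_erase _ _ this

theorem Simplex.exists_face_eq {s : K.Simplex (i + 1)} {e : K.Simplex i}
    (h : e.support ⊆ s.support) : ∃ k, s.face k = e := by
  have hlt : e.support.card < s.support.card := by
    rw [e.card_support, s.card_support]
    omega
  obtain ⟨x, hx, hxe⟩ := Finset.exists_mem_notMem_of_card_lt_card hlt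
  obtain ⟨k, -, rfl⟩ := Finset.mem_image.1 hx
  refine ⟨k, support_injective ?_⟩
  rw [support_face]
  symm
  refine Finset.eq_of_subset_of_card_le ?_ ?_
  · intro y hy
    exact Finset.mem_erase.2 ⟨fun h => hxe (h ▸ hy), h hy⟩
  · rw [Finset.card_erase_of_mem hx, s.card_support, e.card_support]
    omega

/-- A criterion for every cochain of degree `i + 1` to be the coboundary of a cochain that
vanishes on a given set `N` of faces. -/
theorem exists_funCoboundary_eq (hK : K.faces.Finite) (N : Set (Finset V))
    (hprop : ∀ S : Finset V → Prop,
      (∀ t s, t ∈ K.faces → t ∉ N → s ∈ K.faces → t.card = i + 1 → s.card = i + 2 → t ⊆ s →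
        (∀ s' ∈ K.faces, s'.card = i + 2 → t ⊆ s' → s' ≠ s → S s') → S s) →
      ∀ s ∈ K.faces, s.card = i + 2 → S s)
    (c : K.Simplex (i + 1) → A) : ∃ f : K.Simplex i → A, (∀ t, t.support ∈ N → f t = 0) ∧
      K.funCoboundary r G i f = c := by
  classical
  have := finite_simplex hK (i + 1)
  have := Fintype.ofFinite (K.Simplex (i + 1))
  let N' : Submodule ℂ (K.Simplex i → A) :=
    { carrier := {f | ∀ t, t.support ∈ N → f t = 0}
      add_mem' := fun {f g} hf hg t ht => by rw [Pi.add_apply, hf t ht, hg t ht, add_zero]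
      zero_mem' := fun _ _ => rfl
      smul_mem' := fun z f hf t ht => by rw [Pi.smul_apply, hf t ht, smul_zero] }
  suffices h : N'.map (K.funCoboundary r G i) = ⊤ by
    have hc : c ∈ N'.map (K.funCoboundary r G i) := by rw [h]; trivial
    exact hc
  by_contra hne
  -- If some cochain is not reached, a nonzero functional `φ` kills all coboundaries of cochains
  -- vanishing on `N`. The propagation hypothesis is applied to the property that `φ` vanishes on
  -- cochains supported on one simplex.
  obtain ⟨φ, hφ, hle⟩ := Submodule.exists_le_ker_of_lt_top _ (lt_top_iff_ne_top.2 hne)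
  have hsum : ∀ c : K.Simplex (i + 1) → A, φ c = ∑ σ, φ (Pi.single σ (c σ)) := by
    intro c
    rw [← map_sum, Finset.univ_sum_single]
  have hS := hprop (fun s => ∀ σ : K.Simplex (i + 1), σ.support = s → ∀ a,
      φ (Pi.single σ a) = 0) ?_
  · refine hφ (LinearMap.ext fun c => ?_)
    rw [hsum, LinearMap.zero_apply]
    exact Finset.sum_eq_zero fun σ _ => hS _ σ.support_mem σ.card_support σ rfl _
  · rintro t s ht htN hs htc hsc hts hS σ rfl a
    obtain ⟨e, rfl⟩ := Simplex.exists_support_eq ht htc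
    obtain ⟨k, hk⟩ := Simplex.exists_face_eq hts
    set g := G (σ.1 0) ((σ.face k).1 0) with hg
    -- The value at the face `e` is normalized so that its coboundary takes the value `a` on `σ`.
    -- This coboundary is supported on the simplices containing `e`, and `φ` is already known to
    -- vanish on all of them except `σ`.
    set a' : A := (-1 : ℂ) ^ (k : ℕ) • r g⁻¹ a with ha'
    have hmem : K.funCoboundary r G i (Pi.single e a') ∈ N'.map (K.funCoboundary r G i) := by
      refine Submodule.mem_map_of_mem fun t ht => ?_
      have : t ≠ e := fun h => htN (h ▸ ht)
      exact Pi.single_eq_of_ne this _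
    have h0 : φ (K.funCoboundary r G i (Pi.single e a')) = 0 := hle hmem
    rw [hsum, Finset.sum_eq_single σ] at h0
    · have hval : K.funCoboundary r G i (Pi.single e a') σ = a := by
        change ∑ l : Fin (i + 2), (-1 : ℂ) ^ (l : ℕ) • r (G (σ.1 0) ((σ.face l).1 0))
          ((Pi.single e a' : K.Simplex i → A) (σ.face l)) = a
        rw [Finset.sum_eq_single k]
        · rw [hk, Pi.single_eq_same, ← hk, ← hg, ha', map_smul, rep_cancel_inv, smul_smul,
            ← mul_pow]
          norm_num
        · intro l _ hl
          have : σ.face l ≠ e := fun h => hl (σ.face_injective (h.trans hk.symm))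
          rw [Pi.single_eq_of_ne this, map_zero, smul_zero]
        · simp
      rwa [hval] at h0
    · intro τ _ hτ
      by_cases hsub : e.support ⊆ τ.support
      · exact hS _ τ.support_mem τ.card_support hsub
          (fun h => hτ (Simplex.support_injective h)) τ rfl _
      · have hval : K.funCoboundary r G i (Pi.single e a') τ = 0 := by
          change ∑ l : Fin (i + 2), (-1 : ℂ) ^ (l : ℕ) • r (G (τ.1 0) ((τ.face l).1 0))
            ((Pi.single e a' : K.Simplex i → A) (τ.face l)) = 0
          refine Finset.sum_eq_zero fun l _ => ?_
          have : τ.face l ≠ e := fun h => hsub (by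
            rw [← h, Simplex.support_face]
            exact Finset.erase_subset _ _)
          rw [Pi.single_eq_of_ne this, map_zero, smul_zero]
        rw [hval, Pi.single_zero, map_zero]
    · simp

end TopCohomology

/-! ### Faces shared by at most two simplices. -/

section Cofaces

variable {V : Type*} [DecidableEq V] {K : PreAbstractSimplicialComplex V}

theorem eq_of_ncard_cofaces_eq_one {t s s' : Finset V} (h : (K.cofaces t).ncard = 1)
    (hs : s ∈ K.faces) (hts : t ⊆ s) (hsc : s.card = t.card + 1)
    (hs' : s' ∈ K.faces) (hts' : t ⊆ s') (hsc' : s'.card = t.card + 1) : s = s' := by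
  rw [← ncard_cofaces] at h
  obtain ⟨a, ha⟩ := Set.ncard_eq_one.1 h
  have h1 : s ∈ ({a} : Set (Finset V)) := ha ▸ ⟨hs, hts, hsc⟩
  have h2 : s' ∈ ({a} : Set (Finset V)) := ha ▸ ⟨hs', hts', hsc'⟩
  exact h1.trans h2.symm

theorem exists_of_ncard_cofaces_eq_one {t : Finset V} (h : (K.cofaces t).ncard = 1) :
    ∃ s ∈ K.faces, t ⊆ s ∧ s.card = t.card + 1 := by
  rw [← ncard_cofaces] at h
  obtain ⟨a, ha⟩ := Set.ncard_eq_one.1 h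
  have : a ∈ {r | r ∈ K.faces ∧ t ⊆ r ∧ r.card = t.card + 1} := ha ▸ rfl
  exact ⟨a, this⟩

theorem eq_or_eq_of_ncard_cofaces {t s s' : Finset V}
    (h : (K.cofaces t).ncard = 1 ∨ (K.cofaces t).ncard = 2) (hs : s ∈ K.faces) (hts : t ⊆ s)
    (hsc : s.card = t.card + 1) (hs' : s' ∈ K.faces) (hts' : t ⊆ s')
    (hsc' : s'.card = t.card + 1) (hne : s ≠ s') {q : Finset V} (hq : q ∈ K.faces) (htq : t ⊆ q)
    (hqc : q.card = t.card + 1) : q = s ∨ q = s' := by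
  rcases h with h | h
  · exact absurd (eq_of_ncard_cofaces_eq_one h hs hts hsc hs' hts' hsc') hne
  · rw [← ncard_cofaces] at h
    obtain ⟨a, c, hac, he⟩ := Set.ncard_eq_two.1 h
    have h1 : s ∈ ({a, c} : Set (Finset V)) := he ▸ ⟨hs, hts, hsc⟩
    have h2 : s' ∈ ({a, c} : Set (Finset V)) := he ▸ ⟨hs', hts', hsc'⟩
    have h3 : q ∈ ({a, c} : Set (Finset V)) := he ▸ ⟨hq, htq, hqc⟩
    simp only [Set.mem_insert_iff, Set.mem_singleton_iff] at h1 h2 h3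
    rcases h1 with rfl | rfl <;> rcases h2 with rfl | rfl <;> tauto

theorem IsSurface.eq_or_eq (hK : K.IsSurface) {t s s' q : Finset V} (ht : t.card = 2)
    (hs : s ∈ K.faces) (hts : t ⊆ s) (hsc : s.card = 3) (hs' : s' ∈ K.faces) (hts' : t ⊆ s')
    (hsc' : s'.card = 3) (hne : s ≠ s') (hq : q ∈ K.faces) (htq : t ⊆ q) (hqc : q.card = 3) :
    q = s ∨ q = s' :=
  eq_or_eq_of_ncard_cofaces (hK.ncard_cofaces (K.face_mono hs hts
    (Finset.card_pos.1 (by omega))) ht) hs hts (by omega) hs' hts' (by omega) hne hq htq (by omega)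

theorem IsThreeManifold.eq_or_eq (hK : K.IsThreeManifold) {t s s' q : Finset V} (ht : t.card = 3)
    (hs : s ∈ K.faces) (hts : t ⊆ s) (hsc : s.card = 4) (hs' : s' ∈ K.faces) (hts' : t ⊆ s')
    (hsc' : s'.card = 4) (hne : s ≠ s') (hq : q ∈ K.faces) (htq : t ⊆ q) (hqc : q.card = 4) :
    q = s ∨ q = s' :=
  eq_or_eq_of_ncard_cofaces (hK.ncard_cofaces (K.face_mono hs hts
    (Finset.card_pos.1 (by omega))) ht) hs hts (by omega) hs' hts' (by omega) hne hq htq (by omega)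

end Cofaces

/-! ### Adjacent simplices over a triangle -/

section Staircase

variable {U : Type*} [LinearOrder U] {A : PreAbstractSimplicialComplex U} {b : ℕ} {hb : 3 ≤ b}

/-- Over a complex of dimension two, faces at one height and cuts have at most three vertices. So a
tetrahedron must have a doubled column over a triangle. -/
theorem eq_stair_of_card_eq_four (hA : ∀ σ ∈ A.faces, σ.card ≤ 3) {t : Finset (U × ℕ)}
    (ht : t ∈ (A.prod (standardCycle b hb).toComplex).faces) (hc : t.card = 4) :
    ∃ σ ∈ A.faces, σ.card = 3 ∧ ∃ e ∈ cycleEdges b, ∃ x ∈ σ, t = stair σ x e.1 e.2 := by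
  have hσ := fst_mem_of_mem_prod ht
  have h3 := hA _ hσ
  have hlt : ∀ {e}, e ∈ cycleEdges b → e.1 < e.2 := fun he => ((mem_cycleEdges (hb := hb)).1 he).1
  rcases mem_prod_circle ht with ⟨i, hi, h⟩ | ⟨e, he, x, hx, h | ⟨-, h⟩⟩
  · rw [h] at hc
    have := Finset.card_image_le (s := t.image Prod.fst) (f := fun y => (y, i))
    omega
  · refine ⟨_, hσ, ?_, e, he, x, hx, h⟩
    rw [h, card_stair hx (hlt he)] at hc
    omega
  · rw [h, card_stairCut (hlt he)] at hc
    omega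

/-- The doubled column and the two heights are visible in the smaller face. Thus a tetrahedron
containing a wall over an edge doubles the same column, over a triangle containing that edge. -/
theorem stair_subset_stair {σ τ : Finset U} {x y : U} {d e : ℕ × ℕ} (hx : x ∈ σ) (hy : y ∈ τ)
    (hd : d.1 < d.2) (he : e.1 < e.2) (h : stair σ x d.1 d.2 ⊆ stair τ y e.1 e.2) :
    σ ⊆ τ ∧ x = y ∧ d = e := by
  have h1 : σ ⊆ τ := by
    rw [← image_fst_stair (σ := σ), ← image_fst_stair (σ := τ)]
    exact Finset.image_subset_image h
  have h2 := Finset.image_subset_image (f := Prod.snd) h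
  rw [image_snd_stair hx, image_snd_stair hy] at h2
  have h3 : d = e := by
    have a1 := h2 (by simp : d.1 ∈ _)
    have a2 := h2 (by simp : d.2 ∈ _)
    simp only [Finset.mem_insert, Finset.mem_singleton] at a1 a2
    ext <;> omega
  subst h3
  refine ⟨h1, ?_, rfl⟩
  have a1 := h (mem_stair.2 ⟨hx, Or.inl ⟨le_rfl, rfl⟩⟩ : (x, d.1) ∈ _)
  have a2 := h (mem_stair.2 ⟨hx, Or.inr ⟨le_rfl, rfl⟩⟩ : (x, d.2) ∈ _)
  rw [mem_stair] at a1 a2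
  simp only [hd.ne', hd.ne, and_false, and_true, false_or, or_false] at a1 a2
  exact le_antisymm a1.2 a2.2

/-- If `p` is the column just before `x`, a cut between them lies only in the tetrahedra of the same
prism that double one of these two columns. -/
theorem stairCut_subset_stair_iff {σ τ : Finset U} {x y p : U} {d e : ℕ × ℕ} (hx : x ∈ σ)
    (hp : p ∈ σ) (hpx : p < x) (hpx' : ∀ z ∈ σ, z < x → z ≤ p) (hy : y ∈ τ) (hc : τ.card = σ.card)
    (hd : d.1 < d.2) (he : e.1 < e.2) (h : stairCut σ x d.1 d.2 ⊆ stair τ y e.1 e.2) :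
    σ = τ ∧ (y = x ∨ y = p) ∧ d = e := by
  have h1 : σ ⊆ τ := by
    rw [← image_fst_stairCut (σ := σ), ← image_fst_stair (σ := τ)]
    exact Finset.image_subset_image h
  have h1' := Finset.eq_of_subset_of_card_le h1 hc.le
  have h2 := Finset.image_subset_image (f := Prod.snd) h
  rw [image_snd_stairCut hx hp hpx, image_snd_stair hy] at h2
  have h3 : d = e := by
    have a1 := h2 (by simp : d.1 ∈ _)
    have a2 := h2 (by simp : d.2 ∈ _)
    simp only [Finset.mem_insert, Finset.mem_singleton] at a1 a2
    ext <;> omega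
  subst h3 h1'
  refine ⟨rfl, ?_, rfl⟩
  have a1 := h (mem_stairCut.2 ⟨hp, Or.inl ⟨hpx, rfl⟩⟩ : (p, d.1) ∈ _)
  have a2 := h (mem_stairCut.2 ⟨hx, Or.inr ⟨le_rfl, rfl⟩⟩ : (x, d.2) ∈ _)
  rw [mem_stair] at a1 a2
  simp only [hd.ne', hd.ne, and_false, and_true, false_or, or_false] at a1 a2
  rcases lt_or_ge y x with h | h
  · exact Or.inr (le_antisymm (hpx' y hy h) a1.2)
  · exact Or.inl (le_antisymm a2.2 h)

end Staircase

end PreAbstractSimplicialComplex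

open PreAbstractSimplicialComplex

/-! ### Reaching the triangles of `W` from the outer boundary. -/

namespace ComposingSpace

variable {V U : Type*} [LinearOrder V] [LinearOrder U] {n : ℕ} (Y : ComposingSpace V U n)

theorem ncard_cofaces_of_inner {j : Fin n} {t : Finset U} (ht : t ∈ (Y.inner j).toComplex.faces)
    (hc : t.card = 2) : (Y.W.cofaces t).ncard = 1 := by
  rw [← mem_boundary_iff (Y.inner_le j ht) hc, Y.boundary_eq]
  exact (le_iSup (fun j => (Y.inner j).toComplex) j).trans le_sup_right ht

/-- A property of the triangles of `W` holds for all of them if it holds for every triangle all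
of whose neighbours, across an edge that is not in an inner boundary component, have it. -/
theorem triangle_induction {S : Finset U → Prop}
    (hS : ∀ t s, t ∈ Y.W.faces → (∀ j, t ∉ (Y.inner j).toComplex.faces) → s ∈ Y.W.faces →
      t.card = 2 → s.card = 3 → t ⊆ s →
      (∀ s' ∈ Y.W.faces, s'.card = 3 → t ⊆ s' → s' ≠ s → S s') → S s)
    {s : Finset U} (hs : s ∈ Y.W.faces) (hsc : s.card = 3) : S s := by
  -- An edge of the outer boundary lies in only one triangle, so the hypothesis holds there without
  -- any neighbour and provides the first triangle.
  have ht := Y.outer.edge_mem 0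
  set t : Finset U := {Y.outer.vert 0, Y.outer.vert (0 + 1)} with ht_def
  have htc : t.card = 2 := Finset.card_pair (Y.outer.vert_succ_ne 0)
  have htW := Y.outer_le ht
  have h1 : (Y.W.cofaces t).ncard = 1 := by
    rw [← mem_boundary_iff htW htc, Y.boundary_eq]
    exact (le_sup_left (a := Y.outer.toComplex)) ht
  have htN : ∀ j, t ∉ (Y.inner j).toComplex.faces := by
    intro j hj
    have : t ∈ (Y.outer.toComplex ⊓ (Y.inner j).toComplex).faces := ⟨ht, hj⟩
    rw [Y.outer_disjoint j] at this
    exact this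
  obtain ⟨σ, hσ, hts, hσc⟩ := exists_of_ncard_cofaces_eq_one h1
  have hseed : S σ := hS t σ htW htN hσ htc (by omega) hts fun s' hs' hc' hts' hne =>
    absurd (eq_of_ncard_cofaces_eq_one h1 hs' hts' (by omega) hσ hts hσc) hne
  refine Y.surface.induction Y.connected (fun t σ σ' ht htc hσ hσ3 hσ' hσ'3 htσ htσ' h => ?_)
    hσ (by omega) hseed hs hsc
  by_cases hne : σ = σ'
  · exact hne ▸ h
  -- An edge between two different triangles is not in an inner boundary component, whose edges lie
  -- in one triangle only.
  refine hS t σ' ht (fun j hj => ?_) hσ' htc hσ'3 htσ' fun s' hs' hc' hts' hne' => ?_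
  · exact hne (eq_of_ncard_cofaces_eq_one (Y.ncard_cofaces_of_inner hj htc) hσ htσ (by omega)
      hσ' htσ' (by omega))
  · rcases Y.surface.eq_or_eq htc hσ htσ hσ3 hσ' htσ' hσ'3 hne hs' hts' hc' with rfl | rfl
    · exact h
    · exact absurd rfl hne'

/-- Every cochain of degree two on `W` is the coboundary of a cochain that vanishes on the inner
boundary components. -/
theorem exists_relative_coboundary_eq {Γ A : Type*} [Group Γ] [AddCommGroup A] [Module ℂ A]
    {r : Representation ℂ Γ A} {G : U → U → Γ} (c : Y.W.Simplex 2 → A) :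
    ∃ f : Y.W.Simplex 1 → A, (∀ t, (∃ j, t.support ∈ (Y.inner j).toComplex.faces) → f t = 0) ∧
      Y.W.funCoboundary r G 1 f = c :=
  exists_funCoboundary_eq Y.surface.finite {t | ∃ j, t ∈ (Y.inner j).toComplex.faces}
    (fun _ hS _ hs hsc => Y.triangle_induction (fun t s ht htN => hS t s ht
      fun ⟨j, hj⟩ => htN j hj) hs hsc) c

end ComposingSpace

/-! ### Reaching the tetrahedra of `M`, and vanishing of the cohomology in degree three. -/

namespace ConnectedSumExterior

variable {V U : Type*} [LinearOrder V] [LinearOrder U] {n : ℕ} (X : ConnectedSumExterior V U n)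

theorem subset_of_image_subset {s t : Finset (U × ℕ)}
    (hs : s ∈ (X.Y.W.prod X.Y.fibre.toComplex).faces)
    (ht : t ∈ (X.Y.W.prod X.Y.fibre.toComplex).faces) (h : s.image X.Y.φ ⊆ t.image X.Y.φ) :
    s ⊆ t := by
  have hmem : ∀ {s}, s ∈ (X.Y.W.prod X.Y.fibre.toComplex).faces → ∀ p ∈ s,
      {p} ∈ (X.Y.W.prod X.Y.fibre.toComplex).faces := fun hs p hp =>
    PreAbstractSimplicialComplex.face_mono _ hs (by simpa using hp) (by simp)
  intro p hp
  obtain ⟨q, hq, he⟩ := Finset.mem_image.1 (h (Finset.mem_image_of_mem _ hp))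
  rwa [X.Y.injOn_prod (hmem hs p hp) (hmem ht q hq) he.symm]

theorem card_image {s : Finset (U × ℕ)} (hs : s ∈ (X.Y.W.prod X.Y.fibre.toComplex).faces) :
    (s.image X.Y.φ).card = s.card :=
  Finset.card_image_of_injOn (X.Y.injOn_prod.mono fun p hp =>
    PreAbstractSimplicialComplex.face_mono _ hs (by simpa using hp) (by simp))

/-- A face of `Y` in a piece lies in the torus between them. This serves to show that the triangles
crossed inside `Y` are not in any piece, so that all their cofaces are in `Y`. -/
theorem fst_mem_inner {s : Finset (U × ℕ)} (hs : s ∈ (X.Y.W.prod X.Y.fibre.toComplex).faces)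
    {j : Fin n} (h : s.image X.Y.φ ∈ (X.piece j).faces) :
    s.image Prod.fst ∈ (X.Y.inner j).toComplex.faces := by
  obtain ⟨t, ht, he⟩ := X.mem_torus.2 ⟨h, s, hs, rfl⟩
  change t.image X.Y.φ = s.image X.Y.φ at he
  have ht' := X.Y.prod_inner_le j ht
  have : s = t := (X.subset_of_image_subset hs ht' he.ge).antisymm
    (X.subset_of_image_subset ht' hs he.le)
  rw [this]
  exact ht.1

theorem cofaces_of_notMem_piece {s : Finset V} (h : ∀ j, s ∉ (X.piece j).faces) (hs : s.Nonempty)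
    {t : Finset V} (ht : t ∈ X.M.faces) (hst : s ⊆ t) : t ∈ X.Y.toComplex.faces := by
  rcases X.mem_M.1 ht with h' | ⟨j, h'⟩
  · exact h'
  · exact absurd (PreAbstractSimplicialComplex.face_mono _ h' hst hs) (h j)

/-- A property of the tetrahedra of `M` holds for all of them if it holds for every tetrahedron
that has a triangle across which all neighbours have the property. -/
theorem tetrahedron_induction {S : Finset V → Prop}
    (hS : ∀ t s, t ∈ X.M.faces → s ∈ X.M.faces → t.card = 3 → s.card = 4 → t ⊆ s →
      (∀ s' ∈ X.M.faces, s'.card = 4 → t ⊆ s' → s' ≠ s → S s') → S s)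
    {s : Finset V} (hs : s ∈ X.M.faces) (hsc : s.card = 4) : S s := by
  have hYM : X.Y.toComplex ≤ X.M := le_sup_left
  have hE : ∀ {e}, e ∈ cycleEdges X.Y.b → e.1 < e.2 ∧ {e.1, e.2} ∈ X.Y.fibre.toComplex.faces :=
    fun he => (mem_cycleEdges (hb := X.Y.three_le)).1 he
  have hstair : ∀ {σ x e}, σ ∈ X.Y.W.faces → e ∈ cycleEdges X.Y.b →
      stair σ x e.1 e.2 ∈ (X.Y.W.prod X.Y.fibre.toComplex).faces := fun hσ he =>
    stair_mem hσ (hE he).1.le (hE he).2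
  have htet : ∀ {σ x e}, σ ∈ X.Y.W.faces → σ.card = 3 → e ∈ cycleEdges X.Y.b → x ∈ σ →
      ((stair σ x e.1 e.2).image X.Y.φ) ∈ X.M.faces ∧
        ((stair σ x e.1 e.2).image X.Y.φ).card = 4 := fun hσ hc he hx =>
    ⟨hYM ⟨_, hstair hσ he, rfl⟩, by rw [X.card_image (hstair hσ he), card_stair hx (hE he).1, hc]⟩
  have htet' : ∀ {s}, s ∈ X.Y.toComplex.faces → s.card = 4 → ∃ σ ∈ X.Y.W.faces, σ.card = 3 ∧
      ∃ e ∈ cycleEdges X.Y.b, ∃ x ∈ σ, (stair σ x e.1 e.2).image X.Y.φ = s := by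
    rintro _ ⟨t, ht, rfl⟩ hc
    change (t.image X.Y.φ).card = 4 at hc
    rw [X.card_image ht] at hc
    obtain ⟨σ, hσ, hσc, e, he, x, hx, rfl⟩ := eq_stair_of_card_eq_four (hb := X.Y.three_le)
      (fun σ hσ => X.Y.surface.card_le hσ) ht hc
    exact ⟨σ, hσ, hσc, e, he, x, hx, rfl⟩
  -- Over `Y` the induction runs over the triangles of `W`: a triangle has the property if all
  -- tetrahedra in the prisms over it have `S`.
  have hW : ∀ σ ∈ X.Y.W.faces, σ.card = 3 → ∀ e ∈ cycleEdges X.Y.b, ∀ x ∈ σ,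
      S ((stair σ x e.1 e.2).image X.Y.φ) := by
    intro σ hσ hσc
    refine X.Y.triangle_induction (S := fun σ => ∀ e ∈ cycleEdges X.Y.b, ∀ x ∈ σ,
      S ((stair σ x e.1 e.2).image X.Y.φ)) (fun t σ ht htN hσ htc hσc htσ hnb => ?_) hσ hσc
    intro e he
    -- Entering the prism over `σ` through its wall over the edge `t`: this reaches the tetrahedra
    -- whose doubled column is over a vertex of `t`.
    have hside : ∀ x ∈ t, S ((stair σ x e.1 e.2).image X.Y.φ) := by
      intro x hx
      have hT := hstair (x := x) ht he
      have hnot : ∀ j, (stair t x e.1 e.2).image X.Y.φ ∉ (X.piece j).faces := fun j hj => by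
        have := X.fst_mem_inner hT hj
        rw [image_fst_stair] at this
        exact htN j this
      have hsub : stair t x e.1 e.2 ⊆ stair σ x e.1 e.2 := fun p hp => by
        rw [mem_stair] at hp ⊢
        exact ⟨htσ hp.1, hp.2⟩
      obtain ⟨h1, h2⟩ := htet hσ hσc he (htσ hx)
      refine hS _ _ (hYM ⟨_, hT, rfl⟩) h1 (by rw [X.card_image hT, card_stair hx (hE he).1, htc])
        h2 (Finset.image_subset_image hsub) fun s' hs' hc' hts' hne => ?_
      obtain ⟨σ', hσ', hσc', e', he', x', hx', rfl⟩ := htet' (X.cofaces_of_notMem_piece hnot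
        ((PreAbstractSimplicialComplex.face_nonempty _ hT).image _) hs' hts') hc'
      obtain ⟨h3, rfl, rfl⟩ := stair_subset_stair hx hx' (hE he).1 (hE he').1
        (X.subset_of_image_subset hT (hstair hσ' he') hts')
      exact hnb σ' hσ' hσc' h3 (fun h => hne (h ▸ rfl)) e he x hx'
    -- Moving inside the prism: the cut between consecutive columns `p` and `x` separates the two
    -- tetrahedra that double them.
    have hcross : ∀ p x z w, x ∈ σ → p ∈ σ → p < x → (∀ z ∈ σ, z < x → z ≤ p) →
        (z = x ∧ w = p ∨ z = p ∧ w = x) → S ((stair σ w e.1 e.2).image X.Y.φ) →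
        S ((stair σ z e.1 e.2).image X.Y.φ) := by
      intro p x z w hx hp hpx hpx' hzw hw
      have hT : stairCut σ x e.1 e.2 ∈ (X.Y.W.prod X.Y.fibre.toComplex).faces :=
        stairCut_mem hσ (hE he).1.le (hE he).2
      have hnot : ∀ j, (stairCut σ x e.1 e.2).image X.Y.φ ∉ (X.piece j).faces := fun j hj => by
        have := (X.Y.inner j).card_le (X.fst_mem_inner hT hj)
        rw [image_fst_stairCut] at this
        omega
      have hz : z ∈ σ := by rcases hzw with ⟨rfl, -⟩ | ⟨rfl, -⟩ <;> assumption
      have hsub : stairCut σ x e.1 e.2 ⊆ stair σ z e.1 e.2 := fun q hq => by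
        rw [mem_stairCut] at hq
        rw [mem_stair]
        refine ⟨hq.1, ?_⟩
        rcases hzw with ⟨rfl, -⟩ | ⟨rfl, -⟩
        · exact hq.2.imp (fun h => ⟨h.1.le, h.2⟩) id
        · exact hq.2.imp (fun h => ⟨hpx' _ hq.1 h.1, h.2⟩) fun h => ⟨hpx.le.trans h.1, h.2⟩
      obtain ⟨h1, h2⟩ := htet hσ hσc he hz
      refine hS _ _ (hYM ⟨_, hT, rfl⟩) h1 (by rw [X.card_image hT, card_stairCut (hE he).1, hσc])
        h2 (Finset.image_subset_image hsub) fun s' hs' hc' hts' hne => ?_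
      obtain ⟨σ', hσ', hσc', e', he', x', hx', rfl⟩ := htet' (X.cofaces_of_notMem_piece hnot
        ((PreAbstractSimplicialComplex.face_nonempty _ hT).image _) hs' hts') hc'
      obtain ⟨rfl, h3, rfl⟩ := stairCut_subset_stair_iff hx hp hpx hpx' hx' (by omega) (hE he).1
        (hE he').1 (X.subset_of_image_subset hT (hstair hσ' he') hts')
      have : x' = w := by
        have hne' : x' ≠ z := fun h => hne (h ▸ rfl)
        rcases hzw with ⟨rfl, rfl⟩ | ⟨rfl, rfl⟩ <;> tauto
      rwa [this]
    -- Only the column opposite to `t` remains. It is next to another column, above or below, which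
    -- belongs to `t`.
    intro z hz
    by_cases hzt : z ∈ t
    · exact hside z hzt
    have hother : ∀ w ∈ σ, w ≠ z → S ((stair σ w e.1 e.2).image X.Y.φ) := by
      intro w hw hwz
      refine hside w ?_
      by_contra hwt
      have : insert z (insert w t) ⊆ σ :=
        Finset.insert_subset hz (Finset.insert_subset hw htσ)
      have := Finset.card_le_card this
      rw [Finset.card_insert_of_notMem (by simp [hzt, hwz.symm]),
        Finset.card_insert_of_notMem hwt] at this
      omega
    by_cases hup : (σ.filter (z < ·)).Nonempty
    · obtain ⟨x, hx, hmin⟩ := Finset.exists_min_image _ id hup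
      rw [Finset.mem_filter] at hx
      refine hcross z x z x hx.1 hz hx.2 (fun y hy hyx => ?_) (Or.inr ⟨rfl, rfl⟩)
        (hother x hx.1 hx.2.ne')
      by_contra h
      exact absurd (hmin y (Finset.mem_filter.2 ⟨hy, not_le.1 h⟩)) (not_le.2 hyx)
    · have hdown : (σ.filter (· < z)).Nonempty := by
        obtain ⟨w, hw, hwz⟩ := Finset.exists_mem_ne (by omega : 1 < σ.card) z
        rw [Finset.not_nonempty_iff_eq_empty, Finset.filter_eq_empty_iff] at hup
        exact ⟨w, Finset.mem_filter.2 ⟨hw, lt_of_le_of_ne (not_lt.1 (hup hw)) hwz⟩⟩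
      obtain ⟨p, hp, hmax⟩ := Finset.exists_max_image _ id hdown
      rw [Finset.mem_filter] at hp
      exact hcross p z z p hz hp.1 hp.2
        (fun y hy hyz => hmax y (Finset.mem_filter.2 ⟨hy, hyz⟩)) (Or.inl ⟨rfl, rfl⟩)
        (hother p hp.1 hp.2.ne)
  have hY : ∀ s ∈ X.Y.toComplex.faces, s.card = 4 → S s := by
    intro s hs hsc
    obtain ⟨σ, hσ, hσc, e, he, x, hx, rfl⟩ := htet' hs hsc
    exact hW σ hσ hσc e he x hx
  rcases X.mem_M.1 hs with h | ⟨j, h⟩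
  · exact hY s h hsc
  have hM3 := (X.isKnotExterior j).manifold
  have hcof : ∀ t : Finset V, t.card = 3 → t ∈ (X.piece j).faces → ∀ s' ∈ X.M.faces, s'.card = 4 →
      t ⊆ s' → S s' ∨ s' ∈ (X.piece j).faces := by
    intro t htc ht s' hs' hc' hts'
    rcases X.mem_M.1 hs' with h' | ⟨l, h'⟩
    · exact Or.inl (hY s' h' hc')
    · have := X.piece_unique ht (PreAbstractSimplicialComplex.face_mono _ h' hts'
        (Finset.card_pos.1 (by omega)))
      exact Or.inr (this ▸ h')
  -- Entry into a piece through one triangle of its torus: on the side of `Y` the property is known,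
  -- and on the side of the piece there is only one tetrahedron. From there it spreads by
  -- connectedness of the piece.
  obtain ⟨σ, hσ, hσc, hSσ⟩ : ∃ σ ∈ (X.piece j).faces, σ.card = 4 ∧ S σ := by
    have he : ((0, X.Y.b - 1) : ℕ × ℕ) ∈ cycleEdges X.Y.b := Finset.mem_insert_self _ _
    have hT : stair {(X.Y.inner j).vert 0, (X.Y.inner j).vert (0 + 1)} ((X.Y.inner j).vert 0)
        0 (X.Y.b - 1) ∈ ((X.Y.inner j).toComplex.prod X.Y.fibre.toComplex).faces :=
      stair_mem ((X.Y.inner j).edge_mem 0) (hE he).1.le (hE he).2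
    set T := stair {(X.Y.inner j).vert 0, (X.Y.inner j).vert (0 + 1)} ((X.Y.inner j).vert 0)
        0 (X.Y.b - 1) with hT_def
    have htor : T.image X.Y.φ ∈ (X.Y.torus j).faces := ⟨T, hT, rfl⟩
    have hTc : (T.image X.Y.φ).card = 3 := by
      rw [X.card_image (X.Y.prod_inner_le j hT), hT_def, card_stair (by simp) (hE he).1,
        Finset.card_pair ((X.Y.inner j).vert_succ_ne 0)]
    have hpiece := (X.mem_torus.1 htor).1
    have h1 : ((X.piece j).cofaces (T.image X.Y.φ)).ncard = 1 := by
      rw [← mem_boundary_iff hpiece hTc, (X.isKnotExterior j).boundary_eq]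
      exact htor
    obtain ⟨σ, hσ, hts, hσc⟩ := exists_of_ncard_cofaces_eq_one h1
    refine ⟨σ, hσ, by omega, hS _ σ (X.piece_le j hpiece) (X.piece_le j hσ) hTc (by omega) hts
      fun s' hs' hc' hts' hne => ?_⟩
    rcases hcof _ hTc hpiece s' hs' hc' hts' with h' | h'
    · exact h'
    · exact absurd (eq_of_ncard_cofaces_eq_one h1 h' hts' (by omega) hσ hts hσc) hne
  refine hM3.induction (X.isKnotExterior j).connected
    (fun t σ σ' ht htc hσ hσ4 hσ' hσ'4 htσ htσ' h => ?_) hσ hσc hSσ h hsc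
  by_cases hne : σ = σ'
  · exact hne ▸ h
  refine hS t σ' (X.piece_le j ht) (X.piece_le j hσ') htc hσ'4 htσ' fun s' hs' hc' hts' hne' => ?_
  rcases hcof t htc ht s' hs' hc' hts' with h' | h'
  · exact h'
  · rcases hM3.eq_or_eq htc hσ htσ hσ4 hσ' htσ' hσ'4 hne h' hts' hc' with rfl | rfl
    · exact h
    · exact absurd rfl hne'

/-- The twisted cohomology of `M` in degree three vanishes. -/
theorem range_funCoboundary_two {Γ A : Type*} [Group Γ] [AddCommGroup A] [Module ℂ A]
    {r : Representation ℂ Γ A} {G : V → V → Γ} :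
    LinearMap.range (X.M.funCoboundary r G 2) = ⊤ := by
  rw [LinearMap.range_eq_top]
  intro c
  obtain ⟨f, -, hf⟩ := exists_funCoboundary_eq (i := 2) (r := r) (G := G) X.finite_faces ∅
    (fun S hS s hs hsc => X.tetrahedron_induction (fun t s ht hs => hS t s ht (by simp) hs)
      hs hsc) c
  exact ⟨f, hf⟩

end ConnectedSumExterior

end

/-! ### Integrals along closed polygons. -/

noncomputable section

open PreAbstractSimplicialComplex

/-- The sum of a function of pairs of vertices over the edges of a closed polygon. -/
def SimpleCycle.integral {V : Type*} (c : SimpleCycle V) (T : V → V → ℂ) : ℂ :=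
  ∑ i ∈ Finset.range c.length, T (c.vert i) (c.vert (i + 1))

namespace SimpleCycle

variable {V : Type*} [LinearOrder V] (c : SimpleCycle V)

theorem integral_add (S T : V → V → ℂ) : c.integral (S + T) = c.integral S + c.integral T :=
  Finset.sum_add_distrib

theorem integral_smul (a : ℂ) (T : V → V → ℂ) : c.integral (a • T) = a * c.integral T := by
  simp only [integral, Finset.mul_sum]
  rfl

theorem integral_sum {ι : Type*} (s : Finset ι) (T : ι → V → V → ℂ) :
    c.integral (∑ j ∈ s, T j) = ∑ j ∈ s, c.integral (T j) := by
  simp only [integral, Finset.sum_apply]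
  exact Finset.sum_comm

theorem integral_congr {S T : V → V → ℂ}
    (h : ∀ u v, {u, v} ∈ c.toComplex.faces → S u v = T u v) : c.integral S = c.integral T :=
  Finset.sum_congr rfl fun i _ => h _ _ (c.edge_mem i)

theorem integral_coboundary {T : V → V → ℂ} {q : V → ℂ}
    (h : ∀ u v, {u, v} ∈ c.toComplex.faces → T u v = q v - q u) : c.integral T = 0 := by
  rw [c.integral_congr h, integral, Finset.sum_range_sub fun i => q (c.vert i), c.vert_length,
    sub_self]

end SimpleCycle

namespace PreAbstractSimplicialComplex

/-! ### Untwisted one-cocycles -/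

variable {V : Type*} [LinearOrder V] {K : PreAbstractSimplicialComplex V}

/-- Additive 1-cocycles, as functions of pairs of vertices. -/
def IsCocycle (K : PreAbstractSimplicialComplex V) (T : V → V → ℂ) : Prop :=
  ∀ u v w, {u, v, w} ∈ K.faces → T u v + T v w = T u w

/-- Untwisted cochains are treated as twisted ones for the trivial representation of the one-element
group, so that the general results apply to them. -/
theorem isCocycle_iff {T : V → V → ℂ} : K.IsCocycle T ↔
    T ∈ K.pairCocycles (Representation.trivial ℂ Unit ℂ) fun _ _ => 1 := Iff.rfl

theorem isFlat_one {Γ : Type*} [Group Γ] : K.IsFlat fun _ _ => (1 : Γ) :=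
  fun _ _ _ _ => mul_one 1

theorem mem_pairCoboundaries_trivial {T : V → V → ℂ} :
    T ∈ K.pairCoboundaries (Representation.trivial ℂ Unit ℂ) (fun _ _ => 1) ↔
      ∃ q : V → ℂ, ∀ u v, {u, v} ∈ K.faces → T u v = q v - q u := Iff.rfl

namespace IsCocycle

variable {T S : V → V → ℂ}

theorem self (hT : K.IsCocycle T) {u : V} (h : {u} ∈ K.faces) : T u u = 0 := by
  have := hT u u u (by simpa using h)
  simpa using this

theorem symm (hT : K.IsCocycle T) {u v : V} (h : {u, v} ∈ K.faces) : T u v = -T v u := by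
  have e : ({u, v, u} : Finset V) = {u, v} := by ext x; simp; tauto
  have := hT u v u (by rwa [e])
  rw [hT.self (left_mem_of_edge h)] at this
  exact eq_neg_of_add_eq_zero_left this

end IsCocycle

theorem eulerChar_of_card_le_three (hK : K.faces.Finite) (h : ∀ s ∈ K.faces, s.card ≤ 3) :
    K.eulerChar = K.numFaces 1 - K.numFaces 2 + K.numFaces 3 := by
  rw [eulerChar_eq_sum hK, sum_faces hK (fun s hs => (h s hs).trans (by norm_num))
    fun k => (-1) ^ (k - 1), numFaces_eq_zero h (by norm_num : 3 < 4)]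
  norm_num
  ring

/-- A cocycle on a closed polygon with vanishing integral is a coboundary. -/
theorem _root_.SimpleCycle.exists_primitive (c : SimpleCycle V) {T : V → V → ℂ}
    (hT : c.toComplex.IsCocycle T) (h : c.integral T = 0) :
    ∃ q : V → ℂ, ∀ u v, {u, v} ∈ c.toComplex.faces → T u v = q v - q u := by
  classical
  have h3 := c.three_le
  -- The partial sums along the polygon. A vanishing integral makes them periodic, so they descend
  -- to a function of the vertices.
  let Q : ℕ → ℂ := fun k => ∑ i ∈ Finset.range k, T (c.vert i) (c.vert (i + 1))
  have hQ : ∀ k, Q (k + c.length) = Q k := by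
    intro k
    induction k with
    | zero => simpa [Q, SimpleCycle.integral] using h
    | succ k ih =>
      have e : k + 1 + c.length = k + c.length + 1 := by omega
      have e' : Q (k + c.length + 1) =
          Q (k + c.length) + T (c.vert (k + c.length)) (c.vert (k + c.length + 1)) :=
        Finset.sum_range_succ _ _
      have e'' : Q (k + 1) = Q k + T (c.vert k) (c.vert (k + 1)) := Finset.sum_range_succ _ _
      rw [e, e', e'', ih, ← e, c.periodic, c.periodic]
  have hmod : ∀ k, Q (k % c.length) = Q k := by
    intro k
    conv_rhs => rw [← Nat.mod_add_div k c.length]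
    generalize k / c.length = d
    induction d with
    | zero => simp
    | succ d ih => rw [Nat.mul_succ, ← Nat.add_assoc, hQ, ih]
  let q : V → ℂ := fun v => if h : ∃ i, c.vert i = v then Q h.choose else 0
  have hq : ∀ i, q (c.vert i) = Q i := by
    intro i
    have hex : ∃ k, c.vert k = c.vert i := ⟨i, rfl⟩
    have : q (c.vert i) = Q hex.choose := dif_pos hex
    rw [this, ← hmod, c.vert_eq_iff.1 hex.choose_spec, hmod]
  have hstep : ∀ i, T (c.vert i) (c.vert (i + 1)) = q (c.vert (i + 1)) - q (c.vert i) := by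
    intro i
    rw [hq, hq]
    simp only [Q, Finset.sum_range_succ]
    ring
  refine ⟨q, fun u v huv => ?_⟩
  obtain ⟨i, hi⟩ := huv.2
  have hu := hi (by simp : u ∈ _)
  have hv := hi (by simp : v ∈ _)
  simp only [Finset.mem_insert, Finset.mem_singleton] at hu hv
  rcases hu with rfl | rfl <;> rcases hv with rfl | rfl
  · rw [hT.self (c.singleton_mem i), sub_self]
  · exact hstep i
  · rw [hT.symm huv, hstep, neg_sub]
  · rw [hT.self (c.singleton_mem _), sub_self]

end PreAbstractSimplicialComplex

/-! ### The untwisted first cohomology of the disc with holes. -/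

namespace ComposingSpace

variable {V U : Type*} [LinearOrder V] [LinearOrder U] {n : ℕ} (Y : ComposingSpace V U n)

theorem eq_of_mem_inner {i j : Fin n} {s : Finset U} (hi : s ∈ (Y.inner i).toComplex.faces)
    (hj : s ∈ (Y.inner j).toComplex.faces) : i = j := by
  by_contra h
  have : s ∈ ((Y.inner i).toComplex ⊓ (Y.inner j).toComplex).faces := ⟨hi, hj⟩
  rw [Y.inner_disjoint i j h] at this
  exact this

/-- There are cocycles on `W` with prescribed integrals along the inner boundary components. -/
theorem exists_cocycle_integral_eq (a : Fin n → ℂ) :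
    ∃ T : U → U → ℂ, Y.W.IsCocycle T ∧ ∀ j, (Y.inner j).integral T = a j := by
  classical
  -- The function `T₀` is the antisymmetrization of the value `a j` on the first edge of the `j`-th
  -- inner circle. It has the right integrals but need not be a cocycle.
  let e : Fin n → U → U → ℂ := fun j u v =>
    if u = (Y.inner j).vert 0 ∧ v = (Y.inner j).vert 1 then a j else 0
  let T₀ : U → U → ℂ := fun u v => ∑ j, (e j u v - e j v u)
  have hsymm : ∀ u v, T₀ u v = -T₀ v u := by
    intro u v
    simp only [T₀, ← Finset.sum_neg_distrib, neg_sub]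
  have he : ∀ j j' k, e j ((Y.inner j').vert k) ((Y.inner j').vert (k + 1)) =
      if j = j' ∧ k % (Y.inner j').length = 0 then a j else 0 := by
    intro j j' k
    have h3 := (Y.inner j').three_le
    by_cases hj : j = j'
    · subst hj
      simp only [true_and, e, SimpleCycle.vert_eq_iff, Nat.zero_mod]
      congr 1
      rw [eq_iff_iff]
      refine ⟨fun h => h.1, fun h => ⟨h, ?_⟩⟩
      rw [Nat.add_mod, h, zero_add, Nat.mod_mod]
    · have : ¬((Y.inner j').vert k = (Y.inner j).vert 0 ∧
          (Y.inner j').vert (k + 1) = (Y.inner j).vert 1) := fun h =>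
        hj (Y.eq_of_mem_inner ((Y.inner j).singleton_mem 0)
          (h.1 ▸ (Y.inner j').singleton_mem k))
      simp [e, this, hj]
  have he' : ∀ j j' k, e j ((Y.inner j').vert (k + 1)) ((Y.inner j').vert k) = 0 := by
    intro j j' k
    have h3 := (Y.inner j').three_le
    refine if_neg fun h => ?_
    have hj : j = j' := Y.eq_of_mem_inner ((Y.inner j).singleton_mem 1)
      (h.2 ▸ (Y.inner j').singleton_mem k)
    subst hj
    simp only [SimpleCycle.vert_eq_iff, Nat.zero_mod] at h
    obtain ⟨h1, h2⟩ := h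
    rw [Nat.add_mod, h2, Nat.mod_eq_of_lt (by omega : 1 < (Y.inner j).length),
      Nat.mod_eq_of_lt (by omega)] at h1
    omega
  have hint : ∀ j, (Y.inner j).integral T₀ = a j := by
    intro j
    have h3 := (Y.inner j).three_le
    have hval : ∀ k ∈ Finset.range (Y.inner j).length,
        T₀ ((Y.inner j).vert k) ((Y.inner j).vert (k + 1)) = if k = 0 then a j else 0 := by
      intro k hk
      rw [Finset.mem_range] at hk
      simp only [T₀, he, he', sub_zero, Nat.mod_eq_of_lt hk, ite_and, Finset.sum_ite_eq',
        Finset.mem_univ, if_true]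
    rw [SimpleCycle.integral, Finset.sum_congr rfl hval, Finset.sum_ite_eq',
      if_pos (Finset.mem_range.2 (by omega))]
  let c₀ : Y.W.Simplex 1 → ℂ := pairRestrict Y.W ℂ T₀
  -- The coboundary of `c₀` is also the coboundary of a cochain vanishing on the inner circles,
  -- because the outer circle is left free. Subtracting it gives a cocycle with the same integrals.
  obtain ⟨f, hf0, hf⟩ := Y.exists_relative_coboundary_eq
    (r := Representation.trivial ℂ Unit ℂ) (G := fun _ _ => 1)
    (Y.W.funCoboundary (Representation.trivial ℂ Unit ℂ) (fun _ _ => 1) 1 c₀)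
  obtain ⟨T, hT, hTc⟩ := exists_pairRestrict_eq (K := Y.W)
    (r := Representation.trivial ℂ Unit ℂ) (G := fun _ _ => 1) isFlat_one (c := c₀ - f)
    (by rw [map_sub, hf, sub_self])
  have hT' : Y.W.IsCocycle T := isCocycle_iff.2 hT
  refine ⟨T, hT', fun j => ?_⟩
  rw [← hint j]
  refine (Y.inner j).integral_congr fun u v huv => ?_
  have hlt : ∀ u v, u < v → {u, v} ∈ (Y.inner j).toComplex.faces → T u v = T₀ u v := by
    intro u v hlt huv
    have hW := Y.inner_le j huv
    have h1 := congrFun hTc (Simplex.edge hlt hW)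
    change T u v = T₀ u v - f (Simplex.edge hlt hW) at h1
    rw [h1, hf0, sub_zero]
    refine ⟨j, ?_⟩
    have : (Simplex.edge hlt hW).support = {u, v} := by
      change Finset.univ.image ![u, v] = {u, v}
      ext x
      simp [eq_comm]
    rwa [this]
  rcases lt_trichotomy u v with h | rfl | h
  · exact hlt u v h huv
  · rw [hT'.self (left_mem_of_edge (Y.inner_le j huv))]
    have := hsymm u u
    exact (self_eq_neg.1 this).symm
  · rw [hT'.symm (Y.inner_le j huv), hsymm, hlt v u h (edge_symm huv)]

/-- The Euler characteristic is `1 - n`, `H²` vanishes because `d¹` is onto, and `H⁰` has dimension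
at most one by connectedness. -/
theorem finrank_cohomology_W_le :
    Module.finrank ℂ (Subquotient (LinearMap.ker (Y.W.funCoboundary
      (Representation.trivial ℂ Unit ℂ) (fun _ _ => 1) 1)) (Y.W.funCoboundaries
      (Representation.trivial ℂ Unit ℂ) (fun _ _ => 1) 1)) ≤ n := by
  have hfin := Y.surface.finite
  have hfin' := finite_simplex hfin
  have hG : Y.W.IsFlat fun _ _ => (1 : Unit) := isFlat_one
  set r := Representation.trivial ℂ Unit ℂ
  set G : U → U → Unit := fun _ _ => 1
  have r0 := LinearMap.finrank_range_add_finrank_ker (Y.W.funCoboundary r G 0)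
  have r1 := LinearMap.finrank_range_add_finrank_ker (Y.W.funCoboundary r G 1)
  have hs : LinearMap.range (Y.W.funCoboundary r G 1) = ⊤ := by
    rw [LinearMap.range_eq_top]
    intro c
    obtain ⟨f, -, hf⟩ := Y.exists_relative_coboundary_eq (r := r) (G := G) c
    exact ⟨f, hf⟩
  rw [hs, finrank_top, finrank_cochain hfin, finrank_cochain hfin, Module.finrank_self] at r1
  rw [finrank_cochain hfin, Module.finrank_self] at r0
  have q1 := finrank_subquotient (Z := LinearMap.ker (Y.W.funCoboundary r G 1))
    (B := Y.W.funCoboundaries r G 1) (by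
      rintro _ ⟨p, rfl⟩
      exact funCoboundary_comp_zero hG p)
  change _ + Module.finrank ℂ (LinearMap.range (Y.W.funCoboundary r G 0)) = _ at q1
  have hker : Module.finrank ℂ (LinearMap.ker (Y.W.funCoboundary r G 0)) ≤ 1 := by
    obtain ⟨w, hw⟩ := Y.connected.1
    refine (LinearMap.finrank_le_finrank_of_injective
      (f := (LinearMap.proj (Simplex.vertex hw)).comp (Submodule.subtype _)) ?_).trans
      (Module.finrank_self ℂ).le
    rw [← LinearMap.ker_eq_bot, eq_bot_iff]
    rintro ⟨p, hp⟩ hpw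
    change p (Simplex.vertex hw) = 0 at hpw
    rw [LinearMap.mem_ker] at hp
    have hstep : ∀ u v, u < v → ∀ (huv : {u, v} ∈ Y.W.faces),
        p (.vertex (right_mem_of_edge huv)) = p (.vertex (left_mem_of_edge huv)) := by
      intro u v hlt huv
      have h := congrFun hp (Simplex.edge hlt huv)
      rw [funCoboundary_zero_apply hG] at h
      have e1 : (Simplex.edge hlt huv).face 0 = .vertex (right_mem_of_edge huv) := by
        ext a; fin_cases a; rfl
      have e2 : (Simplex.edge hlt huv).face 1 = .vertex (left_mem_of_edge huv) := by
        ext a; fin_cases a; rfl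
      rw [e1, e2] at h
      exact sub_eq_zero.1 h
    let P : U → Prop := fun v => ∀ hv : {v} ∈ Y.W.faces, p (Simplex.vertex hv) = 0
    have hall : ∀ v, {v} ∈ Y.W.faces → P v := by
      intro v hv
      refine Y.connected.induction (P := P)
        (fun u v huv hne h hv => ?_) hw hv (fun _ => hpw)
      rcases lt_or_gt_of_ne hne with hlt | hlt
      · exact (hstep u v hlt huv).trans (h _)
      · exact (hstep v u hlt (edge_symm huv)).symm.trans (h _)
    rw [Submodule.mem_bot]
    refine Subtype.ext (funext fun s => ?_)
    have hs := hall (s.1 0) (s.vertex_mem 0) (s.vertex_mem 0)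
    have e : Simplex.vertex (s.vertex_mem 0) = s := by
      ext a
      fin_cases a
      rfl
    rwa [e] at hs
  have he := Y.euler
  rw [eulerChar_of_card_le_three hfin fun s hs => Y.surface.card_le hs] at he
  have r0' := r0.trans (Nat.mul_one (Y.W.numFaces 1))
  have r1' := ((congrArg (· + _) (Nat.mul_one (Y.W.numFaces 3))).symm.trans r1).trans
    (Nat.mul_one (Y.W.numFaces 2))
  omega

/-- A cocycle on `W` with vanishing integrals along the inner boundary components is a
coboundary. -/
theorem exists_primitive {T : U → U → ℂ} (hT : Y.W.IsCocycle T)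
    (h : ∀ j, (Y.inner j).integral T = 0) :
    ∃ q : U → ℂ, ∀ u v, {u, v} ∈ Y.W.faces → T u v = q v - q u := by
  classical
  by_contra hne
  rw [← mem_pairCoboundaries_trivial] at hne
  have hfin' := finite_simplex Y.surface.finite
  choose S hS hSint using fun j => Y.exists_cocycle_integral_eq (Pi.single j 1)
  set r := Representation.trivial ℂ Unit ℂ
  set G : U → U → Unit := fun _ _ => 1
  have hG : Y.W.IsFlat G := isFlat_one
  -- If `T` were not a coboundary, the cocycles `S j` dual to the inner circles together with `T`
  -- would give `n + 1` independent classes, more than `finrank_cohomology_W_le` permits.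
  let L : (Fin n → ℂ) × ℂ →ₗ[ℂ] (U → U → ℂ) :=
    { toFun := fun p => ∑ j, p.1 j • S j + p.2 • T
      map_add' := fun p q => by
        simp only [Prod.fst_add, Prod.snd_add, Pi.add_apply, add_smul, Finset.sum_add_distrib]
        abel
      map_smul' := fun a p => by
        simp only [Prod.smul_fst, Prod.smul_snd, Pi.smul_apply, smul_eq_mul, mul_smul,
          smul_add, Finset.smul_sum, RingHom.id_apply] }
  have hLmem : ∀ p, L p ∈ Y.W.pairCocycles r G := fun p =>
    Submodule.add_mem _ (Submodule.sum_mem _ fun j _ => Submodule.smul_mem _ _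
      (isCocycle_iff.1 (hS j))) (Submodule.smul_mem _ _ (isCocycle_iff.1 hT))
  have hLint : ∀ p j, (Y.inner j).integral (L p) = p.1 j := by
    intro p j
    change (Y.inner j).integral (∑ i, p.1 i • S i + p.2 • T) = p.1 j
    rw [SimpleCycle.integral_add, SimpleCycle.integral_sum, SimpleCycle.integral_smul, h j,
      mul_zero, add_zero]
    simp only [SimpleCycle.integral_smul, hSint]
    simp [Pi.single_apply]
  let F : (Fin n → ℂ) × ℂ →ₗ[ℂ] LinearMap.ker (Y.W.funCoboundary r G 1) :=
    LinearMap.codRestrict _ ((pairRestrict Y.W ℂ).comp L) fun p =>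
      LinearMap.mem_ker.2 (funCoboundary_pairRestrict hG (hLmem p))
  have hinj : Function.Injective ((Submodule.mkQ ((Y.W.funCoboundaries r G 1).submoduleOf
      (LinearMap.ker (Y.W.funCoboundary r G 1)))).comp F) := by
    rw [← LinearMap.ker_eq_bot, eq_bot_iff]
    intro p hp
    rw [LinearMap.mem_ker, LinearMap.comp_apply, Submodule.mkQ_apply,
      Submodule.Quotient.mk_eq_zero, mem_submoduleOf_iff] at hp
    have hp' : L p ∈ Y.W.pairCoboundaries r G := (pairRestrict_mem_coboundaries hG (hLmem p)).1 hp
    obtain ⟨q, hq⟩ := mem_pairCoboundaries_trivial.1 hp'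
    have h1 : p.1 = 0 := by
      funext j
      rw [← hLint p j]
      exact (Y.inner j).integral_coboundary fun u v huv => hq u v (Y.inner_le j huv)
    have h2 : L p = p.2 • T := by
      change ∑ j, p.1 j • S j + p.2 • T = _
      rw [h1]
      simp
    rw [Submodule.mem_bot]
    refine Prod.ext h1 ?_
    by_contra h3
    refine hne ?_
    have := Submodule.smul_mem _ p.2⁻¹ (h2 ▸ hp' : p.2 • T ∈ Y.W.pairCoboundaries r G)
    rwa [smul_smul, inv_mul_cancel₀ h3, one_smul] at this
  have hle := LinearMap.finrank_le_finrank_of_injective hinj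
  have := hle.trans Y.finrank_cohomology_W_le
  rw [Module.finrank_prod, Module.finrank_fin_fun, Module.finrank_self] at this
  omega

end ComposingSpace

end

noncomputable section

open PreAbstractSimplicialComplex Matrix

local notation "SL2" => SpecialLinearGroup (Fin 2) ℂ
local notation "sl2" => LieAlgebra.SpecialLinear.sl (Fin 2) ℂ

namespace PreAbstractSimplicialComplex

/-! ### Affine transports -/

section Affine

variable {V : Type*} [DecidableEq V] {Γ : Type*} [Group Γ] {K : PreAbstractSimplicialComplex V}
  {A : Type*} [AddCommGroup A] [Module ℂ A] {r : Representation ℂ Γ A} {G : V → V → Γ}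
  {f : V → V → A}

/-- The affine permutation `x ↦ r(g) x - c`. -/
def affinePerm (r : Representation ℂ Γ A) (g : Γ) (c : A) : Equiv.Perm A where
  toFun x := r g x - c
  invFun x := r g⁻¹ (x + c)
  left_inv x := by simp
  right_inv x := by simp

theorem affinePerm_apply (g : Γ) (c x : A) : affinePerm r g c x = r g x - c := rfl

/-- A function of pairs of vertices that satisfies the equation of a twisted cocycle. -/
def IsTwistedCocycle (K : PreAbstractSimplicialComplex V) (r : Representation ℂ Γ A)
    (G : V → V → Γ) (f : V → V → A) : Prop :=
  ∀ u v w, {u, v, w} ∈ K.faces → f u v + r (G u v) (f v w) = f u w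

/-- A twisted cocycle is the translation part of a flat transport by affine maps, and a primitive of
it is the same as a parallel section of that transport. Finding primitives becomes finding fixed
points of affine holonomy. -/
theorem IsFlat.affine (hG : K.IsFlat G) (hf : K.IsTwistedCocycle r G f) :
    K.IsFlat fun u v => affinePerm r (G u v) (f u v) := by
  intro u v w h
  ext x
  change r (G u v) (r (G v w) x - f v w) - f u v = r (G u w) x - f u w
  rw [← hG u v w h, ← hf u v w h, map_sub, map_mul, Module.End.mul_apply]
  abel

theorem hol_affine {u v : V} (p : EdgePath K u v) (x : A) :
    (p.hol (fun u v => affinePerm r (G u v) (f u v)) : Equiv.Perm A) x =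
      r (p.hol G) x + (p.hol (fun u v => affinePerm r (G u v) (f u v)) : Equiv.Perm A) 0 := by
  induction p with
  | nil u => simp [EdgePath.hol]
  | @cons u v w h p ih =>
    change affinePerm r (G u v) (f u v) ((p.hol _ : Equiv.Perm A) x) = r (G u v * p.hol G) x +
      affinePerm r (G u v) (f u v) ((p.hol _ : Equiv.Perm A) 0)
    rw [affinePerm_apply, affinePerm_apply, ih, map_add, map_mul, Module.End.mul_apply]
    abel

/-- The crossed homomorphism on the edge-path group defined by a twisted cocycle. -/
def crossedHol (hG : K.IsFlat G) (hf : K.IsTwistedCocycle r G f) {b : V} (α : Pi1 K b) : A :=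
  -holHom (hG.affine hf) b α 0

theorem holHom_affine (hG : K.IsFlat G) (hf : K.IsTwistedCocycle r G f) {b : V} (α : Pi1 K b)
    (x : A) : holHom (hG.affine hf) b α x = r (holHom hG b α) x - crossedHol hG hf α := by
  rw [crossedHol, sub_neg_eq_add, holHom_apply, holHom_apply]
  induction α using PathClass.ind with
  | h p => exact hol_affine p x

theorem crossedHol_mul (hG : K.IsFlat G) (hf : K.IsTwistedCocycle r G f) {b : V}
    (α β : Pi1 K b) : crossedHol hG hf (α * β) =
      crossedHol hG hf α + r (holHom hG b α) (crossedHol hG hf β) := by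
  have h : crossedHol hG hf (α * β) =
      -(holHom (hG.affine hf) b α (holHom (hG.affine hf) b β 0)) := by
    rw [crossedHol, map_mul, Equiv.Perm.mul_apply]
  have h' : holHom (hG.affine hf) b β 0 = -crossedHol hG hf β := by rw [crossedHol, neg_neg]
  rw [h, h', holHom_affine hG hf, map_neg]
  abel

/-- If the crossed homomorphism is principal, defined by `x`, then `x` is fixed by the affine
holonomy of all loops and extends to a parallel section. -/
theorem exists_primitive_of_crossedHol (hG : K.IsFlat G) (hf : K.IsTwistedCocycle r G f)
    (hK : K.IsConnected) {b : V} (hb : {b} ∈ K.faces) {x : A}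
    (hx : ∀ α, crossedHol hG hf α = r (holHom hG b α) x - x) :
    ∃ s : V → A, ∀ u v, {u, v} ∈ K.faces → f u v = r (G u v) (s v) - s u := by
  obtain ⟨s, -, hs⟩ := (hG.affine hf).exists_section hK hb (x₀ := x) fun α => by
    rw [Equiv.Perm.smul_def, holHom_affine hG hf, hx, sub_sub_cancel]
  refine ⟨s, fun u v h => ?_⟩
  have := hs u v h
  rw [Equiv.Perm.smul_def, affinePerm_apply] at this
  rw [← this, sub_sub_cancel]

/-- The action of a group on a representation. -/
abbrev repMulAction (r : Representation ℂ Γ A) : MulAction Γ A where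
  smul g a := r g a
  one_smul a := by change r 1 a = a; simp
  mul_smul g h a := by change r (g * h) a = r g (r h a); simp

theorem exists_parallel (hG : K.IsFlat G) (hK : K.IsConnected) {b : V} (hb : {b} ∈ K.faces) {x : A}
    (hx : ∀ α, r (holHom hG b α) x = x) :
    ∃ s : V → A, s b = x ∧ ∀ u v, {u, v} ∈ K.faces → r (G u v) (s v) = s u :=
  let _ := repMulAction r
  hG.exists_section hK hb hx

theorem parallel_hol {s : V → A} (hs : ∀ u v, {u, v} ∈ K.faces → r (G u v) (s v) = s u)
    {u v : V} (p : EdgePath K u v) : r (p.hol G) (s v) = s u :=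
  let _ := repMulAction r
  EdgePath.hol_smul_section (G := G) (s := s) hs p

theorem parallel_holHom (hG : K.IsFlat G) {s : V → A}
    (hs : ∀ u v, {u, v} ∈ K.faces → r (G u v) (s v) = s u) {b : V} (α : Pi1 K b) :
    r (holHom hG b α) (s b) = s b := by
  rw [holHom_apply]
  induction α using PathClass.ind with
  | h p => exact parallel_hol hs p

theorem parallel_unique (hK : K.IsConnected) {b : V} (hb : {b} ∈ K.faces) {s s' : V → A}
    (hs : ∀ u v, {u, v} ∈ K.faces → r (G u v) (s v) = s u)
    (hs' : ∀ u v, {u, v} ∈ K.faces → r (G u v) (s' v) = s' u) (h : s b = s' b) {v : V}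
    (hv : {v} ∈ K.faces) : s v = s' v :=
  let _ := repMulAction r
  hK.section_unique (G := G) hb hs hs' h hv

end Affine

end PreAbstractSimplicialComplex

/-! ### Holonomy along sequences of vertices. -/

section SeqHol

variable {V Γ Γ' : Type*} [Group Γ] [Group Γ']

theorem seqHol_map (ψ : Γ →* Γ') (G : V → V → Γ) (v : ℕ → V) (k : ℕ) :
    seqHol (fun u v => ψ (G u v)) v k = ψ (seqHol G v k) := by
  induction k with
  | zero => exact (map_one ψ).symm
  | succ k ih => simp only [seqHol, ih, map_mul]

theorem seqHol_gauge (h : V → Γ) (G : V → V → Γ) (v : ℕ → V) (k : ℕ) :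
    seqHol (fun u v => (h u)⁻¹ * G u v * h v) v k = (h (v 0))⁻¹ * seqHol G v k * h (v k) := by
  induction k with
  | zero => simp [seqHol]
  | succ k ih =>
    simp only [seqHol, ih]
    group

theorem seqHol_comp {U : Type*} (φ : U → V) (G : V → V → Γ) (v : ℕ → U) (k : ℕ) :
    seqHol (fun p q => G (φ p) (φ q)) v k = seqHol G (fun i => φ (v i)) k := by
  induction k with
  | zero => rfl
  | succ k ih => simp only [seqHol, ih]

theorem seqHol_ofAdd_complex (T : V → V → ℂ) (v : ℕ → V) (k : ℕ) :
    seqHol (fun u v => Multiplicative.ofAdd (T u v)) v k =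
      Multiplicative.ofAdd (∑ i ∈ Finset.range k, T (v i) (v (i + 1))) := by
  induction k with
  | zero => rfl
  | succ k ih => rw [seqHol, ih, Finset.sum_range_succ, ofAdd_add]

end SeqHol

/-! ### Diagonal matrices -/

theorem IsDiagSL.mul {g h : SL2} (hg : IsDiagSL g) (hh : IsDiagSL h) : IsDiagSL (g * h) := by
  constructor
  · change (g.1 * h.1) 0 1 = 0
    rw [Matrix.mul_apply, Fin.sum_univ_two, hg.1, hh.1, zero_mul, mul_zero, add_zero]
  · change (g.1 * h.1) 1 0 = 0
    rw [Matrix.mul_apply, Fin.sum_univ_two, hg.2, hh.2, zero_mul, mul_zero, add_zero]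

theorem isDiagSL_one : IsDiagSL (1 : SL2) := ⟨by simp, by simp⟩

theorem IsDiagSL.mul_apply_zero {g h : SL2} (hg : IsDiagSL g) :
    (g * h).1 0 0 = g.1 0 0 * h.1 0 0 := by
  change (g.1 * h.1) 0 0 = _
  rw [Matrix.mul_apply, Fin.sum_univ_two, hg.1, zero_mul, add_zero]

/-- The upper left entry of a diagonal matrix, as a unit. -/
def diagUnit (g : SL2) : ℂˣ := if h : g.1 0 0 ≠ 0 then Units.mk0 _ h else 1

theorem IsDiagSL.coe_diagUnit {g : SL2} (hg : IsDiagSL g) : (diagUnit g : ℂ) = g.1 0 0 := by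
  have h : g.1 0 0 ≠ 0 := left_ne_zero_of_mul_eq_one hg.mul_eq_one
  rw [diagUnit, dif_pos h, Units.val_mk0]

theorem IsDiagSL.coe_diagUnit_inv {g : SL2} (hg : IsDiagSL g) :
    ((diagUnit g)⁻¹ : ℂˣ) = g.1 1 1 := by
  rw [Units.val_inv_eq_inv_val, hg.coe_diagUnit]
  exact inv_eq_of_mul_eq_one_right hg.mul_eq_one

theorem IsDiagSL.diagUnit_mul {g h : SL2} (hg : IsDiagSL g) (hh : IsDiagSL h) :
    diagUnit (g * h) = diagUnit g * diagUnit h := by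
  ext
  rw [Units.val_mul, hg.coe_diagUnit, hh.coe_diagUnit, (hg.mul hh).coe_diagUnit,
    hg.mul_apply_zero]

theorem diagUnit_diagSL (m : ℂˣ) : diagUnit (diagSL m) = m := by
  ext
  rw [(isDiagSL_diagSL m).coe_diagUnit]
  simp [diagSL]

theorem seqHol_diag {V : Type*} {G : V → V → SL2} {v : ℕ → V}
    (h : ∀ i, IsDiagSL (G (v i) (v (i + 1)))) (k : ℕ) :
    IsDiagSL (seqHol G v k) ∧
      seqHol (fun u v => diagUnit (G u v)) v k = diagUnit (seqHol G v k) := by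
  induction k with
  | zero =>
    refine ⟨isDiagSL_one, ?_⟩
    ext
    change ((1 : ℂˣ) : ℂ) = diagUnit 1
    rw [isDiagSL_one.coe_diagUnit]
    simp
  | succ k ih =>
    refine ⟨ih.1.mul (h k), ?_⟩
    rw [seqHol, seqHol, ih.2, ih.1.diagUnit_mul (h k)]

/-- The one-dimensional representation of the group of units of `ℂ`. -/
def unitsRep : Representation ℂ ℂˣ ℂ where
  toFun a := (a : ℂ) • LinearMap.id
  map_one' := by simp; rfl
  map_mul' a c := by
    ext
    simp [mul_comm]

theorem unitsRep_apply (a : ℂˣ) (x : ℂ) : unitsRep a x = a * x := rfl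

namespace PreAbstractSimplicialComplex

/-! ### Twisted cocycles on the product with a circle -/

section Circle

variable {U : Type*} [LinearOrder U] {A : PreAbstractSimplicialComplex U} {b : ℕ} {hb : 3 ≤ b}

local notation "S¹" => SimpleCycle.toComplex (standardCycle b hb)

theorem edges_of_triangle {V : Type*} [DecidableEq V] {K : PreAbstractSimplicialComplex V}
    {u v w : V} (h : {u, v, w} ∈ K.faces) :
    {u, v} ∈ K.faces ∧ {v, w} ∈ K.faces ∧ {u, w} ∈ K.faces :=
  ⟨K.face_mono h (by intro x; simp; tauto) (by simp),
    K.face_mono h (by intro x; simp; tauto) (by simp),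
    K.face_mono h (by intro x; simp; tauto) (by simp)⟩

/-- A twisted cocycle on the product with a circle, with coefficients on which the fibre acts
without fixed vectors, is a coboundary. -/
theorem exists_primitive_of_fibreHol_ne_one {a : U × ℕ → U × ℕ → ℂˣ}
    (ha : (A.prod S¹).IsFlat a) (hfib : ∀ w, {w} ∈ A.faces → fibreHol b a w b ≠ 1)
    {c : U × ℕ → U × ℕ → ℂ} (hc : (A.prod S¹).IsTwistedCocycle unitsRep a c) :
    ∃ e : U × ℕ → ℂ, ∀ p q, {p, q} ∈ (A.prod S¹).faces → c p q = a p q * e q - e p := by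
  have haff : ∀ w k, ∃ C : ℂ, ∀ x : ℂ,
      (fibreHol b (fun p q => affinePerm unitsRep (a p q) (c p q)) w k : Equiv.Perm ℂ) x =
      (fibreHol b a w k : ℂˣ) * x - C := by
    intro w k
    induction k with
    | zero => exact ⟨0, fun x => by simp [fibreHol, seqHol]⟩
    | succ k ih =>
      obtain ⟨C, hC⟩ := ih
      refine ⟨(fibreHol b a w k : ℂˣ) * c (w, k % b) (w, (k + 1) % b) + C, fun x => ?_⟩
      change (fibreHol b (fun p q => affinePerm unitsRep (a p q) (c p q)) w k : Equiv.Perm ℂ)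
        ((a (w, k % b) (w, (k + 1) % b) : ℂ) * x - c (w, k % b) (w, (k + 1) % b)) =
        ((fibreHol b a w k * a (w, k % b) (w, (k + 1) % b) : ℂˣ) : ℂ) * x - _
      rw [hC, Units.val_mul]
      ring
  choose C hC using fun w => haff w b
  have hne : ∀ w, {w} ∈ A.faces → ((fibreHol b a w b : ℂˣ) : ℂ) - 1 ≠ 0 := fun w hw h =>
    hfib w hw (Units.ext (sub_eq_zero.1 h))
  -- The affine holonomy of a fibre is `x ↦ l x - C` with `l ≠ 1`, so `C / (l - 1)` is its only
  -- fixed point. These fixed points form a parallel section, that is, a primitive.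
  obtain ⟨e, he⟩ := (ha.affine hc).exists_fibre_section
    (x := fun w => C w / (((fibreHol b a w b : ℂˣ) : ℂ) - 1))
    (fun w hw => by
      rw [Equiv.Perm.smul_def, hC]
      have := hne w hw
      field_simp
      ring)
    (fun w y hw hy => by
      rw [Equiv.Perm.smul_def, hC] at hy
      have := hne w hw
      field_simp
      linear_combination hy)
  refine ⟨e, fun p q h => ?_⟩
  have := he p q h
  rw [Equiv.Perm.smul_def, affinePerm_apply, unitsRep_apply] at this
  linear_combination -this

variable {G : U × ℕ → U × ℕ → SL2} {m : ℂˣ}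

/-- For `k = 2` and `k = -2` these are the lines of upper and lower triangular entries of `sl₂(ℂ)`
under diagonal matrices. The fibre acts on them by `m ^ k ≠ 1`. -/
theorem exists_offDiagonal_primitive (hG : (A.prod S¹).IsFlat G)
    (hdiag : ∀ p q, {p, q} ∈ (A.prod S¹).faces → IsDiagSL (G p q))
    (hfib : ∀ w, {w} ∈ A.faces → fibreHol b G w b = diagSL m) {k : ℤ} (hk : m ^ k ≠ 1)
    {c : U × ℕ → U × ℕ → ℂ}
    (hc : ∀ u v w, {u, v, w} ∈ (A.prod S¹).faces →
      c u v + ((diagUnit (G u v) ^ k : ℂˣ) : ℂ) * c v w = c u w) :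
    ∃ e : U × ℕ → ℂ, ∀ p q, {p, q} ∈ (A.prod S¹).faces →
      c p q = ((diagUnit (G p q) ^ k : ℂˣ) : ℂ) * e q - e p := by
  have hflat : (A.prod S¹).IsFlat fun p q => diagUnit (G p q) := fun u v w h => by
    have he := edges_of_triangle h
    rw [← (hdiag u v he.1).diagUnit_mul (hdiag v w he.2.1), hG u v w h]
  refine exists_primitive_of_fibreHol_ne_one (a := fun p q => diagUnit (G p q) ^ k)
    (hflat.map (zpowGroupHom k)) (fun w hw => ?_) hc
  have h1 := seqHol_diag (G := G) (v := fun i => (w, i % b))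
    (fun i => hdiag _ _ (vertical_mem hw ((standardCycle b hb).edge_mem i))) b
  have h2 := hfib w hw
  rw [fibreHol] at h2
  have h3 := seqHol_map (zpowGroupHom k) (fun p q => diagUnit (G p q)) (fun i => (w, i % b)) b
  simp only [zpowGroupHom_apply] at h3
  rw [fibreHol, h3, h1.2, h2, diagUnit_diagSL]
  exact hk

/-- Normal form of a twisted cocycle on the product with a circle, for a diagonal transport. -/
theorem exists_cocycle_normal_form (hA : A.IsConnected) (hG : (A.prod S¹).IsFlat G)
    (hdiag : ∀ p q, {p, q} ∈ (A.prod S¹).faces → IsDiagSL (G p q))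
    (hfib : ∀ w, {w} ∈ A.faces → fibreHol b G w b = diagSL m)
    (h1 : (m : ℂ) ≠ 1) (h2 : (m : ℂ) ≠ -1) {f : U × ℕ → U × ℕ → sl2}
    (hf : (A.prod S¹).IsTwistedCocycle adjointRep G f) :
    ∃ (P : U × ℕ → sl2) (t : ℂ),
      (∀ w, {w} ∈ A.faces →
        ∑ i ∈ Finset.range b, (f (w, i % b) (w, (i + 1) % b)).1 0 0 = t) ∧
      ∀ p q, {p, q} ∈ (A.prod S¹).faces → f p q = adjointRep (G p q) (P q) - P p +
        slMk ((f (p.1, 0) (q.1, 0)).1 0 0 + wrap b p.2 q.2 * t) 0 0 := by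
  have hm2 : m ^ 2 ≠ 1 := fun h => by
    have : (m : ℂ) ^ 2 = 1 := by rw [← Units.val_pow_eq_pow_val, h, Units.val_one]
    rcases eq_or_eq_neg_of_sq_eq_sq (m : ℂ) 1 (by rw [this, one_pow]) with h | h
    · exact h1 h
    · exact h2 h
  have hpow : ∀ g : SL2, IsDiagSL g → ((diagUnit g ^ (2 : ℤ) : ℂˣ) : ℂ) = g.1 0 0 ^ 2 ∧
      ((diagUnit g ^ (-2 : ℤ) : ℂˣ) : ℂ) = g.1 1 1 ^ 2 := by
    intro g hg
    constructor
    · rw [zpow_ofNat, Units.val_pow_eq_pow_val, hg.coe_diagUnit]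
    · rw [_root_.zpow_neg, ← _root_.inv_zpow, zpow_ofNat, Units.val_pow_eq_pow_val, hg.coe_diagUnit_inv]
  obtain ⟨e, he⟩ := exists_offDiagonal_primitive (k := 2) hG hdiag hfib
    (by rwa [zpow_ofNat]) (c := fun p q => (f p q).1 0 1) (fun u v w h => by
      have hd := hdiag u v (edges_of_triangle h).1
      rw [(hpow _ hd).1, ← hf u v w h, sl_add_apply, hd.adjoint_zero_one])
  obtain ⟨e', he'⟩ := exists_offDiagonal_primitive (k := -2) hG hdiag hfib
    (by rwa [_root_.zpow_neg, Ne, inv_eq_one, zpow_ofNat]) (c := fun p q => (f p q).1 1 0)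
    (fun u v w h => by
      have hd := hdiag u v (edges_of_triangle h).1
      rw [(hpow _ hd).2, ← hf u v w h, sl_add_apply, hd.adjoint_one_zero])
  -- Diagonal matrices act trivially on the diagonal entry, which is therefore an additive cocycle.
  -- Read as a flat transport in a commutative group, it has the normal form of such transports on a
  -- product with a circle.
  let T : U × ℕ → U × ℕ → Multiplicative ℂ := fun p q => Multiplicative.ofAdd ((f p q).1 0 0)
  have hT : (A.prod S¹).IsFlat T := by
    intro u v w h
    have hd := hdiag u v (edges_of_triangle h).1
    change Multiplicative.ofAdd _ * Multiplicative.ofAdd _ = Multiplicative.ofAdd _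
    rw [← ofAdd_add, ← hf u v w h, sl_add_apply, hd.adjoint_zero_zero]
  obtain ⟨w₀, hw₀⟩ := hA.1
  -- In a commutative group, intertwining by a horizontal edge means equality, so all fibres have
  -- the same period.
  have hconst : ∀ w, {w} ∈ A.faces → fibreHol b T w b = fibreHol b T w₀ b := by
    intro w hw
    refine hA.induction (P := fun w => fibreHol b T w b = fibreHol b T w₀ b)
      (fun u v huv _ h => ?_) hw₀ hw rfl
    have := fibreHol_comm hT huv
    rw [mul_comm, mul_right_cancel_iff] at this
    rw [this, h]
  let F : U × ℕ → ℂ := fun p => Multiplicative.toAdd (fibreHol b T p.1 p.2)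
  refine ⟨fun p => slMk (F p) (e p) (e' p), Multiplicative.toAdd (fibreHol b T w₀ b),
    fun w hw => ?_, fun p q h => ?_⟩
  · rw [← hconst w hw, fibreHol]
    exact (congrArg Multiplicative.toAdd (seqHol_ofAdd_complex (fun p q => (f p q).1 0 0)
      (fun i => (w, i % b)) b)).symm
  · have hd := hdiag p q h
    refine slTwo_ext ?_ ?_ ?_
    · have := congrArg Multiplicative.toAdd (hT.normal_form h)
      rw [hconst q.1 (right_mem_of_edge (edge_fst_mem h))] at this
      simp only [toAdd_mul, toAdd_inv, toAdd_zpow, zsmul_eq_mul] at this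
      rw [sl_add_apply, sl_sub_apply, hd.adjoint_zero_zero]
      change (f p q).1 0 0 = F q - F p + ((f (p.1, 0) (q.1, 0)).1 0 0 + _)
      change (f p q).1 0 0 = -F p + (f (p.1, 0) (q.1, 0)).1 0 0 + _ + F q at this
      rw [this]
      ring
    · rw [sl_add_apply, sl_sub_apply, hd.adjoint_zero_one, ← (hpow _ hd).1]
      exact (he p q h).trans (add_zero _).symm
    · rw [sl_add_apply, sl_sub_apply, hd.adjoint_one_zero, ← (hpow _ hd).2]
      exact (he' p q h).trans (add_zero _).symm

theorem base_isCocycle {f : U × ℕ → U × ℕ → sl2}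
    (hdiag : ∀ p q, {p, q} ∈ (A.prod S¹).faces → IsDiagSL (G p q))
    (hf : (A.prod S¹).IsTwistedCocycle adjointRep G f) :
    A.IsCocycle fun w w' => (f (w, 0) (w', 0)).1 0 0 := by
  intro u v w h
  have hmem : {(u, 0), (v, 0), (w, 0)} ∈ (A.prod S¹).faces := by
    simpa [Finset.image_insert] using
      mem_prod_const h (standardCycle_singleton_mem hb (by omega : 0 < b))
  simp only
  rw [← hf _ _ _ hmem, sl_add_apply,
    (hdiag _ _ (edges_of_triangle hmem).1).adjoint_zero_zero]

end Circle

end PreAbstractSimplicialComplex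

end

noncomputable section

open PreAbstractSimplicialComplex Matrix

local notation "SL2" => SpecialLinearGroup (Fin 2) ℂ
local notation "sl2" => LieAlgebra.SpecialLinear.sl (Fin 2) ℂ

/-! ### Regularity in terms of cocycles -/

theorem SimpleCycle.isConnected {V : Type*} [LinearOrder V] (c : SimpleCycle V) :
    c.toComplex.IsConnected := by
  refine ⟨⟨_, c.singleton_mem 0⟩, fun u v hu hv => ?_⟩
  obtain ⟨i, -, rfl⟩ := c.exists_of_singleton_mem hu
  obtain ⟨j, -, rfl⟩ := c.exists_of_singleton_mem hv
  exact ⟨(c.path i).reverse.append (c.path j)⟩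

section Regular

variable {V : Type*} [LinearOrder V] {E : PreAbstractSimplicialComplex V} {μ : SimpleCycle V}
  {hμ : μ.toComplex ≤ E} {ρ : Pi1 E (μ.vert 0) →* SL2} {G : V → V → SL2} {g : SL2}

/-- The injectivity of the restriction to the meridian, carried over from equivariant cochains to
functions of pairs of vertices. -/
theorem IsMuRegular.mem_pairCoboundaries (h : IsMuRegular μ hμ ρ) (hE : E.IsConnected)
    (hG : E.IsFlat G) (hr : ∀ α, ρ α = g * holHom hG (μ.vert 0) α * g⁻¹) {f : V → V → sl2}
    (hf : f ∈ E.pairCocycles adjointRep G)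
    (hfμ : f ∈ μ.toComplex.pairCoboundaries adjointRep G) :
    f ∈ E.pairCoboundaries adjointRep G := by
  have hr' : ∀ α, (adjointRep.comp ρ) α = adjointRep (g * holHom hG (μ.vert 0) α * g⁻¹) :=
    fun α => congrArg adjointRep (hr α)
  have hx := hμ (μ.singleton_mem 0)
  have h0 := h.2 (toCochain hG g hr' 1 (pairRestrict E sl2 f))
    ((toCochain_mem_cocycles hG g hr' hE hx).2 (funCoboundary_pairRestrict hG hf)) (by
      rw [restrictCochain_toCochain hμ (PathClass.refl E (μ.vert 0)) hG g hr'
        (comp_inclusionHom_eq hμ (PathClass.refl E (μ.vert 0)) hG g hr'),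
        toCochain_mem_coboundaries _ _ _ μ.isConnected (μ.singleton_mem 0)]
      exact (pairRestrict_mem_coboundaries (hG.mono hμ) (pairCocycles_mono hμ hf)).2 hfμ)
  rw [toCochain_mem_coboundaries hG g hr' hE hx] at h0
  exact (pairRestrict_mem_coboundaries hG hf).1 h0

/-- Of the equality `dim H¹ = 1` only the fact that `H¹` is not zero is needed here. -/
theorem IsMuRegular.exists_notMem_pairCoboundaries (h : IsMuRegular μ hμ ρ) (hE : E.IsConnected)
    (hG : E.IsFlat G) (hr : ∀ α, ρ α = g * holHom hG (μ.vert 0) α * g⁻¹) :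
    ∃ f ∈ E.pairCocycles adjointRep G, f ∉ E.pairCoboundaries adjointRep G := by
  have hr' : ∀ α, (adjointRep.comp ρ) α = adjointRep (g * holHom hG (μ.vert 0) α * g⁻¹) :=
    fun α => congrArg adjointRep (hr α)
  have hrank : Module.rank ℂ (E.Cohomology (adjointRep.comp ρ) 1) = 1 := h.1
  rw [rank_cohomology_eq hG g hr' hE (hμ (μ.singleton_mem 0))] at hrank
  by_contra! hne
  have : Subsingleton (Subquotient (LinearMap.ker (E.funCoboundary adjointRep G 1))
      (E.funCoboundaries adjointRep G 1)) := by
    rw [Submodule.Quotient.subsingleton_iff, eq_top_iff]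
    rintro ⟨c, hc⟩ -
    rw [mem_submoduleOf_iff]
    obtain ⟨f, hf, rfl⟩ := exists_pairRestrict_eq hG (LinearMap.mem_ker.1 hc)
    exact (pairRestrict_mem_coboundaries hG hf).2 (hne f hf)
  rw [rank_subsingleton'] at hrank
  exact zero_ne_one hrank

end Regular

/-! ### Coordinates on the composing space -/

namespace ComposingSpace

variable {V U : Type*} [LinearOrder V] [LinearOrder U] {n : ℕ} (Y : ComposingSpace V U n)

open Classical in
/-- The coordinates of a vertex of `Y`. -/
def coord (v : V) : U × ℕ :=
  if h : ∃ p : U × ℕ, ({p.1} ∈ Y.W.faces ∧ p.2 < Y.b) ∧ Y.φ p = v then h.choose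
  else (Y.outer.vert 0, 0)

theorem coord_φ {p : U × ℕ} (h1 : {p.1} ∈ Y.W.faces) (h2 : p.2 < Y.b) : Y.coord (Y.φ p) = p := by
  have h : ∃ q : U × ℕ, ({q.1} ∈ Y.W.faces ∧ q.2 < Y.b) ∧ Y.φ q = Y.φ p := ⟨p, ⟨h1, h2⟩, rfl⟩
  rw [coord, dif_pos h]
  exact Y.φ_injOn h.choose_spec.1 ⟨h1, h2⟩ h.choose_spec.2

/-- The part of `Y` over a subcomplex of `W`. -/
abbrev part (A : PreAbstractSimplicialComplex U) : PreAbstractSimplicialComplex V :=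
  (A.prod Y.fibre.toComplex).map Y.φ

variable {Y} {A : PreAbstractSimplicialComplex U}

theorem part_le (hA : A ≤ Y.W) : Y.part A ≤ Y.toComplex := by
  rintro _ ⟨t, ht, rfl⟩
  exact ⟨t, ⟨hA ht.1, ht.2⟩, rfl⟩

theorem coord_mem (hA : A ≤ Y.W) {s : Finset V} (hs : s ∈ (Y.part A).faces) :
    s.image Y.coord ∈ (A.prod Y.fibre.toComplex).faces ∧ ∀ v ∈ s, Y.φ (Y.coord v) = v := by
  obtain ⟨t, ht, rfl⟩ := hs
  have hc : ∀ p ∈ t, Y.coord (Y.φ p) = p := fun p hp => by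
    have := Y.vertex_mem_prod (p := p) ⟨by
      have := A.face_mono ht.1 (Finset.singleton_subset_iff.2 (Finset.mem_image_of_mem _ hp))
        (by simp)
      simpa using hA this, (PreAbstractSimplicialComplex.face_mono _ ht
        (Finset.singleton_subset_iff.2 hp) (by simp)).2⟩
    exact Y.coord_φ this.1 this.2
  constructor
  · change (t.image Y.φ).image Y.coord ∈ _
    rw [Finset.image_image, Finset.image_congr (f := Y.coord ∘ Y.φ) (g := id) hc, Finset.image_id]
    exact ht
  · intro v hv
    obtain ⟨p, hp, rfl⟩ := Finset.mem_image.1 hv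
    rw [hc p hp]

theorem coord_edge (hA : A ≤ Y.W) {u v : V} (h : {u, v} ∈ (Y.part A).faces) :
    {Y.coord u, Y.coord v} ∈ (A.prod Y.fibre.toComplex).faces ∧ Y.φ (Y.coord u) = u ∧
      Y.φ (Y.coord v) = v := by
  obtain ⟨h1, h2⟩ := coord_mem hA h
  exact ⟨by simpa [Finset.image_insert] using h1, h2 u (by simp), h2 v (by simp)⟩

theorem φ_mem_part {p q : U × ℕ} (h : {p, q} ∈ (A.prod Y.fibre.toComplex).faces) :
    {Y.φ p, Y.φ q} ∈ (Y.part A).faces := ⟨_, h, by simp [Finset.image_insert]⟩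

theorem φ_triangle_mem_part {p q r : U × ℕ} (h : {p, q, r} ∈ (A.prod Y.fibre.toComplex).faces) :
    {Y.φ p, Y.φ q, Y.φ r} ∈ (Y.part A).faces := ⟨_, h, by simp [Finset.image_insert]⟩

theorem part_joined (hA : A ≤ Y.W) (hAc : A.IsConnected) {u v : V}
    (hu : {u} ∈ (Y.part A).faces) (hv : {v} ∈ (Y.part A).faces) : (Y.part A).Joined u v := by
  have key : ∀ {u}, {u} ∈ (Y.part A).faces →
      {(Y.coord u).1} ∈ A.faces ∧ (Y.coord u).2 < Y.b ∧ Y.φ (Y.coord u) = u := by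
    intro u hu
    have h := coord_edge (u := u) (v := u) hA (by simpa using hu)
    exact ⟨left_mem_of_edge (edge_fst_mem h.1), standardCycle_lt (hb := Y.three_le)
      (edge_snd_mem h.1) (by simp), h.2.1⟩
  obtain ⟨hu1, hu2, hu3⟩ := key hu
  obtain ⟨hv1, hv2, hv3⟩ := key hv
  have := (prod_circle_joined (hb := Y.three_le) hAc hu1 hv1 hu2 hv2).map Y.φ
  rwa [hu3, hv3] at this

theorem part_connected (hA : A ≤ Y.W) (hAc : A.IsConnected) : (Y.part A).IsConnected := by
  obtain ⟨w, hw⟩ := hAc.1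
  refine ⟨⟨Y.φ (w, 0), {(w, 0)}, ?_, by simp⟩, fun u v hu hv => part_joined hA hAc hu hv⟩
  have h3 := Y.three_le
  have := vertical_mem (i := 0) (j := 0) hw (by
    simpa using standardCycle_singleton_mem Y.three_le (i := 0) (by omega))
  simpa using this

theorem torus_connected (j : Fin n) : (Y.torus j).IsConnected :=
  part_connected (Y.inner_le j) (Y.inner j).isConnected

end ComposingSpace

theorem trace_conj_SL (g h : SL2) : (g * h * g⁻¹).1.trace = h.1.trace := by
  have hg : (g⁻¹).1 * g.1 = 1 := congrArg Subtype.val (inv_mul_cancel g)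
  change (g.1 * h.1 * (g⁻¹).1).trace = _
  rw [Matrix.trace_mul_comm, ← Matrix.mul_assoc, hg, Matrix.one_mul]

/-! ### Transports that are diagonal on the composing space -/

namespace ConnectedSumExterior

variable {V U : Type*} [LinearOrder V] [LinearOrder U] {n : ℕ} {X : ConnectedSumExterior V U n}

theorem Y_le (X : ConnectedSumExterior V U n) : X.Y.toComplex ≤ X.M := le_sup_left

theorem part_le_M {A : PreAbstractSimplicialComplex U} (hA : A ≤ X.Y.W) : X.Y.part A ≤ X.M :=
  (ComposingSpace.part_le hA).trans X.Y_le

/-- A flat transport on `M` that is diagonal on `Y`, with holonomy `diag(m, m⁻¹)` along the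
fibres. -/
structure IsDiagonalTransport (X : ConnectedSumExterior V U n) (m : ℂˣ) (G : V → V → SL2) :
    Prop where
  flat : X.M.IsFlat G
  diag : ∀ u v, {u, v} ∈ X.Y.toComplex.faces → IsDiagSL (G u v)
  fibre : ∀ w, {w} ∈ X.Y.W.faces →
    fibreHol X.Y.b (fun p q => G (X.Y.φ p) (X.Y.φ q)) w X.Y.b = diagSL m

theorem pullback_flat {A : PreAbstractSimplicialComplex U} (hA : A ≤ X.Y.W) {G : V → V → SL2}
    (hG : X.M.IsFlat G) :
    (A.prod X.Y.fibre.toComplex).IsFlat fun p q => G (X.Y.φ p) (X.Y.φ q) :=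
  fun _ _ _ h => hG _ _ _ (part_le_M hA (ComposingSpace.φ_triangle_mem_part h))

/-- Holonomies of adjacent fibres are conjugate by the edge between them, and `W` is connected. -/
theorem trace_fibreHol {G : V → V → SL2} (hG : X.M.IsFlat G) {w w' : U}
    (hw : {w} ∈ X.Y.W.faces) (hw' : {w'} ∈ X.Y.W.faces) :
    (fibreHol X.Y.b (fun p q => G (X.Y.φ p) (X.Y.φ q)) w' X.Y.b).1.trace =
      (fibreHol X.Y.b (fun p q => G (X.Y.φ p) (X.Y.φ q)) w X.Y.b).1.trace := by
  refine X.Y.connected.induction (P := fun w' =>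
    (fibreHol X.Y.b (fun p q => G (X.Y.φ p) (X.Y.φ q)) w' X.Y.b).1.trace =
      (fibreHol X.Y.b (fun p q => G (X.Y.φ p) (X.Y.φ q)) w X.Y.b).1.trace)
    (fun u v huv _ h => ?_) hw hw' rfl
  rw [← h]
  have hc := fibreHol_comm (hb := X.Y.three_le) (pullback_flat le_rfl hG) huv
  have e := eq_mul_inv_of_mul_eq hc.symm
  rw [e, trace_conj_SL]

/-- At each vertex of `Y` a frame is chosen that diagonalizes the holonomy of the fibre through it.
By centrality of the fibre, the transport along edges of `Y` then commutes with `diag(m, m⁻¹)`,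
hence is diagonal. -/
theorem exists_isDiagonalTransport {ρ : X.M.Pi1 X.base →* SL2} {m : ℂˣ}
    (hm : EigenvalueSL2 (ρ X.mu) m) (h1 : (m : ℂ) ≠ 1) (h2 : (m : ℂ) ≠ -1) :
    ∃ (G : V → V → SL2) (hG : X.IsDiagonalTransport m G) (g : SL2),
      ∀ α, ρ α = g * holHom hG.flat X.base α * g⁻¹ := by
  obtain ⟨G, hG, g, hg⟩ := exists_isFlat X.M_connected (X.Y_le X.base_mem) ρ
  set G' : U × ℕ → U × ℕ → SL2 := fun p q => G (X.Y.φ p) (X.Y.φ q) with hG'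
  have hflat := pullback_flat (X := X) le_rfl hG
  -- The fibre over the base vertex of the outer circle is the meridian, so its trace is that of `ρ
  -- X.mu`.
  have htr : ∀ w, {w} ∈ X.Y.W.faces →
      (fibreHol X.Y.b G' w X.Y.b).1.trace = m + (m⁻¹ : ℂˣ) := by
    intro w hw
    rw [trace_fibreHol hG (X.Y.vert_mem _ X.Y.outer_le 0) hw, ← hm.trace_eq, hg, trace_conj_SL,
      mu, SimpleCycle.hol_loop, fibreHol, seqHol_comp]
    rfl
  have hex : ∀ p : U × ℕ, ∃ h : SL2, {p.1} ∈ X.Y.W.faces →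
      h⁻¹ * fibreLoop X.Y.b G' p * h = diagSL m := by
    intro p
    by_cases hp : {p.1} ∈ X.Y.W.faces
    · have : (fibreLoop X.Y.b G' p).1.trace = m + (m⁻¹ : ℂˣ) := by
        rw [← htr _ hp, fibreLoop]
        have := trace_conj_SL (fibreHol X.Y.b G' p.1 p.2)⁻¹ (fibreHol X.Y.b G' p.1 X.Y.b)
        rwa [inv_inv] at this
      obtain ⟨h, hh⟩ := exists_conj_eq_diagSL h1 h2 this
      exact ⟨h, fun _ => hh⟩
    · exact ⟨1, fun h => absurd h hp⟩
  choose h hh using hex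
  -- Vertices outside `Y` receive the frame of the default coordinate; any frame would do there.
  let k : V → SL2 := fun v => h (X.Y.coord v)
  have hb0 : 0 < X.Y.b := by have := X.Y.three_le; omega
  refine ⟨fun u v => (k u)⁻¹ * G u v * k v, ⟨hG.gauge k, fun u v huv => ?_, fun w hw => ?_⟩,
    g * k X.base, fun α => ?_⟩
  · obtain ⟨hc, hu, hv⟩ := ComposingSpace.coord_edge (A := X.Y.W) le_rfl huv
    have hcomm := hflat.fibreLoop_comm (hb := X.Y.three_le) hc
    have e1 := hh _ (left_mem_of_edge (edge_fst_mem hc))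
    have e2 := hh _ (right_mem_of_edge (edge_fst_mem hc))
    refine isDiagSL_of_commute h1 h2 ?_
    have hGuv : G' (X.Y.coord u) (X.Y.coord v) = G u v := by rw [hG']; simp only [hu, hv]
    change G' _ _ * fibreLoop X.Y.b G' _ = fibreLoop X.Y.b G' _ * G' _ _ at hcomm
    rw [hGuv] at hcomm
    calc (k u)⁻¹ * G u v * k v * diagSL m
        = (k u)⁻¹ * (G u v * fibreLoop X.Y.b G' (X.Y.coord v)) * k v := by
          rw [← e2]; simp only [k]; group
      _ = diagSL m * ((k u)⁻¹ * G u v * k v) := by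
          rw [hcomm, ← e1]; simp only [k]; group
  · have hk : k (X.Y.φ (w, 0)) = h (w, 0) := by
      simp only [k]
      rw [X.Y.coord_φ (p := (w, 0)) hw hb0]
    have e := hh (w, 0) hw
    rw [fibreLoop] at e
    have e0 : fibreHol X.Y.b G' w 0 = 1 := rfl
    simp only at e
    rw [e0, inv_one, one_mul, mul_one] at e
    rw [fibreHol, seqHol_comp (φ := X.Y.φ) (G := fun u v => (k u)⁻¹ * G u v * k v),
      seqHol_gauge, ← seqHol_comp (φ := X.Y.φ) (G := G)]
    simp only [Nat.zero_mod, Nat.mod_self, hk]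
    exact e
  · rw [hg]
    have : holHom (hG.gauge k) X.base α = (k X.base)⁻¹ * holHom hG X.base α * k X.base := by
      rw [holHom_apply, holHom_apply]
      induction α using PathClass.ind with
      | h p => exact EdgePath.hol_gauge k p
    rw [this]
    group

namespace IsDiagonalTransport

variable {m : ℂˣ} {G : V → V → SL2} (hG : X.IsDiagonalTransport m G)
include hG

theorem piece_flat (j : Fin n) : (X.piece j).IsFlat G := hG.flat.mono (X.piece_le j)

theorem holHom_meridian (j : Fin n) :
    holHom (hG.piece_flat j) (X.pieceBase j) ((X.Y.meridian j).loop (X.meridian_le j)) =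
      diagSL m := by
  rw [SimpleCycle.hol_loop, ← hG.fibre _ (X.Y.vert_mem _ (X.Y.inner_le j) 0), fibreHol,
    seqHol_comp (φ := X.Y.φ) (G := G)]
  rfl

/-- Normal form of a twisted cocycle on a part of the composing space. -/
theorem exists_normal_form (h1 : (m : ℂ) ≠ 1) (h2 : (m : ℂ) ≠ -1)
    {A : PreAbstractSimplicialComplex U} (hA : A ≤ X.Y.W) (hAc : A.IsConnected)
    {f : V → V → sl2} (hf : (X.Y.part A).IsTwistedCocycle adjointRep G f) :
    A.IsCocycle (fun w w' => (f (X.Y.φ (w, 0)) (X.Y.φ (w', 0))).1 0 0) ∧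
    ∃ (P : V → sl2) (t : ℂ),
      (∀ w, {w} ∈ A.faces → ∑ i ∈ Finset.range X.Y.b,
        (f (X.Y.φ (w, i % X.Y.b)) (X.Y.φ (w, (i + 1) % X.Y.b))).1 0 0 = t) ∧
      ∀ u v, {u, v} ∈ (X.Y.part A).faces → f u v = adjointRep (G u v) (P v) - P u +
        slMk ((f (X.Y.φ ((X.Y.coord u).1, 0)) (X.Y.φ ((X.Y.coord v).1, 0))).1 0 0 +
          wrap X.Y.b (X.Y.coord u).2 (X.Y.coord v).2 * t) 0 0 := by
  have hflat := pullback_flat hA hG.flat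
  have hdiag : ∀ p q, {p, q} ∈ (A.prod X.Y.fibre.toComplex).faces →
      IsDiagSL (G (X.Y.φ p) (X.Y.φ q)) := fun p q h =>
    hG.diag _ _ (ComposingSpace.part_le hA (ComposingSpace.φ_mem_part h))
  have hfib : ∀ w, {w} ∈ A.faces →
      fibreHol X.Y.b (fun p q => G (X.Y.φ p) (X.Y.φ q)) w X.Y.b = diagSL m :=
    fun w hw => hG.fibre w (hA hw)
  have hf' : (A.prod X.Y.fibre.toComplex).IsTwistedCocycle adjointRep
      (fun p q => G (X.Y.φ p) (X.Y.φ q)) (fun p q => f (X.Y.φ p) (X.Y.φ q)) :=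
    fun _ _ _ h => hf _ _ _ (ComposingSpace.φ_triangle_mem_part h)
  obtain ⟨P, t, ht, hP⟩ := exists_cocycle_normal_form (hb := X.Y.three_le) hAc hflat hdiag hfib
    h1 h2 hf'
  refine ⟨base_isCocycle (hb := X.Y.three_le) hdiag hf', fun v => P (X.Y.coord v), t, ht,
    fun u v huv => ?_⟩
  obtain ⟨hc, hu, hv⟩ := ComposingSpace.coord_edge hA huv
  have := hP _ _ hc
  simp only [hu, hv] at this
  exact this

/-- In the normal form the obstructions are the period and the class of the cocycle on the base. The
first is zero, and the second is removed by adding `q` times `diag(1, -1)` to the primitive. -/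
theorem exists_primitive_part (h1 : (m : ℂ) ≠ 1) (h2 : (m : ℂ) ≠ -1)
    {A : PreAbstractSimplicialComplex U} (hA : A ≤ X.Y.W) (hAc : A.IsConnected)
    {f : V → V → sl2} (hf : (X.Y.part A).IsTwistedCocycle adjointRep G f) {w : U}
    (hw : {w} ∈ A.faces) (ht : ∑ i ∈ Finset.range X.Y.b,
      (f (X.Y.φ (w, i % X.Y.b)) (X.Y.φ (w, (i + 1) % X.Y.b))).1 0 0 = 0) {q : U → ℂ}
    (hq : ∀ u v, {u, v} ∈ A.faces →
      (f (X.Y.φ (u, 0)) (X.Y.φ (v, 0))).1 0 0 = q v - q u) :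
    ∃ P : V → sl2, ∀ u v, {u, v} ∈ (X.Y.part A).faces →
      f u v = adjointRep (G u v) (P v) - P u := by
  obtain ⟨-, P, t, ht', hP⟩ := hG.exists_normal_form h1 h2 hA hAc hf
  obtain rfl : t = 0 := (ht' w hw).symm.trans ht
  refine ⟨fun v => P v + slMk (q (X.Y.coord v).1) 0 0, fun u v huv => ?_⟩
  have hd := hG.diag u v (ComposingSpace.part_le hA huv)
  rw [hP u v huv, map_add, hd.adjoint_slMk, hq _ _
    (edge_fst_mem (ComposingSpace.coord_edge hA huv).1), mul_zero, add_zero]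
  have : slMk (q (X.Y.coord v).1 - q (X.Y.coord u).1) 0 0 =
      slMk (q (X.Y.coord v).1) 0 0 - slMk (q (X.Y.coord u).1) 0 0 := by
    refine slTwo_ext ?_ ?_ ?_ <;> rw [sl_sub_apply] <;> simp
  rw [this]
  exact sub_add_sub_comm _ _ _ _

/-- A twisted cocycle on a boundary torus with vanishing period is a coboundary on the
meridian. -/
theorem exists_primitive_meridian (h1 : (m : ℂ) ≠ 1) (h2 : (m : ℂ) ≠ -1) (j : Fin n)
    {f : V → V → sl2} (hf : (X.Y.torus j).IsTwistedCocycle adjointRep G f)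
    (ht : (X.Y.meridian j).integral (fun u v => (f u v).1 0 0) = 0) :
    ∃ P : V → sl2, ∀ u v, {u, v} ∈ (X.Y.meridian j).toComplex.faces →
      f u v = adjointRep (G u v) (P v) - P u := by
  obtain ⟨hc, P, t, ht', hP⟩ := hG.exists_normal_form h1 h2 (X.Y.inner_le j)
    (X.Y.inner j).isConnected hf
  obtain rfl : t = 0 := (ht' _ ((X.Y.inner j).singleton_mem 0)).symm.trans ht
  refine ⟨P, fun u v huv => ?_⟩
  obtain ⟨hle, -⟩ := (X.isKnotExterior j).meridian
  -- All vertices of the meridian lie over one vertex of `W`, so the base term of the normal form is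
  -- the value of a cocycle on a constant edge, which is zero.
  have hcoord : ∀ v, {v} ∈ (X.Y.meridian j).toComplex.faces →
      (X.Y.coord v).1 = (X.Y.inner j).vert 0 := by
    intro v hv
    obtain ⟨i, -, rfl⟩ := (X.Y.meridian j).exists_of_singleton_mem hv
    change (X.Y.coord (X.Y.φ _)).1 = _
    rw [X.Y.coord_φ (p := ((X.Y.inner j).vert 0, X.Y.fibre.vert i))
      (X.Y.vert_mem _ (X.Y.inner_le j) 0) (X.Y.fibre_lt i)]
  rw [hP u v (hle huv), hcoord u (left_mem_of_edge huv), hcoord v (right_mem_of_edge huv),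
    hc.self ((X.Y.inner j).singleton_mem 0), mul_zero, add_zero]
  have : slMk 0 0 0 = 0 := by refine slTwo_ext ?_ ?_ ?_ <;> rw [sl_zero_apply] <;> simp
  rw [this, add_zero]

end IsDiagonalTransport

end ConnectedSumExterior

end

noncomputable section

open PreAbstractSimplicialComplex Matrix

local notation "SL2" => SpecialLinearGroup (Fin 2) ℂ
local notation "sl2" => LieAlgebra.SpecialLinear.sl (Fin 2) ℂ

/-! ### Reducible representations of knot groups -/

section Reducible

variable {π : Type*} [Group π] {ν : π →* Multiplicative ℤ} {μ : π} {m : ℂˣ} {σ : π →* SL2}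

theorem AlexanderRegular.isDiagSL_of_not_irreducible (h : AlexanderRegular ν μ m)
    (h1 : (m : ℂ) ≠ 1) (h2 : (m : ℂ) ≠ -1) (hμ : σ μ = diagSL m) (hσ : ¬ IrreducibleSL2 σ)
    (α : π) : IsDiagSL (σ α) := by
  rw [h.hom_eq (fun α hα => h.eq_one_of_not_irreducible h1 h2 hμ hσ hα) α, hμ, diagSL_zpow]
  exact isDiagSL_diagSL _

theorem not_irreducibleSL2_of_isDiagSL (h : ∀ α, IsDiagSL (σ α)) : ¬ IrreducibleSL2 σ := by
  intro hσ
  refine hσ.not_eigenvector (v := ![1, 0]) (fun h => by simpa using congrFun h 0) fun α =>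
    ⟨(σ α).1 0 0, ?_⟩
  ext i
  fin_cases i
  · simp [Matrix.mulVec, dotProduct, Fin.sum_univ_two]
  · simpa [Matrix.mulVec, dotProduct, Fin.sum_univ_two] using (h α).2

/-- An abelian representation commutes with `diag(m, m⁻¹)`, so it is diagonal and reducible. A
reducible one is trivial on elements of degree zero, so all its values are powers of the meridian
matrix. -/
theorem AlexanderRegular.abelian_iff (h : AlexanderRegular ν μ m)
    (h1 : (m : ℂ) ≠ 1) (h2 : (m : ℂ) ≠ -1) (hμ : σ μ = diagSL m) :
    AbelianSL2 σ ↔ ¬ IrreducibleSL2 σ := by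
  constructor
  · intro hab
    refine not_irreducibleSL2_of_isDiagSL fun α => isDiagSL_of_commute h1 h2 ?_
    rw [← hμ]
    exact hab α μ
  · intro hσ α β
    have hp := h.hom_eq fun α hα => h.eq_one_of_not_irreducible h1 h2 hμ hσ hα
    rw [hp α, hp β]
    exact (Commute.refl (σ μ)).zpow_zpow _ _

theorem AbelianSL2.conj {ρ : π →* SL2} (hρ : AbelianSL2 ρ) {g : SL2}
    (h : ∀ α, ρ α = g * σ α * g⁻¹) : AbelianSL2 σ := by
  intro α β
  have := hρ α β
  rw [h, h] at this
  have e := this.eq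
  have e' : g * (σ α * σ β) * g⁻¹ = g * (σ β * σ α) * g⁻¹ := by
    calc _ = g * σ α * g⁻¹ * (g * σ β * g⁻¹) := by group
      _ = _ := by rw [e]; group
  exact mul_left_cancel (mul_right_cancel e')

end Reducible

/-! ### Crossed homomorphisms and subcomplexes -/

namespace PreAbstractSimplicialComplex

variable {V : Type*} [DecidableEq V] {Γ : Type*} [Group Γ] {K : PreAbstractSimplicialComplex V}
  {A : Type*} [AddCommGroup A] [Module ℂ A] {r : Representation ℂ Γ A} {G : V → V → Γ}
  {f : V → V → A}

theorem IsTwistedCocycle.mono {L : PreAbstractSimplicialComplex V} (hf : K.IsTwistedCocycle r G f)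
    (hL : L ≤ K) : L.IsTwistedCocycle r G f := fun u v w h => hf u v w (hL h)

/-- A primitive along the polygon is parallel for the affine transport, so its value at the starting
vertex is fixed by the affine holonomy of the loop. -/
theorem crossedHol_loop (c : SimpleCycle V) (h : c.toComplex ≤ K) (hG : K.IsFlat G)
    (hf : K.IsTwistedCocycle r G f) {s : V → A}
    (hs : ∀ u v, {u, v} ∈ c.toComplex.faces → f u v = r (G u v) (s v) - s u) :
    crossedHol hG hf (c.loop h) = r (holHom hG _ (c.loop h)) (s (c.vert 0)) - s (c.vert 0) := by
  have h1 : holHom (hG.affine hf) _ (c.loop h) (s (c.vert 0)) = s (c.vert 0) := by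
    have key : ∀ k, (seqHol (fun u v => affinePerm r (G u v) (f u v)) c.vert k) (s (c.vert k)) =
        s (c.vert 0) := by
      intro k
      induction k with
      | zero => rfl
      | succ k ih =>
        rw [seqHol, Equiv.Perm.mul_apply, affinePerm_apply, hs _ _ (c.edge_mem k), sub_sub_cancel,
          ih]
    have := key c.length
    rwa [c.vert_length, ← c.hol_loop (hG.affine hf) h] at this
  rw [holHom_affine hG hf, sub_eq_iff_eq_add] at h1
  exact (sub_eq_of_eq_add' h1).symm

end PreAbstractSimplicialComplex

/-! ### Parallel sections and cocycles on a single piece. -/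

namespace ConnectedSumExterior

variable {V U : Type*} [LinearOrder V] [LinearOrder U] {n : ℕ} {X : ConnectedSumExterior V U n}

/-- The integral over the meridian of the diagonal part of a function of pairs of vertices. -/
def period (X : ConnectedSumExterior V U n) (j : Fin n) (f : V → V → sl2) : ℂ :=
  (X.Y.meridian j).integral fun u v => (f u v).1 0 0

theorem period_add (j : Fin n) (f g : V → V → sl2) :
    X.period j (f + g) = X.period j f + X.period j g := SimpleCycle.integral_add _ _ _

theorem period_smul (j : Fin n) (a : ℂ) (f : V → V → sl2) :
    X.period j (a • f) = a * X.period j f := SimpleCycle.integral_smul _ _ _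

theorem torus_le_piece (j : Fin n) : X.Y.torus j ≤ X.piece j := by
  rw [← X.piece_inter j]
  exact inf_le_left

theorem meridian_le_torus (j : Fin n) : (X.Y.meridian j).toComplex ≤ X.Y.torus j :=
  (X.isKnotExterior j).meridian.1

theorem pieceBase_mem (j : Fin n) : {X.pieceBase j} ∈ (X.piece j).faces :=
  X.torus_le_piece j (X.torus_vertex_mem j)

namespace IsDiagonalTransport

variable {m : ℂˣ} {G : V → V → SL2} (hG : X.IsDiagonalTransport m G)
include hG

/-- The holonomy representation of a piece. -/
abbrev pieceHol (j : Fin n) : Pi1 (X.piece j) (X.pieceBase j) →* SL2 :=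
  holHom (hG.piece_flat j) (X.pieceBase j)

theorem restrict_eq {ρ : X.M.Pi1 X.base →* SL2} {g : SL2}
    (hρ : ∀ α, ρ α = g * holHom hG.flat X.base α * g⁻¹) (j : Fin n)
    (γ : X.M.PathClass X.base (X.pieceBase j)) (α : Pi1 (X.piece j) (X.pieceBase j)) :
    X.restrict ρ j γ α =
      (g * PathClass.hol hG.flat γ) * hG.pieceHol j α * (g * PathClass.hol hG.flat γ)⁻¹ := by
  rw [restrict, MonoidHom.comp_apply, hρ, holHom_inclusionHom hG.flat (X.piece_le j)]
  group

theorem parallel_torus (j : Fin n) (u v : V) (h : {u, v} ∈ (X.Y.torus j).faces) :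
    adjointRep (G u v) (slMk 1 0 0) = slMk 1 0 0 :=
  (hG.diag u v (X.Y.torus_le j h)).adjoint_slMk 1

/-- The value at the base point is invariant under an irreducible holonomy, hence zero, and a
parallel section on a connected complex is determined by one value. -/
theorem parallel_eq_zero {j : Fin n} (hirr : IrreducibleSL2 (hG.pieceHol j)) {s : V → sl2}
    (hs : ∀ u v, {u, v} ∈ (X.piece j).faces → adjointRep (G u v) (s v) = s u) {v : V}
    (hv : {v} ∈ (X.piece j).faces) : s v = 0 := by
  have hb : s (X.pieceBase j) = 0 := hirr.eq_zero_of_invariant fun α =>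
    parallel_holHom (hG.piece_flat j) hs α
  exact parallel_unique (r := adjointRep) (s' := fun _ => 0) (X.isKnotExterior j).connected
    (X.pieceBase_mem j) hs (fun u v _ => map_zero _) hb hv

section Regular

variable {j : Fin n} {ν : Pi1 (X.piece j) (X.pieceBase j) →* Multiplicative ℤ}
  (hν : AlexanderRegular ν ((X.Y.meridian j).loop (X.meridian_le j)) m)
  (h1 : (m : ℂ) ≠ 1) (h2 : (m : ℂ) ≠ -1)
include hν h1 h2

/-- A reducible holonomy is diagonal, so `diag(1, -1)` is invariant and extends to a parallel
section of the piece. On the torus the transport itself is diagonal and the constant section is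
parallel too; the two agree at the base point. -/
theorem exists_parallel_eq (hred : ¬ IrreducibleSL2 (hG.pieceHol j)) :
    ∃ s : V → sl2, (∀ u v, {u, v} ∈ (X.piece j).faces → adjointRep (G u v) (s v) = s u) ∧
      ∀ v, {v} ∈ (X.Y.torus j).faces → s v = slMk 1 0 0 := by
  obtain ⟨s, hsb, hs⟩ := exists_parallel (r := adjointRep) (hG.piece_flat j)
    (X.isKnotExterior j).connected (X.pieceBase_mem j) (x := slMk 1 0 0) fun α =>
      (hν.isDiagSL_of_not_irreducible h1 h2 (hG.holHom_meridian j) hred α).adjoint_slMk 1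
  exact ⟨s, hs, fun v hv => parallel_unique (r := adjointRep) (s' := fun _ => slMk 1 0 0)
    (ComposingSpace.torus_connected j) (X.torus_vertex_mem j)
    (fun u v h => hs u v (X.torus_le_piece j h)) (hG.parallel_torus j) hsb hv⟩

/-- With zero period the cocycle is a coboundary on the meridian, so its crossed homomorphism has
zero diagonal entry at the meridian; `crossed_principal` then makes it principal. -/
theorem exists_primitive_of_not_irreducible (hred : ¬ IrreducibleSL2 (hG.pieceHol j))
    {f : V → V → sl2} (hf : (X.piece j).IsTwistedCocycle adjointRep G f)
    (h0 : X.period j f = 0) :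
    ∃ p : V → sl2, ∀ u v, {u, v} ∈ (X.piece j).faces → f u v = adjointRep (G u v) (p v) - p u := by
  obtain ⟨P, hP⟩ := hG.exists_primitive_meridian h1 h2 j (hf.mono (X.torus_le_piece j)) h0
  have hF := crossedHol_loop (X.Y.meridian j) (X.meridian_le j) (hG.piece_flat j) hf hP
  obtain ⟨x, hx⟩ := hν.crossed_principal h1 h2 (hG.holHom_meridian j)
    (fun α hα => hν.eq_one_of_not_irreducible h1 h2 (hG.holHom_meridian j) hred hα)
    (F := crossedHol (hG.piece_flat j) hf) (crossedHol_mul (hG.piece_flat j) hf) (by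
      rw [hF, sl_sub_apply, hG.holHom_meridian j, (isDiagSL_diagSL m).adjoint_zero_zero, sub_self])
  exact exists_primitive_of_crossedHol (hG.piece_flat j) hf (X.isKnotExterior j).connected
    (X.pieceBase_mem j) hx

/-- The product of an integral meridional cocycle with the parallel section of `exists_parallel_eq`:
its period is the value of the integral cocycle on the meridian. -/
theorem exists_period_eq_one_of_not_irreducible (hred : ¬ IrreducibleSL2 (hG.pieceHol j))
    {z : V → V → ℤ} (hz : IsMeridionalCocycle (X.piece j) (X.Y.meridian j) z) :
    ∃ c : V → V → sl2, (X.piece j).IsTwistedCocycle adjointRep G c ∧ X.period j c = 1 := by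
  obtain ⟨s, hs, hst⟩ := hG.exists_parallel_eq hν h1 h2 hred
  refine ⟨fun u v => (z u v : ℂ) • s u, fun u v w h => ?_, ?_⟩
  · change (z u v : ℂ) • s u + adjointRep (G u v) ((z v w : ℂ) • s v) = (z u w : ℂ) • s u
    rw [map_smul, hs u v (edges_of_triangle h).1, ← add_smul, ← hz.1 u v w h, Int.cast_add]
  · have hμ : X.period j (fun u v => (z u v : ℂ) • s u) =
        (X.Y.meridian j).integral fun u v => (z u v : ℂ) := by
      refine SimpleCycle.integral_congr _ fun u v h => ?_
      rw [sl_smul_apply, hst u (X.meridian_le_torus j (left_mem_of_edge h)), slMk_zero_zero,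
        mul_one]
    rw [hμ, SimpleCycle.integral]
    exact_mod_cast congrArg (Int.cast : ℤ → ℂ) hz.2

end Regular

section MuRegular

variable {j : Fin n} {σ : Pi1 (X.piece j) (X.pieceBase j) →* SL2} {g : SL2}
  (hreg : IsMuRegular (X.Y.meridian j) (X.meridian_le j) σ)
  (hσ : ∀ α, σ α = g * hG.pieceHol j α * g⁻¹) (h1 : (m : ℂ) ≠ 1) (h2 : (m : ℂ) ≠ -1)
include hreg hσ h1 h2

theorem exists_primitive_of_isMuRegular {f : V → V → sl2}
    (hf : (X.piece j).IsTwistedCocycle adjointRep G f) (h0 : X.period j f = 0) :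
    ∃ p : V → sl2, ∀ u v, {u, v} ∈ (X.piece j).faces → f u v = adjointRep (G u v) (p v) - p u :=
  hreg.mem_pairCoboundaries (X.isKnotExterior j).connected (hG.piece_flat j) hσ hf
    (hG.exists_primitive_meridian h1 h2 j (hf.mono (X.torus_le_piece j)) h0)

/-- A cocycle that is not a coboundary has nonzero period, by `exists_primitive_of_isMuRegular`, and
can be rescaled. -/
theorem exists_period_eq_one_of_isMuRegular :
    ∃ c : V → V → sl2, (X.piece j).IsTwistedCocycle adjointRep G c ∧ X.period j c = 1 := by
  obtain ⟨f, hf, hf'⟩ := hreg.exists_notMem_pairCoboundaries (X.isKnotExterior j).connected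
    (hG.piece_flat j) hσ
  have h0 : X.period j f ≠ 0 := fun h0 =>
    hf' (hG.exists_primitive_of_isMuRegular hreg hσ h1 h2 hf h0)
  exact ⟨(X.period j f)⁻¹ • f, Submodule.smul_mem _ _ hf, by
    rw [period_smul, inv_mul_cancel₀ h0]⟩

end MuRegular

end IsDiagonalTransport

end ConnectedSumExterior

end

noncomputable section

open PreAbstractSimplicialComplex Matrix

local notation "SL2" => SpecialLinearGroup (Fin 2) ℂ
local notation "sl2" => LieAlgebra.SpecialLinear.sl (Fin 2) ℂ

theorem slMk_add (x y : ℂ) : slMk (x + y) 0 0 = slMk x 0 0 + slMk y 0 0 := by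
  refine slTwo_ext ?_ ?_ ?_ <;> rw [sl_add_apply] <;> simp

/-- The off-diagonal entries are multiplied by `m²` and `m⁻²`, both different from `1`, so they
vanish in an invariant element. -/
theorem eq_smul_of_adjoint_diagSL {m : ℂˣ} (h1 : (m : ℂ) ≠ 1) (h2 : (m : ℂ) ≠ -1) {X : sl2}
    (h : adjointRep (diagSL m) X = X) : X = (X.1 0 0) • slMk 1 0 0 := by
  have hd := isDiagSL_diagSL m
  have h3 : (m : ℂ) * (m⁻¹ : ℂˣ) = 1 := m.mul_inv
  have hne := units_sub_inv_ne_zero h1 h2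
  have e1 := congrArg (fun Y : sl2 => Y.1 0 1) h
  have e2 := congrArg (fun Y : sl2 => Y.1 1 0) h
  simp only [hd.adjoint_zero_one, hd.adjoint_one_zero] at e1 e2
  change (m : ℂ) ^ 2 * X.1 0 1 = X.1 0 1 at e1
  change ((m⁻¹ : ℂˣ) : ℂ) ^ 2 * X.1 1 0 = X.1 1 0 at e2
  refine slTwo_ext ?_ ?_ ?_
  · simp [sl_smul_apply]
  · rw [sl_smul_apply, slMk_zero_one, mul_zero]
    refine (mul_eq_zero.1 (?_ : ((m : ℂ) - (m⁻¹ : ℂˣ)) * X.1 0 1 = 0)).resolve_left hne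
    linear_combination ((m⁻¹ : ℂˣ) : ℂ) * e1 - m * X.1 0 1 * h3
  · rw [sl_smul_apply, slMk_one_zero, mul_zero]
    refine (mul_eq_zero.1 (?_ : ((m : ℂ) - (m⁻¹ : ℂˣ)) * X.1 1 0 = 0)).resolve_left hne
    linear_combination -(m : ℂ) * e2 + ((m⁻¹ : ℂˣ) : ℂ) * X.1 1 0 * h3

theorem seqHol_parallel {V Γ A : Type*} [Group Γ] [AddCommGroup A] [Module ℂ A]
    {r : Representation ℂ Γ A} {G : V → V → Γ} {v : ℕ → V} {s : V → A}
    (h : ∀ k, r (G (v k) (v (k + 1))) (s (v (k + 1))) = s (v k)) (k : ℕ) :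
    r (seqHol G v k) (s (v k)) = s (v 0) := by
  induction k with
  | zero => simp [seqHol]
  | succ k ih => rw [seqHol, map_mul, Module.End.mul_apply, h, ih]

theorem sum_wrap {b : ℕ} (hb : 3 ≤ b) :
    ∑ i ∈ Finset.range b, wrap b (i % b) ((i + 1) % b) = 1 := by
  rw [Finset.sum_eq_single (b - 1)]
  · rw [Nat.mod_eq_of_lt (by omega), Nat.sub_add_cancel (by omega), Nat.mod_self, wrap,
      if_pos ⟨rfl, rfl⟩]
  · intro i hi hne
    rw [Finset.mem_range] at hi
    rw [Nat.mod_eq_of_lt hi, Nat.mod_eq_of_lt (by omega), wrap, if_neg (by omega),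
      if_neg (by omega)]
  · intro h
    exact absurd (Finset.mem_range.2 (by omega)) h

theorem ComposingSpace.zero_mem_fibre {V U : Type*} [LinearOrder V] [LinearOrder U] {n : ℕ}
    (Y : ComposingSpace V U n) : {0} ∈ Y.fibre.toComplex.faces :=
  standardCycle_singleton_mem Y.three_le (lt_of_lt_of_le (by norm_num) Y.three_le)

namespace ConnectedSumExterior

variable {V U : Type*} [LinearOrder V] [LinearOrder U] {n : ℕ} {X : ConnectedSumExterior V U n}

/-! ### Gluing -/

section Glue

variable {A : Type*}

/-- An edge lies in at most one piece, and an edge of both `Y` and a piece lies in the torus. So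
agreement on the tori is all that is required. -/
theorem exists_glue {fY : V → V → A} {f : Fin n → V → V → A}
    (h : ∀ j u v, {u, v} ∈ (X.Y.torus j).faces → f j u v = fY u v) :
    ∃ F : V → V → A, (∀ u v, {u, v} ∈ X.Y.toComplex.faces → F u v = fY u v) ∧
      ∀ j u v, {u, v} ∈ (X.piece j).faces → F u v = f j u v := by
  classical
  refine ⟨fun u v => if hj : ∃ j, {u, v} ∈ (X.piece j).faces then f hj.choose u v else fY u v,
    fun u v huv => ?_, fun j u v huv => ?_⟩
  · dsimp only
    split_ifs with hj
    · exact h _ _ _ (X.mem_torus.2 ⟨hj.choose_spec, huv⟩)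
    · rfl
  · have hj : ∃ j, {u, v} ∈ (X.piece j).faces := ⟨j, huv⟩
    dsimp only
    rw [dif_pos hj, X.piece_unique hj.choose_spec huv]

theorem exists_glue_vertex {pY : V → A} {p : Fin n → V → A}
    (h : ∀ j v, {v} ∈ (X.Y.torus j).faces → p j v = pY v) :
    ∃ P : V → A, (∀ v, {v} ∈ X.Y.toComplex.faces → P v = pY v) ∧
      ∀ j v, {v} ∈ (X.piece j).faces → P v = p j v := by
  obtain ⟨F, hF, hF'⟩ := exists_glue (X := X) (fY := fun u _ => pY u) (f := fun j u _ => p j u)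
    fun j u v huv => h j u (left_mem_of_edge huv)
  exact ⟨fun v => F v v, fun v hv => hF v v (by simpa using hv),
    fun j v hv => hF' j v v (by simpa using hv)⟩

variable [AddCommGroup A] [Module ℂ A] {Γ : Type*} [Group Γ] {r : Representation ℂ Γ A}
  {G : V → V → Γ} {f : V → V → A}

theorem isTwistedCocycle_M (hY : X.Y.toComplex.IsTwistedCocycle r G f)
    (h : ∀ j, (X.piece j).IsTwistedCocycle r G f) : X.M.IsTwistedCocycle r G f := by
  intro u v w huvw
  rcases X.mem_M.1 huvw with h' | ⟨j, h'⟩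
  · exact hY u v w h'
  · exact h j u v w h'

end Glue

theorem _root_.PreAbstractSimplicialComplex.IsTwistedCocycle.congr {A Γ : Type*} [AddCommGroup A]
    [Module ℂ A] [Group Γ] {r : Representation ℂ Γ A} {G : V → V → Γ} {f g : V → V → A}
    {K : PreAbstractSimplicialComplex V} (hf : K.IsTwistedCocycle r G f)
    (h : ∀ u v, {u, v} ∈ K.faces → g u v = f u v) : K.IsTwistedCocycle r G g := by
  intro u v w huvw
  obtain ⟨h1, h2, h3⟩ := edges_of_triangle huvw
  rw [h u v h1, h v w h2, h u w h3]
  exact hf u v w huvw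

/-- The properties of the pieces of the exterior of a connected sum, with respect to a flat
transport, that determine the first twisted cohomology; `I j` means that the representation of
the piece is irreducible. -/
structure PieceRegularity (X : ConnectedSumExterior V U n) (G : V → V → SL2) (I : Fin n → Prop) :
    Prop where
  primitive : ∀ j f, (X.piece j).IsTwistedCocycle adjointRep G f → X.period j f = 0 →
    ∃ p : V → sl2, ∀ u v, {u, v} ∈ (X.piece j).faces → f u v = adjointRep (G u v) (p v) - p u
  generator : ∀ j, ∃ c : V → V → sl2,
    (X.piece j).IsTwistedCocycle adjointRep G c ∧ X.period j c = 1
  eq_zero : ∀ j, I j → ∀ s : V → sl2,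
    (∀ u v, {u, v} ∈ (X.piece j).faces → adjointRep (G u v) (s v) = s u) →
    ∀ v, {v} ∈ (X.piece j).faces → s v = 0
  parallel : ∀ j, ¬ I j → ∃ s : V → sl2,
    (∀ u v, {u, v} ∈ (X.piece j).faces → adjointRep (G u v) (s v) = s u) ∧
    ∀ v, {v} ∈ (X.Y.torus j).faces → s v = slMk 1 0 0

theorem period_congr {j : Fin n} {f g : V → V → sl2}
    (h : ∀ u v, {u, v} ∈ (X.Y.torus j).faces → f u v = g u v) : X.period j f = X.period j g :=
  SimpleCycle.integral_congr _ fun u v huv => by rw [h u v (X.meridian_le_torus j huv)]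

/-! ### Parallel sections on `Y` and a cocycle with all periods one. -/

namespace IsDiagonalTransport

variable {m : ℂˣ} {G : V → V → SL2} (hG : X.IsDiagonalTransport m G)
include hG

theorem period_coboundary (j : Fin n) (p : V → sl2) :
    X.period j (fun u v => adjointRep (G u v) (p v) - p u) = 0 :=
  SimpleCycle.integral_coboundary _ (q := fun v => (p v).1 0 0) fun u v huv => by
    rw [sl_sub_apply, (hG.diag u v (X.Y.torus_le j (X.meridian_le_torus j huv))).adjoint_zero_zero]

theorem parallel_Y (u v : V) (h : {u, v} ∈ X.Y.toComplex.faces) :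
    adjointRep (G u v) (slMk 1 0 0) = slMk 1 0 0 := (hG.diag u v h).adjoint_slMk 1

/-- Parallel sections on a part of the composing space are multiples of `diag(1, -1)`. -/
theorem exists_eq_smul (h1 : (m : ℂ) ≠ 1) (h2 : (m : ℂ) ≠ -1)
    {A : PreAbstractSimplicialComplex U} (hA : A ≤ X.Y.W) (hAc : A.IsConnected) {s : V → sl2}
    (hs : ∀ u v, {u, v} ∈ (X.Y.part A).faces → adjointRep (G u v) (s v) = s u) :
    ∃ c : ℂ, ∀ v, {v} ∈ (X.Y.part A).faces → s v = c • slMk 1 0 0 := by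
  obtain ⟨w, hw⟩ := hAc.1
  have hb : {X.Y.φ (w, 0)} ∈ (X.Y.part A).faces := by
    have := ComposingSpace.φ_mem_part (horizontal_mem (w := w) (w' := w) (by simpa using hw)
      X.Y.zero_mem_fibre)
    exact left_mem_of_edge this
  have hfix : adjointRep (diagSL m) (s (X.Y.φ (w, 0))) = s (X.Y.φ (w, 0)) := by
    have := seqHol_parallel (r := adjointRep) (G := fun p q => G (X.Y.φ p) (X.Y.φ q))
      (s := fun p => s (X.Y.φ p)) (v := fun i => (w, i % X.Y.b)) (fun i => hs _ _
        (ComposingSpace.φ_mem_part (vertical_mem hw (X.Y.fibre.edge_mem i))))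
      X.Y.b
    rw [Nat.mod_self] at this
    rw [← hG.fibre w (hA hw)]
    exact this
  refine ⟨(s (X.Y.φ (w, 0))).1 0 0, fun v hv => parallel_unique (r := adjointRep)
    (s' := fun _ => (s (X.Y.φ (w, 0))).1 0 0 • slMk 1 0 0) (ComposingSpace.part_connected hA hAc) hb
    hs (fun u v h => ?_) (eq_smul_of_adjoint_diagSL h1 h2 hfix) hv⟩
  rw [map_smul, hG.parallel_Y u v (ComposingSpace.part_le hA h)]

/-- A cocycle on the exterior of the connected sum with period one. -/
theorem exists_cocycle_period_eq_one (h1 : (m : ℂ) ≠ 1) (h2 : (m : ℂ) ≠ -1) {I : Fin n → Prop}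
    (hP : X.PieceRegularity G I) :
    ∃ f : V → V → sl2, X.M.IsTwistedCocycle adjointRep G f ∧ ∀ j, X.period j f = 1 := by
  choose c hc hc1 using hP.generator
  -- On `W`, an ordinary cocycle whose integrals along the inner circles agree with those of the
  -- given cocycles of the pieces along the curves `λ_j`.
  obtain ⟨T, hT, hTint⟩ := X.Y.exists_cocycle_integral_eq fun j => (X.Y.inner j).integral
    fun w w' => (c j (X.Y.φ (w, 0)) (X.Y.φ (w', 0))).1 0 0
  -- The cocycle on `Y` with values multiples of `diag(1, -1)`: the pullback of `T` plus that of the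
  -- generator `wrap` of the circle, which gives every fibre period one.
  let y : V → V → sl2 := fun u v =>
    slMk (T (X.Y.coord u).1 (X.Y.coord v).1 + wrap X.Y.b (X.Y.coord u).2 (X.Y.coord v).2) 0 0
  have hb0 : 0 < X.Y.b := lt_of_lt_of_le (by norm_num) X.Y.three_le
  have hy : X.Y.toComplex.IsTwistedCocycle adjointRep G y := by
    intro u v w h
    obtain ⟨hmem, -⟩ := ComposingSpace.coord_mem (A := X.Y.W) le_rfl h
    obtain ⟨hfst, hsnd, -⟩ := hmem
    simp only [Finset.image_insert, Finset.image_singleton] at hfst hsnd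
    have e1 := hT _ _ _ hfst
    have e2 := wrap_add (hb := X.Y.three_le) hsnd
    rw [(hG.diag u v (edges_of_triangle h).1).adjoint_slMk, ← slMk_add]
    simp only [y]
    rw [← e1, ← e2]
    push_cast
    congr 1
    ring
  have hcoord : ∀ j i k, X.Y.coord (X.Y.φ ((X.Y.inner j).vert i, k % X.Y.b)) =
      ((X.Y.inner j).vert i, k % X.Y.b) := fun j i k =>
    X.Y.coord_φ (X.Y.vert_mem _ (X.Y.inner_le j) i) (Nat.mod_lt _ hb0)
  have hwrap : wrap X.Y.b 0 0 = 0 := by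
    have := X.Y.three_le
    rw [wrap, if_neg (by omega), if_neg (by omega)]
  have hyper : ∀ j, X.period j y = 1 := by
    intro j
    have : ∀ i, (y (X.Y.φ ((X.Y.inner j).vert 0, i % X.Y.b))
        (X.Y.φ ((X.Y.inner j).vert 0, (i + 1) % X.Y.b))).1 0 0 =
        ((wrap X.Y.b (i % X.Y.b) ((i + 1) % X.Y.b) : ℤ) : ℂ) := by
      intro i
      simp only [y, slMk_zero_zero]
      rw [hcoord, hcoord, hT.self (X.Y.vert_mem _ (X.Y.inner_le j) 0), zero_add]
    change ∑ i ∈ Finset.range X.Y.b, (y (X.Y.φ ((X.Y.inner j).vert 0, i % X.Y.b))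
        (X.Y.φ ((X.Y.inner j).vert 0, (i + 1) % X.Y.b))).1 0 0 = 1
    rw [Finset.sum_congr rfl fun i _ => this i, ← Int.cast_sum, sum_wrap X.Y.three_le,
      Int.cast_one]
  -- On the torus `c j` and `y` have the same period along the fibre and the same integral along
  -- `λ_j`, hence differ by a coboundary.
  have hprim : ∀ j, ∃ P : V → sl2, ∀ u v, {u, v} ∈ (X.Y.torus j).faces →
      (c j - y) u v = adjointRep (G u v) (P v) - P u := by
    intro j
    have hd : (X.Y.torus j).IsTwistedCocycle adjointRep G (c j - y) :=
      Submodule.sub_mem (pairCocycles (X.Y.torus j) adjointRep G)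
        ((hc j).mono (X.torus_le_piece j)) (hy.mono (X.Y.torus_le j))
    have hcyc := (hG.exists_normal_form h1 h2 (X.Y.inner_le j) (X.Y.inner j).isConnected hd).1
    obtain ⟨q, hq⟩ := (X.Y.inner j).exists_primitive hcyc (by
      have e : (X.Y.inner j).integral (fun w w' =>
          ((c j - y) (X.Y.φ (w, 0)) (X.Y.φ (w', 0))).1 0 0) =
          (X.Y.inner j).integral ((fun w w' => (c j (X.Y.φ (w, 0)) (X.Y.φ (w', 0))).1 0 0) +
            (-1 : ℂ) • T) := by
        refine Finset.sum_congr rfl fun i _ => ?_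
        have hz : ∀ i, X.Y.coord (X.Y.φ ((X.Y.inner j).vert i, 0)) = ((X.Y.inner j).vert i, 0) :=
          fun i => by simpa using hcoord j i 0
        change (c j _ _ - y _ _).1 0 0 = (c j _ _).1 0 0 + (-1 : ℂ) * T _ _
        rw [sl_sub_apply]
        simp only [y, slMk_zero_zero]
        rw [hz, hz, hwrap]
        push_cast
        ring
      rw [e, SimpleCycle.integral_add, SimpleCycle.integral_smul, hTint]
      ring)
    refine hG.exists_primitive_part h1 h2 (X.Y.inner_le j) (X.Y.inner j).isConnected hd
      ((X.Y.inner j).singleton_mem 0) ?_ hq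
    change X.period j (c j - y) = 0
    rw [sub_eq_add_neg, ← neg_one_smul ℂ y, period_add, period_smul, hc1, hyper]
    ring
  choose P hPr using hprim
  -- The function `P j` is defined on all vertices, so its coboundary can be subtracted from `c j`
  -- over the whole piece; then the cocycles agree on the torus.
  obtain ⟨F, hFY, hF⟩ := exists_glue (X := X) (fY := y)
    (f := fun j u v => c j u v - (adjointRep (G u v) (P j v) - P j u)) fun j u v huv => by
      rw [← hPr j u v huv]
      exact sub_sub_cancel _ _
  refine ⟨F, isTwistedCocycle_M (hy.congr hFY) fun j => IsTwistedCocycle.congr ?_ (hF j),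
    fun j => ?_⟩
  · exact Submodule.sub_mem (pairCocycles (X.piece j) adjointRep G) (hc j)
      (pairCoboundary_mem (hG.piece_flat j) (P j))
  · rw [← hyper j]
    exact period_congr fun u v huv => hFY u v (X.Y.torus_le j huv)

variable (h1 : (m : ℂ) ≠ 1) (h2 : (m : ℂ) ≠ -1)
include h1 h2

/-- A cocycle with vanishing periods is a coboundary on the composing space. -/
theorem exists_primitive_Y {f : V → V → sl2}
    (hf : X.M.IsTwistedCocycle adjointRep G f) (j₀ : Fin n) (hper : X.period j₀ f = 0)
    {p : Fin n → V → sl2}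
    (hp : ∀ j u v, {u, v} ∈ (X.piece j).faces → f u v = adjointRep (G u v) (p j v) - p j u) :
    ∃ P : V → sl2, ∀ u v, {u, v} ∈ X.Y.toComplex.faces →
      f u v = adjointRep (G u v) (P v) - P u := by
  have hfY : (X.Y.part X.Y.W).IsTwistedCocycle adjointRep G f := hf.mono X.Y_le
  -- The integrals along the inner circles vanish because `f` is a coboundary on the pieces.
  obtain ⟨q, hq⟩ := X.Y.exists_primitive
    (hG.exists_normal_form h1 h2 le_rfl X.Y.connected hfY).1 fun j =>
      SimpleCycle.integral_coboundary _ (q := fun w => (p j (X.Y.φ (w, 0))).1 0 0)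
        fun w w' hww' => by
          have hmem : {X.Y.φ (w, 0), X.Y.φ (w', 0)} ∈ (X.Y.torus j).faces :=
            ComposingSpace.φ_mem_part (horizontal_mem hww' X.Y.zero_mem_fibre)
          rw [hp j _ _ (X.torus_le_piece j hmem), sl_sub_apply,
            (hG.diag _ _ (X.Y.torus_le j hmem)).adjoint_zero_zero]
  exact hG.exists_primitive_part h1 h2 le_rfl X.Y.connected hfY
    (X.Y.vert_mem _ (X.Y.inner_le j₀) 0) hper hq

end IsDiagonalTransport

end ConnectedSumExterior

end

noncomputable section

open PreAbstractSimplicialComplex Matrix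

local notation "SL2" => SpecialLinearGroup (Fin 2) ℂ
local notation "sl2" => LieAlgebra.SpecialLinear.sl (Fin 2) ℂ

namespace ConnectedSumExterior

variable {V U : Type*} [LinearOrder V] [LinearOrder U] {n : ℕ} {X : ConnectedSumExterior V U n}

/-! ### Bending cocycles -/

section Bending

variable {I : Fin n → Prop}

open Classical in
/-- The function with value `δ j` on the vertices of the `j`-th piece. -/
def pieceFunction (X : ConnectedSumExterior V U n) (δ : {j // I j} → ℂ) (v : V) : ℂ :=
  if h : ∃ j : {j // I j}, {v} ∈ (X.piece j).faces then δ h.choose else 0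

theorem pieceFunction_eq (δ : {j // I j} → ℂ) {j : Fin n} (hj : I j) {v : V}
    (hv : {v} ∈ (X.piece j).faces) : X.pieceFunction δ v = δ ⟨j, hj⟩ := by
  have h : ∃ j : {j // I j}, {v} ∈ (X.piece j).faces := ⟨⟨j, hj⟩, hv⟩
  rw [pieceFunction, dif_pos h]
  exact congrArg δ (Subtype.ext (X.piece_unique h.choose_spec hv))

theorem pieceFunction_eq_zero (δ : {j // I j} → ℂ) {j : Fin n} (hj : ¬ I j) {v : V}
    (hv : {v} ∈ (X.piece j).faces) : X.pieceFunction δ v = 0 := by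
  rw [pieceFunction, dif_neg]
  rintro ⟨i, hi⟩
  exact hj (X.piece_unique hi hv ▸ i.2)

theorem pieceFunction_add (δ ε : {j // I j} → ℂ) (v : V) :
    X.pieceFunction (δ + ε) v = X.pieceFunction δ v + X.pieceFunction ε v := by
  unfold pieceFunction
  split_ifs <;> simp

theorem pieceFunction_smul (t : ℂ) (δ : {j // I j} → ℂ) (v : V) :
    X.pieceFunction (t • δ) v = t * X.pieceFunction δ v := by
  unfold pieceFunction
  split_ifs <;> simp

/-- The cocycles obtained by bending along the tori `Σ_j`, and the multiples of a given one. -/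
def bending (X : ConnectedSumExterior V U n) (I : Fin n → Prop) (G : V → V → SL2)
    (f₀ : V → V → sl2) : (({j // I j} → ℂ) × ℂ) →ₗ[ℂ] (V → V → sl2) where
  toFun x u v := X.pieceFunction x.1 u • (adjointRep (G u v) (slMk 1 0 0) - slMk 1 0 0) +
    x.2 • f₀ u v
  map_add' x y := by
    funext u v
    simp only [Prod.fst_add, Prod.snd_add, pieceFunction_add, add_smul, Pi.add_apply]
    exact add_add_add_comm _ _ _ _
  map_smul' t x := by
    funext u v
    simp only [Prod.smul_fst, Prod.smul_snd, pieceFunction_smul, smul_eq_mul, mul_smul,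
      Pi.smul_apply, smul_add, RingHom.id_apply]

theorem bending_apply (G : V → V → SL2) (f₀ : V → V → sl2) (x : ({j // I j} → ℂ) × ℂ) (u v : V) :
    X.bending I G f₀ x u v =
      X.pieceFunction x.1 u • (adjointRep (G u v) (slMk 1 0 0) - slMk 1 0 0) + x.2 • f₀ u v := rfl

end Bending

/-! ### The bending cocycles span the first cohomology. -/

namespace IsDiagonalTransport

variable {m : ℂˣ} {G : V → V → SL2} (hG : X.IsDiagonalTransport m G)
  {I : Fin n → Prop} {f₀ : V → V → sl2}
include hG

/-- The element `diag(1, -1)` is parallel on `Y`, so the bending term vanishes there and different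
parameters on the pieces do not interfere. -/
theorem bending_Y (x : ({j // I j} → ℂ) × ℂ) {u v : V} (h : {u, v} ∈ X.Y.toComplex.faces) :
    X.bending I G f₀ x u v = x.2 • f₀ u v := by
  rw [bending_apply, hG.parallel_Y u v h, sub_self, smul_zero, zero_add]

/-- On a piece with `I j` the bending term is the coboundary of a constant multiple of `diag(1,
-1)`. On `Y` and on the other pieces it vanishes. -/
theorem bending_isTwistedCocycle (hf₀ : X.M.IsTwistedCocycle adjointRep G f₀)
    (x : ({j // I j} → ℂ) × ℂ) : X.M.IsTwistedCocycle adjointRep G (X.bending I G f₀ x) := by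
  have hsmul : ∀ (K : PreAbstractSimplicialComplex V) (t : ℂ) (f : V → V → sl2),
      K.IsTwistedCocycle adjointRep G f → K.IsTwistedCocycle adjointRep G (t • f) :=
    fun K t f hf => Submodule.smul_mem (pairCocycles K adjointRep G) t hf
  refine isTwistedCocycle_M ((hsmul _ x.2 _ (hf₀.mono X.Y_le)).congr fun u v h => hG.bending_Y x h)
    fun j => ?_
  by_cases hj : I j
  · refine IsTwistedCocycle.congr (Submodule.add_mem (pairCocycles (X.piece j) adjointRep G)
      (hsmul _ (x.1 ⟨j, hj⟩) _ (pairCoboundary_mem (hG.piece_flat j) fun _ => slMk 1 0 0))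
      (hsmul _ x.2 _ (hf₀.mono (X.piece_le j)))) fun u v h => ?_
    rw [bending_apply, pieceFunction_eq _ hj (left_mem_of_edge h)]
    rfl
  · refine (hsmul _ x.2 _ (hf₀.mono (X.piece_le j))).congr fun u v h => ?_
    rw [bending_apply, pieceFunction_eq_zero _ hj (left_mem_of_edge h), zero_smul, zero_add]
    rfl

theorem period_bending (x : ({j // I j} → ℂ) × ℂ) (j : Fin n) :
    X.period j (X.bending I G f₀ x) = x.2 * X.period j f₀ := by
  rw [← period_smul]
  exact period_congr fun u v h => hG.bending_Y x (X.Y.torus_le j h)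

/-- A section that is parallel on `Y` and on the pieces with reducible representations, and
constant on the others. -/
theorem exists_section_piece (hP : X.PieceRegularity G I) (j : Fin n) (c : ℂ) :
    ∃ s : V → sl2, (∀ u v, {u, v} ∈ (X.piece j).faces → adjointRep (G u v) (s v) - s u =
        X.pieceFunction (fun _ : {j // I j} => c) u •
          (adjointRep (G u v) (slMk 1 0 0) - slMk 1 0 0)) ∧
      ∀ v, {v} ∈ (X.Y.torus j).faces → s v = c • slMk 1 0 0 := by
  by_cases hj : I j
  · refine ⟨fun _ => c • slMk 1 0 0, fun u v h => ?_, fun _ _ => rfl⟩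
    rw [pieceFunction_eq _ hj (left_mem_of_edge h), map_smul, smul_sub]
  · obtain ⟨s, hs, hst⟩ := hP.parallel j hj
    refine ⟨c • s, fun u v h => ?_, fun v hv => by rw [Pi.smul_apply, hst v hv]⟩
    rw [pieceFunction_eq_zero _ hj (left_mem_of_edge h), Pi.smul_apply, Pi.smul_apply, map_smul,
      hs u v h, sub_self, zero_smul]

/-- Otherwise the parallel sections of the pieces would glue with the constant section `diag(1, -1)`
on `Y` to a nonzero parallel section on `M`, contrary to irreducibility. -/
theorem exists_irreducible_piece (hP : X.PieceRegularity G I)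
    (hirr : IrreducibleSL2 (holHom hG.flat X.base)) : ∃ j, I j := by
  by_contra! hI
  choose s hs hst using fun j => hP.parallel j (hI j)
  obtain ⟨p, hpY, hp⟩ := exists_glue_vertex (X := X) (pY := fun _ => slMk 1 0 0) hst
  have hpar : ∀ u v, {u, v} ∈ X.M.faces → adjointRep (G u v) (p v) = p u := by
    intro u v h
    rcases X.mem_M.1 h with h | ⟨j, h⟩
    · rw [hpY v (right_mem_of_edge h), hpY u (left_mem_of_edge h), hG.parallel_Y u v h]
    · rw [hp j v (right_mem_of_edge h), hp j u (left_mem_of_edge h), hs j u v h]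
  have h0 := hirr.eq_zero_of_invariant fun α => parallel_holHom hG.flat hpar α
  rw [hpY _ X.base_mem] at h0
  have := congrArg (fun Y : sl2 => Y.1 0 0) h0
  exact one_ne_zero (α := ℂ) this

variable (h1 : (m : ℂ) ≠ 1) (h2 : (m : ℂ) ≠ -1)
include h1 h2

/-- After removal of the period, primitives exist on `Y` and on each piece. Their mismatch along a
torus is a multiple of `diag(1, -1)`; it is absorbed over reducible pieces and becomes a bending
parameter over irreducible ones. -/
theorem exists_sub_bending_mem (hP : X.PieceRegularity G I)
    (hf₀ : X.M.IsTwistedCocycle adjointRep G f₀) (hper₀ : ∀ j, X.period j f₀ = 1) (j₀ : Fin n)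
    {f : V → V → sl2} (hf : X.M.IsTwistedCocycle adjointRep G f) :
    ∃ x, f - X.bending I G f₀ x ∈ X.M.pairCoboundaries adjointRep G := by
  -- All meridians are fibres of `Y`, so `f` has the same period on each of them.
  obtain ⟨-, -, t, ht, -⟩ := hG.exists_normal_form h1 h2 le_rfl X.Y.connected
    (f := f) (hf.mono X.Y_le)
  have ht' : ∀ j, X.period j f = t := fun j => ht _ (X.Y.vert_mem _ (X.Y.inner_le j) 0)
  set f' := f - X.bending I G f₀ (0, t) with hf'
  have hf'c : X.M.IsTwistedCocycle adjointRep G f' :=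
    Submodule.sub_mem (pairCocycles X.M adjointRep G) hf (hG.bending_isTwistedCocycle hf₀ _)
  have hper : ∀ j, X.period j f' = 0 := by
    intro j
    rw [hf', sub_eq_add_neg, ← neg_one_smul ℂ (X.bending I G f₀ (0, t)), period_add, period_smul,
      hG.period_bending, hper₀, ht']
    ring
  choose p hp using fun j => hP.primitive j f' (hf'c.mono (X.piece_le j)) (hper j)
  obtain ⟨q, hq⟩ := hG.exists_primitive_Y h1 h2 hf'c j₀ (hper j₀) hp
  -- Two primitives of the same cocycle on the torus differ by a parallel section.
  have hc : ∀ j, ∃ c : ℂ, ∀ v, {v} ∈ (X.Y.torus j).faces → q v - p j v = c • slMk 1 0 0 := by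
    intro j
    refine hG.exists_eq_smul h1 h2 (X.Y.inner_le j) (X.Y.inner j).isConnected fun u v h => ?_
    have e1 := hq u v (X.Y.torus_le j h)
    have e2 := hp j u v (X.torus_le_piece j h)
    rw [map_sub, sub_eq_sub_iff_sub_eq_sub, ← e1, ← e2]
  choose c hc using hc
  choose s hs hst using fun j => hG.exists_section_piece hP j (c j)
  obtain ⟨P, hPY, hPp⟩ := exists_glue_vertex (X := X) (pY := q) (p := fun j v => p j v + s j v)
    fun j v hv => by rw [hst j v hv, ← hc j v hv, add_sub_cancel]
  -- On a piece the primitive is `p j + s j`. The coboundary of `s j` is the bending term with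
  -- parameter `c j`, which has to be subtracted from `f` with the opposite sign.
  refine ⟨(fun j => -c j, t), P, fun u v h => ?_⟩
  have hsplit : ∀ u v, (f - X.bending I G f₀ (fun j => -c j, t)) u v = f' u v +
      X.pieceFunction (fun j : {j // I j} => c j) u •
        (adjointRep (G u v) (slMk 1 0 0) - slMk 1 0 0) := by
    intro u v
    have e : ((fun j => -c j, t) : ({j // I j} → ℂ) × ℂ) =
        (0, t) - ((fun j => c j, 0) : ({j // I j} → ℂ) × ℂ) :=
      Prod.ext (funext fun j => (zero_sub (c j)).symm) (sub_zero t).symm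
    have e' : X.bending I G f₀ (fun j => c j, 0) u v =
        X.pieceFunction (fun j : {j // I j} => c j) u •
          (adjointRep (G u v) (slMk 1 0 0) - slMk 1 0 0) := by
      rw [bending_apply, zero_smul, add_zero]
    rw [e, map_sub, ← e']
    exact (sub_add _ _ _).symm
  rw [hsplit]
  rcases X.mem_M.1 h with h | ⟨j, h⟩
  · rw [hG.parallel_Y u v h, sub_self, smul_zero, add_zero, hPY v (right_mem_of_edge h),
      hPY u (left_mem_of_edge h), hq u v h]
  · have hfun : X.pieceFunction (fun j : {j // I j} => c j) u =
        X.pieceFunction (fun _ : {j // I j} => c j) u := by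
      by_cases hj : I j
      · rw [pieceFunction_eq _ hj (left_mem_of_edge h), pieceFunction_eq _ hj (left_mem_of_edge h)]
      · rw [pieceFunction_eq_zero _ hj (left_mem_of_edge h),
          pieceFunction_eq_zero _ hj (left_mem_of_edge h)]
    rw [hPp j v (right_mem_of_edge h), hPp j u (left_mem_of_edge h), map_add, hfun,
      ← hs j u v h, hp j u v h]
    exact sub_add_sub_comm _ _ _ _

/-- A primitive of a bending cocycle is `c` times `diag(1, -1)` on `Y`. On an irreducible piece it
differs from the bending constant by a parallel section, which is zero, so all parameters equal `c`.
-/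
theorem bending_mem_iff (hP : X.PieceRegularity G I) (hper₀ : ∀ j, X.period j f₀ = 1)
    (j₀ : Fin n) (x : ({j // I j} → ℂ) × ℂ) :
    X.bending I G f₀ x ∈ X.M.pairCoboundaries adjointRep G ↔
      ∃ t : ℂ, x = t • ((fun _ => 1, 0) : ({j // I j} → ℂ) × ℂ) := by
  constructor
  · rintro ⟨p, hp⟩
    -- The period of the bending cocycle is `x.2`, and coboundaries have period zero.
    have hx2 : x.2 = 0 := by
      rw [← mul_one x.2, ← hper₀ j₀, ← hG.period_bending x j₀, ← hG.period_coboundary j₀ p]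
      exact period_congr fun u v h => hp u v (X.piece_le j₀ (X.torus_le_piece j₀ h))
    obtain ⟨c, hc⟩ := hG.exists_eq_smul h1 h2 le_rfl X.Y.connected (s := p) fun u v h => by
      have := hp u v (X.Y_le h)
      rw [hG.bending_Y x h, hx2, zero_smul] at this
      exact (sub_eq_zero.1 this.symm)
    refine ⟨c, Prod.ext (funext fun j => ?_) (by simp [hx2])⟩
    have hz : p (X.pieceBase j) - x.1 j • slMk 1 0 0 = 0 := hP.eq_zero j j.2 (fun v => p v - x.1 j • slMk 1 0 0) (fun u v h => by
      have := hp u v (X.piece_le j h)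
      rw [bending_apply, hx2, zero_smul, add_zero, pieceFunction_eq _ j.2 (left_mem_of_edge h),
        smul_sub] at this
      rw [map_sub, map_smul, sub_eq_sub_iff_sub_eq_sub]
      exact this.symm) _ (X.pieceBase_mem j)
    have hY : {X.pieceBase j} ∈ X.Y.toComplex.faces := X.Y.torus_le j (X.torus_vertex_mem j)
    rw [hc _ hY, ← sub_smul] at hz
    have := congrArg (fun Y : sl2 => Y.1 0 0) hz
    simp only [sl_smul_apply, slMk_zero_zero, mul_one] at this
    change c - x.1 j = 0 at this
    simpa using (sub_eq_zero.1 this).symm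
  · rintro ⟨t, rfl⟩
    rw [map_smul]
    refine Submodule.smul_mem _ t ?_
    -- With all parameters equal to one, the primitive is `diag(1, -1)` on `Y` and on irreducible
    -- pieces, continued by parallel sections over the others.
    choose s hs hst using fun j => hG.exists_section_piece hP j 1
    obtain ⟨P, hPY, hPp⟩ := exists_glue_vertex (X := X) (pY := fun _ => slMk 1 0 0) (p := s)
      fun j v hv => by rw [hst j v hv, one_smul]
    refine ⟨P, fun u v h => ?_⟩
    rcases X.mem_M.1 h with h | ⟨j, h⟩
    · rw [hG.bending_Y _ h, zero_smul, hPY v (right_mem_of_edge h), hPY u (left_mem_of_edge h),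
        hG.parallel_Y u v h, sub_self]
    · rw [bending_apply, zero_smul, add_zero, hPp j v (right_mem_of_edge h),
        hPp j u (left_mem_of_edge h), hs j u v h]

/-- There is one parameter for each irreducible piece and one for the period, with one line of
relations. Its spanning vector is nonzero only because some piece is irreducible. -/
theorem rank_funCohomology_one (hP : X.PieceRegularity G I)
    (hirr : IrreducibleSL2 (holHom hG.flat X.base)) :
    Module.rank ℂ (Subquotient (LinearMap.ker (X.M.funCoboundary adjointRep G 1))
      (X.M.funCoboundaries adjointRep G 1)) = ({j | I j}.ncard : Cardinal) := by
  classical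
  obtain ⟨j₀, hj₀⟩ := hG.exists_irreducible_piece hP hirr
  obtain ⟨f₀, hf₀, hper₀⟩ := hG.exists_cocycle_period_eq_one h1 h2 hP
  rw [finrank_funCohomology_one hG.flat (X.bending I G f₀)
    (fun x => hG.bending_isTwistedCocycle hf₀ x)
    (fun f hf => hG.exists_sub_bending_mem h1 h2 hP hf₀ hper₀ j₀ hf)
    (p₀ := (fun _ => 1, 0)) (fun h => one_ne_zero (α := ℂ) (congrFun (congrArg Prod.fst h) ⟨j₀, hj₀⟩))
    (hG.bending_mem_iff h1 h2 hP hper₀ j₀)]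
  rw [Module.finrank_prod, Module.finrank_fintype_fun_eq_card, Module.finrank_self,
    Nat.add_sub_cancel, ← Nat.card_eq_fintype_card, Set.ncard]
  rfl

end IsDiagonalTransport

end ConnectedSumExterior

end

noncomputable section

open PreAbstractSimplicialComplex Matrix

/-! ### The cohomology of the exterior of a connected sum -/

/-- A cocycle of degree zero is a parallel section; its value at the base point is invariant under
the holonomy. -/
theorem PreAbstractSimplicialComplex.ker_funCoboundary_zero {V : Type*} [LinearOrder V]
    {K : PreAbstractSimplicialComplex V} (hK : K.IsConnected)
    {G : V → V → SpecialLinearGroup (Fin 2) ℂ} (hG : K.IsFlat G) {x : V} (hx : {x} ∈ K.faces)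
    (hirr : IrreducibleSL2 (holHom hG x)) :
    LinearMap.ker (K.funCoboundary adjointRep G 0) = ⊥ := by
  rw [LinearMap.ker_eq_bot']
  intro p hp
  obtain ⟨q, hqp, hq⟩ := exists_primitive_of_funCoboundary_zero hG (f := 0)
    (Submodule.zero_mem _) (p := p) (hp.trans (map_zero _).symm)
  have hpar : ∀ u v, {u, v} ∈ K.faces → adjointRep (G u v) (q v) = q u := fun u v h =>
    sub_eq_zero.1 (hq u v h).symm
  have h0 : q x = 0 := hirr.eq_zero_of_invariant fun α => parallel_holHom hG hpar α
  funext s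
  have hs : {s.1 0} ∈ K.faces := s.vertex_mem 0
  have hvert : s = .vertex hs := by
    ext a
    fin_cases a
    rfl
  rw [hvert, ← hqp _ hs]
  exact parallel_unique (r := adjointRep) (s' := fun _ => 0) hK hx hpar
    (fun u v _ => map_zero _) h0 hs

end

theorem mainTheorem7 {V U : Type*} [LinearOrder V] [LinearOrder U] {n : ℕ}
    (X : ConnectedSumExterior V U n)
    (ρ : X.M.Pi1 X.base →* Matrix.SpecialLinearGroup (Fin 2) ℂ)
    (hρ : IrreducibleSL2 ρ)
    (γ : ∀ j, X.M.PathClass X.base (X.pieceBase j))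
    (m : ℂˣ) (hm : EigenvalueSL2 (ρ X.mu) m)
    (hm_one : (m : ℂ) ≠ 1) (hm_neg : (m : ℂ) ≠ -1)
    (Δ : Fin n → LaurentPolynomial ℤ)
    (hΔ : ∀ j, IsAlexanderPolynomial (X.piece j) (X.Y.meridian j) (Δ j))
    (hΔm : ∀ j, LaurentPolynomial.eval₂ (Int.castRingHom ℂ) (m ^ 2) (Δ j) ≠ 0)
    (hreg : ∀ j, IrreducibleSL2 (X.restrict ρ j (γ j)) →
      (∀ l : ℂ, EigenvalueSL2 (X.restrict ρ j (γ j) (X.pieceLongitude j)) l → l ≠ 1 ∧ l ≠ -1) ∧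
      IsMuRegular (X.Y.meridian j) (X.meridian_le j) (X.restrict ρ j (γ j)))
    (k : ℕ) (hk : k = {j | AbelianSL2 (X.restrict ρ j (γ j))}.ncard) :
    ∀ i : ℕ, Module.rank ℂ (AdCohomology X.M ρ i) =
      ((if i = 1 ∨ i = 2 then n - k else 0 : ℕ) : Cardinal) := by
  intro i
  obtain ⟨G, hG, g, hg⟩ := X.exists_isDiagonalTransport hm hm_one hm_neg
  have hirr : IrreducibleSL2 (PreAbstractSimplicialComplex.holHom hG.flat X.base) := hρ.conj hg
  have hres := fun j => hG.restrict_eq hg j (γ j)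
  choose ν hν using fun j => (hΔ j).alexanderRegular (X.isKnotExterior j).connected
    (X.meridian_le j) (hΔm j)
  -- The restriction of `ρ` and the holonomy of the piece are conjugate; both directions are needed
  -- to exchange irreducibility and commutativity between them.
  have hinv : ∀ j α, hG.pieceHol j α =
      (g * PreAbstractSimplicialComplex.PathClass.hol hG.flat (γ j))⁻¹ *
        X.restrict ρ j (γ j) α *
        ((g * PreAbstractSimplicialComplex.PathClass.hol hG.flat (γ j))⁻¹)⁻¹ := by
    intro j α
    rw [hres j α]
    group
  let I : Fin n → Prop := fun j => IrreducibleSL2 (X.restrict ρ j (γ j))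
  have hI : ∀ j, I j ↔ IrreducibleSL2 (hG.pieceHol j) := fun j =>
    ⟨fun h => h.conj (hres j), fun h => h.conj (hinv j)⟩
  have hab : ∀ j, AbelianSL2 (X.restrict ρ j (γ j)) ↔ ¬ I j := by
    intro j
    rw [hI j, ← (hν j).abelian_iff hm_one hm_neg (hG.holHom_meridian j)]
    exact ⟨fun h => h.conj (hres j), fun h => h.conj (hinv j)⟩
  -- For irreducible pieces `μ`-regularity gives the primitives and generators; for the others they
  -- come from the Alexander polynomial.
  have hP : X.PieceRegularity G I := by
    refine ⟨fun j f hf h0 => ?_, fun j => ?_, fun j hj s hs v hv => ?_, fun j hj => ?_⟩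
    · by_cases hj : I j
      · exact hG.exists_primitive_of_isMuRegular (hreg j hj).2 (hres j) hm_one hm_neg hf h0
      · exact hG.exists_primitive_of_not_irreducible (hν j) hm_one hm_neg
          (fun h => hj ((hI j).2 h)) hf h0
    · by_cases hj : I j
      · exact hG.exists_period_eq_one_of_isMuRegular (hreg j hj).2 (hres j) hm_one hm_neg
      · obtain ⟨-, -, z, hz, -⟩ := hΔ j
        exact hG.exists_period_eq_one_of_not_irreducible (hν j) hm_one hm_neg
          (fun h => hj ((hI j).2 h)) hz
    · exact hG.parallel_eq_zero ((hI j).1 hj) hs hv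
    · exact hG.exists_parallel_eq (hν j) hm_one hm_neg fun h => hj ((hI j).2 h)
  -- By `hab` the `k` abelian indices are exactly the complement of the irreducible ones.
  have hcard : {j | I j}.ncard = n - k := by
    have h := Set.ncard_add_ncard_compl {j | I j}
    have hc : {j | I j}ᶜ = {j | AbelianSL2 (X.restrict ρ j (γ j))} := by
      ext j
      exact (hab j).symm
    rw [hc, ← hk, Nat.card_fin] at h
    omega
  change Module.rank ℂ (X.M.Cohomology (adjointRep.comp ρ) i) = _
  rw [PreAbstractSimplicialComplex.rank_cohomology_eq hG.flat g
    (fun α => congrArg adjointRep (hg α)) X.M_connected (X.Y_le X.base_mem)]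
  refine PreAbstractSimplicialComplex.rank_funCohomology hG.flat X.finite_faces
    (fun s hs => X.card_le hs) X.euler_M
    (PreAbstractSimplicialComplex.ker_funCoboundary_zero X.M_connected hG.flat (X.Y_le X.base_mem)
      hirr) X.range_funCoboundary_two ?_ i
  rw [← hcard]
  exact hG.rank_funCohomology_one hm_one hm_neg hP hirr
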